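/- **Setting.** Let $\mathrm T=[a,b]$ with $a<b$ and let $\mathrm Z=\prod_{k=1}^p[c_k,d_k]\subset\mathbb R^p$ with $c_k<d_k$. For subjects $i=1,2,\dots$ let $X_i(t,z)$, $(t,z)\in\mathrm T\times\mathrm Z$, be i.i.d. jointly measurable random functions with mean $\mu(t,z)=E X_i(t,z)$ and covariance $\Gamma(s,t,z)=\operatorname{cov}(X_i(s,z),X_i(t,z))$. Let $Z_i\in\mathrm Z$ be covariates, $T_{ij}\in\mathrm T$ observation times, and $\varepsilon_{ij}$ identically distributed errors with mean $0$ and variance $\sigma^2$, such that all the $X_i$, $Z_i$, $T_{ij}$, $\varepsilon_{ij}$ are mutually independent. The pair $(T_{ij},Z_i)$ has the density $g(t,z)$ on $\mathrm T\times\mathrm Z$ for all $i,j$. We observe $$Y_{ij}=X_i(T_{ij},Z_i)+\varepsilon_{ij},\qquad 1\le j\le N_i,\ 1\le i\le n,$$ where the numbers $N_i=N_{n,i}\ge 2$ are non-random and may depend on $n$. Put $U_{ij}=Y_{ij}-\mu(T_{ij},Z_i)$, let $\Gamma^*(s,t)=E\,\Gamma(s,t,Z_1)$ be the pooled covariance,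 and let $\gamma_{nk}=\big(n^{-1}\sum_{i\le n}N_i^{-k}\big)^{-1}$, $k=1,2$. **Estimators.** Let $K_h(u)=K(u/h)/h$, with bandwidths $h_t,\ h_z^{(1)},\dots,h_z^{(p)},\ h_\Gamma>0$ depending on $n$. The $h_z^{(k)}$ are all of the same order as a sequence $h_z>0$, and $h_z\to0$. Let $\hat\mu(t,z)=\hat b_0$, where $(\hat b_0,\hat b_1,\hat{\boldsymbol b}_2)$ minimizes $$\frac1n\sum_{i=1}^n\frac1{N_i}\sum_{j=1}^{N_i}\{Y_{ij}-b_0-b_1(T_{ij}-t)-\boldsymbol b_2^\top(Z_i-z)\}^2K_{h_t}(T_{ij}-t)\prod_{k=1}^pK_{h_z^{(k)}}(Z_i^{(k)}-z^{(k)}).$$ Let $\hat U_{ij}=Y_{ij}-\hat\mu(T_{ij},Z_i)$, and let $\hat\Gamma^*(s,t)=\hat b_0$, where $(\hat b_0,\hat b_1,\hat b_2)$ minimizes $$\frac1n\sum_{i=1}^n\frac1{N_i(N_i-1)}\sum_{j\ne k}\{\hat U_{ij}\hat U_{ik}-b_0-b_1(T_{ij}-s)-b_2(T_{ik}-t)\}^2K_{h_\Gamma}(T_{ij}-s)K_{h_\Gamma}(T_{ik}-t).$$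 (Where a minimizer is not unique, any choice is allowed.) **Assumptions.** - (A.1) $m_T\le g\le M_T$ on $\mathrm T\times\mathrm Z$ for some $0<m_T\le M_T<\infty$, and $g$ is differentiable there with bounded derivative. - (A.2) $K$ is a symmetric probability density on $[-1,1]$, of bounded variation on $[-1,1]$ and zero outside it. - (B.1) $\mu$ is twice differentiable on $\mathrm T\times\mathrm Z$ with bounded second derivative. - (B.2) For some $\lambda_\mu\in(2,\infty)$: $E|U_{ij}|^{\lambda_\mu}<\infty$ and $\sup_{z\in\mathrm Z}E\sup_{t\in\mathrm T}|X_i(t,z)|^{\lambda_\mu}<\infty$; $h_t\to0$ and $\big(h_t^2|\boldsymbol h_z|+h_t|\boldsymbol h_z|/\gamma_{n1}\big)^{-1}(\log n/n)^{1-2/\lambda_\mu}\to0$, where $|\boldsymbol h_z|=\prod_kh_z^{(k)}$. - (B.3) All second-order partial derivatives of $\Gamma^*$ exist and are bounded on $\mathrm T\times\mathrm T$. - (B.4) For some $\lambda_\Gamma\in(2,\infty)$: $E|U_{ij}|^{2\lambda_\Gamma}<\infty$ and $\sup_{z\in\mathrm Z}E\sup_{t\in\mathrm T}|X_i(t,z)|^{2\lambda_\Gamma}<\infty$;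 $h_\Gamma\to0$ and $\big(h_\Gamma^4+h_\Gamma^3/\gamma_{n1}+h_\Gamma^2/\gamma_{n2}\big)^{-1}(\log n/n)^{1-2/\lambda_\Gamma}\to0$. **Theorem.** Let $$\delta_n=\Big[\Big\{1+\tfrac1{\gamma_{n1}h_t}\Big\}\tfrac{\log n}{nh_z^p}\Big]^{1/2},\quad \delta_{n1}=\Big\{\Big(1+\tfrac1{\gamma_{n1}h_\Gamma}\Big)\tfrac{\log n}n\Big\}^{1/2},\quad \delta_{n2}=\Big\{\Big(1+\tfrac1{\gamma_{n1}h_\Gamma}+\tfrac1{\gamma_{n2}h_\Gamma^2}\Big)\tfrac{\log n}n\Big\}^{1/2}.$$ Then, as $n\to\infty$, $$\sup_{s,t\in\mathrm T}|\hat\Gamma^*(s,t)-\Gamma^*(s,t)|=O\big(\delta_{n2}+h_\Gamma^2+\delta_{n1}(h_t^2+h_z^2+\delta_n)+h_t^4+h_z^4+\delta_n^2\big)\quad\text{a.s.},$$ and also $$\sup_{s,t\in\mathrm T}|\hat\Gamma^*(s,t)-\Gamma^*(s,t)|=O\big(\delta_{n2}+h_\Gamma^2+h_t^4+h_z^4+\delta_n^2\big)\quad\text{a.s.}$$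 -/

import Mathlib

open MeasureTheory ProbabilityTheory Filter Topology Asymptotics Set

noncomputable section

namespace PooledCov

/-! ### Kernels and bandwidth-type quantities -/

/-- A symmetric probability density on `[-1,1]` (extended by zero) of bounded variation there. -/
structure IsKernel (K : ℝ → ℝ) : Prop where
  nonneg : ∀ u, 0 ≤ K u
  symm : ∀ u, K (-u) = K u
  support : ∀ u, u ∉ Icc (-1 : ℝ) 1 → K u = 0
  integral_eq_one : ∫ u in (-1 : ℝ)..1, K u = 1
  boundedVariation : BoundedVariationOn K (Icc (-1) 1)

/-- The scaled kernel `K_h(u) = K(u/h)/h`. -/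
def scaled (K : ℝ → ℝ) (h u : ℝ) : ℝ := K (u / h) / h

/-- `γ_{nk} = (n⁻¹ ∑_{i<n} N_{n,i}^{-k})⁻¹`; `N n i` is the number of observations of
subject `i` in the sample of size `n`. -/
def gam (N : ℕ → ℕ → ℕ) (k n : ℕ) : ℝ :=
  ((n : ℝ)⁻¹ * ∑ i ∈ Finset.range n, ((N n i : ℝ) ^ k)⁻¹)⁻¹

/-- `δ_n = [{1 + 1/(γ_{n1} h_t)} log n / (n h_z^p)]^{1/2}`. -/
def delta (N : ℕ → ℕ → ℕ) (p : ℕ) (ht hz : ℕ → ℝ) (n : ℕ) : ℝ :=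
  Real.sqrt ((1 + 1 / (gam N 1 n * ht n)) * (Real.log n / (n * hz n ^ p)))

/-- `δ_{n1} = {(1 + 1/(γ_{n1} h_Γ)) log n / n}^{1/2}`. -/
def delta1 (N : ℕ → ℕ → ℕ) (hG : ℕ → ℝ) (n : ℕ) : ℝ :=
  Real.sqrt ((1 + 1 / (gam N 1 n * hG n)) * (Real.log n / n))

/-- `δ_{n2} = {(1 + 1/(γ_{n1} h_Γ) + 1/(γ_{n2} h_Γ²)) log n / n}^{1/2}`. -/
def delta2 (N : ℕ → ℕ → ℕ) (hG : ℕ → ℝ) (n : ℕ) : ℝ :=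
  Real.sqrt ((1 + 1 / (gam N 1 n * hG n) + 1 / (gam N 2 n * hG n ^ 2)) * (Real.log n / n))

/-! ### The two local linear estimators, for a fixed realization of the data

`T i j`, `Y i j` are the time and value of the `j`-th observation of subject `i`, `Z i` its
covariate; the sample of size `n` consists of the subjects `i < n` and the observations
`j < N n i`. -/

/-- The objective function of the `(p+1)`-dimensional local linear smoother at `(t,z)`. -/
def meanLoss {p : ℕ} (K : ℝ → ℝ) (ht : ℝ) (hz : Fin p → ℝ) (n : ℕ) (N : ℕ → ℕ)
    (T : ℕ → ℕ → ℝ) (Z : ℕ → Fin p → ℝ) (Y : ℕ → ℕ → ℝ) (t : ℝ) (z : Fin p → ℝ)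
    (b₀ b₁ : ℝ) (b₂ : Fin p → ℝ) : ℝ :=
  (1 / (n : ℝ)) * ∑ i ∈ Finset.range n, (1 / (N i : ℝ)) * ∑ j ∈ Finset.range (N i),
    (Y i j - b₀ - b₁ * (T i j - t) - ∑ k, b₂ k * (Z i k - z k)) ^ 2
      * (scaled K ht (T i j - t) * ∏ k, scaled K (hz k) (Z i k - z k))

/-- `m` is the local linear estimate of the mean at `(t,z)`: the intercept of a minimizer. -/
def IsMeanFit {p : ℕ} (K : ℝ → ℝ) (ht : ℝ) (hz : Fin p → ℝ) (n : ℕ) (N : ℕ → ℕ)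
    (T : ℕ → ℕ → ℝ) (Z : ℕ → Fin p → ℝ) (Y : ℕ → ℕ → ℝ) (t : ℝ) (z : Fin p → ℝ)
    (m : ℝ) : Prop :=
  ∃ (b₁ : ℝ) (b₂ : Fin p → ℝ), ∀ (c₀ c₁ : ℝ) (c₂ : Fin p → ℝ),
    meanLoss K ht hz n N T Z Y t z m b₁ b₂ ≤ meanLoss K ht hz n N T Z Y t z c₀ c₁ c₂

/-- The objective function of the two-dimensional local linear smoother at `(s,t)`, applied to the
off-diagonal products of the residuals `R i j`. -/
def covLoss (K : ℝ → ℝ) (h : ℝ) (n : ℕ) (N : ℕ → ℕ) (T R : ℕ → ℕ → ℝ) (s t : ℝ)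
    (b₀ b₁ b₂ : ℝ) : ℝ :=
  (1 / (n : ℝ)) * ∑ i ∈ Finset.range n, (1 / ((N i : ℝ) * ((N i : ℝ) - 1))) *
    ∑ j ∈ Finset.range (N i), ∑ k ∈ (Finset.range (N i)).erase j,
      (R i j * R i k - b₀ - b₁ * (T i j - s) - b₂ * (T i k - t)) ^ 2
        * (scaled K h (T i j - s) * scaled K h (T i k - t))

/-- `c` is the local linear estimate of the pooled covariance at `(s,t)`. -/
def IsCovFit (K : ℝ → ℝ) (h : ℝ) (n : ℕ) (N : ℕ → ℕ) (T R : ℕ → ℕ → ℝ) (s t c : ℝ) : Prop :=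
  ∃ b₁ b₂ : ℝ, ∀ c₀ c₁ c₂ : ℝ,
    covLoss K h n N T R s t c b₁ b₂ ≤ covLoss K h n N T R s t c₀ c₁ c₂

/-! ### The random model

Subject `i` carries a random element `θ i` of a measurable space `S`; its random function of time
and covariate is `(t,z) ↦ x (θ i) t z`, with `x` jointly measurable. -/

section Model

variable {Ω S : Type*} [MeasurableSpace Ω] [MeasurableSpace S] {p : ℕ}

/-- The mean function `μ(t,z) = E X(t,z)`. -/
def meanFn (P : Measure Ω) (x : S → ℝ → (Fin p → ℝ) → ℝ) (θ : ℕ → Ω → S)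
    (t : ℝ) (z : Fin p → ℝ) : ℝ :=
  ∫ ω, x (θ 0 ω) t z ∂P

/-- The covariance function `Γ(s,t,z) = cov(X(s,z), X(t,z))`. -/
def covFn (P : Measure Ω) (x : S → ℝ → (Fin p → ℝ) → ℝ) (θ : ℕ → Ω → S)
    (s t : ℝ) (z : Fin p → ℝ) : ℝ :=
  covariance (fun ω => x (θ 0 ω) s z) (fun ω => x (θ 0 ω) t z) P

/-- The pooled covariance function `Γ*(s,t) = E Γ(s,t,Z)`. -/
def pooledCov (P : Measure Ω) (x : S → ℝ → (Fin p → ℝ) → ℝ) (θ : ℕ → Ω → S)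
    (Z : ℕ → Ω → Fin p → ℝ) (s t : ℝ) : ℝ :=
  ∫ ω, covFn P x θ s t (Z 0 ω) ∂P

/-- The observations `Y_{ij} = X_i(T_{ij}, Z_i) + ε_{ij}`. -/
def obs (x : S → ℝ → (Fin p → ℝ) → ℝ) (θ : ℕ → Ω → S) (Z : ℕ → Ω → Fin p → ℝ)
    (T ε : ℕ → ℕ → Ω → ℝ) (i j : ℕ) (ω : Ω) : ℝ :=
  x (θ i ω) (T i j ω) (Z i ω) + ε i j ω

/-- The errors `U_{ij} = Y_{ij} - μ(T_{ij}, Z_i)`. -/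
def err (P : Measure Ω) (x : S → ℝ → (Fin p → ℝ) → ℝ) (θ : ℕ → Ω → S)
    (Z : ℕ → Ω → Fin p → ℝ) (T ε : ℕ → ℕ → Ω → ℝ) (i j : ℕ) (ω : Ω) : ℝ :=
  obs x θ Z T ε i j ω - meanFn P x θ (T i j ω) (Z i ω)

/-- The sampling scheme: identically distributed independent subjects; random functions,
covariates, observation times and measurement errors are independent of each other; the times of a
subject are independent, and so are its errors, which are centred with variance `σ²`. The pair
`(T_{ij}, Z_i)` has density `g` on the box `I ×ˢ D`. -/
structure IsSampling (P : Measure Ω) (x : S → ℝ → (Fin p → ℝ) → ℝ) (θ : ℕ → Ω → S)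
    (Z : ℕ → Ω → Fin p → ℝ) (T ε : ℕ → ℕ → Ω → ℝ) (σ : ℝ) (I : Set ℝ) (D : Set (Fin p → ℝ))
    (g : ℝ × (Fin p → ℝ) → ℝ) : Prop where
  measurable_x : Measurable fun v : S × ℝ × (Fin p → ℝ) => x v.1 v.2.1 v.2.2
  measurable_θ : ∀ i, Measurable (θ i)
  measurable_Z : ∀ i, Measurable (Z i)
  measurable_T : ∀ i j, Measurable (T i j)
  measurable_ε : ∀ i j, Measurable (ε i j)
  indep_subjects : iIndepFun
    (fun (i : ℕ) (ω : Ω) => (θ i ω, Z i ω, (fun j => T i j ω), (fun j => ε i j ω))) P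
  indep_θ_Z : ∀ i, IndepFun (θ i) (Z i) P
  indep_T : ∀ i, IndepFun (fun ω => (θ i ω, Z i ω)) (fun ω j => T i j ω) P
  iIndep_T : ∀ i, iIndepFun (fun j => T i j) P
  indep_ε : ∀ i, IndepFun (fun ω => (θ i ω, Z i ω, (fun j => T i j ω))) (fun ω j => ε i j ω) P
  iIndep_ε : ∀ i, iIndepFun (fun j => ε i j) P
  ident_θ : ∀ i, IdentDistrib (θ i) (θ 0) P P
  ident_ε : ∀ i j, IdentDistrib (ε i j) (ε 0 0) P P
  law_TZ : ∀ i j, P.map (fun ω => (T i j ω, Z i ω)) =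
    (volume.restrict (I ×ˢ D)).withDensity fun v => ENNReal.ofReal (g v)
  memLp_ε : ∀ i j, MemLp (ε i j) 2 P
  mean_ε : ∀ i j, ∫ ω, ε i j ω ∂P = 0
  var_ε : ∀ i j, variance (ε i j) P = σ ^ 2

/-- `E sup_{t ∈ I} |X(t,z)|^q` is finite, uniformly in `z ∈ D`; the supremum over an uncountable
set is expressed by a measurable envelope `M`. -/
def HasSupMoment (P : Measure Ω) (x : S → ℝ → (Fin p → ℝ) → ℝ) (θ : ℕ → Ω → S)
    (I : Set ℝ) (D : Set (Fin p → ℝ)) (q : ℝ) : Prop :=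
  ∃ (M : S → (Fin p → ℝ) → ENNReal) (C : NNReal),
    Measurable (fun v : S × (Fin p → ℝ) => M v.1 v.2) ∧
    (∀ᵐ ω ∂P, ∀ z ∈ D, ∀ t ∈ I, ENNReal.ofReal (|x (θ 0 ω) t z| ^ q) ≤ M (θ 0 ω) z) ∧
    ∀ z ∈ D, ∫⁻ ω, M (θ 0 ω) z ∂P ≤ C

end Model

/-! ### Smoothness and moment/bandwidth conditions -/

/-- The density is bounded away from zero and infinity on the box `B`, and differentiable there
with bounded derivative. -/
def DensityCondition {p : ℕ} (g : ℝ × (Fin p → ℝ) → ℝ) (B : Set (ℝ × (Fin p → ℝ))) : Prop :=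
  (∃ m M : ℝ, 0 < m ∧ ∀ v ∈ B, m ≤ g v ∧ g v ≤ M) ∧
  DifferentiableOn ℝ g B ∧ ∃ C : ℝ, ∀ v ∈ B, ‖fderivWithin ℝ g B v‖ ≤ C

/-- `f` is twice differentiable on the box `B` with bounded second derivative. -/
def TwiceDiffBounded {E : Type*} [NormedAddCommGroup E] [NormedSpace ℝ E] (f : E → ℝ)
    (B : Set E) : Prop :=
  DifferentiableOn ℝ f B ∧ DifferentiableOn ℝ (fderivWithin ℝ f B) B ∧
  ∃ C : ℝ, ∀ v ∈ B, ‖fderivWithin ℝ (fderivWithin ℝ f B) B v‖ ≤ C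

/-- All second-order partial derivatives of `G` exist and are bounded on `I × I`
(one-sided at the endpoints of `I`). -/
def BoundedSecondPartials (G : ℝ → ℝ → ℝ) (I : Set ℝ) : Prop :=
  ∃ (G₁ G₂ G₁₁ G₁₂ G₂₁ G₂₂ : ℝ → ℝ → ℝ) (C : ℝ), ∀ s ∈ I, ∀ t ∈ I,
    HasDerivWithinAt (fun u => G u t) (G₁ s t) I s ∧
    HasDerivWithinAt (fun v => G s v) (G₂ s t) I t ∧
    HasDerivWithinAt (fun u => G₁ u t) (G₁₁ s t) I s ∧
    HasDerivWithinAt (fun v => G₁ s v) (G₁₂ s t) I t ∧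
    HasDerivWithinAt (fun u => G₂ u t) (G₂₁ s t) I s ∧
    HasDerivWithinAt (fun v => G₂ s v) (G₂₂ s t) I t ∧
    |G₁₁ s t| ≤ C ∧ |G₁₂ s t| ≤ C ∧ |G₂₁ s t| ≤ C ∧ |G₂₂ s t| ≤ C

/-- Bandwidths of the mean estimator: `hzv n k` is the bandwidth of the `k`-th covariate, all of
the same order as `hz n`; `q` is the moment exponent. -/
structure MeanBandwidth {p : ℕ} (N : ℕ → ℕ → ℕ) (ht hz : ℕ → ℝ) (hzv : ℕ → Fin p → ℝ)
    (q : ℝ) : Prop where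
  ht_pos : ∀ n, 0 < ht n
  hz_pos : ∀ n, 0 < hz n
  hzv_pos : ∀ n k, 0 < hzv n k
  same_order : ∀ k, (fun n => hzv n k) =Θ[atTop] hz
  ht_tendsto : Tendsto ht atTop (𝓝 0)
  hz_tendsto : Tendsto hz atTop (𝓝 0)
  rate : Tendsto (fun n : ℕ =>
      (ht n ^ 2 * (∏ k, hzv n k) + ht n * (∏ k, hzv n k) / gam N 1 n)⁻¹
        * (Real.log n / n) ^ (1 - 2 / q)) atTop (𝓝 0)

/-- Bandwidth of the covariance estimator. -/
structure CovBandwidth (N : ℕ → ℕ → ℕ) (hG : ℕ → ℝ) (q : ℝ) : Prop where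
  pos : ∀ n, 0 < hG n
  tendsto : Tendsto hG atTop (𝓝 0)
  rate : Tendsto (fun n : ℕ =>
      (hG n ^ 4 + hG n ^ 3 / gam N 1 n + hG n ^ 2 / gam N 2 n)⁻¹
        * (Real.log n / n) ^ (1 - 2 / q)) atTop (𝓝 0)

end PooledCov

end

open MeasureTheory ProbabilityTheory Filter Topology Asymptotics Set

noncomputable section

set_option linter.unusedSectionVars false

namespace PooledCov

open Finset (abs_prod abs_sum_le_sum_abs card_insert_of_notMem card_pair card_range card_univ measurable_sum
  mem_coe mem_filter mem_product mul_sum ne_of_mem_erase prod_congr prod_const prod_eq_single prod_eq_zero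
  prod_mul_distrib prod_nonneg prod_pos range single_le_sum sum_add_distrib sum_comm sum_congr sum_const
  sum_eq_zero sum_ite_eq sum_le_sum sum_mul sum_mul_sum sum_neg_distrib sum_nonneg sum_sigma sum_sub_distrib)
open ENNReal (add_ne_top coe_lt_top coe_ne_top coe_toNNReal mul_ne_top ofReal ofReal_add ofReal_le_ofReal
  ofReal_mul ofReal_ne_top toReal_mono toReal_mul toReal_nonneg tsum_le_tsum)
open Real (exp exp_add exp_nat_mul exp_pos log norm_eq_abs norm_of_nonneg rpow_add rpow_le_rpow rpow_mul
  rpow_natCast rpow_neg_one rpow_nonneg rpow_one sq_sqrt sqrt sqrt_nonneg)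
open MeasureTheory.Measure (infinitePi infinitePi_map_eval isProbabilityMeasure_map prod_restrict restrict_le_self
  volume_eq_prod)

/-! ### Uniform approximation by combinations of interval indicators -/

/-- `f` is a uniform limit of combinations of indicators of subintervals of `[-1,1]` whose
coefficients have total mass at most `M`. -/
def StepApprox (f : ℝ → ℝ) (M : ℝ) : Prop :=
  ∀ η > 0, ∃ (R : Type) (_ : Fintype R) (c : R → ℝ) (I : R → Set ℝ),
    (∀ r, (I r).OrdConnected ∧ I r ⊆ Icc (-1) 1) ∧ ∑ r, |c r| ≤ M ∧
    ∀ v, |f v - ∑ r, c r * (I r).indicator 1 v| ≤ η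

lemma StepApprox.congr {f g : ℝ → ℝ} {M : ℝ} (hf : StepApprox f M) (h : ∀ v, g v = f v) :
    StepApprox g M := by
  rwa [show g = f from funext h]

lemma StepApprox.sub {f g : ℝ → ℝ} {M M' : ℝ} (hf : StepApprox f M) (hg : StepApprox g M') :
    StepApprox (fun v => f v - g v) (M + M') := by
  intro η hη
  obtain ⟨R, _, c, I, hI, hc, h⟩ := hf (η / 2) (by positivity)
  obtain ⟨R', _, c', I', hI', hc', h'⟩ := hg (η / 2) (by positivity)
  refine ⟨R ⊕ R', inferInstance, Sum.elim c (fun r => - c' r), Sum.elim I I', ?_, ?_, ?_⟩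
  · rintro (r | r)
    · exact hI r
    · exact hI' r
  · simp only [Fintype.sum_sum_type, Sum.elim_inl, Sum.elim_inr, abs_neg]
    linarith
  · intro v
    simp only [Fintype.sum_sum_type, Sum.elim_inl, Sum.elim_inr, neg_mul, sum_neg_distrib]
    have h1 := h v
    have h2 := h' v
    rw [abs_le] at *
    constructor <;> linarith [h1.1, h1.2, h2.1, h2.2]

lemma abs_sum_mul_indicator_le {R : Type*} [Fintype R] (c : R → ℝ) (I : R → Set ℝ) (v : ℝ) :
    |∑ r, c r * (I r).indicator 1 v| ≤ ∑ r, |c r| := by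
  refine (abs_sum_le_sum_abs _ _).trans (sum_le_sum fun r _ => ?_)
  by_cases h : v ∈ I r <;> simp [h]

lemma StepApprox.abs_le {f : ℝ → ℝ} {M : ℝ} (hf : StepApprox f M) (v : ℝ) : |f v| ≤ M := by
  refine le_of_forall_pos_le_add fun η hη => ?_
  obtain ⟨R, _, c, I, -, hc, h⟩ := hf η hη
  have h1 := abs_sum_mul_indicator_le c I v
  have h2 := h v
  have h3 := abs_sub_abs_le_abs_sub (f v) (∑ r, c r * (I r).indicator 1 v)
  linarith

lemma StepApprox.nonneg {f : ℝ → ℝ} {M : ℝ} (hf : StepApprox f M) : 0 ≤ M :=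
  (abs_nonneg _).trans (hf.abs_le 0)

lemma StepApprox.eq_zero {f : ℝ → ℝ} {M : ℝ} (hf : StepApprox f M) {v : ℝ}
    (hv : v ∉ Icc (-1 : ℝ) 1) : f v = 0 := by
  have : |f v| ≤ 0 := by
    refine le_of_forall_pos_le_add fun η hη => ?_
    obtain ⟨R, _, c, I, hI, hc, h⟩ := hf η hη
    have h2 := h v
    have h3 : ∑ r, c r * (I r).indicator 1 v = 0 := sum_eq_zero fun r _ => by
        rw [indicator_of_notMem (fun h => hv ((hI r).2 h)), mul_zero]
    rw [h3] at h2
    simpa using h2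
  exact abs_nonpos_iff.1 this

lemma StepApprox.mul {f g : ℝ → ℝ} {M M' : ℝ} (hf : StepApprox f M) (hg : StepApprox g M') :
    StepApprox (fun v => f v * g v) (M * M') := by
  intro η hη
  have hM := hf.nonneg
  have hM' := hg.nonneg
  set δ := η / (M + M' + 1) with hδ
  have hδ0 : 0 < δ := by positivity
  obtain ⟨R, _, c, I, hI, hc, h⟩ := hf δ hδ0
  obtain ⟨R', _, c', I', hI', hc', h'⟩ := hg δ hδ0
  refine ⟨R × R', inferInstance, fun r => c r.1 * c' r.2, fun r => I r.1 ∩ I' r.2, ?_, ?_, ?_⟩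
  · rintro ⟨r, r'⟩
    exact ⟨(hI r).1.inter (hI' r').1, inter_subset_left.trans (hI r).2⟩
  · simp only [Fintype.sum_prod_type, abs_mul]
    rw [← sum_mul_sum]
    exact mul_le_mul hc hc' (sum_nonneg fun _ _ => abs_nonneg _) hM
  · intro v
    have e : ∑ r : R × R', c r.1 * c' r.2 * (I r.1 ∩ I' r.2).indicator (1 : ℝ → ℝ) v
        = (∑ r, c r * (I r).indicator 1 v) * ∑ r, c' r * (I' r).indicator 1 v := by
      rw [sum_mul_sum, Fintype.sum_prod_type]
      refine sum_congr rfl fun r _ => sum_congr rfl fun r' _ => ?_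
      rw [inter_indicator_one]
      simp only [Pi.mul_apply]
      ring
    rw [e]
    set A := ∑ r, c r * (I r).indicator (1 : ℝ → ℝ) v
    set B := ∑ r, c' r * (I' r).indicator (1 : ℝ → ℝ) v
    have hA : |A| ≤ M := (abs_sum_mul_indicator_le c I v).trans hc
    have hg' := hg.abs_le v
    calc |f v * g v - A * B| = |(f v - A) * g v + A * (g v - B)| := by ring_nf
      _ ≤ |f v - A| * |g v| + |A| * |g v - B| := by rw [← abs_mul, ← abs_mul]; exact abs_add_le _ _
      _ ≤ δ * M' + M * δ := by
        gcongr
        · exact h v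
        · exact h' v
      _ ≤ η := by
        have : δ * (M + M' + 1) = η := by rw [hδ]; field_simp
        nlinarith

lemma StepApprox.measurable {f : ℝ → ℝ} {M : ℝ} (hf : StepApprox f M) : Measurable f := by
  have : ∀ n : ℕ, ∃ g : ℝ → ℝ, Measurable g ∧ ∀ v, |f v - g v| ≤ 1 / ((n : ℝ) + 1) := by
    intro n
    obtain ⟨R, _, c, I, hI, -, h⟩ := hf (1 / ((n : ℝ) + 1)) (by positivity)
    refine ⟨fun v => ∑ r, c r * (I r).indicator 1 v, ?_, h⟩
    exact measurable_sum _ fun r _ => (measurable_const.indicator (hI r).1.measurableSet).const_mul _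
  choose g hg h using this
  refine measurable_of_tendsto_metrizable hg (tendsto_pi_nhds.2 fun v => ?_)
  rw [tendsto_iff_dist_tendsto_zero]
  refine squeeze_zero (fun _ => dist_nonneg) (fun n => ?_) tendsto_one_div_add_atTop_nhds_zero_nat
  rw [dist_comm, Real.dist_eq]
  exact h n v

lemma sum_indicator_level (y : ℝ) (R : ℕ) (hy : y ≤ R) :
    ∑ r : Fin R, (if ((r : ℕ) : ℝ) + 1 ≤ y then (1 : ℝ) else 0) = ⌊y⌋₊ := by
  rw [Fin.sum_univ_eq_sum_range (fun r => if ((r : ℕ) : ℝ) + 1 ≤ y then (1 : ℝ) else 0), Finset.sum_boole]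
  congr 1
  have : (range R).filter (fun r : ℕ => (r : ℝ) + 1 ≤ y) = range ⌊y⌋₊ := by
    ext r
    simp only [mem_filter, Finset.mem_range]
    have key : (r : ℝ) + 1 ≤ y ↔ r < ⌊y⌋₊ := by
      rw [← Nat.succ_le_iff, Nat.le_floor_iff' (Nat.succ_ne_zero r)]
      push_cast
      rfl
    rw [key]
    refine ⟨fun h => h.2, fun h => ⟨?_, h⟩⟩
    have h1 : (r : ℝ) + 1 ≤ R := (key.2 h).trans hy
    exact_mod_cast h1
  rw [this, card_range]

lemma MonotoneOn.stepApprox_sub_left {f : ℝ → ℝ} (hf : MonotoneOn f (Icc (-1) 1)) :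
    StepApprox ((Icc (-1) 1).indicator fun v => f v - f (-1)) (f 1 - f (-1)) := by
  have hm1 : (-1 : ℝ) ∈ Icc (-1 : ℝ) 1 := by constructor <;> norm_num
  have h1 : (1 : ℝ) ∈ Icc (-1 : ℝ) 1 := by constructor <;> norm_num
  intro η hη
  set L := f 1 - f (-1) with hL
  have hL0 : 0 ≤ L := sub_nonneg.2 (hf hm1 h1 (by norm_num))
  obtain ⟨R, hR⟩ := exists_nat_gt (L / η)
  have hR0 : (0 : ℝ) < R := lt_of_le_of_lt (by positivity) hR
  refine ⟨Fin R, inferInstance, fun _ => L / R,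
    fun r => {v | v ∈ Icc (-1 : ℝ) 1 ∧ ((r : ℕ) : ℝ) + 1 ≤ (f v - f (-1)) * R / L}, ?_, ?_, ?_⟩
  · intro r
    refine ⟨⟨fun u hu v hv w hw => ?_⟩, fun v hv => hv.1⟩
    have hw1 : w ∈ Icc (-1 : ℝ) 1 := ⟨hu.1.1.trans hw.1, hw.2.trans hv.1.2⟩
    refine ⟨hw1, hu.2.trans ?_⟩
    have := hf hu.1 hw1 hw.1
    gcongr
  · simp only [sum_const, card_univ, Fintype.card_fin, nsmul_eq_mul]
    rw [abs_of_nonneg (by positivity)]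
    field_simp
    exact le_rfl
  · intro v
    rw [← mul_sum]
    by_cases hv : v ∈ Icc (-1 : ℝ) 1
    · rw [indicator_of_mem hv]
      have hg0 : 0 ≤ f v - f (-1) := sub_nonneg.2 (hf hm1 hv hv.1)
      have hgL : f v - f (-1) ≤ L := by linarith [hf hv h1 hv.2]
      set g := f v - f (-1) with hg
      have e : ∑ r : Fin R, ({v | v ∈ Icc (-1 : ℝ) 1 ∧
          ((r : ℕ) : ℝ) + 1 ≤ (f v - f (-1)) * R / L}).indicator (1 : ℝ → ℝ) v
          = ⌊g * R / L⌋₊ := by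
        rw [← sum_indicator_level (g * R / L) R]
        · refine sum_congr rfl fun r _ => ?_
          simp only [indicator_apply, mem_ofPred_eq, hv, true_and, Pi.one_apply, ← hg]
        · rcases hL0.eq_or_lt with h0 | h0
          · rw [← h0]; simp
          · rw [div_le_iff₀ h0]; nlinarith
      rw [e]
      rcases hL0.eq_or_lt with h0 | h0
      · have : g = 0 := le_antisymm (by linarith) hg0
        rw [this, ← h0]; simpa using hη.le
      · have hf1 := Nat.floor_le (a := g * R / L) (by positivity)
        have hf2 := (Nat.lt_floor_add_one (g * R / L)).le
        have e2 : g = L / R * (g * R / L) := by field_simp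
        have hLR : L / R ≤ η := by
          rw [div_lt_iff₀ hη] at hR
          rw [div_le_iff₀ hR0]; linarith
        have hLR0 : 0 ≤ L / R := by positivity
        set F : ℝ := ((⌊g * R / L⌋₊ : ℕ) : ℝ)
        rw [abs_of_nonneg]
        · nlinarith
        · nlinarith
    · rw [indicator_of_notMem hv]
      have : ∑ r : Fin R, ({v | v ∈ Icc (-1 : ℝ) 1 ∧
          ((r : ℕ) : ℝ) + 1 ≤ (f v - f (-1)) * R / L}).indicator (1 : ℝ → ℝ) v = 0 :=
        sum_eq_zero fun r _ => indicator_of_notMem (fun h => hv h.1) _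
      rw [this]
      simpa using hη.le

lemma stepApprox_const_indicator (c : ℝ) : StepApprox ((Icc (-1) 1).indicator fun _ => c) |c| := by
  intro η hη
  refine ⟨Unit, inferInstance, fun _ => c, fun _ => Icc (-1) 1,
    fun _ => ⟨ordConnected_Icc, subset_rfl⟩, by simp, fun v => ?_⟩
  by_cases hv : v ∈ Icc (-1 : ℝ) 1
  · simp [indicator_of_mem hv, hη.le]
  · simp [indicator_of_notMem hv, hη.le]

lemma exists_stepApprox_of_monotoneOn {f : ℝ → ℝ} (hf : MonotoneOn f (Icc (-1) 1)) :
    ∃ M, StepApprox ((Icc (-1) 1).indicator f) M := by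
  have h := (MonotoneOn.stepApprox_sub_left hf).sub (stepApprox_const_indicator (- f (-1)))
  refine ⟨_, h.congr fun v => ?_⟩
  by_cases hv : v ∈ Icc (-1 : ℝ) 1
  · simp [indicator_of_mem hv]
  · simp [indicator_of_notMem hv]


lemma IsKernel.exists_stepApprox {K : ℝ → ℝ} (hK : IsKernel K) : ∃ M, StepApprox K M := by
  obtain ⟨f, g, hf, hg, e⟩ := hK.boundedVariation.locallyBoundedVariationOn.exists_monotoneOn_sub_monotoneOn
  obtain ⟨M, hM⟩ := exists_stepApprox_of_monotoneOn hf
  obtain ⟨M', hM'⟩ := exists_stepApprox_of_monotoneOn hg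
  refine ⟨M + M', (hM.sub hM').congr fun v => ?_⟩
  by_cases hv : v ∈ Icc (-1 : ℝ) 1
  · simp [indicator_of_mem hv, e]
  · simp [indicator_of_notMem hv, hK.support v hv]

/-- The kernel times a monomial. -/
def kerPow (K : ℝ → ℝ) (e : ℕ) (v : ℝ) : ℝ := K v * v ^ e

lemma IsKernel.exists_stepApprox_kerPow {K : ℝ → ℝ} (hK : IsKernel K) (e : ℕ) :
    ∃ M, StepApprox (kerPow K e) M := by
  induction e with
  | zero =>
    obtain ⟨M, hM⟩ := hK.exists_stepApprox
    exact ⟨M, hM.congr fun v => by simp [kerPow]⟩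
  | succ e ih =>
    obtain ⟨M, hM⟩ := ih
    obtain ⟨M', hM'⟩ := exists_stepApprox_of_monotoneOn (f := fun v => v) (fun u _ v _ h => h)
    refine ⟨M * M', (hM.mul hM').congr fun v => ?_⟩
    by_cases hv : v ∈ Icc (-1 : ℝ) 1
    · simp only [kerPow, indicator_of_mem hv]; ring
    · simp [kerPow, indicator_of_notMem hv, hK.support v hv]

/-! ### From interval boxes to product kernels -/

variable {ι : Type} [Fintype ι]

/-- Boxes with interval sides of length at most `2 h k`, inside `[-Λ,Λ]`. -/
structure IsSmallBox (Λ : ℝ) (h : ι → ℝ) (I : ι → Set ℝ) : Prop where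
  ordConnected : ∀ k, (I k).OrdConnected
  subset : ∀ k, I k ⊆ Icc (-Λ) Λ
  diam : ∀ k, ∀ u ∈ I k, ∀ v ∈ I k, u - v ≤ 2 * h k

lemma IsSmallBox.measurableSet {Λ : ℝ} {h : ι → ℝ} {I : ι → Set ℝ} (hI : IsSmallBox Λ h I) :
    MeasurableSet (univ.pi I) :=
  MeasurableSet.univ_pi fun k => (hI.ordConnected k).measurableSet

lemma isSmallBox_preimage {Λ : ℝ} {h t : ι → ℝ} (hh : ∀ k, 0 < h k) (ht : ∀ k, |t k| + h k ≤ Λ)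
    {I : ι → Set ℝ} (hI : ∀ k, (I k).OrdConnected ∧ I k ⊆ Icc (-1) 1) :
    IsSmallBox Λ h fun k => (fun u => (u - t k) / h k) ⁻¹' I k := by
  have key : ∀ k u, (u - t k) / h k ∈ I k → |u - t k| ≤ h k := by
    intro k u hu
    have := (hI k).2 hu
    rw [mem_Icc, le_div_iff₀ (hh k), div_le_iff₀ (hh k)] at this
    rw [abs_le]; constructor <;> linarith [this.1, this.2]
  refine ⟨fun k => ?_, fun k u hu => ?_, fun k u hu v hv => ?_⟩
  · refine (hI k).1.preimage_mono fun u v huv => ?_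
    have := (hh k).le
    gcongr
  · have h1 := abs_le.1 (key k u hu)
    have h2 := ht k
    have h3 := abs_le.1 (le_refl |t k|)
    constructor <;> linarith [h1.1, h1.2, h3.1, h3.2]
  · have h1 := abs_le.1 (key k u hu)
    have h2 := abs_le.1 (key k v hv)
    linarith [h1.1, h1.2, h2.1, h2.2]

lemma indicator_pi_one (I : ι → Set ℝ) (u : ι → ℝ) :
    (univ.pi I).indicator (1 : (ι → ℝ) → ℝ) u = ∏ k, (I k).indicator 1 (u k) := by
  classical
  by_cases hu : u ∈ univ.pi I
  · rw [indicator_of_mem hu]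
    exact (Finset.prod_eq_one fun k _ => indicator_of_mem (hu k (mem_univ k)) _).symm
  · rw [indicator_of_notMem hu]
    simp only [Set.mem_pi, mem_univ, true_implies, not_forall] at hu
    obtain ⟨k, hk⟩ := hu
    exact (prod_eq_zero (Finset.mem_univ k) (indicator_of_notMem hk _)).symm

lemma abs_prod_sub_prod_le {s : Finset ι} {f g : ι → ℝ} {M η : ℝ} (hM : 1 ≤ M)
    (hf : ∀ k, |f k| ≤ M) (hg : ∀ k, |g k| ≤ M) (h : ∀ k, |f k - g k| ≤ η) :
    |∏ k ∈ s, f k - ∏ k ∈ s, g k| ≤ s.card * M ^ s.card * η := by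
  classical
  induction s using Finset.induction_on with
  | empty => simp
  | insert a s ha ih =>
    rw [Finset.prod_insert ha, Finset.prod_insert ha, card_insert_of_notMem ha]
    have hM0 : 0 ≤ M := by linarith
    have hη : 0 ≤ η := (abs_nonneg _).trans (h a)
    have hgs : |∏ k ∈ s, g k| ≤ M ^ s.card := by
      rw [abs_prod]
      exact (Finset.prod_le_prod (fun _ _ => abs_nonneg _) (fun k _ => hg k)).trans (by rw [prod_const])
    calc |f a * ∏ k ∈ s, f k - g a * ∏ k ∈ s, g k|
        = |f a * (∏ k ∈ s, f k - ∏ k ∈ s, g k) + (f a - g a) * ∏ k ∈ s, g k| := by ring_nf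
      _ ≤ |f a| * |∏ k ∈ s, f k - ∏ k ∈ s, g k| + |f a - g a| * |∏ k ∈ s, g k| := by
        rw [← abs_mul, ← abs_mul]; exact abs_add_le _ _
      _ ≤ M * (s.card * M ^ s.card * η) + η * M ^ s.card := by
        gcongr
        · exact hf a
        · exact h a
      _ ≤ M * (s.card * M ^ s.card * η) + η * M ^ (s.card + 1) := by
        gcongr
        · exact Nat.le_succ _
      _ = _ := by push_cast; ring

/-- The product kernel with factors `f k` at the point `t` with bandwidths `h`. -/
def prodKer (f : ι → ℝ → ℝ) (h t u : ι → ℝ) : ℝ := ∏ k, f k ((u k - t k) / h k)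

lemma measurable_prodKer {f : ι → ℝ → ℝ} (hf : ∀ k, Measurable (f k)) (h : ι → ℝ) :
    Measurable fun v : (ι → ℝ) × (ι → ℝ) => prodKer f h v.1 v.2 := by
  unfold prodKer
  exact Finset.measurable_prod _ fun k _ => (hf k).comp (by fun_prop)

lemma abs_prodKer_le {f : ι → ℝ → ℝ} {M : ι → ℝ} (hf : ∀ k v, |f k v| ≤ M k) (h t u : ι → ℝ) :
    |prodKer f h t u| ≤ ∏ k, M k := by
  unfold prodKer
  rw [abs_prod]
  exact Finset.prod_le_prod (fun _ _ => abs_nonneg _) fun k _ => hf k _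

/-- A linear functional that is continuous for the uniform norm and small on the indicators of
small boxes is small on product kernels. -/
lemma abs_apply_prodKer_le {f : ι → ℝ → ℝ} {M : ι → ℝ} (hf : ∀ k, StepApprox (f k) (M k))
    {Λ X L : ℝ} {h t : ι → ℝ} (hh : ∀ k, 0 < h k) (ht : ∀ k, |t k| + h k ≤ Λ)
    (Φ : ((ι → ℝ) → ℝ) → ℝ)
    (hadd : ∀ (R : Type) (_ : Fintype R) (c : R → ℝ) (A : R → Set (ι → ℝ)), (∀ r, MeasurableSet (A r)) →
      Φ (fun u => ∑ r, c r * (A r).indicator 1 u) = ∑ r, c r * Φ ((A r).indicator 1))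
    (hcont : ∀ (f g : (ι → ℝ) → ℝ) (η : ℝ), Measurable f → Measurable g →
      (∀ u, |f u| ≤ ∏ k, M k) → (∀ u, |g u| ≤ ∏ k, M k) →
      (∀ u, |f u - g u| ≤ η) → |Φ f - Φ g| ≤ L * η)
    (hX : ∀ I, IsSmallBox Λ h I → |Φ ((univ.pi I).indicator 1)| ≤ X) :
    |Φ (prodKer f h t)| ≤ (∏ k, M k) * X := by
  classical
  have hM0 : ∀ k, 0 ≤ M k := fun k => (hf k).nonneg
  have hX0 : 0 ≤ X := (abs_nonneg _).trans (hX (fun k => (fun u => (u - t k) / h k) ⁻¹' ∅)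
    (isSmallBox_preimage hh ht fun _ => ⟨ordConnected_empty, empty_subset _⟩))
  have hmf : Measurable (prodKer f h t) :=
    (measurable_prodKer (fun k => (hf k).measurable) h).comp (by fun_prop : Measurable fun u => (t, u))
  set M₁ := 1 + ∑ k, M k with hM₁
  have hMM : ∀ k, M k ≤ M₁ := fun k => by
    have := single_le_sum (fun k _ => hM0 k) (Finset.mem_univ k)
    linarith
  have hM₁1 : 1 ≤ M₁ := by have := sum_nonneg (s := Finset.univ) fun k _ => hM0 k; linarith
  refine le_of_forall_pos_le_add fun ε hε => ?_
  set B := |L| * ((Fintype.card ι : ℝ) * M₁ ^ Fintype.card ι) + 1 with hB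
  have hB0 : 0 < B := by positivity
  choose R _ c I hI hc happ using fun k => hf k (ε / B) (by positivity)
  set g : (ι → ℝ) → ℝ := fun u => ∑ r : (k : ι) → R k, (∏ k, c k (r k)) *
    (univ.pi fun k => (fun u => (u - t k) / h k) ⁻¹' I k (r k)).indicator 1 u with hg
  have hg' : ∀ u, g u = ∏ k, ∑ r, c k r * (I k r).indicator 1 ((u k - t k) / h k) := by
    intro u
    rw [Fintype.prod_sum]
    refine sum_congr rfl fun r _ => ?_
    rw [indicator_pi_one, ← prod_mul_distrib]
    rfl
  have hbox : ∀ r : (k : ι) → R k, IsSmallBox Λ h fun k => (fun u => (u - t k) / h k) ⁻¹' I k (r k) :=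
    fun r => isSmallBox_preimage hh ht fun k => hI k (r k)
  have hsum : ∀ k v, |∑ r, c k r * (I k r).indicator (1 : ℝ → ℝ) v| ≤ M k := fun k v =>
    (abs_sum_mul_indicator_le _ _ _).trans (hc k)
  have hgb : ∀ u, |g u| ≤ ∏ k, M k := by
    intro u
    rw [hg', abs_prod]
    exact Finset.prod_le_prod (fun _ _ => abs_nonneg _) fun k _ => hsum k _
  have hgm : Measurable g := measurable_sum _ fun r _ =>
    (measurable_const.indicator (hbox r).measurableSet).const_mul _
  have h1 : |Φ (prodKer f h t) - Φ g| ≤ L * (Fintype.card ι * M₁ ^ Fintype.card ι * (ε / B)) := by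
    refine hcont _ _ _ hmf hgm (abs_prodKer_le (fun k v => (hf k).abs_le v) h t) hgb fun u => ?_
    rw [hg']
    exact abs_prod_sub_prod_le (s := Finset.univ) hM₁1
      (fun k => ((hf k).abs_le _).trans (hMM k)) (fun k => (hsum k _).trans (hMM k))
      fun k => happ k _
  have h2 : |Φ g| ≤ (∏ k, M k) * X := by
    rw [hg, hadd _ inferInstance _ _ fun r => (hbox r).measurableSet]
    calc |∑ r : (k : ι) → R k, (∏ k, c k (r k)) * Φ _|
        ≤ ∑ r : (k : ι) → R k, (∏ k, |c k (r k)|) * X := by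
          refine (abs_sum_le_sum_abs _ _).trans (sum_le_sum fun r _ => ?_)
          rw [abs_mul, abs_prod]
          exact mul_le_mul_of_nonneg_left (hX _ (hbox r)) (prod_nonneg fun _ _ => abs_nonneg _)
      _ = (∏ k, ∑ r, |c k r|) * X := by rw [Fintype.prod_sum, sum_mul]
      _ ≤ (∏ k, M k) * X := by
          refine mul_le_mul_of_nonneg_right ?_ hX0
          exact Finset.prod_le_prod (fun k _ => sum_nonneg fun _ _ => abs_nonneg _) fun k _ => hc k
  have h3 : L * (Fintype.card ι * M₁ ^ Fintype.card ι * (ε / B)) ≤ ε := by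
    have h4 : L * (Fintype.card ι * M₁ ^ Fintype.card ι * (ε / B)) ≤
        (|L| * (Fintype.card ι * M₁ ^ Fintype.card ι)) * (ε / B) := by
      rw [← mul_assoc]
      gcongr
      exact le_abs_self L
    refine h4.trans ?_
    calc _ ≤ B * (ε / B) := by gcongr; linarith
      _ = ε := by field_simp
  have := abs_sub_abs_le_abs_sub (Φ (prodKer f h t)) (Φ g)
  linarith

/-! ### Exponential inequality for adapted sums -/

variable {Ω Ξ A : Type*} [MeasurableSpace Ω] [MeasurableSpace Ξ] {P : Measure Ω}
  [IsProbabilityMeasure P] {Q : Measure Ξ} [IsProbabilityMeasure Q] {D : ℕ → Ω → Ξ}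

lemma lintegral_exp_mul_le {f : Ξ → ℝ} (hf : Measurable f) {B v l : ℝ} (hB : ∀ d, |f d| ≤ B)
    (h0 : ∫ d, f d ∂Q = 0) (hv : ∫ d, f d ^ 2 ∂Q ≤ v) (hl : 0 ≤ l) (hlB : l * B ≤ 1) :
    ∫⁻ d, ofReal (exp (l * f d)) ∂Q ≤ ofReal (exp (l ^ 2 * v)) := by
  have hb : ∀ d, |l * f d| ≤ 1 := fun d => by
    rw [abs_mul, abs_of_nonneg hl]
    exact (mul_le_mul_of_nonneg_left (hB d) hl).trans hlB
  have hi : Integrable f Q := .of_bound hf.aestronglyMeasurable B (ae_of_all _ hB)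
  have hi2 : Integrable (fun d => f d ^ 2) Q :=
    .of_bound (hf.pow_const 2).aestronglyMeasurable (B ^ 2) (ae_of_all _ fun d => by
      rw [norm_eq_abs, abs_pow]
      exact pow_le_pow_left₀ (abs_nonneg _) (hB d) 2)
  have hle : ∀ d, exp (l * f d) ≤ 1 + l * f d + l ^ 2 * f d ^ 2 := fun d => by
    have := (abs_le.1 (Real.abs_exp_sub_one_sub_id_le (hb d))).2
    nlinarith
  have hir : Integrable (fun d => 1 + l * f d + l ^ 2 * f d ^ 2) Q :=
    ((integrable_const 1).add (hi.const_mul l)).add (hi2.const_mul _)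
  calc ∫⁻ d, ofReal (exp (l * f d)) ∂Q
      ≤ ∫⁻ d, ofReal (1 + l * f d + l ^ 2 * f d ^ 2) ∂Q := lintegral_mono fun d => ofReal_le_ofReal (hle d)
    _ = ofReal (∫ d, 1 + l * f d + l ^ 2 * f d ^ 2 ∂Q) := (ofReal_integral_eq_lintegral_ofReal hir
          (ae_of_all _ fun d => (exp_pos _).le.trans (hle d))).symm
    _ = ofReal (1 + l ^ 2 * ∫ d, f d ^ 2 ∂Q) := by
        have hi1 : Integrable (fun d => 1 + l * f d) Q := (integrable_const 1).add (hi.const_mul l)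
        rw [integral_add hi1 (hi2.const_mul _),
          integral_add (integrable_const 1) (hi.const_mul l), integral_const_mul,
          integral_const_mul, h0]
        simp
    _ ≤ _ := by
        apply ofReal_le_ofReal
        have h1 : l ^ 2 * ∫ d, f d ^ 2 ∂Q ≤ l ^ 2 * v := by gcongr
        linarith [Real.add_one_le_exp (l ^ 2 * v)]

/-- The `D i` are independent with law `Q`. -/
structure IsIID (P : Measure Ω) (D : ℕ → Ω → Ξ) (Q : Measure Ξ) : Prop where
  measurable : ∀ i, Measurable (D i)
  indep : iIndepFun D P
  law : ∀ i, P.map (D i) = Q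

lemma IsIID.indepFun_past (hD : IsIID P D Q) (m : ℕ) : IndepFun (fun ω (l : Fin m) => D l ω) (D m) P := by
  have h := hD.indep.indepFun_finset (range m) {m} (by simp) hD.measurable
  exact h.comp (φ := fun (y : range m → Ξ) (l : Fin m) => y ⟨l, by simp⟩)
    (ψ := fun (y : ({m} : Finset ℕ) → Ξ) => y ⟨m, by simp⟩) (by fun_prop) (by fun_prop)

section Bernstein

variable {n : ℕ} {f : (i : ℕ) → (Fin i → Ξ) → Ξ → ℝ} {v : ℕ → ℝ} {B l : ℝ}

lemma lintegral_exp_adapted_le (hD : IsIID P D Q)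
    (hf : ∀ i, Measurable fun w : (Fin i → Ξ) × Ξ => f i w.1 w.2)
    (hB : ∀ i < n, ∀ y d, |f i y d| ≤ B) (h0 : ∀ i < n, ∀ y, ∫ d, f i y d ∂Q = 0)
    (hv : ∀ i < n, ∀ y, ∫ d, f i y d ^ 2 ∂Q ≤ v i) (hl : 0 ≤ l) (hlB : l * B ≤ 1)
    {m : ℕ} (hm : m ≤ n) :
    ∫⁻ ω, ofReal (exp (l * ∑ i ∈ range m, f i (fun l => D l ω) (D i ω))) ∂P
      ≤ ofReal (exp (l ^ 2 * ∑ i ∈ range m, v i)) := by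
  induction m with
  | zero => simp
  | succ m ih =>
    have hmn : m < n := hm
    set Y : Ω → Fin m → Ξ := fun ω l => D l ω with hY
    have hYm : Measurable Y := measurable_pi_lambda _ fun l => hD.measurable l
    set s : (Fin m → Ξ) → ℝ := fun y => ∑ i : Fin m, f i (fun l => y (Fin.castLE i.2.le l)) (y i) with hs
    have hsm : Measurable s := measurable_sum _ fun i _ =>
      (hf i).comp (by fun_prop :
        Measurable fun y : Fin m → Ξ => ((fun l : Fin i => y (Fin.castLE i.2.le l)), y i))
    have hsY : ∀ ω, ∑ i ∈ range m, f i (fun l => D l ω) (D i ω) = s (Y ω) := by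
      intro ω
      rw [Finset.sum_range]
      rfl
    have hprod : P.map (fun ω => (Y ω, D m ω)) = (P.map Y).prod Q := by
      rw [(indepFun_iff_map_prod_eq_prod_map_map hYm.aemeasurable
        (hD.measurable m).aemeasurable).1 (hD.indepFun_past m), hD.law]
    have hprob : IsProbabilityMeasure (P.map Y) := isProbabilityMeasure_map hYm.aemeasurable
    have hfm := hf m
    calc ∫⁻ ω, ofReal
          (exp (l * ∑ i ∈ range (m + 1), f i (fun l => D l ω) (D i ω))) ∂P
        = ∫⁻ ω, (fun w : (Fin m → Ξ) × Ξ => ofReal (exp (l * s w.1)) *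
            ofReal (exp (l * f m w.1 w.2))) (Y ω, D m ω) ∂P := by
          refine lintegral_congr fun ω => ?_
          rw [Finset.sum_range_succ, hsY, mul_add, exp_add, ofReal_mul (exp_pos _).le]
      _ = ∫⁻ w, ofReal (exp (l * s w.1)) * ofReal (exp (l * f m w.1 w.2)) ∂(P.map Y).prod Q := by
          rw [← hprod, lintegral_map (by fun_prop) (hYm.prodMk (hD.measurable m))]
      _ = ∫⁻ y, ofReal (exp (l * s y)) * ∫⁻ d, ofReal (exp (l * f m y d)) ∂Q ∂P.map Y := by
          rw [lintegral_prod _ (by fun_prop)]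
          refine lintegral_congr fun y => ?_
          exact lintegral_const_mul (μ := Q) (ofReal (exp (l * s y)))
            (f := fun d => ofReal (exp (l * f m y d)))
            ((hfm.comp measurable_prodMk_left).const_mul l).exp.ennreal_ofReal
      _ ≤ ∫⁻ y, ofReal (exp (l * s y)) * ofReal (exp (l ^ 2 * v m)) ∂P.map Y := by
          refine lintegral_mono fun y => mul_le_mul_right ?_ _
          exact lintegral_exp_mul_le (hfm.comp measurable_prodMk_left) (hB m hmn y) (h0 m hmn y)
            (hv m hmn y) hl hlB
      _ = (∫⁻ ω, ofReal (exp (l * s (Y ω))) ∂P) * ofReal (exp (l ^ 2 * v m)) := by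
          rw [lintegral_mul_const _ (by fun_prop), lintegral_map (by fun_prop) hYm]
      _ ≤ ofReal (exp (l ^ 2 * ∑ i ∈ range m, v i)) * ofReal (exp (l ^ 2 * v m)) := by
          have := ih hmn.le
          simp_rw [hsY] at this
          gcongr
      _ = _ := by rw [← ofReal_mul (exp_pos _).le, ← exp_add, Finset.sum_range_succ, mul_add]

lemma measure_le_exp_of_lintegral {S : Ω → ℝ} (hS : Measurable S) {l x w : ℝ} (hl : 0 ≤ l)
    (h : ∫⁻ ω, ofReal (exp (l * S ω)) ∂P ≤ ofReal (exp w)) :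
    P {ω | x ≤ S ω} ≤ ofReal (exp (w - l * x)) := by
  have h1 : P {ω | x ≤ S ω} ≤ P {ω | ofReal (exp (l * x)) ≤ ofReal (exp (l * S ω))} := by
    refine measure_mono fun ω (hω : x ≤ S ω) => ?_
    refine ofReal_le_ofReal ?_
    gcongr
  have h2 := mul_meas_ge_le_lintegral₀ (μ := P) (f := fun ω => ofReal (exp (l * S ω))) (by fun_prop)
    (ofReal (exp (l * x)))
  have h3 : ofReal (exp (w - l * x)) = ofReal (exp w) / ofReal (exp (l * x)) := by
    rw [← ENNReal.ofReal_div_of_pos (exp_pos _), Real.exp_sub]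
  rw [h3]
  refine h1.trans ?_
  rw [ENNReal.le_div_iff_mul_le (Or.inl (by simp [exp_pos])) (Or.inl (by simp)), mul_comm]
  exact h2.trans h

lemma measure_abs_adapted_ge_le (hD : IsIID P D Q)
    (hf : ∀ i, Measurable fun w : (Fin i → Ξ) × Ξ => f i w.1 w.2)
    (hB : ∀ i < n, ∀ y d, |f i y d| ≤ B) (h0 : ∀ i < n, ∀ y, ∫ d, f i y d ∂Q = 0)
    (hv : ∀ i < n, ∀ y, ∫ d, f i y d ^ 2 ∂Q ≤ v i) (hl : 0 ≤ l) (hlB : l * B ≤ 1)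
    {m : ℕ} (hm : m ≤ n) (x : ℝ) :
    P {ω | x ≤ |∑ i ∈ range m, f i (fun l => D l ω) (D i ω)|}
      ≤ 2 * ofReal (exp (l ^ 2 * (∑ i ∈ range m, v i) - l * x)) := by
  have hSm : ∀ g : (i : ℕ) → (Fin i → Ξ) → Ξ → ℝ, (∀ i, Measurable fun w : (Fin i → Ξ) × Ξ => g i w.1 w.2) →
      Measurable fun ω => ∑ i ∈ range m, g i (fun l => D l ω) (D i ω) := fun g hg =>
    measurable_sum _ fun i _ => (hg i).comp
      ((measurable_pi_lambda _ fun l : Fin i => hD.measurable l).prodMk (hD.measurable i))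
  have h1 := measure_le_exp_of_lintegral (x := x) (hSm f hf) hl
    (lintegral_exp_adapted_le hD hf hB h0 hv hl hlB hm)
  have hfn : ∀ i, Measurable fun w : (Fin i → Ξ) × Ξ => -f i w.1 w.2 := fun i => (hf i).neg
  have h2 := measure_le_exp_of_lintegral (x := x) (hSm (fun i y d => - f i y d) hfn) hl
    (lintegral_exp_adapted_le (f := fun i y d => - f i y d) (v := v) hD hfn
      (fun i hi y d => by rw [abs_neg]; exact hB i hi y d)
      (fun i hi y => by rw [integral_neg, h0 i hi y, neg_zero])
      (fun i hi y => by simpa using hv i hi y) hl hlB hm)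
  refine (measure_mono (t := {ω | x ≤ ∑ i ∈ range m, f i (fun l => D l ω) (D i ω)} ∪
    {ω | x ≤ ∑ i ∈ range m, -f i (fun l => D l ω) (D i ω)}) fun ω hω => ?_).trans
    ((measure_union_le _ _).trans ?_)
  · have hω' : x ≤ |∑ i ∈ range m, f i (fun l => D l ω) (D i ω)| := hω
    rcases le_abs.1 hω' with h | h
    · exact Or.inl h
    · right
      show x ≤ ∑ i ∈ range m, -f i (fun l => D l ω) (D i ω)
      rwa [sum_neg_distrib]
  · rw [two_mul]
    exact add_le_add h1 h2

end Bernstein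

/-! ### Rates and the Borel–Cantelli argument over a grid -/

/-- The rate `(b_n log n / n)^{1/2}`. -/
def rateX (b : ℕ → ℝ) (n : ℕ) : ℝ := √(b n * (log n / n))

/-- The truncation level `(b_n n / log n)^{1/2}`. -/
def rateQ (b : ℕ → ℝ) (n : ℕ) : ℝ := √(b n / (log n / n))

lemma log_div_pos {n : ℕ} (hn : 2 ≤ n) : 0 < log n / n :=
  div_pos (Real.log_pos (by exact_mod_cast hn)) (by positivity)

lemma rateX_nonneg (b : ℕ → ℝ) (n : ℕ) : 0 ≤ rateX b n := sqrt_nonneg _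

lemma rateQ_nonneg (b : ℕ → ℝ) (n : ℕ) : 0 ≤ rateQ b n := sqrt_nonneg _

lemma rateQ_pos {b : ℕ → ℝ} (hb : ∀ n, 0 < b n) {n : ℕ} (hn : 2 ≤ n) : 0 < rateQ b n :=
  Real.sqrt_pos.2 (div_pos (hb n) (log_div_pos hn))

lemma rateX_eq {b : ℕ → ℝ} (hb : ∀ n, 0 < b n) {n : ℕ} (hn : 2 ≤ n) :
    rateX b n = rateQ b n * (log n / n) := by
  have hL := log_div_pos hn
  unfold rateX rateQ
  rw [show b n * (log n / n) = b n / (log n / n) * (log n / n) ^ 2 by field_simp,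
    Real.sqrt_mul (div_pos (hb n) hL).le, Real.sqrt_sq hL.le]

lemma rateQ_sq {b : ℕ → ℝ} (hb : ∀ n, 0 < b n) {n : ℕ} (hn : 2 ≤ n) : rateQ b n ^ 2 = b n / (log n / n) :=
  sq_sqrt (div_pos (hb n) (log_div_pos hn)).le

lemma ae_eventually_notMem_of_le {Ω : Type*} [MeasurableSpace Ω] {P : Measure Ω}
    {bad : ℕ → Set Ω} {C : ℝ} (hC : 0 ≤ C)
    (h : ∀ᶠ n : ℕ in atTop, P (bad n) ≤ ofReal (C / (n : ℝ) ^ 2)) :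
    ∀ᵐ ω ∂P, ∀ᶠ n in atTop, ω ∉ bad n := by
  obtain ⟨n₀, hn₀⟩ := eventually_atTop.1 h
  have hs : (∑' n, P (if n₀ ≤ n then bad n else ∅)) ≠ ⊤ := by
    have hsum : Summable fun n : ℕ => C / (n : ℝ) ^ 2 :=
      (Real.summable_one_div_nat_pow.2 one_lt_two).mul_left C |>.congr fun n => by ring
    refine ne_top_of_le_ne_top hsum.tsum_ofReal_ne_top (tsum_le_tsum fun n => ?_)
    split_ifs with hn
    · exact hn₀ n hn
    · simp
  filter_upwards [ae_eventually_notMem hs] with ω hω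
  filter_upwards [hω, eventually_ge_atTop n₀] with n hn hn'
  simpa [hn'] using hn

lemma integral_sub_integral_sq_le {f : Ξ → ℝ} (hf : Measurable f) {B : ℝ} (hB : ∀ d, |f d| ≤ B) :
    ∫ d, (f d - ∫ d, f d ∂Q) ^ 2 ∂Q ≤ ∫ d, f d ^ 2 ∂Q := by
  have hi : MemLp f 2 Q := MemLp.of_bound hf.aestronglyMeasurable B (ae_of_all _ hB)
  have h := variance_eq_sub hi
  rw [variance_eq_integral hf.aemeasurable] at h
  rw [h]
  have : 0 ≤ (∫ d, f d ∂Q) ^ 2 := sq_nonneg _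
  simp only [Pi.pow_apply]
  linarith

lemma abs_sub_integral_le {f : Ξ → ℝ} {B : ℝ} (hB : ∀ d, |f d| ≤ B) (d : Ξ) :
    |f d - ∫ d, f d ∂Q| ≤ 2 * B := by
  have h1 : |∫ d, f d ∂Q| ≤ B := by
    have := norm_integral_le_of_norm_le_const (μ := Q) (f := f) (C := B) (ae_of_all _ hB)
    simpa using this
  have h2 := abs_sub (f d) (∫ d, f d ∂Q)
  linarith [hB d]

theorem ae_eventually_grid_le (hD : IsIID P D Q) {b : ℕ → ℝ} (hb : ∀ n, 0 < b n)
    {G : Type*} (𝒢 : ℕ → Finset G) (κ : ℕ) (C₀ C₁ : ℝ)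
    (hcard : ∀ᶠ n : ℕ in atTop, ((𝒢 n).card : ℝ) ≤ C₀ * (n : ℝ) ^ κ)
    (σ : ℕ → ℕ → ℕ) (hσ : ∀ n, Function.Injective (σ n))
    (F : (n i : ℕ) → G → (Fin i → Ξ) → Ξ → ℝ)
    (hF : ∀ n i g, Measurable fun w : (Fin i → Ξ) × Ξ => F n i g w.1 w.2)
    (hFB : ∀ᶠ n in atTop, ∀ i < n, ∀ g ∈ 𝒢 n, ∀ y d, |F n i g y d| ≤ rateQ b n)
    (V : ℕ → ℕ → ℝ) (hV0 : ∀ n i, 0 ≤ V n i)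
    (hFV : ∀ᶠ n in atTop, ∀ i < n, ∀ g ∈ 𝒢 n, ∀ y, ∫ d, F n i g y d ^ 2 ∂Q ≤ V n i)
    (hV : ∀ᶠ n : ℕ in atTop, ∑ i ∈ range n, V n i ≤ C₁ * (n * b n)) :
    ∃ C : ℝ, 0 ≤ C ∧ ∀ᵐ ω ∂P, ∀ᶠ n : ℕ in atTop, ∀ m ≤ n, ∀ g ∈ 𝒢 n,
      |∑ i ∈ range m, (F n i g (fun l => D (σ n l) ω) (D (σ n i) ω)
        - ∫ d, F n i g (fun l => D (σ n l) ω) d ∂Q)| ≤ C * (n * rateX b n) := by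
  set C := 2 * ((κ : ℝ) + 3) + |C₁| with hC
  refine ⟨C, by positivity, ?_⟩
  set f : (n i : ℕ) → G → (Fin i → Ξ) → Ξ → ℝ := fun n i g y d =>
    F n i g y d - ∫ d, F n i g y d ∂Q with hfdef
  have hf : ∀ n i g, Measurable fun w : (Fin i → Ξ) × Ξ => f n i g w.1 w.2 := by
    intro n i g
    have h1 : StronglyMeasurable fun y : Fin i → Ξ => ∫ d, F n i g y d ∂Q :=
      (hF n i g).stronglyMeasurable.integral_prod_right
    exact (hF n i g).sub (h1.measurable.comp measurable_fst)
  set bad : ℕ → Set Ω := fun n => ⋃ m ∈ range (n + 1), ⋃ g ∈ 𝒢 n, {ω | C * (n * rateX b n) ≤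
      |∑ i ∈ range m, f n i g (fun l => D (σ n l) ω) (D (σ n i) ω)|} with hbad
  have hmain : ∀ᵐ ω ∂P, ∀ᶠ n in atTop, ω ∉ bad n := by
    refine ae_eventually_notMem_of_le (C := 4 * |C₀|) (by positivity) ?_
    filter_upwards [hcard, hFB, hFV, hV, eventually_ge_atTop 2] with n hcard hFB hFV hV hn
    have hq := rateQ_pos hb hn
    have hL := log_div_pos hn
    have hn0 : (0 : ℝ) < n := by positivity
    set l := 1 / (2 * rateQ b n) with hl
    have hbound : ∀ m ∈ range (n + 1), ∀ g ∈ 𝒢 n, P {ω | C * (n * rateX b n) ≤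
        |∑ i ∈ range m, f n i g (fun l => D (σ n l) ω) (D (σ n i) ω)|}
        ≤ ofReal (2 / (n : ℝ) ^ (κ + 3)) := by
      intro m hm g hg
      have hm' : m ≤ n := by simpa [Nat.lt_succ_iff] using hm
      have h := measure_abs_adapted_ge_le (P := P) (Q := Q) (D := fun i => D (σ n i)) (n := n)
        (f := fun i => f n i g) (v := V n) (B := 2 * rateQ b n) (l := l) 
        ⟨fun i => hD.measurable _, hD.indep.precomp (hσ n), fun i => hD.law _⟩ (fun i => hf n i g)
        (fun i hi y d => abs_sub_integral_le (hFB i hi g hg y) d)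
        (fun i hi y => by
          have hInt : Integrable (fun d => F n i g y d) Q :=
            .of_bound ((hF n i g).comp measurable_prodMk_left).aestronglyMeasurable _
              (ae_of_all _ (hFB i hi g hg y))
          simp only [hfdef]
          rw [integral_sub hInt (integrable_const _)]
          simp)
        (fun i hi y => (integral_sub_integral_sq_le
          ((hF n i g).comp measurable_prodMk_left) (hFB i hi g hg y)).trans (hFV i hi g hg y))
        (by positivity) (by rw [hl]; field_simp; exact le_rfl) hm' (C * (n * rateX b n))
      refine h.trans ?_
      have e1 : l * (C * (n * rateX b n)) = C / 2 * log n := by rw [rateX_eq hb hn, hl]; field_simp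
      have e2 : l ^ 2 * ∑ i ∈ range m, V n i ≤ |C₁| / 4 * log n := by
        have h1 : ∑ i ∈ range m, V n i ≤ |C₁| * (n * b n) := by
          refine (Finset.sum_le_sum_of_subset_of_nonneg (Finset.range_mono hm')
            fun i _ _ => hV0 n i).trans (hV.trans ?_)
          have := hb n
          gcongr
          exact le_abs_self _
        have e3 : l ^ 2 = (log n / n) / (4 * b n) := by
          rw [hl, div_pow, mul_pow, rateQ_sq hb hn]
          have := (hb n).ne'
          field_simp
          ring
        calc l ^ 2 * ∑ i ∈ range m, V n i ≤ l ^ 2 * (|C₁| * (n * b n)) := by gcongr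
          _ = _ := by
            rw [e3]
            have := (hb n).ne'
            field_simp
      have hlog : 0 ≤ log n := Real.log_nonneg (by exact_mod_cast (by omega : 1 ≤ n))
      have e4 : l ^ 2 * (∑ i ∈ range m, V n i) - l * (C * (n * rateX b n)) ≤
          - (((κ + 3 : ℕ) : ℝ) * log n) := by
        rw [e1, hC]
        push_cast
        nlinarith [abs_nonneg C₁]
      have e5 : exp (- (((κ + 3 : ℕ) : ℝ) * log n)) = 1 / (n : ℝ) ^ (κ + 3) := by
        rw [Real.exp_neg, exp_nat_mul, Real.exp_log hn0, one_div]
      calc 2 * ofReal _ ≤ 2 * ofReal (1 / (n : ℝ) ^ (κ + 3)) := by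
            rw [← e5]; gcongr
        _ = _ := by
            rw [show (2 : ENNReal) = ofReal 2 by simp, ← ofReal_mul (by norm_num)]
            congr 1; ring
    calc P (bad n) ≤ ∑ m ∈ range (n + 1), ∑ g ∈ 𝒢 n,
            ofReal (2 / (n : ℝ) ^ (κ + 3)) := by
          refine (measure_biUnion_finset_le _ _).trans (sum_le_sum fun m hm => ?_)
          exact (measure_biUnion_finset_le _ _).trans (sum_le_sum fun g hg => hbound m hm g hg)
      _ = ofReal (((n : ℝ) + 1) * ((𝒢 n).card * (2 / (n : ℝ) ^ (κ + 3)))) := by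
          rw [sum_const, sum_const, nsmul_eq_mul, nsmul_eq_mul, card_range,
            ofReal_mul (by positivity), ofReal_mul (by positivity)]
          congr 1
          · rw [← Nat.cast_add_one, ENNReal.ofReal_natCast]
          · rw [ENNReal.ofReal_natCast]
      _ ≤ _ := by
          apply ofReal_le_ofReal
          have h1 : (n : ℝ) + 1 ≤ 2 * n := by
            have : (1 : ℝ) ≤ n := by exact_mod_cast (by omega : 1 ≤ n)
            linarith
          have h2 : ((𝒢 n).card : ℝ) ≤ |C₀| * (n : ℝ) ^ κ := hcard.trans (by gcongr; exact le_abs_self _)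
          calc ((n : ℝ) + 1) * ((𝒢 n).card * (2 / (n : ℝ) ^ (κ + 3)))
              ≤ (2 * n) * ((|C₀| * (n : ℝ) ^ κ) * (2 / (n : ℝ) ^ (κ + 3))) := by gcongr
            _ = 4 * |C₀| / (n : ℝ) ^ 2 := by field_simp; ring
  filter_upwards [hmain] with ω hω
  filter_upwards [hω] with n hn m hm g hg
  by_contra! hcon
  exact hn (mem_biUnion (by simpa [Nat.lt_succ_iff] using hm) (mem_biUnion hg hcon.le))

/-! ### Weighted sums over the observations of a subject -/

section Smp

variable {Ξ A : Type*} {ι : Type}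

/-- The sum `c ∑_{α ∈ s} W_α(d) f(ξ_α(d))` attached to a subject with data `d`. -/
def smp (s : Finset A) (c : ℝ) (ξ : A → Ξ → ι → ℝ) (W : A → Ξ → ℝ) (f : (ι → ℝ) → ℝ) (d : Ξ) : ℝ :=
  c * ∑ α ∈ s, W α d * f (ξ α d)

variable {s : Finset A} {c : ℝ} {ξ : A → Ξ → ι → ℝ} {W E : A → Ξ → ℝ} {f g : (ι → ℝ) → ℝ} {d : Ξ}

lemma abs_smp_le (hc : 0 ≤ c) (hW : ∀ α ∈ s, |W α d| ≤ E α d) (hf : ∀ u, |f u| ≤ g u) :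
    |smp s c ξ W f d| ≤ smp s c ξ E g d := by
  unfold smp
  rw [abs_mul, abs_of_nonneg hc]
  refine mul_le_mul_of_nonneg_left ?_ hc
  refine (abs_sum_le_sum_abs _ _).trans (sum_le_sum fun α hα => ?_)
  rw [abs_mul]
  exact mul_le_mul (hW α hα) (hf _) (abs_nonneg _) ((abs_nonneg _).trans (hW α hα))

lemma smp_mono (hc : 0 ≤ c) (hW : ∀ α ∈ s, 0 ≤ W α d) (hWE : ∀ α ∈ s, W α d ≤ E α d)
    (hf : ∀ u, 0 ≤ f u) (hfg : ∀ u, f u ≤ g u) : smp s c ξ W f d ≤ smp s c ξ E g d :=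
  (le_abs_self _).trans (abs_smp_le hc (fun α hα => by rw [abs_of_nonneg (hW α hα)]; exact hWE α hα)
    fun u => by rw [abs_of_nonneg (hf u)]; exact hfg u)

lemma smp_nonneg (hc : 0 ≤ c) (hW : ∀ α ∈ s, 0 ≤ W α d) (hf : ∀ u, 0 ≤ f u) : 0 ≤ smp s c ξ W f d :=
  mul_nonneg hc (sum_nonneg fun α hα => mul_nonneg (hW α hα) (hf _))

lemma smp_sub_fun : smp s c ξ W (fun u => f u - g u) d = smp s c ξ W f d - smp s c ξ W g d := by
  simp only [smp, mul_sub, sum_sub_distrib]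

lemma smp_add_weight : smp s c ξ (fun α d => W α d + E α d) f d = smp s c ξ W f d + smp s c ξ E f d := by
  simp only [smp, add_mul, sum_add_distrib, mul_add]

lemma smp_sum_fun {R : Type*} (t : Finset R) (a : R → ℝ) (F : R → (ι → ℝ) → ℝ) :
    smp s c ξ W (fun u => ∑ r ∈ t, a r * F r u) d = ∑ r ∈ t, a r * smp s c ξ W (F r) d := by
  simp only [smp, mul_sum]
  rw [sum_comm]
  exact sum_congr rfl fun r _ => sum_congr rfl fun α _ => by ring

lemma mul_sum_le_of_card {M : ℝ} {f : A → ℝ} (hc : 0 ≤ c) (hs : c * s.card = 1)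
    (hf : ∀ α ∈ s, f α ≤ M) : c * ∑ α ∈ s, f α ≤ M := by
  calc _ ≤ c * ∑ _α ∈ s, M := mul_le_mul_of_nonneg_left (sum_le_sum hf) hc
    _ = M := by rw [sum_const, nsmul_eq_mul, ← mul_assoc, hs, one_mul]

variable [MeasurableSpace Ξ] {Q : Measure Ξ}

lemma measurable_smp (hξ : ∀ α, Measurable (ξ α)) (hW : ∀ α, Measurable (W α)) (hf : Measurable f) :
    Measurable (smp s c ξ W f) := by
  unfold smp
  exact (measurable_sum _ fun α _ => (hW α).mul (hf.comp (hξ α))).const_mul c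

lemma integrable_smp (hξ : ∀ α, Measurable (ξ α)) (hW : ∀ α, Measurable (W α))
    (hf : Measurable f) {M : ℝ} (hM : ∀ u, |f u| ≤ M) (hE : ∀ α, Integrable (E α) Q)
    (hWE : ∀ α d, |W α d| ≤ E α d) : Integrable (smp s c ξ W f) Q := by
  unfold smp
  refine (integrable_finsetSum _ fun α _ => ?_).const_mul c
  refine ((hE α).mul_const M).mono' ((hW α).mul (hf.comp (hξ α))).aestronglyMeasurable
    (ae_of_all _ fun d => ?_)
  rw [norm_mul]
  exact mul_le_mul (hWE α d) (hM _) (abs_nonneg _) ((abs_nonneg _).trans (hWE α d))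

end Smp

/-- A half-open box. -/
def box {ι : Type} (l r : ι → ℝ) : Set (ι → ℝ) := univ.pi fun k => Ico (l k) (r k)

lemma measurableSet_box (l r : ι → ℝ) : MeasurableSet (box l r) :=
  MeasurableSet.univ_pi fun _ => measurableSet_Ico

/-- Part of the weight at which the envelope exceeds `q`. -/
def tailW (q : ℝ) (E W : A → Ξ → ℝ) (α : A) (d : Ξ) : ℝ := if q < E α d then W α d else 0

/-- Part of the weight at which the envelope is at most `q`. -/
def headW (q : ℝ) (E W : A → Ξ → ℝ) (α : A) (d : Ξ) : ℝ := if q < E α d then 0 else W α d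

/-- The conditions on an envelope of the weights under which centred sums over small boxes are
uniformly of the order `rateX b`. -/
structure IsEnvelope (P : Measure Ω) (Q : Measure Ξ) (D : ℕ → Ω → Ξ) (s : ℕ → ℕ → Finset A)
    (c : ℕ → ℕ → ℝ) (ξ : A → Ξ → ι → ℝ) (E : ℕ → ℕ → A → Ξ → ℝ) (h : ℕ → ι → ℝ)
    (b : ℕ → ℝ) : Prop where
  iid : IsIID P D Q
  c_nonneg : ∀ n i, 0 ≤ c n i
  c_card : ∀ n i, c n i * (s n i).card ≤ 1
  measurable_ξ : ∀ α, Measurable (ξ α)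
  measurable_E : ∀ n i α, Measurable (E n i α)
  E_nonneg : ∀ n i α d, 0 ≤ E n i α d
  memLp_E : ∀ n i α, MemLp (E n i α) 2 Q
  b_pos : ∀ n, 0 < b n
  h_pos : ∀ n k, 0 < h n k
  h_tendsto : ∀ k, Tendsto (fun n => h n k) atTop (𝓝 0)
  le_h : ∀ᶠ n : ℕ in atTop, ∀ k, 1 / (n : ℝ) ^ 2 ≤ h n k
  le_rateX : ∀ᶠ n : ℕ in atTop, 1 / (n : ℝ) ≤ rateX b n
  second_moment : ∃ (V : ℕ → ℕ → ℝ) (C : ℝ), (∀ n i, 0 ≤ V n i) ∧ (∀ n i l r, (∀ k, r k - l k ≤ 4 * h n k) →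
      ∫ d, smp (s n i) (c n i) ξ (E n i) ((box l r).indicator 1) d ^ 2 ∂Q ≤ V n i) ∧
    ∀ᶠ n : ℕ in atTop, ∑ i ∈ range n, V n i ≤ C * (n * b n)
  first_moment : ∃ C : ℝ, 0 ≤ C ∧ ∀ n i l r, (∀ k, l k ≤ r k) →
    ∫ d, smp (s n i) (c n i) ξ (E n i) ((box l r).indicator 1) d ∂Q ≤ C * ∏ k, (r k - l k)
  tail_ae : ∀ᵐ ω ∂P, ∃ C : ℝ, ∀ᶠ n : ℕ in atTop,
    ∑ i ∈ range n, smp (s n i) (c n i) ξ (tailW (rateQ b n) (E n i) (E n i)) 1 (D i ω) ≤ C * (n * rateX b n)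
  tail_mean : ∃ C : ℝ, 0 ≤ C ∧ ∀ᶠ n : ℕ in atTop, ∀ i,
    ∫ d, smp (s n i) (c n i) ξ (tailW (rateQ b n) (E n i) (E n i)) 1 d ∂Q ≤ C * rateX b n

/-! ### The grid of half-open boxes -/

/-- The box with corners `g / n²`. -/
def gridBox (n : ℕ) (g : ι → ℤ × ℤ) : Set (ι → ℝ) :=
  box (fun k => ((g k).1 : ℝ) / (n : ℝ) ^ 2) fun k => ((g k).2 : ℝ) / (n : ℝ) ^ 2

open Classical in
/-- The boxes of the grid of mesh `n⁻²` in `[-Λ,Λ]` whose sides are at most four bandwidths. -/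
def grid (Λ : ℕ) (h : ℕ → ι → ℝ) (n : ℕ) : Finset (ι → ℤ × ℤ) := (Fintype.piFinset fun _ : ι =>
    Finset.Icc (-((Λ * n ^ 2 + 2 : ℕ) : ℤ)) ((Λ * n ^ 2 + 2 : ℕ) : ℤ) ×ˢ
      Finset.Icc (-((Λ * n ^ 2 + 2 : ℕ) : ℤ)) ((Λ * n ^ 2 + 2 : ℕ) : ℤ)).filter fun g =>
    ∀ k, ((g k).2 : ℝ) / (n : ℝ) ^ 2 - ((g k).1 : ℝ) / (n : ℝ) ^ 2 ≤ 4 * h n k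

lemma card_grid_le (Λ : ℕ) (h : ℕ → ι → ℝ) {n : ℕ} (hn : 1 ≤ n) : ((grid Λ h n).card : ℝ) ≤
      ((2 * Λ + 5 : ℕ) ^ (2 * Fintype.card ι) : ℕ) * (n : ℝ) ^ (4 * Fintype.card ι) := by
  classical
  have h1 : (grid Λ h n).card ≤ (2 * (Λ * n ^ 2 + 2) + 1) ^ (2 * Fintype.card ι) := by
    refine (Finset.card_filter_le _ _).trans (le_of_eq ?_)
    rw [Fintype.card_piFinset, prod_const, Finset.card_product, Int.card_Icc, card_univ]
    rw [show ((Λ * n ^ 2 + 2 : ℕ) : ℤ) + 1 - -((Λ * n ^ 2 + 2 : ℕ) : ℤ)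
      = ((2 * (Λ * n ^ 2 + 2) + 1 : ℕ) : ℤ) by push_cast; ring, Int.toNat_natCast, ← pow_two,
      ← pow_mul]
  have h2 : (2 * (Λ * n ^ 2 + 2) + 1) ≤ (2 * Λ + 5) * n ^ 2 := by
    have : 1 ≤ n ^ 2 := Nat.one_le_pow _ _ hn
    nlinarith
  have h3 := h1.trans (Nat.pow_le_pow_left h2 _)
  rw [mul_pow, ← pow_mul, show 2 * (2 * Fintype.card ι) = 4 * Fintype.card ι by ring] at h3
  calc ((grid Λ h n).card : ℝ)
      ≤ (((2 * Λ + 5) ^ (2 * Fintype.card ι) * n ^ (4 * Fintype.card ι) : ℕ) : ℝ) := by exact_mod_cast h3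
    _ = _ := by push_cast; ring

lemma exists_grid_interval {Λ N : ℕ} (hN : 1 ≤ N) {h : ℝ} (hh : 1 / (N : ℝ) ≤ h) {I : Set ℝ}
    (hI : I.OrdConnected) (hne : I.Nonempty) (hsub : I ⊆ Icc (-(Λ : ℝ)) Λ)
    (hd : ∀ u ∈ I, ∀ v ∈ I, u - v ≤ 2 * h) :
    ∃ p q : ℤ, p ≤ q ∧ (∀ u ∈ I, (p : ℝ) / N ≤ u ∧ u < (q + 1 : ℤ) / N) ∧
      (∀ u, ((p + 1 : ℤ) : ℝ) / N ≤ u → u < (q : ℝ) / N → u ∈ I) ∧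
      -((Λ * N + 2 : ℕ) : ℤ) ≤ p ∧ q + 1 ≤ ((Λ * N + 2 : ℕ) : ℤ) ∧
      ((q + 1 : ℤ) : ℝ) / N - (p : ℝ) / N ≤ 4 * h ∧
      ((q + 1 : ℤ) : ℝ) / N - (p : ℝ) / N ≤ 2 * Λ + 2 := by
  have hN0 : (0 : ℝ) < N := by exact_mod_cast hN
  have hbb : BddBelow I := ⟨_, fun u hu => (hsub hu).1⟩
  have hba : BddAbove I := ⟨_, fun u hu => (hsub hu).2⟩
  set i := sInf I
  set S := sSup I
  have hiS : i ≤ S := csInf_le_csSup hne hbb hba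
  have hi1 : -(Λ : ℝ) ≤ i := le_csInf hne fun u hu => (hsub hu).1
  have hS1 : S ≤ Λ := csSup_le hne fun u hu => (hsub hu).2
  have hSi : S - i ≤ 2 * h := by
    have : S ≤ i + 2 * h := csSup_le hne fun u hu => by
      have : u - 2 * h ≤ i := le_csInf hne fun v hv => by linarith [hd u hu v hv]
      linarith
    linarith
  have p1 := Int.floor_le (N * i)
  have p2 := Int.lt_floor_add_one (N * i)
  have q1 := Int.floor_le (N * S)
  have q2 := Int.lt_floor_add_one (N * S)
  have hNi : N * i ≤ N * S := by gcongr
  have hlen : ((⌊N * S⌋ + 1 : ℤ) : ℝ) / N - (⌊N * i⌋ : ℝ) / N ≤ (S - i) + 2 / N := by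
    rw [← sub_div, show (S - i) + 2 / N = (N * S - N * i + 2) / N by field_simp]
    gcongr
    push_cast
    linarith
  refine ⟨⌊N * i⌋, ⌊N * S⌋, Int.floor_mono hNi, fun u hu => ⟨?_, ?_⟩, fun u h1 h2 => ?_, ?_, ?_, ?_, ?_⟩
  · rw [div_le_iff₀ hN0]
    have : i ≤ u := csInf_le hbb hu
    nlinarith
  · rw [lt_div_iff₀ hN0]
    have : u ≤ S := le_csSup hba hu
    push_cast
    nlinarith
  · rw [div_le_iff₀ hN0] at h1
    rw [lt_div_iff₀ hN0] at h2
    push_cast at h1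
    have h3 : i < u := by by_contra! hc; nlinarith
    have h4 : u < S := by by_contra! hc; nlinarith
    obtain ⟨v, hv, hvu⟩ := exists_lt_of_csInf_lt hne h3
    obtain ⟨w, hw, huw⟩ := exists_lt_of_lt_csSup hne h4
    exact hI.out hv hw ⟨hvu.le, huw.le⟩
  · rw [Int.le_floor]
    push_cast
    nlinarith
  · have : ⌊N * S⌋ < (Λ * N + 1 : ℕ) := by
      rw [Int.floor_lt]
      push_cast
      nlinarith
    push_cast at *
    linarith
  · have : 2 / (N : ℝ) ≤ 2 * h := by rw [show 2 / (N : ℝ) = 2 * (1 / N) by ring]; linarith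
    linarith
  · have : 2 / (N : ℝ) ≤ 2 := div_le_self (by norm_num) (by exact_mod_cast hN)
    linarith

lemma exists_grid_sandwich {Λ n : ℕ} (hn : 1 ≤ n) {h : ℕ → ι → ℝ}
    (hh : ∀ k, 1 / (n : ℝ) ^ 2 ≤ h n k) {I : ι → Set ℝ} (hI : IsSmallBox Λ (h n) I) :
    ∃ g ∈ grid Λ h n, ∃ g' ∈ grid Λ h n, gridBox n g ⊆ univ.pi I ∧ univ.pi I ⊆ gridBox n g' ∧
      ∃ l r : ι × Bool → ι → ℝ, (∀ j k, l j k ≤ r j k) ∧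
        (∀ j, ∏ k, (r j k - l j k) ≤ (2 * Λ + 2 : ℝ) ^ Fintype.card ι / (n : ℝ) ^ 2) ∧
        ∀ u, (gridBox n g').indicator (1 : (ι → ℝ) → ℝ) u - (gridBox n g).indicator 1 u ≤
          ∑ j, (box (l j) (r j)).indicator 1 u := by
  classical
  have hn0 : (0 : ℝ) < (n : ℝ) ^ 2 := by positivity
  by_cases hne : ∀ k, (I k).Nonempty
  · have key := fun k => exists_grid_interval (Λ := Λ) (N := n ^ 2) (Nat.one_le_pow _ _ hn)
      (h := h n k) (by push_cast; exact hh k) (hI.ordConnected k) (hne k) (hI.subset k) (hI.diam k)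
    push_cast at key
    choose p q hpq hout hin hp hq hlen hlen' using key
    have hpq' : ∀ k, (p k : ℝ) ≤ q k := fun k => by exact_mod_cast hpq k
    have hside : ∀ k, ((q k : ℝ) + 1) / (n : ℝ) ^ 2 - p k / (n : ℝ) ^ 2 ≤ 2 * Λ + 2 := hlen'
    refine ⟨fun k => (p k + 1, q k), ?_, fun k => (p k, q k + 1), ?_, ?_, ?_, ?_⟩
    · simp only [grid, mem_filter, Fintype.mem_piFinset, mem_product, Finset.mem_Icc]
      refine ⟨fun k => ?_, fun k => ?_⟩
      · have := hp k; have := hq k; have := hpq k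
        push_cast
        refine ⟨⟨?_, ?_⟩, ?_, ?_⟩ <;> linarith
      · refine le_trans ?_ (hlen k)
        push_cast
        gcongr <;> linarith
    · simp only [grid, mem_filter, Fintype.mem_piFinset, mem_product, Finset.mem_Icc]
      refine ⟨fun k => ?_, fun k => ?_⟩
      · have := hp k; have := hq k; have := hpq k
        push_cast
        refine ⟨⟨?_, ?_⟩, ?_, ?_⟩ <;> linarith
      · push_cast
        exact hlen k
    · intro u hu k _
      have := hu k trivial
      simp only [mem_Ico] at this
      push_cast at this
      exact hin k _ this.1 this.2
    · intro u hu k _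
      have := hout k _ (hu k trivial)
      simp only [mem_Ico]
      push_cast
      exact this
    · set e : ι × Bool → ℤ := fun j => if j.2 then p j.1 else q j.1 with he
      refine ⟨fun j => Function.update (fun k => (p k : ℝ) / (n : ℝ) ^ 2) j.1 (e j / (n : ℝ) ^ 2),
        fun j => Function.update (fun k => ((q k : ℝ) + 1) / (n : ℝ) ^ 2) j.1
          ((e j + 1) / (n : ℝ) ^ 2), fun j k => ?_, fun j => ?_, fun u => ?_⟩
      · by_cases hk : k = j.1
        · subst hk
          simp only [Function.update_self]
          gcongr
          linarith
        · simp only [Function.update_of_ne hk]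
          have := hpq' k
          gcongr
          linarith
      · rw [← Finset.mul_prod_erase Finset.univ _ (Finset.mem_univ j.1)]
        simp only [Function.update_self]
        have e1 : ((e j : ℝ) + 1) / (n : ℝ) ^ 2 - e j / (n : ℝ) ^ 2 = 1 / (n : ℝ) ^ 2 := by ring
        rw [e1]
        have hL : (1 : ℝ) ≤ 2 * Λ + 2 := by
          have : (0 : ℝ) ≤ Λ := Nat.cast_nonneg _
          linarith
        calc 1 / (n : ℝ) ^ 2 * _ ≤ 1 / (n : ℝ) ^ 2 *
              ∏ k ∈ Finset.univ.erase j.1, (2 * Λ + 2 : ℝ) := by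
              refine mul_le_mul_of_nonneg_left ?_ (by positivity)
              refine Finset.prod_le_prod (fun k hk => ?_) fun k hk => ?_
              · rw [Function.update_of_ne (ne_of_mem_erase hk),
                  Function.update_of_ne (ne_of_mem_erase hk), sub_nonneg]
                have := hpq' k
                gcongr
                linarith
              · rw [Function.update_of_ne (ne_of_mem_erase hk), Function.update_of_ne (ne_of_mem_erase hk)]
                exact hside k
          _ ≤ 1 / (n : ℝ) ^ 2 * (2 * Λ + 2 : ℝ) ^ Fintype.card ι := by
              rw [prod_const]
              refine mul_le_mul_of_nonneg_left (pow_le_pow_right₀ hL ?_) (by positivity)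
              exact Finset.card_le_univ _
          _ = _ := by ring
      · have hnn : ∀ j, 0 ≤ (box (Function.update (fun k => (p k : ℝ) / (n : ℝ) ^ 2) (j : ι × Bool).1
            (e j / (n : ℝ) ^ 2)) (Function.update (fun k => ((q k : ℝ) + 1) / (n : ℝ) ^ 2) j.1
          ((e j + 1) / (n : ℝ) ^ 2))).indicator (1 : (ι → ℝ) → ℝ) u := fun j =>
          indicator_nonneg (fun _ _ => zero_le_one) u
        by_cases h2 : u ∈ gridBox n fun k => (p k + 1, q k)
        · rw [indicator_of_mem h2]
          have h3 : (gridBox n fun k => (p k, q k + 1)).indicator (1 : (ι → ℝ) → ℝ) u ≤ 1 :=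
            indicator_le_self' (fun _ _ => zero_le_one) u
          have := sum_nonneg (s := Finset.univ) fun j _ => hnn j
          simp only [Pi.one_apply]
          linarith
        · by_cases h1 : u ∈ gridBox n fun k => (p k, q k + 1)
          · rw [indicator_of_mem h1, indicator_of_notMem h2]
            have h1' : ∀ k, (p k : ℝ) / (n : ℝ) ^ 2 ≤ u k ∧ u k < ((q k : ℝ) + 1) / (n : ℝ) ^ 2 := by
              intro k
              have := h1 k trivial
              simp only [mem_Ico] at this
              push_cast at this
              exact this
            have h2' : ∃ k, ¬ (((p k : ℝ) + 1) / (n : ℝ) ^ 2 ≤ u k ∧ u k < (q k : ℝ) / (n : ℝ) ^ 2) := by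
              by_contra! hc
              refine h2 fun k _ => ?_
              simp only [mem_Ico]
              push_cast
              exact hc k
            obtain ⟨k, hk⟩ := h2'
            have hj : ∃ j : ι × Bool, j.1 = k ∧ (e j : ℝ) / (n : ℝ) ^ 2 ≤ u k ∧
                u k < ((e j : ℝ) + 1) / (n : ℝ) ^ 2 := by
              by_cases hk1 : ((p k : ℝ) + 1) / (n : ℝ) ^ 2 ≤ u k
              · refine ⟨(k, false), rfl, ?_, ?_⟩
                · simpa [he] using not_lt.1 fun hc => hk ⟨hk1, hc⟩
                · simpa [he] using (h1' k).2
              · refine ⟨(k, true), rfl, ?_, ?_⟩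
                · simpa [he] using (h1' k).1
                · simpa [he] using not_le.1 hk1
            obtain ⟨j, hjk, hj1, hj2⟩ := hj
            refine le_trans ?_ (single_le_sum (fun j _ => hnn j) (Finset.mem_univ j))
            rw [indicator_of_mem]
            · simp
            · intro k' _
              subst hjk
              by_cases hk' : k' = j.1
              · subst hk'
                simp only [Function.update_self]
                exact ⟨hj1, hj2⟩
              · simp only [Function.update_of_ne hk']
                exact h1' k'
          · rw [indicator_of_notMem h1, indicator_of_notMem h2, sub_zero]
            exact sum_nonneg fun j _ => hnn j
  · push Not at hne
    obtain ⟨k₀, hk₀⟩ := hne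
    have hemp : univ.pi I = ∅ := Set.univ_pi_eq_empty hk₀
    have hgb : gridBox n (fun _ : ι => ((0, 0) : ℤ × ℤ)) = ∅ := by
      refine Set.univ_pi_eq_empty (i := k₀) ?_
      simp
    have hmem : (fun _ : ι => ((0, 0) : ℤ × ℤ)) ∈ grid Λ h n := by
      simp only [grid, mem_filter, Fintype.mem_piFinset, mem_product, Finset.mem_Icc]
      refine ⟨fun k => ?_, fun k => ?_⟩
      · push_cast
        refine ⟨⟨?_, ?_⟩, ?_, ?_⟩ <;> first | positivity | (rw [neg_nonpos]; positivity)
      · have : (0 : ℝ) ≤ h n k := le_trans (by positivity) (hh k)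
        simpa using this
    refine ⟨_, hmem, _, hmem, by rw [hgb]; exact empty_subset _, by rw [hemp]; exact empty_subset _,
      fun _ _ => 0, fun _ _ => 0, fun _ _ => le_rfl, fun j => ?_, fun u => ?_⟩
    · have : 0 < Fintype.card ι := Fintype.card_pos_iff.2 ⟨k₀⟩
      simp [this.ne']
      positivity
    · rw [sub_self]
      exact sum_nonneg fun j _ => indicator_nonneg (fun _ _ => zero_le_one) u

lemma headW_add_tailW (q : ℝ) (E W : A → Ξ → ℝ) (α : A) (d : Ξ) :
    headW q E W α d + tailW q E W α d = W α d := by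
  unfold headW tailW; split_ifs <;> simp

lemma abs_headW_le {q : ℝ} {E W : A → Ξ → ℝ} (hE : ∀ α d, 0 ≤ E α d) (hW : ∀ α d, |W α d| ≤ E α d)
    (α : A) (d : Ξ) : |headW q E W α d| ≤ E α d := by
  unfold headW; split_ifs <;> simp [hE α d, hW α d]

lemma abs_headW_le' {q : ℝ} (hq : 0 ≤ q) {E W : A → Ξ → ℝ}
    (hW : ∀ α d, |W α d| ≤ E α d) (α : A) (d : Ξ) : |headW q E W α d| ≤ q := by
  unfold headW
  split_ifs with h
  · simpa using hq
  · exact (hW α d).trans (not_lt.1 h)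

lemma abs_tailW_le {q : ℝ} {E W : A → Ξ → ℝ} (hW : ∀ α d, |W α d| ≤ E α d)
    (α : A) (d : Ξ) : |tailW q E W α d| ≤ tailW q E E α d := by
  unfold tailW; split_ifs <;> simp [hW α d]

lemma tailW_nonneg {q : ℝ} {E : A → Ξ → ℝ} (hE : ∀ α d, 0 ≤ E α d) (α : A) (d : Ξ) :
    0 ≤ tailW q E E α d := by
  unfold tailW; split_ifs <;> simp [hE α d]

lemma tailW_le {q : ℝ} {E : A → Ξ → ℝ} (hE : ∀ α d, 0 ≤ E α d) (α : A) (d : Ξ) :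
    tailW q E E α d ≤ E α d := by
  unfold tailW; split_ifs <;> simp [hE α d]

lemma measurable_headW {q : ℝ} {E W : A → Ξ → ℝ} (hE : ∀ α, Measurable (E α))
    (hW : ∀ α, Measurable (W α)) (α : A) : Measurable (headW q E W α) :=
  Measurable.ite (measurableSet_lt measurable_const (hE α)) measurable_const (hW α)

lemma measurable_tailW {q : ℝ} {E W : A → Ξ → ℝ} (hE : ∀ α, Measurable (E α))
    (hW : ∀ α, Measurable (W α)) (α : A) : Measurable (tailW q E W α) :=
  Measurable.ite (measurableSet_lt measurable_const (hE α)) (hW α) measurable_const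

lemma sum_range_comp_le {σ : ℕ → ℕ} (hσ : Function.Injective σ) {n m : ℕ} (hm : m ≤ n)
    (hσn : ∀ i < n, σ i < n) {t : ℕ → ℝ} (ht : ∀ i, 0 ≤ t i) :
    ∑ i ∈ range m, t (σ i) ≤ ∑ i ∈ range n, t i := by
  rw [← Finset.sum_image (f := t) (g := σ) (s := range m) hσ.injOn]
  refine Finset.sum_le_sum_of_subset_of_nonneg (fun j hj => ?_) fun i _ _ => ht i
  obtain ⟨i, hi, rfl⟩ := Finset.mem_image.1 hj
  exact Finset.mem_range.2 (hσn i ((Finset.mem_range.1 hi).trans_le hm))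

lemma indicator_one_abs_le (S : Set (ι → ℝ)) (u : ι → ℝ) :
    |S.indicator (1 : (ι → ℝ) → ℝ) u| ≤ (1 : (ι → ℝ) → ℝ) u := by
  by_cases hu : u ∈ S <;> simp [hu]

lemma measurable_indicator_one {S : Set (ι → ℝ)} (hS : MeasurableSet S) :
    Measurable (S.indicator (1 : (ι → ℝ) → ℝ)) := measurable_const.indicator hS

variable {s : ℕ → ℕ → Finset A} {c : ℕ → ℕ → ℝ} {ξ : A → Ξ → ι → ℝ}
  {E : ℕ → ℕ → A → Ξ → ℝ} {h : ℕ → ι → ℝ} {b : ℕ → ℝ}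

local notation "ℰ" => IsEnvelope P Q D s c ξ E h b
local notation:max "Ψ" n:max i:max => smp (s n i) (c n i) ξ

lemma IsEnvelope.integrable_E (H : ℰ) (n i : ℕ) (α : A) :
    Integrable (E n i α) Q := (H.memLp_E n i α).integrable one_le_two

lemma IsEnvelope.integrable_smp (H : ℰ) (n i : ℕ) {W : A → Ξ → ℝ}
    (hWm : ∀ α, Measurable (W α)) (hW : ∀ α d, |W α d| ≤ E n i α d) {f : (ι → ℝ) → ℝ}
    (hf : Measurable f) {M : ℝ} (hM : ∀ u, |f u| ≤ M) :
    Integrable (Ψ n i W f) Q :=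
  PooledCov.integrable_smp H.measurable_ξ hWm hf hM (H.integrable_E n i) hW

lemma IsEnvelope.integrable_indicator (H : ℰ) (n i : ℕ) {S : Set (ι → ℝ)} (hS : MeasurableSet S) :
    Integrable (Ψ n i (E n i) (S.indicator 1)) Q :=
  H.integrable_smp n i (H.measurable_E n i) (fun α d => (abs_of_nonneg (H.E_nonneg n i α d)).le)
    (measurable_indicator_one hS) (indicator_one_abs_le _)

lemma IsEnvelope.memLp_smp (H : ℰ) (n i : ℕ) {S : Set (ι → ℝ)}
    (hS : MeasurableSet S) : MemLp (Ψ n i (E n i) (S.indicator 1)) 2 Q := by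
  have : MemLp (fun d => ∑ α ∈ s n i, E n i α d * S.indicator (1 : (ι → ℝ) → ℝ) (ξ α d)) 2 Q := by
    refine memLp_finsetSum _ fun α _ => ?_
    refine (H.memLp_E n i α).mono' ?_ (ae_of_all _ fun d => ?_)
    · exact ((H.measurable_E n i α).mul
        ((measurable_indicator_one hS).comp (H.measurable_ξ α))).aestronglyMeasurable
    · rw [norm_mul, norm_of_nonneg (H.E_nonneg _ _ _ _)]
      exact mul_le_of_le_one_right (H.E_nonneg _ _ _ _) (indicator_one_abs_le _ _)
  exact this.const_mul (c n i)

/-- Weights that may depend on the preceding subjects in the order `σ`. -/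
structure IsAdapted (E : ℕ → ℕ → A → Ξ → ℝ) (σ : ℕ → ℕ → ℕ)
    (W : (n i : ℕ) → A → (Fin i → Ξ) → Ξ → ℝ) : Prop where
  injective : ∀ n, Function.Injective (σ n)
  lt : ∀ n, ∀ i < n, σ n i < n
  measurable : ∀ n i α, Measurable fun w : (Fin i → Ξ) × Ξ => W n i α w.1 w.2
  abs_le : ∀ n i α y d, |W n i α y d| ≤ E n (σ n i) α d

lemma isAdapted_id {W : ℕ → ℕ → A → Ξ → ℝ} (hWm : ∀ n i α, Measurable (W n i α))
    (hW : ∀ n i α d, |W n i α d| ≤ E n i α d) :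
    IsAdapted E (fun _ i => i) fun n i α _ d => W n i α d :=
  ⟨fun _ => Function.injective_id, fun _ _ hi => hi, fun n i α => (hWm n i α).comp measurable_snd,
    fun n i α _ d => hW n i α d⟩

section Adapted

variable {σ : ℕ → ℕ → ℕ} {W : (n i : ℕ) → A → (Fin i → Ξ) → Ξ → ℝ}

local notation:max "Θ" n:max i:max ω:max => fun α => W n i α fun l => D (σ n l) ω

lemma IsEnvelope.ae_grid_le (H : ℰ) (hA : IsAdapted E σ W) (Λ : ℕ) :
    ∀ᵐ ω ∂P, ∃ C : ℝ, 0 ≤ C ∧ ∀ᶠ n : ℕ in atTop, ∀ m ≤ n, ∀ g ∈ grid Λ h n,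
      |∑ i ∈ range m, (Ψ n (σ n i) (Θ n i ω) ((gridBox n g).indicator 1) (D (σ n i) ω)
        - ∫ d, Ψ n (σ n i) (Θ n i ω) ((gridBox n g).indicator 1) d ∂Q)| ≤ C * (n * rateX b n) := by
  obtain ⟨V, C₁, hV0, hV, hVs⟩ := H.second_moment
  obtain ⟨C₂, hC₂, htm⟩ := H.tail_mean
  set F : (n i : ℕ) → (ι → ℤ × ℤ) → (Fin i → Ξ) → Ξ → ℝ := fun n i g y d =>
    Ψ n (σ n i) (headW (rateQ b n) (E n (σ n i)) fun α => W n i α y) ((gridBox n g).indicator 1) d with hF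
  have hWy : ∀ n i α y, Measurable (W n i α y) := fun n i α y =>
    (hA.measurable n i α).comp measurable_prodMk_left
  have hgm : ∀ n g, Measurable ((gridBox n g).indicator (1 : (ι → ℝ) → ℝ)) := fun n g =>
    measurable_indicator_one (measurableSet_box _ _)
  have hFm : ∀ n i g, Measurable fun w : (Fin i → Ξ) × Ξ => F n i g w.1 w.2 := by
    intro n i g
    simp only [hF, smp]
    refine (measurable_sum _ fun α _ => ?_).const_mul _
    refine Measurable.mul ?_ ((hgm n g).comp ((H.measurable_ξ α).comp measurable_snd))
    exact Measurable.ite (measurableSet_lt measurable_const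
      ((H.measurable_E n _ α).comp measurable_snd)) measurable_const (hA.measurable n i α)
  have hFE : ∀ n i g y d, |F n i g y d| ≤ Ψ n (σ n i) (E n (σ n i)) ((gridBox n g).indicator 1) d := by
    intro n i g y d
    refine abs_smp_le (H.c_nonneg _ _) (fun α _ => abs_headW_le (H.E_nonneg n _)
      (fun α d => hA.abs_le n i α y d) α d) fun u => ?_
    by_cases hu : u ∈ gridBox n g <;> simp [hu]
  obtain ⟨C₃, hC₃, hgrid⟩ := ae_eventually_grid_le H.iid H.b_pos (grid Λ h) (4 * Fintype.card ι) _ C₁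
    ((eventually_ge_atTop 1).mono fun n hn => card_grid_le Λ h hn) σ hA.injective F hFm
    (Eventually.of_forall fun n i _ g _ y d => by
      refine (abs_smp_le (E := fun _ _ => rateQ b n) (H.c_nonneg _ _) (fun α _ =>
        abs_headW_le' (rateQ_nonneg b n) (fun α d => hA.abs_le n i α y d) α d)
        (indicator_one_abs_le _)).trans ?_
      simp only [smp, Pi.one_apply, mul_one, sum_const, nsmul_eq_mul]
      rw [← mul_assoc]
      exact mul_le_of_le_one_left (rateQ_nonneg b n) (H.c_card _ _))
    (fun n i => V n (σ n i)) (fun n i => hV0 _ _)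
    (Eventually.of_forall fun n i _ g hg y => by
      refine le_trans (integral_mono_of_nonneg (ae_of_all _ fun d => sq_nonneg _) ?_
        (ae_of_all _ fun d => ?_)) (hV n (σ n i) _ _ (mem_filter.1 hg).2)
      · exact (H.memLp_smp n (σ n i) (measurableSet_box _ _)).integrable_sq
      · show F n i g y d ^ 2 ≤ _
        rw [← sq_abs (F n i g y d)]
        exact pow_le_pow_left₀ (abs_nonneg _) (hFE n i g y d) 2)
    (hVs.mono fun n hn => (sum_range_comp_le (hA.injective n) le_rfl (hA.lt n) (hV0 n)).trans hn)
  filter_upwards [hgrid, H.tail_ae] with ω hω ⟨C₄, hC₄⟩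
  refine ⟨C₃ + |C₄| + C₂, by positivity, ?_⟩
  filter_upwards [hω, hC₄, htm, eventually_ge_atTop 2] with n hω hC₄ htm hn m hm g hg
  have hx := rateX_nonneg b n
  set y : (i : ℕ) → Fin i → Ξ := fun i l => D (σ n l) ω with hy
  set S'' : ℕ → Ξ → ℝ := fun i d => Ψ n (σ n i)
      (tailW (rateQ b n) (E n (σ n i)) fun α => W n i α (y i)) ((gridBox n g).indicator 1) d with hS''
  set T : ℕ → Ξ → ℝ := fun i d => Ψ n i (tailW (rateQ b n) (E n i) (E n i)) 1 d with hT
  have hT0 : ∀ i d, 0 ≤ T i d := fun i d => smp_nonneg (H.c_nonneg _ _)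
    (fun α _ => tailW_nonneg (H.E_nonneg n i) α d) fun u => zero_le_one
  have hTi : ∀ i, Integrable (T i) Q := fun i =>
    H.integrable_smp n i (measurable_tailW (H.measurable_E n i) (H.measurable_E n i)) (fun α d => by
        rw [abs_of_nonneg (tailW_nonneg (H.E_nonneg n i) α d)]
        exact tailW_le (H.E_nonneg n i) α d) measurable_const (M := 1) (fun u => by simp)
  have hS''T : ∀ i d, |S'' i d| ≤ T (σ n i) d := fun i d =>
    abs_smp_le (H.c_nonneg _ _) (fun α _ => abs_tailW_le (fun α d => hA.abs_le n i α (y i) d) α d)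
      (indicator_one_abs_le _)
  have hdec : ∀ i d, Ψ n (σ n i) (fun α => W n i α (y i))
      ((gridBox n g).indicator 1) d = F n i g (y i) d + S'' i d := by
    intro i d
    simp only [hF, hS'', ← smp_add_weight, headW_add_tailW]
  have hS''i : ∀ i, Integrable (S'' i) Q := fun i => by
    refine (hTi (σ n i)).mono' (measurable_smp H.measurable_ξ
      (measurable_tailW (H.measurable_E n _) fun α => hWy n i α _) (hgm n g)).aestronglyMeasurable
      (ae_of_all _ (hS''T i))
  have hFi : ∀ i, Integrable (F n i g (y i)) Q := fun i =>
    H.integrable_smp n _ (measurable_headW (H.measurable_E n _) fun α => hWy n i α _)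
      (abs_headW_le (H.E_nonneg n _) fun α d => hA.abs_le n i α _ d) (hgm n g) (indicator_one_abs_le _)
  have e : ∀ i, Ψ n (σ n i) (fun α => W n i α (y i)) ((gridBox n g).indicator 1) (D (σ n i) ω)
      - ∫ d, Ψ n (σ n i) (fun α => W n i α (y i)) ((gridBox n g).indicator 1) d ∂Q
      = F n i g (y i) (D (σ n i) ω) - ∫ d, F n i g (y i) d ∂Q
        + (S'' i (D (σ n i) ω) - ∫ d, S'' i d ∂Q) := fun i => by
    simp_rw [hdec]
    rw [integral_add (hFi i) (hS''i i)]
    ring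
  simp only [hy] at e
  simp_rw [e]
  rw [sum_add_distrib, sum_sub_distrib (fun i => S'' i (D (σ n i) ω))]
  have h1 := hω m hm g hg
  have h2 : |∑ i ∈ range m, S'' i (D (σ n i) ω)| ≤ |C₄| * (n * rateX b n) := by
    refine (abs_sum_le_sum_abs _ _).trans ((sum_le_sum fun i _ => hS''T i _).trans ?_)
    refine (sum_range_comp_le (t := fun i => T i (D i ω)) (hA.injective n) hm (hA.lt n)
      fun i => hT0 i _).trans (hC₄.trans ?_)
    gcongr
    exact le_abs_self _
  have h3 : |∑ i ∈ range m, ∫ d, S'' i d ∂Q| ≤ C₂ * (n * rateX b n) := by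
    refine (abs_sum_le_sum_abs _ _).trans ?_
    refine (Finset.sum_le_card_nsmul _ _ (C₂ * rateX b n) fun i _ => (norm_integral_le_of_norm_le
      (f := S'' i) (hTi (σ n i)) (ae_of_all _ (hS''T i))).trans (htm (σ n i))).trans ?_
    rw [card_range, nsmul_eq_mul, mul_left_comm]
    gcongr
  rw [abs_le] at h1 h2 h3 ⊢
  constructor <;> nlinarith [h1.1, h1.2, h2.1, h2.2, h3.1, h3.2]

lemma IsEnvelope.integral_sandwich_le (H : ℰ) (Λ : ℕ) :
    ∃ C : ℝ, 0 ≤ C ∧ ∀ᶠ n : ℕ in atTop, ∀ (g g' : ι → ℤ × ℤ) (l r : ι × Bool → ι → ℝ),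
      (∀ j k, l j k ≤ r j k) →
      (∀ j, ∏ k, (r j k - l j k) ≤ (2 * Λ + 2 : ℝ) ^ Fintype.card ι / (n : ℝ) ^ 2) →
      (∀ u, (gridBox n g').indicator (1 : (ι → ℝ) → ℝ) u - (gridBox n g).indicator 1 u ≤
          ∑ j, (box (l j) (r j)).indicator 1 u) →
      ∀ i, ∫ d, (Ψ n i (E n i) ((gridBox n g').indicator 1) d
        - Ψ n i (E n i) ((gridBox n g).indicator 1) d) ∂Q ≤ C * rateX b n := by
  classical
  obtain ⟨C, hC, hfm⟩ := H.first_moment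
  set B := Fintype.card (ι × Bool) * (C * (2 * Λ + 2 : ℝ) ^ Fintype.card ι) with hB
  have hB0 : 0 ≤ B := by positivity
  refine ⟨B, hB0, ?_⟩
  filter_upwards [H.le_rateX, eventually_ge_atTop 1] with n hx hn g g' l r hlr hvol hle i
  have hn1 : (1 : ℝ) ≤ n := by exact_mod_cast hn
  have hx0 := rateX_nonneg b n
  have hInt := fun (l r : ι → ℝ) => H.integrable_indicator n i (measurableSet_box l r)
  calc _ ≤ ∫ d, ∑ j, Ψ n i (E n i) ((box (l j) (r j)).indicator 1) d ∂Q := by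
        refine integral_mono ((hInt _ _).sub (hInt _ _)) (integrable_finsetSum _ fun j _ => hInt _ _)
          fun d => ?_
        have e2 := smp_sum_fun (s := s n i) (c := c n i) (ξ := ξ) (W := E n i) (d := d)
          Finset.univ (fun _ => 1) fun j => (box (l j) (r j)).indicator (1 : (ι → ℝ) → ℝ)
        simp only [one_mul] at e2
        rw [← e2, ← smp_sub_fun]
        exact mul_le_mul_of_nonneg_left (sum_le_sum fun α _ =>
          mul_le_mul_of_nonneg_left (hle _) (H.E_nonneg n i α d)) (H.c_nonneg n i)
    _ = ∑ j, ∫ d, Ψ n i (E n i) ((box (l j) (r j)).indicator 1) d ∂Q :=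
        integral_finsetSum _ fun j _ => hInt _ _
    _ ≤ ∑ j : ι × Bool, C * ((2 * Λ + 2 : ℝ) ^ Fintype.card ι / (n : ℝ) ^ 2) :=
        sum_le_sum fun j _ => (hfm n i _ _ (hlr j)).trans (mul_le_mul_of_nonneg_left (hvol j) hC)
    _ = B * (1 / n) * (1 / n) := by
        rw [sum_const, nsmul_eq_mul, card_univ, hB]
        ring
    _ ≤ B * rateX b n * 1 := by
        gcongr
        rwa [div_le_one (by linarith)]
    _ = _ := mul_one _

/-- Centred sums over small boxes are uniformly of order `rateX b`. -/
theorem IsEnvelope.ae_box_le (H : ℰ) (hA : IsAdapted E σ W) (Λ : ℕ) :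
    ∀ᵐ ω ∂P, ∃ C : ℝ, 0 ≤ C ∧ ∀ᶠ n : ℕ in atTop, ∀ m ≤ n, ∀ I, IsSmallBox Λ (h n) I →
      |∑ i ∈ range m, (Ψ n (σ n i) (Θ n i ω) ((univ.pi I).indicator 1) (D (σ n i) ω)
        - ∫ d, Ψ n (σ n i) (Θ n i ω) ((univ.pi I).indicator 1) d ∂Q)| ≤ C * (n * rateX b n) := by
  obtain ⟨C₁, hC₁, hsand⟩ := H.integral_sandwich_le Λ
  filter_upwards [H.ae_grid_le hA Λ, H.ae_grid_le (isAdapted_id H.measurable_E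
    fun n i α d => (abs_of_nonneg (H.E_nonneg n i α d)).le) Λ] with ω ⟨C, hC, hω⟩ ⟨C', hC', hω'⟩
  refine ⟨C + 2 * C' + 2 * C₁, by positivity, ?_⟩
  filter_upwards [hω, hω', hsand, H.le_h, eventually_ge_atTop 1] with n hω hω' hsand hh hn m hm I hI
  obtain ⟨g, hg, g', hg', hsub, hsub', l, r, hlr, hvol, hle⟩ := exists_grid_sandwich hn hh hI
  have h0 := hω m hm g hg
  have h1 := hω' n le_rfl g hg
  have h2 := hω' n le_rfl g' hg'
  have h3 := hsand g g' l r hlr hvol hle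
  set e : ℕ → Ξ → ℝ := fun i d => Ψ n i (E n i) ((gridBox n g').indicator 1) d -
    Ψ n i (E n i) ((gridBox n g).indicator 1) d with he
  have hbm : ∀ g, MeasurableSet (gridBox n g : Set (ι → ℝ)) := fun g => measurableSet_box _ _
  have hei : ∀ i, Integrable (e i) Q := fun i =>
    (H.integrable_indicator n i (hbm g')).sub (H.integrable_indicator n i (hbm g))
  have hde : ∀ i d, |Ψ n (σ n i) (Θ n i ω) ((univ.pi I).indicator 1) d -
      Ψ n (σ n i) (Θ n i ω) ((gridBox n g).indicator 1) d| ≤ e (σ n i) d := by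
    intro i d
    simp only [he, ← smp_sub_fun]
    refine abs_smp_le (H.c_nonneg _ _) (fun α _ => hA.abs_le n i α _ _) fun u => ?_
    have b1 : (gridBox n g).indicator (1 : (ι → ℝ) → ℝ) u ≤ (univ.pi I).indicator 1 u :=
      indicator_le_indicator_of_subset hsub (fun _ => zero_le_one) u
    have b2 : (univ.pi I).indicator (1 : (ι → ℝ) → ℝ) u ≤ (gridBox n g').indicator 1 u :=
      indicator_le_indicator_of_subset hsub' (fun _ => zero_le_one) u
    rw [abs_of_nonneg (by linarith)]
    linarith
  have he0 : ∀ i d, 0 ≤ e i d := fun i d => sub_nonneg.2 (smp_mono (H.c_nonneg n i)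
    (fun α _ => H.E_nonneg n i α _) (fun α _ => le_rfl)
    (fun u => indicator_nonneg (fun _ _ => zero_le_one) u)
    fun u => indicator_le_indicator_of_subset (hsub.trans hsub') (fun _ => zero_le_one) u)
  have hInt : ∀ i (S : Set (ι → ℝ)), MeasurableSet S →
      Integrable (Ψ n (σ n i) (Θ n i ω) (S.indicator 1)) Q := fun i S hS =>
    H.integrable_smp n _ (fun α => (hA.measurable n i α).comp measurable_prodMk_left)
      (fun α d => hA.abs_le n i α _ d) (measurable_indicator_one hS) (indicator_one_abs_le _)
  have h4 : |∑ i ∈ range m, (Ψ n (σ n i) (Θ n i ω) ((univ.pi I).indicator 1) (D (σ n i) ω)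
        - ∫ d, Ψ n (σ n i) (Θ n i ω) ((univ.pi I).indicator 1) d ∂Q) -
      ∑ i ∈ range m, (Ψ n (σ n i) (Θ n i ω) ((gridBox n g).indicator 1) (D (σ n i) ω)
        - ∫ d, Ψ n (σ n i) (Θ n i ω) ((gridBox n g).indicator 1) d ∂Q)| ≤
      ∑ i ∈ range n, (e i (D i ω) + ∫ d, e i d ∂Q) := by
    rw [← sum_sub_distrib]
    refine (abs_sum_le_sum_abs _ _).trans ((sum_le_sum fun i _ => ?_).trans (sum_range_comp_le
      (t := fun i => e i (D i ω) + ∫ d, e i d ∂Q) (hA.injective n) hm (hA.lt n)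
      fun i => add_nonneg (he0 i _) (integral_nonneg (he0 i))))
    rw [sub_sub_sub_comm, ← integral_sub (hInt i _ hI.measurableSet) (hInt i _ (hbm g))]
    refine (abs_sub _ _).trans (add_le_add (hde i _) ?_)
    rw [← norm_eq_abs]
    exact norm_integral_le_of_norm_le (hei _) (ae_of_all _ (hde i))
  have h5 : ∑ i ∈ range n, (e i (D i ω) + ∫ d, e i d ∂Q) ≤ (2 * C' + 2 * C₁) * (n * rateX b n) := by
    have h6 := Finset.sum_le_card_nsmul (range n) (fun i => ∫ d, e i d ∂Q) _ fun i _ => h3 i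
    have h7 : ∀ i, ∫ d, e i d ∂Q = ∫ d, Ψ n i (E n i) ((gridBox n g').indicator 1) d ∂Q -
        ∫ d, Ψ n i (E n i) ((gridBox n g).indicator 1) d ∂Q := fun i =>
      integral_sub (H.integrable_indicator n i (hbm g')) (H.integrable_indicator n i (hbm g))
    rw [card_range, nsmul_eq_mul] at h6
    rw [sum_add_distrib]
    simp only [h7] at h6 ⊢
    simp only [he, sum_sub_distrib] at h1 h2 h6 ⊢
    rw [abs_le] at h1 h2
    linarith [h1.1, h2.2]
  rw [abs_le] at h0 h4 ⊢
  constructor <;> linarith [h0.1, h0.2, h4.1, h4.2]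

/-! ### Product kernels -/

lemma IsEnvelope.eventually_abs_add_le (H : ℰ) (Λ : ℕ) :
    ∀ᶠ n in atTop, ∀ t : ι → ℝ, (∀ k, |t k| ≤ Λ) → ∀ k, |t k| + h n k ≤ ((Λ + 1 : ℕ) : ℝ) := by
  have : ∀ᶠ n in atTop, ∀ k, h n k ≤ 1 :=
    eventually_all.2 fun k => (H.h_tendsto k).eventually_le_const one_pos
  filter_upwards [this] with n hn t ht k
  push_cast
  linarith [hn k, ht k]

lemma abs_sum_smp_sub_le {n m : ℕ} (σ : ℕ → ℕ) {W : ℕ → A → Ξ → ℝ} {D : ℕ → Ξ}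
    {f g : (ι → ℝ) → ℝ} {η : ℝ} (hc : ∀ i, 0 ≤ c n i) (h : ∀ u, |f u - g u| ≤ η) :
    |∑ i ∈ range m, smp (s n (σ i)) (c n (σ i)) ξ (W i) f (D i)
      - ∑ i ∈ range m, smp (s n (σ i)) (c n (σ i)) ξ (W i) g (D i)|
      ≤ (∑ i ∈ range m, smp (s n (σ i)) (c n (σ i)) ξ (fun α d => |W i α d|) 1 (D i)) * η := by
  rw [← sum_sub_distrib, sum_mul]
  refine (abs_sum_le_sum_abs _ _).trans (sum_le_sum fun i _ => ?_)
  rw [← smp_sub_fun]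
  refine (abs_smp_le (E := fun α d => |W i α d|) (g := fun _ => η) (hc _) (fun _ _ => le_rfl) h).trans
    (le_of_eq ?_)
  simp only [smp, Pi.one_apply, mul_one, ← sum_mul]
  ring

/-- Centred sums with product kernels are uniformly of order `rateX b`. -/
theorem IsEnvelope.ae_adapted_prodKer_le (H : ℰ) (hA : IsAdapted E σ W) (Λ : ℕ) {f : ι → ℝ → ℝ}
    {M : ι → ℝ} (hf : ∀ k, StepApprox (f k) (M k)) :
    ∀ᵐ ω ∂P, ∃ C : ℝ, 0 ≤ C ∧ ∀ᶠ n : ℕ in atTop, ∀ m ≤ n, ∀ t : ι → ℝ, (∀ k, |t k| ≤ Λ) →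
      |∑ i ∈ range m, (Ψ n (σ n i) (Θ n i ω) (prodKer f (h n) t) (D (σ n i) ω)
        - ∫ d, Ψ n (σ n i) (Θ n i ω) (prodKer f (h n) t) d ∂Q)| ≤ C * (n * rateX b n) := by
  filter_upwards [H.ae_box_le hA (Λ + 1)] with ω ⟨C, hC, hω⟩
  have hM0 : 0 ≤ ∏ k, M k := prod_nonneg fun k _ => (hf k).nonneg
  refine ⟨(∏ k, M k) * C, by positivity, ?_⟩
  filter_upwards [hω, H.eventually_abs_add_le Λ] with n hω hΛ m hm t ht
  have hWm : ∀ i α, Measurable (Θ n i ω α) := fun i α => (hA.measurable n i α).comp measurable_prodMk_left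
  have hInt : ∀ i (g : (ι → ℝ) → ℝ) (M : ℝ), Measurable g → (∀ u, |g u| ≤ M) →
      Integrable (Ψ n (σ n i) (Θ n i ω) g) Q := fun i g M hg hM =>
    H.integrable_smp n _ (hWm i) (fun α d => hA.abs_le n i α _ d) hg hM
  have hintE : ∀ i, Integrable (Ψ n (σ n i) (fun α d => |Θ n i ω α d|) 1) Q := fun i =>
    H.integrable_smp n _ (W := fun α d => |Θ n i ω α d|) (fun α => measurable_abs.comp (hWm i α))
      (fun α d => by rw [abs_abs]; exact hA.abs_le n i α _ d) measurable_const (M := 1) (by simp)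
  rw [mul_assoc]
  refine abs_apply_prodKer_le (Λ := ((Λ + 1 : ℕ) : ℝ)) (X := C * (n * rateX b n))
    (L := ∑ i ∈ range m, Ψ n (σ n i) (fun α d => |Θ n i ω α d|) 1 (D (σ n i) ω)
      + ∑ i ∈ range m, ∫ d, Ψ n (σ n i) (fun α d => |Θ n i ω α d|) 1 d ∂Q)
    hf (H.h_pos n) (hΛ t ht)
    (fun g => ∑ i ∈ range m, (Ψ n (σ n i) (Θ n i ω) g (D (σ n i) ω)
        - ∫ d, Ψ n (σ n i) (Θ n i ω) g d ∂Q)) ?_ ?_ (hω m hm)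
  · intro R _ a B hB
    simp_rw [mul_sum]
    rw [sum_comm]
    refine sum_congr rfl fun i _ => ?_
    simp_rw [smp_sum_fun]
    rw [integral_finsetSum _ fun r _ => ((hInt i _ 1 (measurable_indicator_one (hB r))
      (indicator_one_abs_le _)).const_mul _), ← sum_sub_distrib]
    refine sum_congr rfl fun r _ => ?_
    rw [integral_const_mul, mul_sub]
  · intro f g η hf hg hfM hgM hfg
    rw [sum_sub_distrib, sum_sub_distrib, sub_sub_sub_comm, add_mul]
    refine (abs_sub _ _).trans (add_le_add ?_ ?_)
    · exact abs_sum_smp_sub_le (σ n) (D := fun i => D (σ n i) ω) (W := fun i => Θ n i ω) (H.c_nonneg n) hfg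
    · rw [← sum_sub_distrib, sum_mul]
      refine (abs_sum_le_sum_abs _ _).trans (sum_le_sum fun i _ => ?_)
      rw [← integral_sub (hInt i f _ hf hfM) (hInt i g _ hg hgM), ← integral_mul_const]
      rw [← norm_eq_abs]
      refine norm_integral_le_of_norm_le ((hintE i).mul_const η) (ae_of_all _ fun d => ?_)
      have := abs_sum_smp_sub_le (s := s) (ξ := ξ) (n := n) (m := 1) (fun _ => σ n i) (D := fun _ => d)
        (W := fun _ => Θ n i ω) (H.c_nonneg n) hfg
      simpa using this

end Adapted

theorem IsEnvelope.ae_prodKer_le (H : ℰ) (Λ : ℕ) (W : ℕ → ℕ → A → Ξ → ℝ)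
    (hWm : ∀ n i α, Measurable (W n i α)) (hW : ∀ n i α d, |W n i α d| ≤ E n i α d)
    {f : ι → ℝ → ℝ} {M : ι → ℝ} (hf : ∀ k, StepApprox (f k) (M k)) :
    ∀ᵐ ω ∂P, ∃ C : ℝ, 0 ≤ C ∧ ∀ᶠ n : ℕ in atTop, ∀ m ≤ n, ∀ t : ι → ℝ, (∀ k, |t k| ≤ Λ) →
      |∑ i ∈ range m, (Ψ n i (W n i) (prodKer f (h n) t) (D i ω)
        - ∫ d, Ψ n i (W n i) (prodKer f (h n) t) d ∂Q)| ≤ C * (n * rateX b n) :=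
  H.ae_adapted_prodKer_le (isAdapted_id hWm hW) Λ hf

/-! ### The law of the data of one subject -/

local notation:max "ℝ^" p:max => Fin p → ℝ

/-- Random element, covariate and errors of a subject. -/
abbrev Base (S : Type*) (p : ℕ) := S × ℝ^p × (ℕ → ℝ)

/-- The data of a subject: random element, covariate and errors, and the observation times. -/
abbrev Subj (S : Type*) (p : ℕ) := Base S p × (ℕ → ℝ)

variable {S : Type*} [MeasurableSpace S] {p : ℕ}

local notation:max μ:max "^ℕ" => infinitePi fun _ : ℕ => μ

/-- The law of random element, covariate and errors. -/
def baseLaw (Pθ : Measure S) (PZ : Measure ℝ^p) (Pε : Measure ℝ) : Measure (Base S p) :=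
  Pθ.prod (PZ.prod Pε^ℕ)

/-- The law of the data of a subject. -/
def subjLaw (Pθ : Measure S) (PZ : Measure ℝ^p) (PT Pε : Measure ℝ) : Measure (Subj S p) :=
  (baseLaw Pθ PZ Pε).prod PT^ℕ

/-- The envelope `m(θ,z) + |ε_j|` of the observations. -/
def env (mm : S → ℝ^p → ℝ) (j : ℕ) (y : Base S p) : ℝ := mm y.1 y.2.1 + |y.2.2 j|

variable {Pθ : Measure S} {PZ : Measure ℝ^p} {PT Pε : Measure ℝ}
  [IsProbabilityMeasure Pθ] [IsProbabilityMeasure PZ] [IsProbabilityMeasure PT]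
  [IsProbabilityMeasure Pε] {mm : S → ℝ^p → ℝ} {q : ℝ}

local notation "ℬ" => baseLaw Pθ PZ Pε
local notation "ℒ" => subjLaw Pθ PZ PT Pε

instance : IsProbabilityMeasure ℬ := by unfold baseLaw; infer_instance

instance : IsProbabilityMeasure ℒ := by unfold subjLaw; infer_instance

/-- Moment and density conditions on the law of a subject, for the moment exponent `q`. -/
structure SubjModel (Pθ : Measure S) (PZ : Measure ℝ^p) (PT Pε : Measure ℝ)
    (mm : S → ℝ^p → ℝ) (q : ℝ) : Prop where
  measurable_mm : Measurable fun v : S × ℝ^p => mm v.1 v.2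
  one_le_mm : ∀ θ z, 1 ≤ mm θ z
  moment_mm : ∃ C : NNReal, ∀ z, ∫⁻ θ, ofReal (mm θ z ^ q) ∂Pθ ≤ C
  moment_e : Integrable (fun e => |e| ^ q) Pε
  PT_le : ∃ C : NNReal, PT ≤ C • volume
  PZ_le : ∃ C : NNReal, PZ ≤ C • volume

local notation "ℳ" => SubjModel Pθ PZ PT Pε mm

namespace SubjModel

lemma one_le_env (H : ℳ q) (j : ℕ) (y) : 1 ≤ env mm j y := by
  unfold env
  linarith [H.one_le_mm y.1 y.2.1, abs_nonneg (y.2.2 j)]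

lemma env_nonneg (H : ℳ q) (j : ℕ) (y) : 0 ≤ env mm j y := zero_le_one.trans (H.one_le_env j y)

lemma measurable_env (H : ℳ q) (j : ℕ) : Measurable (env mm j) := by
  have := H.measurable_mm
  exact (this.comp (by fun_prop : Measurable fun y : Base S p => (y.1, y.2.1))).add
    (measurable_abs.comp (by fun_prop))

lemma add_rpow_le {a b : ℝ} (ha : 0 ≤ a) (hb : 0 ≤ b) (hq : 0 ≤ q) :
    (a + b) ^ q ≤ 2 ^ q * (a ^ q + b ^ q) := by
  have h1 : a + b ≤ 2 * max a b := by
    rcases le_total a b with h | h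
    · rw [max_eq_right h]; linarith
    · rw [max_eq_left h]; linarith
  calc (a + b) ^ q ≤ (2 * max a b) ^ q := rpow_le_rpow (by positivity) h1 hq
    _ = 2 ^ q * (max a b) ^ q := Real.mul_rpow (by norm_num) (le_max_of_le_left ha)
    _ ≤ 2 ^ q * (a ^ q + b ^ q) := by
      gcongr
      rcases le_total a b with h | h
      · rw [max_eq_right h]; linarith [rpow_nonneg ha q]
      · rw [max_eq_left h]; linarith [rpow_nonneg hb q]

lemma lintegral_env_rpow_le (H : ℳ q) (hq : 0 ≤ q) : ∃ C : NNReal, ∀ j, ∀ B : Set ℝ^p, MeasurableSet B →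
      ∫⁻ y, ofReal (env mm j y ^ q) * B.indicator 1 y.2.1 ∂ℬ ≤ C * PZ B := by
  obtain ⟨C, hC⟩ := H.moment_mm
  have hmm := H.measurable_mm
  set Me : ENNReal := ∫⁻ e, ofReal (|e| ^ q) ∂Pε with hMe
  have hMe' : Me ≠ ⊤ := by
    have := H.moment_e.lintegral_lt_top
    exact this.ne
  refine ⟨Real.toNNReal (2 ^ q) * (C + Me.toNNReal), fun j B hB => ?_⟩
  have hBm : Measurable (B.indicator (1 : ℝ^p → ENNReal)) := measurable_const.indicator hB
  have h1 : ∫⁻ y, ofReal (mm y.1 y.2.1 ^ q) * B.indicator 1 y.2.1 ∂ℬ ≤ C * PZ B := by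
    unfold baseLaw
    rw [lintegral_prod_symm' _ (by fun_prop)]
    calc ∫⁻ w, ∫⁻ θ, ofReal (mm θ w.1 ^ q) * B.indicator 1 w.1 ∂Pθ
          ∂PZ.prod Pε^ℕ
        ≤ ∫⁻ w, C * B.indicator 1 w.1 ∂PZ.prod Pε^ℕ := by
          refine lintegral_mono fun w => ?_
          have hm : Measurable fun θ => ofReal (mm θ w.1 ^ q) :=
            ((hmm.comp measurable_prodMk_right).pow_const q).ennreal_ofReal
          rw [lintegral_mul_const _ hm]
          exact mul_le_mul_left (hC w.1) _
      _ = C * PZ B := by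
          rw [lintegral_const_mul _ (by fun_prop), lintegral_prod _ (by fun_prop)]
          simp [lintegral_indicator_one hB]
  have h2 : ∫⁻ y, ofReal (|y.2.2 j| ^ q) * B.indicator 1 y.2.1 ∂ℬ = Me * PZ B := by
    unfold baseLaw
    rw [lintegral_prod _ (by fun_prop)]
    simp only [lintegral_const, measure_univ, mul_one]
    have e1 : ∫⁻ w : ℕ → ℝ, ofReal (|w j| ^ q) ∂Pε^ℕ = Me := by
      have h := infinitePi_map_eval (fun _ : ℕ => Pε) j
      rw [hMe]
      conv_rhs => rw [← h]
      rw [lintegral_map (by fun_prop) (by fun_prop)]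
    rw [lintegral_prod _ (by fun_prop)]
    calc ∫⁻ z, ∫⁻ w : ℕ → ℝ, ofReal (|w j| ^ q) * B.indicator 1 z
          ∂Pε^ℕ ∂PZ
        = ∫⁻ z, Me * B.indicator 1 z ∂PZ := by
          refine lintegral_congr fun z => ?_
          rw [lintegral_mul_const _ (by fun_prop), e1]
      _ = Me * PZ B := by rw [lintegral_const_mul _ hBm, lintegral_indicator_one hB]
  calc ∫⁻ y, ofReal (env mm j y ^ q) * B.indicator 1 y.2.1 ∂ℬ
      ≤ ∫⁻ y, ofReal (2 ^ q) * (ofReal (mm y.1 y.2.1 ^ q) * B.indicator 1 y.2.1 +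
          ofReal (|y.2.2 j| ^ q) * B.indicator 1 y.2.1) ∂ℬ := by
        refine lintegral_mono fun y => ?_
        have hm0 : 0 ≤ mm y.1 y.2.1 := zero_le_one.trans (H.one_le_mm _ _)
        rw [← add_mul, ← mul_assoc, ← ofReal_add (by positivity) (by positivity),
          ← ofReal_mul (by positivity)]
        gcongr
        exact add_rpow_le hm0 (abs_nonneg _) hq
    _ = ofReal (2 ^ q) * (∫⁻ y, ofReal (mm y.1 y.2.1 ^ q) * B.indicator 1 y.2.1 ∂ℬ + Me * PZ B) := by
        rw [lintegral_const_mul _ (by fun_prop), lintegral_add_left (by fun_prop), h2]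
    _ ≤ ofReal (2 ^ q) * (C * PZ B + Me * PZ B) := by gcongr
    _ = _ := by
        rw [← add_mul, ← mul_assoc]
        push_cast
        rw [coe_toNNReal hMe']
        rfl

lemma integrable_env_rpow (H : ℳ q) (hq : 0 ≤ q) (j : ℕ) : Integrable (fun y => env mm j y ^ q) ℬ := by
  obtain ⟨C, hC⟩ := H.lintegral_env_rpow_le hq
  refine ⟨((H.measurable_env j).pow_const q).aestronglyMeasurable, ?_⟩
  rw [hasFiniteIntegral_iff_ofReal (ae_of_all _ fun y => rpow_nonneg (H.env_nonneg j y) q)]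
  refine lt_of_le_of_lt ?_ (coe_lt_top (r := C))
  have := hC j univ MeasurableSet.univ
  simpa using this

lemma integral_env_rpow_mul_le (H : ℳ q) (hq : 0 ≤ q) :
    ∃ C : ℝ, 0 ≤ C ∧ ∀ j, ∀ B : Set ℝ^p, MeasurableSet B →
      ∫ y, env mm j y ^ q * B.indicator 1 y.2.1 ∂ℬ ≤ C * PZ.real B := by
  obtain ⟨C, hC⟩ := H.lintegral_env_rpow_le hq
  refine ⟨C, C.2, fun j B hB => ?_⟩
  have h0 : ∀ y : Base S p, 0 ≤ env mm j y ^ q * B.indicator (1 : ℝ^p → ℝ) y.2.1 :=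
    fun y => mul_nonneg (rpow_nonneg (H.env_nonneg j y) q) (indicator_nonneg (fun _ _ => zero_le_one) _)
  have hBm : Measurable (B.indicator (1 : ℝ^p → ℝ)) := measurable_const.indicator hB
  rw [integral_eq_lintegral_of_nonneg_ae (ae_of_all _ h0)
    (((H.measurable_env j).pow_const q).mul (hBm.comp (by fun_prop))).aestronglyMeasurable]
  have h1 : ∫⁻ y, ofReal (env mm j y ^ q * B.indicator (1 : ℝ^p → ℝ) y.2.1) ∂ℬ ≤ C * PZ B := by
    refine le_trans (le_of_eq (lintegral_congr fun y => ?_)) (hC j B hB)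
    rw [ofReal_mul (rpow_nonneg (H.env_nonneg j y) q)]
    congr 1
    by_cases hy : y.2.1 ∈ B <;> simp [hy]
  have h2 := toReal_mono (by finiteness) h1
  simpa [Measure.real] using h2

lemma integrable_env_pow (H : ℳ q) {k : ℕ} (hk : (k : ℝ) ≤ q) (j : ℕ) :
    Integrable (fun y => env mm j y ^ k) ℬ := by
  refine (H.integrable_env_rpow ((Nat.cast_nonneg k).trans hk) j).mono'
    ((H.measurable_env j).pow_const k).aestronglyMeasurable (ae_of_all _ fun y => ?_)
  rw [norm_of_nonneg (pow_nonneg (H.env_nonneg j y) k), ← rpow_natCast]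
  exact Real.rpow_le_rpow_of_exponent_le (H.one_le_env j y) hk

lemma integral_env_pow_mul_le (H : ℳ q) {k : ℕ} (hk : (k : ℝ) ≤ q) :
    ∃ C : ℝ, 0 ≤ C ∧ ∀ j, ∀ B : Set ℝ^p, MeasurableSet B →
      ∫ y, env mm j y ^ k * B.indicator 1 y.2.1 ∂ℬ ≤ C * PZ.real B := by
  have hq := (Nat.cast_nonneg k).trans hk
  obtain ⟨C, hC0, hC⟩ := H.integral_env_rpow_mul_le hq
  refine ⟨C, hC0, fun j B hB => le_trans ?_ (hC j B hB)⟩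
  have hBm : Measurable (B.indicator (1 : ℝ^p → ℝ)) := measurable_const.indicator hB
  refine integral_mono_of_nonneg (ae_of_all _ fun y => mul_nonneg (pow_nonneg (H.env_nonneg j y) k)
      (indicator_nonneg (fun _ _ => zero_le_one) _)) ?_ (ae_of_all _ fun y => ?_)
  · refine (H.integrable_env_rpow hq j).mono' (((H.measurable_env j).pow_const q).mul
      (hBm.comp (by fun_prop))).aestronglyMeasurable (ae_of_all _ fun y => ?_)
    rw [norm_mul, norm_of_nonneg (rpow_nonneg (H.env_nonneg j y) q)]
    refine mul_le_of_le_one_right (rpow_nonneg (H.env_nonneg j y) q) ?_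
    by_cases hy : y.2.1 ∈ B <;> simp [hy]
  · simp only
    rw [← rpow_natCast]
    exact mul_le_mul_of_nonneg_right (Real.rpow_le_rpow_of_exponent_le (H.one_le_env j y) hk)
      (indicator_nonneg (fun _ _ => zero_le_one) _)

lemma exists_PT_real_Ico_le (H : ℳ q) :
    ∃ C : ℝ, 0 ≤ C ∧ ∀ l r : ℝ, PT.real (Ico l r) ≤ C * max (r - l) 0 := by
  obtain ⟨C, hC⟩ := H.PT_le
  refine ⟨C, C.2, fun l r => ?_⟩
  have h1 : PT (Ico l r) ≤ C * ofReal (r - l) := by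
    refine (hC (Ico l r)).trans (le_of_eq ?_)
    rw [Measure.smul_apply, Real.volume_Ico]
    rfl
  have h2 := toReal_mono (by finiteness) h1
  rw [toReal_mul, ENNReal.toReal_ofReal'] at h2
  exact h2

lemma exists_PZ_real_box_le (H : ℳ q) :
    ∃ C : ℝ, 0 ≤ C ∧ ∀ l r : ℝ^p, PZ.real (box l r) ≤ C * ∏ k, max (r k - l k) 0 := by
  obtain ⟨C, hC⟩ := H.PZ_le
  refine ⟨C, C.2, fun l r => ?_⟩
  have h1 : PZ (box l r) ≤ C * ∏ k, ofReal (r k - l k) := by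
    refine (hC (box l r)).trans (le_of_eq ?_)
    rw [Measure.smul_apply, box, Real.volume_pi_Ico]
    rfl
  have h2 := toReal_mono (mul_ne_top coe_ne_top (ENNReal.prod_ne_top fun k _ => ofReal_ne_top)) h1
  rw [toReal_mul, ENNReal.toReal_prod] at h2
  simpa [ENNReal.toReal_ofReal', Measure.real] using h2

end SubjModel

/-- The indicator that all times with index in `F` lie in `I`. -/
def allIn (F : Finset ℕ) (I : Set ℝ) : Set (ℕ → ℝ) := (F : Set ℕ).pi fun _ => I

lemma measurableSet_allIn (F : Finset ℕ) {I : Set ℝ} (hI : MeasurableSet I) :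
    MeasurableSet (allIn F I) := MeasurableSet.pi F.countable_toSet fun _ _ => hI

lemma infinitePi_real_allIn (F : Finset ℕ) {I : Set ℝ} (hI : MeasurableSet I) :
    PT^ℕ.real (allIn F I) = PT.real I ^ F.card := by
  rw [Measure.real, allIn, Measure.infinitePi_pi _ fun _ _ => hI, prod_const, ENNReal.toReal_pow]
  rfl

lemma integral_subjLaw_mul (f : Base S p → ℝ) (g : (ℕ → ℝ) → ℝ) : ∫ d, f d.1 * g d.2 ∂ℒ =
      (∫ y, f y ∂ℬ) * ∫ τ, g τ ∂PT^ℕ :=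
  integral_prod_mul f g

lemma integrable_subjLaw_mul {f : Base S p → ℝ} {g : (ℕ → ℝ) → ℝ}
    (hf : Integrable f ℬ) (hg : Integrable g PT^ℕ) :
    Integrable (fun d : Subj S p => f d.1 * g d.2) ℒ :=
  hf.mul_prod hg

lemma integral_mul_allIn {f : Base S p → ℝ} (F : Finset ℕ) {I : Set ℝ} (hI : MeasurableSet I) :
    ∫ d, f d.1 * (allIn F I).indicator 1 d.2 ∂ℒ = (∫ y, f y ∂ℬ) * PT.real I ^ F.card := by
  rw [integral_subjLaw_mul, integral_indicator_one (measurableSet_allIn F hI), infinitePi_real_allIn F hI]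

lemma integrable_mul_allIn {f : Base S p → ℝ}
    (hf : Integrable f ℬ) (F : Finset ℕ) {I : Set ℝ} (hI : MeasurableSet I) :
    Integrable (fun d : Subj S p => f d.1 * (allIn F I).indicator 1 d.2) ℒ :=
  integrable_subjLaw_mul hf ((integrable_indicator_iff (measurableSet_allIn F hI)).2
    (integrable_const (1 : ℝ)).integrableOn)

/-! ### Consequences of the bandwidth conditions -/

lemma log_div_le_one (n : ℕ) : log n / n ≤ 1 := by
  rcases Nat.eq_zero_or_pos n with rfl | hn
  · simp
  · rw [div_le_one (by exact_mod_cast hn)]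
    exact (Real.log_le_sub_one_of_pos (by exact_mod_cast hn)).trans (by linarith)

lemma one_div_le_log_div {n : ℕ} (hn : 3 ≤ n) : 1 / (n : ℝ) ≤ log n / n := by
  have h0 : (0 : ℝ) < n := by positivity
  gcongr
  rw [Real.le_log_iff_exp_le h0]
  have : (3 : ℝ) ≤ n := by exact_mod_cast hn
  linarith [Real.exp_one_lt_d9]

/-- The bandwidth condition on the variance proxy `b` for the moment exponent `q`. -/
abbrev IsRate (b : ℕ → ℝ) (q : ℝ) : Prop :=
  Tendsto (fun n : ℕ => (b n)⁻¹ * (log n / n) ^ (1 - 2 / q)) atTop (𝓝 0)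

lemma eventually_rpow_le_of_rate (hb : ∀ n, 0 < b n) (hr : IsRate b q) :
    ∀ᶠ n : ℕ in atTop, (log n / n) ^ (1 - 2 / q) ≤ b n := by
  filter_upwards [hr.eventually_le_const one_pos] with n hn
  have := hb n
  rw [inv_mul_le_iff₀ this] at hn
  linarith

lemma eventually_log_div_le_of_rate (hb : ∀ n, 0 < b n) (hq : 2 < q) (hr : IsRate b q) :
    ∀ᶠ n : ℕ in atTop, log n / n ≤ b n := by
  filter_upwards [eventually_rpow_le_of_rate hb hr, eventually_ge_atTop 2] with n hn hn2
  refine le_trans ?_ hn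
  have hL := log_div_pos hn2
  calc log n / n = (log n / n) ^ (1 : ℝ) := (rpow_one _).symm
    _ ≤ _ := Real.rpow_le_rpow_of_exponent_ge hL (log_div_le_one n) (by
        have : 0 < 2 / q := by positivity
        linarith)

lemma eventually_rateQ_rpow_le (hb : ∀ n, 0 < b n) (hq : 2 < q) (hr : IsRate b q) :
    ∀ᶠ n : ℕ in atTop, rateQ b n ^ (1 - q) ≤ rateX b n := by
  filter_upwards [eventually_rpow_le_of_rate hb hr, eventually_ge_atTop 2] with n hn hn2
  have hL := log_div_pos hn2
  have hQ := rateQ_pos hb hn2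
  set L := log n / n with hLdef
  have hq0 : 0 < q := by linarith
  have key : L⁻¹ ≤ rateQ b n ^ q := by
    have h1 : L ^ (1 - 2 / q) / L ≤ rateQ b n ^ 2 := by rw [rateQ_sq hb hn2]; gcongr
    have h2 : L ^ (1 - 2 / q) / L = L ^ (-(2 / q)) := by
      conv_lhs => rw [← rpow_one L, ← rpow_mul hL.le, one_mul, ← Real.rpow_sub hL]
      congr 1; ring
    rw [h2] at h1
    have h3 := rpow_le_rpow (by positivity) h1 (by positivity : 0 ≤ q / 2)
    rw [← rpow_mul hL.le, ← rpow_natCast, ← rpow_mul hQ.le] at h3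
    have e1 : -(2 / q) * (q / 2) = -1 := by field_simp
    have e2 : ((2 : ℕ) : ℝ) * (q / 2) = q := by push_cast; ring
    rwa [e1, e2, rpow_neg_one] at h3
  rw [rateX_eq hb hn2, Real.rpow_sub hQ, rpow_one, div_eq_mul_inv]
  gcongr
  exact inv_le_of_inv_le₀ hL key

lemma eventually_one_div_le_rateX (hb : ∀ n, 0 < b n) (hq : 2 < q) (hr : IsRate b q) :
    ∀ᶠ n : ℕ in atTop, 1 / (n : ℝ) ≤ rateX b n := by
  filter_upwards [eventually_log_div_le_of_rate hb hq hr, eventually_ge_atTop 3] with n hn hn3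
  have hL := log_div_pos (by omega : 2 ≤ n)
  have h1 := one_div_le_log_div hn3
  refine Real.le_sqrt_of_sq_le ?_
  have : (0 : ℝ) ≤ 1 / n := by positivity
  nlinarith

lemma eventually_one_div_sq_le_of_rate (hb : ∀ n, 0 < b n) (hq : 2 < q) (hr : IsRate b q) :
    ∀ᶠ n : ℕ in atTop, 3 / (n : ℝ) ^ 2 ≤ b n := by
  filter_upwards [eventually_log_div_le_of_rate hb hq hr, eventually_ge_atTop 3] with n hn hn3
  refine le_trans ?_ ((one_div_le_log_div hn3).trans hn)
  have h3 : (3 : ℝ) ≤ n := by exact_mod_cast hn3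
  rw [div_le_div_iff₀ (by positivity) (by positivity)]
  nlinarith

/-- The average of `N_i^{-k}`. -/
def invGam (N : ℕ → ℕ → ℕ) (k n : ℕ) : ℝ := (n : ℝ)⁻¹ * ∑ i ∈ range n, ((N n i : ℝ) ^ k)⁻¹

lemma gam_eq_inv (N : ℕ → ℕ → ℕ) (k n : ℕ) : gam N k n = (invGam N k n)⁻¹ := rfl

lemma invGam_nonneg (N : ℕ → ℕ → ℕ) (k n : ℕ) : 0 ≤ invGam N k n := by unfold invGam; positivity

lemma invGam_le_one {N : ℕ → ℕ → ℕ} (hN : ∀ n i, 2 ≤ N n i) (k n : ℕ) : invGam N k n ≤ 1 := by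
  unfold invGam
  have : ∑ i ∈ range n, ((N n i : ℝ) ^ k)⁻¹ ≤ ∑ i ∈ range n, 1 :=
    sum_le_sum fun i _ => inv_le_one_of_one_le₀ (one_le_pow₀ (by
      exact_mod_cast (by have := hN n i; omega : 1 ≤ N n i)))
  rw [sum_const, card_range, nsmul_eq_mul, mul_one] at this
  calc (n : ℝ)⁻¹ * _ ≤ (n : ℝ)⁻¹ * n := by gcongr
    _ ≤ 1 := inv_mul_le_one

lemma sum_inv_eq (N : ℕ → ℕ → ℕ) (k n : ℕ) : ∑ i ∈ range n, ((N n i : ℝ) ^ k)⁻¹ = n * invGam N k n := by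
  unfold invGam
  rcases Nat.eq_zero_or_pos n with rfl | hn
  · simp
  · rw [← mul_assoc, mul_inv_cancel₀ (by positivity), one_mul]

/-! ### Strong law and Chernoff bounds for the tails -/

lemma ae_exists_sum_le (hD : IsIID P D Q) {V : Ξ → ℝ} (hV : Measurable V) (hVi : Integrable V Q) :
    ∀ᵐ ω ∂P, ∃ C : ℝ, 0 ≤ C ∧ ∀ᶠ n : ℕ in atTop, ∑ i ∈ range n, V (D i ω) ≤ C * n := by
  have h := strong_law_ae_real (fun i ω => V (D i ω))
    (by rw [← hD.law 0] at hVi; exact hVi.comp_measurable (hD.measurable 0))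
    (fun i j hij => (hD.indep.indepFun hij).comp hV hV)
    (fun i => IdentDistrib.comp (f := D i) (g := D 0)
      ⟨(hD.measurable i).aemeasurable, (hD.measurable 0).aemeasurable, by rw [hD.law, hD.law]⟩ hV)
  filter_upwards [h] with ω hω
  refine ⟨|∫ a, V (D 0 a) ∂P| + 1, by positivity, ?_⟩
  filter_upwards [hω.eventually_le_const (lt_of_le_of_lt (le_abs_self _) (lt_add_one _)),
    eventually_gt_atTop 0] with n hn hn0
  rwa [div_le_iff₀ (by exact_mod_cast hn0)] at hn

lemma mgf_le_exp_of_mem_Icc {f : Ξ → ℝ} (hf : Measurable f) {l : ℝ} (h0 : ∀ d, 0 ≤ l * f d)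
    (h1 : ∀ d, l * f d ≤ 1) : mgf f Q l ≤ exp (2 * ∫ d, l * f d ∂Q) := by
  have hi : Integrable (fun d => l * f d) Q :=
    .of_bound (hf.const_mul l).aestronglyMeasurable 1 (ae_of_all _ fun d => by
      rw [norm_of_nonneg (h0 d)]; exact h1 d)
  have hle : ∀ d, exp (l * f d) ≤ 1 + 2 * (l * f d) := fun d => by
    have := (abs_le.1 (Real.abs_exp_sub_one_sub_id_le (by rw [abs_of_nonneg (h0 d)]; exact h1 d))).2
    nlinarith [h0 d, h1 d]
  calc mgf f Q l ≤ ∫ d, 1 + 2 * (l * f d) ∂Q := by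
        refine integral_mono_of_nonneg (ae_of_all _ fun d => (exp_pos _).le)
          ((integrable_const 1).add (hi.const_mul 2)) (ae_of_all _ hle)
    _ = 1 + 2 * ∫ d, l * f d ∂Q := by
        rw [integral_add (integrable_const 1) (hi.const_mul 2), integral_const_mul]; simp
    _ ≤ _ := by linarith [Real.add_one_le_exp (2 * ∫ d, l * f d ∂Q)]

/-- Errors whose size lies between `a` and `N a`. -/
def midErr (a : ℝ) (N : ℕ) (x : ℝ) : ℝ := if a < |x| ∧ |x| ≤ N * a then |x| else 0

lemma measurable_midErr (a : ℝ) (N : ℕ) : Measurable (midErr a N) :=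
  Measurable.ite ((measurableSet_lt measurable_const measurable_abs).inter
    (measurableSet_le measurable_abs measurable_const)) measurable_abs measurable_const

lemma midErr_nonneg (a : ℝ) (N : ℕ) (x : ℝ) : 0 ≤ midErr a N x := by
  unfold midErr; split_ifs
  · exact abs_nonneg x
  · exact le_rfl

lemma midErr_le {a : ℝ} (ha : 0 ≤ a) (N : ℕ) (x : ℝ) : midErr a N x ≤ N * a := by
  unfold midErr; split_ifs with h
  · exact h.2
  · positivity

lemma le_rpow_mul_of_lt {a y q : ℝ} (ha : 0 < a) (hay : a < y) (hq : 1 ≤ q) : y ≤ a ^ (1 - q) * y ^ q := by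
  have hy : 0 < y := ha.trans hay
  calc y = y ^ (1 - q) * y ^ q := by rw [← rpow_add hy]; simp
    _ ≤ a ^ (1 - q) * y ^ q := by
      exact mul_le_mul_of_nonneg_right (Real.rpow_le_rpow_of_nonpos ha hay.le (by linarith)) (by positivity)

lemma midErr_le_rpow {a q : ℝ} (ha : 0 < a) (hq : 1 ≤ q) (N : ℕ) (x : ℝ) :
    midErr a N x ≤ a ^ (1 - q) * |x| ^ q := by
  unfold midErr; split_ifs with h
  · exact le_rpow_mul_of_lt ha h.1 hq
  · positivity

lemma mgf_avg_midErr_le (hq : 1 ≤ q) (he : Integrable (fun e => |e| ^ q) Pε) {a : ℝ} (ha : 0 < a)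
    {N : ℕ} (hN : 1 ≤ N) :
    mgf (fun e : ℕ → ℝ => (N : ℝ)⁻¹ * ∑ j ∈ range N, midErr a N (e j)) Pε^ℕ a⁻¹
      ≤ exp (2 * (a ^ (-q) * ∫ e, |e| ^ q ∂Pε)) := by
  have hN0 : (0 : ℝ) < N := by exact_mod_cast hN
  have hind : iIndepFun (fun (j : ℕ) (e : ℕ → ℝ) => midErr a N (e j)) Pε^ℕ :=
    iIndepFun_infinitePi (P := fun _ : ℕ => Pε) (X := fun _ => midErr a N) fun _ => measurable_midErr a N
  have hm : ∀ j : ℕ, Measurable fun e : ℕ → ℝ => midErr a N (e j) := fun j =>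
    (measurable_midErr a N).comp (measurable_pi_apply j)
  have h1 : mgf (fun e : ℕ → ℝ => (N : ℝ)⁻¹ * ∑ j ∈ range N, midErr a N (e j)) Pε^ℕ a⁻¹ =
      ∏ j ∈ range N, mgf (fun e : ℕ → ℝ => midErr a N (e j)) Pε^ℕ (a⁻¹ * (N : ℝ)⁻¹) := by
    rw [← hind.mgf_sum hm]
    simp only [mgf, Finset.sum_apply]
    refine integral_congr_ae (ae_of_all _ fun e => ?_)
    simp only
    congr 1
    ring
  rw [h1]
  have h2 : ∀ j ∈ range N, mgf (fun e : ℕ → ℝ => midErr a N (e j)) Pε^ℕ (a⁻¹ * (N : ℝ)⁻¹) ≤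
      exp (2 * (a ^ (-q) * ∫ e, |e| ^ q ∂Pε) * (N : ℝ)⁻¹) := by
    intro j _
    refine (mgf_le_exp_of_mem_Icc (hm j) (fun e => mul_nonneg (by positivity) (midErr_nonneg _ _ _))
      fun e => ?_).trans ?_
    · rw [← mul_inv, inv_mul_le_one₀ (by positivity), mul_comm]
      exact midErr_le ha.le N _
    · refine Real.exp_le_exp.2 ?_
      have e1 : ∫ e : ℕ → ℝ, a⁻¹ * (N : ℝ)⁻¹ * midErr a N (e j) ∂Pε^ℕ
          = a⁻¹ * (N : ℝ)⁻¹ * ∫ e, midErr a N e ∂Pε := by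
        rw [integral_const_mul]
        congr 1
        have h := infinitePi_map_eval (fun _ : ℕ => Pε) j
        conv_rhs => rw [← h]
        rw [integral_map (measurable_pi_apply j).aemeasurable (measurable_midErr a N).aestronglyMeasurable]
      rw [e1]
      have e2 : ∫ e, midErr a N e ∂Pε ≤ a ^ (1 - q) * ∫ e, |e| ^ q ∂Pε := by
        rw [← integral_const_mul]
        exact integral_mono_of_nonneg (ae_of_all _ fun e => midErr_nonneg _ _ _) (he.const_mul _)
          (ae_of_all _ fun e => midErr_le_rpow ha hq N e)
      have e3 : a ^ (-q) = a⁻¹ * a ^ (1 - q) := by rw [← rpow_neg_one, ← rpow_add ha]; congr 1; ring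
      calc 2 * (a⁻¹ * (N : ℝ)⁻¹ * ∫ e, midErr a N e ∂Pε)
          ≤ 2 * (a⁻¹ * (N : ℝ)⁻¹ * (a ^ (1 - q) * ∫ e, |e| ^ q ∂Pε)) := by gcongr
        _ = _ := by rw [e3]; ring
  refine (Finset.prod_le_prod (fun j _ => mgf_nonneg) h2).trans (le_of_eq ?_)
  rw [prod_const, card_range, ← exp_nat_mul]
  congr 1
  field_simp

section Chernoff

variable {D : ℕ → Ω → ℕ → ℝ}

lemma ae_sum_midErr_le (hD : IsIID P D Pε^ℕ) (hq : 2 < q)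
    (he : Integrable (fun e => |e| ^ q) Pε) {b : ℕ → ℝ} (hb : ∀ n, 0 < b n)
    (hr : IsRate b q)
    {N : ℕ → ℕ → ℕ} (hN : ∀ n i, 2 ≤ N n i) :
    ∃ C : ℝ, 0 ≤ C ∧ ∀ᵐ ω ∂P, ∀ᶠ n : ℕ in atTop, ∑ i ∈ range n, (N n i : ℝ)⁻¹ *
        ∑ j ∈ range (N n i), midErr (rateQ b n / 2) (N n i) (D i ω j)
        ≤ C * (n * rateX b n) := by
  set M := ∫ e, |e| ^ q ∂Pε with hM
  have hM0 : 0 ≤ M := integral_nonneg fun e => by positivity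
  set C := 1 + 2 * 2 ^ (q - 1) * M with hC
  refine ⟨C, by positivity, ?_⟩
  set Y : ℕ → ℕ → Ω → ℝ := fun n i ω => (N n i : ℝ)⁻¹ *
    ∑ j ∈ range (N n i), midErr (rateQ b n / 2) (N n i) (D i ω j) with hY
  have hg : ∀ n i, Measurable fun e : ℕ → ℝ => (N n i : ℝ)⁻¹ *
      ∑ j ∈ range (N n i), midErr (rateQ b n / 2) (N n i) (e j) := fun n i =>
    (measurable_sum _ fun j _ => (measurable_midErr _ _).comp (measurable_pi_apply j)).const_mul _
  have hYm : ∀ n i, Measurable (Y n i) := fun n i => (hg n i).comp (hD.measurable i)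
  have h := ae_eventually_notMem_of_le (P := P) (C := 1) zero_le_one
    (bad := fun n => {ω | C * (n * rateX b n) ≤ ∑ i ∈ range n, Y n i ω}) ?_
  · filter_upwards [h] with ω hω
    filter_upwards [hω] with n hn
    exact (not_le.1 fun hc => hn hc).le
  · filter_upwards [eventually_rateQ_rpow_le hb hq hr, eventually_ge_atTop 2] with n hQx hn
    have hn0 : (0 : ℝ) < n := by positivity
    have hQp := rateQ_pos hb hn
    set a := rateQ b n / 2 with ha
    have ha0 : 0 < a := by positivity
    have hind : iIndepFun (Y n) P := hD.indep.comp _ (hg n)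
    have hmgf : mgf (∑ i ∈ range n, Y n i) P a⁻¹ ≤ exp (n * (2 * (a ^ (-q) * M))) := by
      rw [hind.mgf_sum (hYm n)]
      have h1 : ∀ i ∈ range n, mgf (Y n i) P a⁻¹ ≤ exp (2 * (a ^ (-q) * M)) := by
        intro i _
        have h2 := mgf_avg_midErr_le (N := N n i) (by linarith : 1 ≤ q) he ha0 (by have := hN n i; omega)
        rw [← hD.law i] at h2
        rw [mgf, integral_map (hD.measurable i).aemeasurable
          (((hg n i).const_mul _).exp.aestronglyMeasurable)] at h2
        exact h2
      refine (Finset.prod_le_prod (fun j _ => mgf_nonneg) h1).trans (le_of_eq ?_)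
      rw [prod_const, card_range, ← exp_nat_mul]
    have hbd : ∀ i ω, |Y n i ω| ≤ N n i * a := by
      intro i ω
      have hN0 : (0 : ℝ) < N n i := by have := hN n i; positivity
      rw [abs_of_nonneg (mul_nonneg (by positivity) (sum_nonneg fun j _ => midErr_nonneg _ _ _))]
      calc (N n i : ℝ)⁻¹ * ∑ j ∈ range (N n i), midErr a (N n i) (D i ω j)
          ≤ (N n i : ℝ)⁻¹ * ∑ j ∈ range (N n i), (N n i * a) := by
            gcongr
            exact midErr_le ha0.le _ _
        _ = _ := by
            rw [sum_const, card_range, nsmul_eq_mul]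
            field_simp
    have hInt : Integrable (fun ω => exp (a⁻¹ * (∑ i ∈ range n, Y n i) ω)) P := by
      have hsm : Measurable (∑ i ∈ range n, Y n i) := by
        rw [show (∑ i ∈ range n, Y n i) = fun ω => ∑ i ∈ range n, Y n i ω from
          funext fun ω => Finset.sum_apply _ _ _]
        exact measurable_sum _ fun i _ => hYm n i
      refine .of_bound ((hsm.const_mul a⁻¹).exp.aestronglyMeasurable)
        (exp (a⁻¹ * ∑ i ∈ range n, N n i * a)) (ae_of_all _ fun ω => ?_)
      rw [norm_of_nonneg (exp_pos _).le, Finset.sum_apply]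
      gcongr
      exact (le_abs_self _).trans (hbd _ _)
    have h3 := measure_ge_le_exp_mul_mgf (μ := P) (X := ∑ i ∈ range n, Y n i)
      (C * (n * rateX b n)) (t := a⁻¹) (by positivity) hInt
    have hset : {ω | C * (n * rateX b n) ≤ ∑ i ∈ range n, Y n i ω} =
        {ω | C * (n * rateX b n) ≤ (∑ i ∈ range n, Y n i) ω} := by
      simp [Finset.sum_apply]
    rw [hset]
    rw [Measure.real] at h3
    refine (ENNReal.le_ofReal_iff_toReal_le (measure_ne_top _ _) (by positivity)).2 (h3.trans ?_)
    have e1 : a⁻¹ * (n * rateX b n) = 2 * log n := by rw [rateX_eq hb hn, ha]; field_simp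
    have e2 : n * a ^ (-q) ≤ 2 ^ (q - 1) * (2 * log n) := by
      have e3 : a ^ (-q) = a⁻¹ * (2 ^ (q - 1) * rateQ b n ^ (1 - q)) := by
        rw [show a ^ (-q) = a⁻¹ * a ^ (1 - q) by
          rw [← rpow_neg_one, ← rpow_add ha0]; congr 1; ring, ha,
          Real.div_rpow hQp.le (by norm_num), show (1 - q) = -(q - 1) by ring,
          Real.rpow_neg (by norm_num : (0 : ℝ) ≤ 2)]
        field_simp
      calc n * a ^ (-q) = 2 ^ (q - 1) * (a⁻¹ * (n * rateQ b n ^ (1 - q))) := by rw [e3]; ring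
        _ ≤ 2 ^ (q - 1) * (a⁻¹ * (n * rateX b n)) := by gcongr
        _ = _ := by rw [e1]
    have hlog : 0 ≤ log n := Real.log_nonneg (by exact_mod_cast (by omega : 1 ≤ n))
    calc exp (-a⁻¹ * (C * (n * rateX b n))) * mgf (∑ i ∈ range n, Y n i) P a⁻¹
        ≤ exp (-(C * (2 * log n))) * exp (n * (2 * (a ^ (-q) * M))) := by
          rw [← e1]
          refine mul_le_mul (le_of_eq (by ring_nf)) hmgf mgf_nonneg (exp_pos _).le
      _ = exp (-(C * (2 * log n)) + 2 * M * (n * a ^ (-q))) := by rw [← exp_add]; ring_nf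
      _ ≤ exp (-(C * (2 * log n)) + 2 * M * (2 ^ (q - 1) * (2 * log n))) := by gcongr
      _ = exp (-(((2 : ℕ) : ℝ) * log n)) := by congr 1; rw [hC]; push_cast; ring
      _ = 1 / (n : ℝ) ^ 2 := by rw [Real.exp_neg, exp_nat_mul, Real.exp_log hn0, one_div]

end Chernoff

lemma ae_exists_sum_toReal_le (hD : IsIID P D Q) {V : Ξ → ENNReal} (hV : Measurable V) (hVi : ∫⁻ d, V d ∂Q ≠ ⊤) :
    ∀ᵐ ω ∂P, (∀ i, V (D i ω) ≠ ⊤) ∧ ∃ C : ℝ, 0 ≤ C ∧ ∀ᶠ n : ℕ in atTop,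
      ∑ i ∈ range n, (V (D i ω)).toReal ≤ C * n := by
  have h1 := ae_exists_sum_le hD hV.ennreal_toReal
    (integrable_toReal_of_lintegral_ne_top hV.aemeasurable hVi)
  have h2 : ∀ᵐ ω ∂P, ∀ i, V (D i ω) ≠ ⊤ := by
    rw [ae_all_iff]
    intro i
    have h3 : ∀ᵐ d ∂P.map (D i), V d ≠ ⊤ := by
      rw [hD.law i]
      filter_upwards [ae_lt_top hV hVi] with d hd using hd.ne
    exact ae_of_ae_map (hD.measurable i).aemeasurable h3
  filter_upwards [h1, h2] with ω h1 h2 using ⟨h2, h1⟩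

lemma tailW_le_rpow {A : Type*} {a q : ℝ} (ha : 0 < a) (hq : 1 ≤ q) {E : A → Ξ → ℝ}
    (hE : ∀ α d, 0 ≤ E α d) (α : A) (d : Ξ) : tailW a E E α d ≤ a ^ (1 - q) * E α d ^ q := by
  unfold tailW
  split_ifs with h
  · exact le_rpow_mul_of_lt ha h hq
  · exact mul_nonneg (by positivity) (rpow_nonneg (hE α d) q)

lemma measurePreserving_fst_subjLaw : MeasurePreserving Prod.fst ℒ ℬ := measurePreserving_fst

lemma map_errors_subjLaw : (ℒ).map (fun d => d.1.2.2) = Pε^ℕ := by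
  have h : MeasurePreserving (fun d : Subj S p => d.1.2.2) ℒ Pε^ℕ :=
    (measurePreserving_snd (μ := PZ) (ν := Pε^ℕ)).comp ((measurePreserving_snd (μ := Pθ)
        (ν := PZ.prod Pε^ℕ)).comp measurePreserving_fst_subjLaw)
  exact h.map_eq

/-- The second moment of a weighted sum over observations in a small box is controlled by the
number of distinct observation times that occur in pairs of summands. -/
lemma integral_sum_sq_le {A : Type*} (c : ℝ) (s : Finset A) {E : A → Base S p → ℝ} (hE0 : ∀ α y, 0 ≤ E α y)
    (hEi : ∀ α, Integrable (fun y => E α y ^ 2) ℬ) {B : Set ℝ^p}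
    (hB : MeasurableSet B) {M : ℝ}
    (hM : ∀ α, ∫ y, E α y ^ 2 * B.indicator 1 y.2.1 ∂ℬ ≤ M) (F : A → Finset ℕ)
    {I : Set ℝ} (hI : MeasurableSet I) {G : A → Subj S p → ℝ} (hG0 : ∀ α d, 0 ≤ G α d)
    (hG : ∀ α d, G α d ≤ B.indicator 1 d.1.2.1 * (allIn (F α) I).indicator 1 d.2) :
    ∫ d, (c * ∑ α ∈ s, E α d.1 * G α d) ^ 2 ∂ℒ ≤
      M * (c ^ 2 * ∑ α ∈ s, ∑ β ∈ s, PT.real I ^ (F α ∪ F β).card) := by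
  set f : A → A → Base S p → ℝ := fun α β y =>
    2⁻¹ * (E α y ^ 2 * B.indicator 1 y.2.1 + E β y ^ 2 * B.indicator 1 y.2.1) with hf
  have hBm : Measurable fun y : Base S p => B.indicator (1 : ℝ^p → ℝ) y.2.1 :=
    (measurable_const.indicator hB).comp (by fun_prop)
  have hEBi : ∀ α, Integrable (fun y => E α y ^ 2 * B.indicator 1 y.2.1) ℬ := by
    intro α
    refine (hEi α).mul_bdd (c := 1) hBm.aestronglyMeasurable (ae_of_all _ fun y => ?_)
    by_cases hy : y.2.1 ∈ B <;> simp [hy]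
  have hfi : ∀ α β, Integrable (f α β) ℬ := fun α β => ((hEBi α).add (hEBi β)).const_mul _
  have hfM : ∀ α β, ∫ y, f α β y ∂ℬ ≤ M := by
    intro α β
    rw [hf]
    simp only
    rw [integral_const_mul, integral_add (hEBi α) (hEBi β)]
    linarith [hM α, hM β]
  have hpt : ∀ d : Subj S p, (c * ∑ α ∈ s, E α d.1 * G α d) ^ 2 ≤
      c ^ 2 * ∑ α ∈ s, ∑ β ∈ s, f α β d.1 * (allIn (F α ∪ F β) I).indicator 1 d.2 := by
    intro d
    rw [mul_pow, pow_two (∑ α ∈ s, _), sum_mul_sum]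
    refine mul_le_mul_of_nonneg_left (sum_le_sum fun α _ => sum_le_sum fun β _ => ?_) (sq_nonneg c)
    have h1 : G α d * G β d ≤ B.indicator 1 d.1.2.1 * (allIn (F α ∪ F β) I).indicator 1 d.2 := by
      refine (mul_le_mul (hG α d) (hG β d) (hG0 β d) ((hG0 α d).trans (hG α d))).trans ?_
      by_cases hy : d.1.2.1 ∈ B
      · by_cases h2 : d.2 ∈ allIn (F α ∪ F β) I
        · simp only [hy, h2, indicator_of_mem, Pi.one_apply, one_mul, mul_one]
          by_cases h3 : d.2 ∈ allIn (F α) I <;> by_cases h4 : d.2 ∈ allIn (F β) I <;> simp [h3, h4]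
        · have : d.2 ∉ allIn (F α) I ∨ d.2 ∉ allIn (F β) I := by
            by_contra! hc
            refine h2 fun m hm => ?_
            rcases Finset.mem_union.1 (mem_coe.1 hm) with h | h
            · exact hc.1 m (mem_coe.2 h)
            · exact hc.2 m (mem_coe.2 h)
          rcases this with h | h <;> simp [h, h2]
      · simp [hy]
    calc E α d.1 * G α d * (E β d.1 * G β d) = E α d.1 * E β d.1 * (G α d * G β d) := by ring
      _ ≤ 2⁻¹ * (E α d.1 ^ 2 + E β d.1 ^ 2) *
          (B.indicator 1 d.1.2.1 * (allIn (F α ∪ F β) I).indicator 1 d.2) := by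
        refine mul_le_mul ?_ h1 (mul_nonneg (hG0 _ _) (hG0 _ _)) (by positivity)
        nlinarith [sq_nonneg (E α d.1 - E β d.1)]
      _ = _ := by rw [hf]; ring
  have hInt : ∀ α β, Integrable (fun d : Subj S p => f α β d.1 *
      (allIn (F α ∪ F β) I).indicator 1 d.2) ℒ := fun α β =>
    integrable_mul_allIn (hfi α β) _ hI
  calc ∫ d, (c * ∑ α ∈ s, E α d.1 * G α d) ^ 2 ∂ℒ
      ≤ ∫ d, c ^ 2 * ∑ α ∈ s, ∑ β ∈ s, f α β d.1 * (allIn (F α ∪ F β) I).indicator 1 d.2 ∂ℒ :=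
        integral_mono_of_nonneg (ae_of_all _ fun d => sq_nonneg _)
          ((integrable_finsetSum _ fun α _ => integrable_finsetSum _ fun β _ => hInt α β).const_mul _)
          (ae_of_all _ hpt)
    _ = c ^ 2 * ∑ α ∈ s, ∑ β ∈ s, (∫ y, f α β y ∂ℬ) * PT.real I ^ (F α ∪ F β).card := by
        rw [integral_const_mul, integral_finsetSum _ fun α _ => integrable_finsetSum _ fun β _ => hInt α β]
        congr 1
        refine sum_congr rfl fun α _ => ?_
        rw [integral_finsetSum _ fun β _ => hInt α β]
        exact sum_congr rfl fun β _ => integral_mul_allIn _ hI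
    _ ≤ c ^ 2 * ∑ α ∈ s, ∑ β ∈ s, M * PT.real I ^ (F α ∪ F β).card := by
        gcongr with α _ β _
        exact hfM α β
    _ = _ := by simp only [← mul_sum]; ring

lemma sum_card_union_singleton_le {t : ℝ} (ht : 0 ≤ t) {N : ℕ} (hN : 1 ≤ N) :
    (1 / (N : ℝ)) ^ 2 * ∑ j ∈ range N, ∑ k ∈ range N,
      t ^ (({j} : Finset ℕ) ∪ {k}).card ≤ t ^ 2 + t / N := by
  have hN0 : (0 : ℝ) < N := by exact_mod_cast hN
  have h1 : ∀ j ∈ range N, ∑ k ∈ range N, t ^ (({j} : Finset ℕ) ∪ {k}).card ≤ N * t ^ 2 + t := by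
    intro j hj
    calc ∑ k ∈ range N, t ^ (({j} : Finset ℕ) ∪ {k}).card
        ≤ ∑ k ∈ range N, (t ^ 2 + if j = k then t else 0) := by
          refine sum_le_sum fun k _ => ?_
          by_cases h : j = k
          · subst h; simp; positivity
          · have : (({j} : Finset ℕ) ∪ {k}).card = 2 := card_pair h
            simp [this, h]
      _ = N * t ^ 2 + t := by
          rw [sum_add_distrib, sum_const, card_range, nsmul_eq_mul, sum_ite_eq, if_pos hj]
  calc (1 / (N : ℝ)) ^ 2 * ∑ j ∈ range N, ∑ k ∈ range N,
      t ^ (({j} : Finset ℕ) ∪ {k}).card ≤ (1 / (N : ℝ)) ^ 2 * ∑ j ∈ range N, (N * t ^ 2 + t) := by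
        gcongr with j hj; exact h1 j hj
    _ = _ := by
        rw [sum_const, card_range, nsmul_eq_mul]
        field_simp

/-! ### The envelope for the mean estimator -/

/-- Observation time and covariate of the `j`-th observation. -/
def timeCov (j : ℕ) (d : Subj S p) : ℝ^(p + 1) := Fin.cons (d.2 j) d.1.2.1

lemma measurable_timeCov (j : ℕ) : Measurable (timeCov j : Subj S p → ℝ^(p + 1)) := by
  refine measurable_pi_lambda _ fun k => ?_
  refine Fin.cases ?_ (fun k => ?_) k
  · simp only [timeCov, Fin.cons_zero]; fun_prop
  · simp only [timeCov, Fin.cons_succ]; fun_prop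

lemma indicator_box_timeCov (l r : ℝ^(p + 1)) (j : ℕ) (d : Subj S p) :
    (box l r).indicator (1 : ℝ^(p + 1) → ℝ) (timeCov j d) =
      (box (fun k => l k.succ) fun k => r k.succ).indicator 1 d.1.2.1 *
        (allIn {j} (Ico (l 0) (r 0))).indicator 1 d.2 := by
  have h : timeCov j d ∈ box l r ↔ d.1.2.1 ∈ box (fun k => l k.succ) (fun k => r k.succ) ∧
      d.2 ∈ allIn {j} (Ico (l 0) (r 0)) := by
    simp only [box, allIn, Set.mem_pi, mem_univ, true_imp_iff, Fin.forall_fin_succ, timeCov,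
      Fin.cons_zero, Fin.cons_succ, Finset.coe_singleton, mem_singleton_iff, forall_eq]
    tauto
  by_cases h1 : d.1.2.1 ∈ box (fun k => l k.succ) (fun k => r k.succ) <;>
  by_cases h2 : d.2 ∈ allIn {j} (Ico (l 0) (r 0)) <;>
  simp [indicator, h, h1, h2]

/-- The variance proxy of the mean estimator. -/
def meanB (N : ℕ → ℕ → ℕ) (ht : ℕ → ℝ) (hzv : ℕ → ℝ^p) (n : ℕ) : ℝ :=
  ht n ^ 2 * (∏ k, hzv n k) + ht n * (∏ k, hzv n k) / gam N 1 n

/-- The dominating function for the tails of the envelope. -/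
def tailDom (mm : S → ℝ^p → ℝ) (q : ℝ) (d : Subj S p) : ENNReal := ofReal (mm d.1.1 d.1.2.1 ^ q) +
    ∑' j : ℕ, ofReal (|d.1.2.2 j| ^ q * ((j : ℝ) + 1) ^ (-q))

lemma SubjModel.measurable_mm_rpow (H : ℳ q) :
    Measurable fun d : Subj S p => ofReal (mm d.1.1 d.1.2.1 ^ q) :=
  ((H.measurable_mm.comp (by fun_prop : Measurable fun d : Subj S p => (d.1.1, d.1.2.1))).pow_const
    q).ennreal_ofReal

lemma SubjModel.measurable_tailDom (H : ℳ q) : Measurable (tailDom mm q) :=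
  H.measurable_mm_rpow.add (Measurable.tsum fun j => by fun_prop)

lemma SubjModel.lintegral_rpow_le (H : ℳ q) (hq : 0 ≤ q) :
    ∃ C : NNReal, ∀ j, ∫⁻ d, ofReal (env mm j d.1 ^ q) ∂ℒ ≤ C := by
  obtain ⟨C, hC⟩ := H.lintegral_env_rpow_le hq
  refine ⟨C, fun j => ?_⟩
  have h := hC j univ MeasurableSet.univ
  rw [measurePreserving_fst_subjLaw.lintegral_comp
    (f := fun y => ofReal (env mm j y ^ q)) ((H.measurable_env j).pow_const q).ennreal_ofReal]
  simpa using h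

lemma SubjModel.lintegral_mm_rpow_ne_top (H : ℳ q) (hq : 0 ≤ q) :
    ∫⁻ d : Subj S p, ofReal (mm d.1.1 d.1.2.1 ^ q) ∂ℒ ≠ ⊤ := by
  obtain ⟨C, hC⟩ := H.lintegral_rpow_le (PT := PT) hq
  refine ne_top_of_le_ne_top coe_ne_top ((lintegral_mono fun d => ofReal_le_ofReal (rpow_le_rpow
    (zero_le_one.trans (H.one_le_mm _ _)) ?_ hq)).trans (hC 0))
  simp only [env]; linarith [abs_nonneg (d.1.2.2 0)]

lemma SubjModel.lintegral_tailDom (H : ℳ q) (hq : 1 < q) : ∫⁻ d, tailDom mm q d ∂ℒ ≠ ⊤ := by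
  have hq0 : 0 ≤ q := by linarith
  obtain ⟨C, hC⟩ := H.lintegral_rpow_le (PT := PT) hq0
  unfold tailDom
  rw [lintegral_add_left H.measurable_mm_rpow]
  refine add_ne_top.2 ⟨H.lintegral_mm_rpow_ne_top hq0, ?_⟩
  rw [lintegral_tsum fun j => by fun_prop]
  have h1 : ∀ j : ℕ, ∫⁻ d, ofReal (|d.1.2.2 j| ^ q * ((j : ℝ) + 1) ^ (-q))
      ∂ℒ ≤ C * ofReal (((j : ℝ) + 1) ^ (-q)) := by
    intro j
    calc ∫⁻ d, ofReal (|d.1.2.2 j| ^ q * ((j : ℝ) + 1) ^ (-q)) ∂ℒ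
        ≤ ∫⁻ d, ofReal (env mm j d.1 ^ q) * ofReal (((j : ℝ) + 1) ^ (-q)) ∂ℒ := by
          refine lintegral_mono fun d => ?_
          rw [← ofReal_mul (rpow_nonneg (H.env_nonneg _ _) _)]
          refine ofReal_le_ofReal (mul_le_mul_of_nonneg_right
            (rpow_le_rpow (abs_nonneg _) ?_ hq0) (by positivity))
          simp only [env]; linarith [H.one_le_mm d.1.1 d.1.2.1]
      _ ≤ _ := by
          have hm : Measurable fun d : Subj S p => ofReal (env mm j d.1 ^ q) :=
            (((H.measurable_env j).comp measurable_fst).pow_const q).ennreal_ofReal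
          rw [lintegral_mul_const _ hm]
          gcongr
          exact hC j
  refine ne_top_of_le_ne_top ?_ (tsum_le_tsum h1)
  rw [ENNReal.tsum_mul_left]
  refine mul_ne_top coe_ne_top ?_
  have h2 : Summable fun j : ℕ => ((j : ℝ) + 1) ^ (-q) := by
    have := (summable_nat_add_iff 1).2 (Real.summable_nat_rpow.2 (by linarith : -q < -1))
    simpa using this
  rw [← ENNReal.ofReal_tsum_of_nonneg (fun j => by positivity) h2]
  exact ofReal_ne_top

lemma tail_env_le (hmm : ∀ θ z, 1 ≤ mm θ z) {a : ℝ} (ha : 0 < a) (hq : 1 ≤ q) {N j : ℕ}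
    (hj : j < N) (d : Subj S p) :
    (N : ℝ)⁻¹ * tailW (2 * a) (fun j (d : Subj S p) => env mm j d.1) (fun j d => env mm j d.1) j d ≤
      (N : ℝ)⁻¹ * (2 * (a ^ (1 - q) * mm d.1.1 d.1.2.1 ^ q)) + 2 * ((N : ℝ)⁻¹ * midErr a N (d.1.2.2 j)) +
        2 * a ^ (1 - q) * (|d.1.2.2 j| ^ q * ((j : ℝ) + 1) ^ (-q)) := by
  have hN0 : (0 : ℝ) < N := by exact_mod_cast (by omega : 0 < N)
  set m := mm d.1.1 d.1.2.1 with hm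
  set e := |d.1.2.2 j| with he
  have hm1 : 1 ≤ m := hmm _ _
  have he0 : 0 ≤ e := abs_nonneg _
  have hm' : 0 ≤ a ^ (1 - q) * m ^ q := by positivity
  have hme := midErr_nonneg a N (d.1.2.2 j)
  have hlast : 0 ≤ a ^ (1 - q) * (e ^ q * ((j : ℝ) + 1) ^ (-q)) := by positivity
  unfold tailW
  split_ifs with h
  · simp only [env] at h ⊢
    rw [← hm, ← he] at h ⊢
    have key : (N : ℝ)⁻¹ * e ≤ (N : ℝ)⁻¹ * midErr a N (d.1.2.2 j) +
        a ^ (1 - q) * (e ^ q * ((j : ℝ) + 1) ^ (-q)) ∨ e ≤ a := by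
      by_cases h1 : a < e
      · left
        by_cases h2 : e ≤ N * a
        · rw [midErr, if_pos ⟨h1, h2⟩]; linarith
        · push Not at h2
          have h3 := le_rpow_mul_of_lt (by positivity) h2 hq
          have h4 : (N : ℝ)⁻¹ * ((N * a) ^ (1 - q) * e ^ q) ≤
              a ^ (1 - q) * (e ^ q * ((j : ℝ) + 1) ^ (-q)) := by
            rw [Real.mul_rpow hN0.le ha.le]
            have h5 : (N : ℝ)⁻¹ * (N : ℝ) ^ (1 - q) = (N : ℝ) ^ (-q) := by
              rw [← rpow_neg_one, ← rpow_add hN0]; congr 1; ring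
            calc (N : ℝ)⁻¹ * ((N : ℝ) ^ (1 - q) * a ^ (1 - q) * e ^ q)
                = a ^ (1 - q) * (e ^ q * ((N : ℝ)⁻¹ * (N : ℝ) ^ (1 - q))) := by ring
              _ = a ^ (1 - q) * (e ^ q * (N : ℝ) ^ (-q)) := by rw [h5]
              _ ≤ _ := by
                refine mul_le_mul_of_nonneg_left (mul_le_mul_of_nonneg_left ?_ (by positivity))
                  (by positivity)
                exact Real.rpow_le_rpow_of_nonpos (by positivity) (by exact_mod_cast hj) (by linarith)
          have h6 := mul_le_mul_of_nonneg_left h3 (by positivity : (0 : ℝ) ≤ (N : ℝ)⁻¹)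
          have : 0 ≤ (N : ℝ)⁻¹ * midErr a N (d.1.2.2 j) := by positivity
          linarith
      · right; exact not_lt.1 h1
    have hp : 0 ≤ (N : ℝ)⁻¹ * midErr a N (d.1.2.2 j) := by positivity
    rcases le_total m e with hme' | hme'
    · rcases key with k | k
      · have : (N : ℝ)⁻¹ * m ≤ (N : ℝ)⁻¹ * e := by gcongr
        have h7 : 0 ≤ (N : ℝ)⁻¹ * (2 * (a ^ (1 - q) * m ^ q)) := by positivity
        rw [mul_add]; linarith
      · linarith
    · have h1 : a < m := by linarith
      have h2 := le_rpow_mul_of_lt ha h1 hq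
      have h3 : (N : ℝ)⁻¹ * (m + e) ≤ (N : ℝ)⁻¹ * (2 * (a ^ (1 - q) * m ^ q)) := by gcongr; linarith
      linarith
  · rw [mul_zero]; positivity

variable {N : ℕ → ℕ → ℕ} {ht hz hG : ℕ → ℝ} {hzv : ℕ → ℝ^p} {L : ℝ}

section Mean

variable {D : ℕ → Ω → Subj S p}

lemma meanB_eq (n : ℕ) : meanB N ht hzv n = (∏ k, hzv n k) * (ht n ^ 2 + ht n * invGam N 1 n) := by
  rw [meanB, gam_eq_inv, div_inv_eq_mul]; ring

lemma MeanBandwidth.hzv_tendsto (hB : MeanBandwidth N ht hz hzv q) (k : Fin p) :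
    Tendsto (fun n => hzv n k) atTop (𝓝 0) :=
  (hB.same_order k).isBigO.trans_tendsto hB.hz_tendsto

lemma MeanBandwidth.meanB_pos (hB : MeanBandwidth N ht hz hzv q) (n : ℕ) : 0 < meanB N ht hzv n := by
  rw [meanB_eq]
  have h1 : 0 < ∏ k, hzv n k := prod_pos fun k _ => hB.hzv_pos n k
  have h2 := hB.ht_pos n
  have h3 := invGam_nonneg N 1 n
  positivity

lemma MeanBandwidth.eventually_le_one (hB : MeanBandwidth N ht hz hzv q) :
    ∀ᶠ n in atTop, ht n ≤ 1 ∧ ∀ k, hzv n k ≤ 1 :=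
  (hB.ht_tendsto.eventually_le_const one_pos).and
    (eventually_all.2 fun k => (hB.hzv_tendsto k).eventually_le_const one_pos)

lemma MeanBandwidth.eventually_meanB_le (hB : MeanBandwidth N ht hz hzv q)
    (hN : ∀ n i, 2 ≤ N n i) : ∀ᶠ n in atTop, meanB N ht hzv n ≤ 2 * (ht n * ∏ k, hzv n k) ∧
      meanB N ht hzv n ≤ 2 * ht n ∧ ∀ k, meanB N ht hzv n ≤ 2 * hzv n k := by
  filter_upwards [hB.eventually_le_one] with n ⟨h1, h2⟩
  have hp : 0 < ∏ k, hzv n k := prod_pos fun k _ => hB.hzv_pos n k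
  have ht0 := hB.ht_pos n
  have hg1 := invGam_le_one hN 1 n
  have hg0 := invGam_nonneg N 1 n
  have hle : ∀ s : Finset (Fin p), ∏ k ∈ s, hzv n k ≤ 1 := fun s =>
    Finset.prod_le_one (fun k _ => (hB.hzv_pos n k).le) fun k _ => h2 k
  have h3 : ht n ^ 2 + ht n * invGam N 1 n ≤ 2 * ht n := by nlinarith
  have h4 : meanB N ht hzv n ≤ 2 * (ht n * ∏ k, hzv n k) := by
    rw [meanB_eq]
    calc _ ≤ (∏ k, hzv n k) * (2 * ht n) := by gcongr
      _ = _ := by ring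
  have h5 := hle Finset.univ
  refine ⟨h4, by nlinarith, fun k => ?_⟩
  have h6 : ∏ k, hzv n k ≤ hzv n k := by
    rw [← Finset.mul_prod_erase _ _ (Finset.mem_univ k)]
    exact mul_le_of_le_one_right (hB.hzv_pos n k).le (hle _)
  nlinarith

lemma isEnvelope_mean (hD : IsIID P D ℒ) (H : ℳ q) (hq : 2 < q)
    (hN : ∀ n i, 2 ≤ N n i) (hB : MeanBandwidth N ht hz hzv q) :
    IsEnvelope P ℒ D (fun n i => range (N n i))
      (fun n i => 1 / (N n i : ℝ)) timeCov (fun _ _ j d => env mm j d.1)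
      (fun n => Fin.cons (ht n) (hzv n)) (meanB N ht hzv) := by
  have hN0 : ∀ n i, (0 : ℝ) < N n i := fun n i => by have := hN n i; positivity
  have hc1 : ∀ n i, 1 / (N n i : ℝ) * (range (N n i)).card = 1 := fun n i => by
    rw [card_range, one_div_mul_cancel (hN0 n i).ne']
  have hb := hB.meanB_pos
  have hEm : ∀ j, Measurable fun d : Subj S p => env mm j d.1 := fun j =>
    (H.measurable_env j).comp measurable_fst
  have hrate : IsRate (meanB N ht hzv) q := hB.rate
  obtain ⟨CT, hCT0, hCT⟩ := H.exists_PT_real_Ico_le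
  obtain ⟨CZ, hCZ0, hCZ⟩ := H.exists_PZ_real_box_le
  refine ⟨hD, fun n i => by positivity, fun n i => (hc1 n i).le, measurable_timeCov,
    fun _ _ j => hEm j, fun _ _ j d => H.env_nonneg j d.1, fun n i j => ?_, hb, fun n k => ?_,
    fun k => ?_, ?_, eventually_one_div_le_rateX hb hq hrate, ?_, ?_, ?_, ?_⟩
  · rw [memLp_two_iff_integrable_sq (hEm j).aestronglyMeasurable]
    exact measurePreserving_fst_subjLaw.integrable_comp_of_integrable
      (H.integrable_env_pow (k := 2) (by push_cast; linarith) j)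
  · exact Fin.cases (hB.ht_pos n) (hB.hzv_pos n) k
  · exact Fin.cases hB.ht_tendsto hB.hzv_tendsto k
  · filter_upwards [hB.eventually_meanB_le hN, eventually_one_div_sq_le_of_rate hb hq hrate]
      with n ⟨_, h1, h2⟩ h3 k
    have h4 : 3 / (n : ℝ) ^ 2 = 3 * (1 / (n : ℝ) ^ 2) := by ring
    have h5 : 0 ≤ 1 / (n : ℝ) ^ 2 := by positivity
    refine Fin.cases ?_ (fun k => ?_) k <;> simp only [Fin.cons_zero, Fin.cons_succ]
    · linarith
    · linarith [h2 k]
  · obtain ⟨C2, hC20, hC2⟩ := H.integral_env_pow_mul_le (k := 2) (by push_cast; linarith)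
    refine ⟨fun n i => C2 * (CZ * ∏ k, (4 * hzv n k)) *
      ((CT * (4 * ht n)) ^ 2 + CT * (4 * ht n) / N n i), C2 * CZ * 4 ^ p * (16 * CT ^ 2 + 4 * CT),
      fun n i => ?_, fun n i l r hlr => ?_, ?_⟩
    · have h1 : 0 ≤ ∏ k, (4 * hzv n k) := prod_nonneg fun k _ => by have := hB.hzv_pos n k; positivity
      have := (hB.ht_pos n).le
      positivity
    · set B := box (fun k : Fin p => l k.succ) fun k => r k.succ with hBdef
      have hBm : MeasurableSet B := measurableSet_box _ _
      have hPZ : PZ.real B ≤ CZ * ∏ k, (4 * hzv n k) := by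
        refine (hCZ _ _).trans ?_
        gcongr with k
        exact max_le (by simpa using hlr k.succ) (by have := hB.hzv_pos n k; positivity)
      have hPT : PT.real (Ico (l 0) (r 0)) ≤ CT * (4 * ht n) := by
        refine (hCT _ _).trans ?_
        gcongr
        exact max_le (by simpa using hlr 0) (by have := hB.ht_pos n; positivity)
      refine (integral_sum_sq_le (PT := PT) (1 / (N n i : ℝ)) (range (N n i))
        (E := env mm) (fun j y => H.env_nonneg j y)
        (fun j => H.integrable_env_pow (k := 2) (by push_cast; linarith) j) hBm
        (fun j => (hC2 j B hBm).trans (mul_le_mul_of_nonneg_left hPZ hC20)) (fun j => {j})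
        (I := Ico (l 0) (r 0)) measurableSet_Ico
        (G := fun j d => (box l r).indicator 1 (timeCov j d))
        (fun j d => indicator_nonneg (fun _ _ => zero_le_one) _)
        (fun j d => (indicator_box_timeCov l r j d).le)).trans ?_
      have hp : 0 ≤ ∏ k, (4 * hzv n k) := prod_nonneg fun k _ => by have := hB.hzv_pos n k; positivity
      refine mul_le_mul_of_nonneg_left ?_ (by positivity)
      refine (sum_card_union_singleton_le measureReal_nonneg (by have := hN n i; omega)).trans ?_
      have := measureReal_nonneg (μ := PT) (s := Ico (l 0) (r 0))
      gcongr
    · refine Eventually.of_forall fun n => ?_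
      have hp : 0 < ∏ k, hzv n k := prod_pos fun k _ => hB.hzv_pos n k
      have ht0 := hB.ht_pos n
      have hg0 := invGam_nonneg N 1 n
      rw [← mul_sum, sum_add_distrib, sum_const, card_range,
        nsmul_eq_mul, prod_mul_distrib, prod_const, card_univ, Fintype.card_fin,
        meanB_eq]
      have e : ∑ i ∈ range n, CT * (4 * ht n) / N n i = CT * (4 * ht n) * (n * invGam N 1 n) := by
        rw [← sum_inv_eq, mul_sum]
        exact sum_congr rfl fun i _ => by rw [pow_one, div_eq_mul_inv]
      rw [e]
      have : 0 ≤ C2 * CZ * 4 ^ p * (n * ∏ k, hzv n k) *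
        (4 * CT * ht n ^ 2 + 16 * CT ^ 2 * (ht n * invGam N 1 n)) := by positivity
      linarith
  · obtain ⟨C1, hC10, hC1⟩ := H.integral_env_pow_mul_le (k := 1) (by push_cast; linarith)
    refine ⟨C1 * CZ * CT, by positivity, fun n i l r hlr => ?_⟩
    set B := box (fun k : Fin p => l k.succ) fun k => r k.succ with hBdef
    have hBm : MeasurableSet B := measurableSet_box _ _
    have hBm' : Measurable fun y : Base S p =>
      B.indicator (1 : ℝ^p → ℝ) y.2.1 := (measurable_const.indicator hBm).comp (by fun_prop)
    have hEBi : ∀ j, Integrable (fun y => env mm j y * B.indicator 1 y.2.1) ℬ := by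
      intro j
      have h1 := H.integrable_env_pow (k := 1) (by push_cast; linarith) j
      simp only [pow_one] at h1
      refine h1.mul_bdd (c := 1) hBm'.aestronglyMeasurable (ae_of_all _ fun y => ?_)
      by_cases hy : y.2.1 ∈ B <;> simp [hy]
    have hj : ∀ j, ∫ d, env mm j d.1 * (box l r).indicator 1 (timeCov j d) ∂ℒ
        ≤ C1 * CZ * CT * ∏ k, (r k - l k) := by
      intro j
      have e1 : ∀ d : Subj S p, env mm j d.1 * (box l r).indicator (1 : ℝ^(p + 1) → ℝ) (timeCov j d) =
          (fun y : Base S p => env mm j y * B.indicator 1 y.2.1) d.1 *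
            (allIn {j} (Ico (l 0) (r 0))).indicator 1 d.2 := fun d => by
        rw [indicator_box_timeCov]; ring
      rw [integral_congr_ae (ae_of_all _ e1), integral_mul_allIn
        (f := fun y : Base S p => env mm j y * B.indicator 1 y.2.1) _ measurableSet_Ico,
        Finset.card_singleton, pow_one, Fin.prod_univ_succ]
      have h1 := hC1 j B hBm
      simp only [pow_one] at h1
      have h2 := hCZ (fun k => l k.succ) fun k => r k.succ
      have h3 := hCT (l 0) (r 0)
      rw [max_eq_left (sub_nonneg.2 (hlr 0))] at h3
      rw [prod_congr rfl fun k _ => max_eq_left (sub_nonneg.2 (hlr k.succ))] at h2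
      have hp : 0 ≤ ∏ k : Fin p, (r k.succ - l k.succ) := prod_nonneg fun k _ => sub_nonneg.2 (hlr k.succ)
      calc _ ≤ C1 * (CZ * ∏ k : Fin p, (r k.succ - l k.succ)) * (CT * (r 0 - l 0)) := by
            refine mul_le_mul (h1.trans ?_) h3 measureReal_nonneg (by positivity)
            exact mul_le_mul_of_nonneg_left h2 hC10
        _ = _ := by ring
    unfold smp
    rw [integral_const_mul, integral_finsetSum]
    · exact mul_sum_le_of_card (by positivity) (hc1 n i) fun j _ => hj j
    · intro j _
      refine (integrable_mul_allIn (hEBi j) {j} (I := Ico (l 0) (r 0)) measurableSet_Ico).congr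
        (ae_of_all _ fun d => ?_)
      simp only
      rw [indicator_box_timeCov]; ring
  · have hme : Measurable fun d : Subj S p => d.1.2.2 := by fun_prop
    obtain ⟨C1, hC10, h1⟩ := ae_sum_midErr_le (D := fun i ω => (D i ω).1.2.2) (P := P)
      ⟨fun i => hme.comp (hD.measurable i), hD.indep.comp _ fun i => hme, fun i => by
        rw [← map_errors_subjLaw (Pθ := Pθ) (PZ := PZ) (PT := PT), ← hD.law i, Measure.map_map
          (by fun_prop) (hD.measurable i)]; rfl⟩ hq H.moment_e hb hrate hN
    have h2 := ae_exists_sum_toReal_le hD H.measurable_tailDom (H.lintegral_tailDom (by linarith))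
    filter_upwards [h1, h2] with ω h1 ⟨hfin, C2, hC2, h2⟩
    refine ⟨2 * C1 + 2 * 2 ^ (q - 1) * C2, ?_⟩
    filter_upwards [h1, h2, eventually_rateQ_rpow_le hb hq hrate, eventually_ge_atTop 2] with n h1 h2 h3 hn
    have hQp := rateQ_pos hb hn
    set a := rateQ (meanB N ht hzv) n / 2 with ha
    have ha0 : 0 < a := by positivity
    have ha2 : rateQ (meanB N ht hzv) n = 2 * a := by rw [ha]; ring
    have haq : a ^ (1 - q) = 2 ^ (q - 1) * rateQ (meanB N ht hzv) n ^ (1 - q) := by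
      rw [ha, Real.div_rpow hQp.le (by norm_num), show (1 - q) = -(q - 1) by ring,
        Real.rpow_neg (by norm_num : (0 : ℝ) ≤ 2)]
      field_simp
    have hi : ∀ i, smp (range (N n i)) (1 / (N n i : ℝ)) timeCov
        (tailW (rateQ (meanB N ht hzv) n) (fun j d => env mm j d.1) fun j d => env mm j d.1) 1 (D i ω)
        ≤ 2 * ((N n i : ℝ)⁻¹ * ∑ j ∈ range (N n i), midErr a (N n i) ((D i ω).1.2.2 j)) +
          2 * a ^ (1 - q) * (tailDom mm q (D i ω)).toReal := by
      intro i
      have hA := (hN0 n i)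
      have hsum : ofReal (mm (D i ω).1.1 (D i ω).1.2.1 ^ q +
          ∑ j ∈ range (N n i), |(D i ω).1.2.2 j| ^ q * ((j : ℝ) + 1) ^ (-q)) ≤
          tailDom mm q (D i ω) := by
        rw [ofReal_add (rpow_nonneg (zero_le_one.trans (H.one_le_mm _ _)) _)
          (sum_nonneg fun j _ => by positivity),
          ENNReal.ofReal_sum_of_nonneg fun j _ => by positivity]
        unfold tailDom
        gcongr
        exact ENNReal.sum_le_tsum _
      have hsum' := (ENNReal.ofReal_le_iff_le_toReal (hfin i)).1 hsum
      unfold smp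
      simp only [Pi.one_apply, mul_one, one_div, ha2]
      rw [mul_sum]
      calc _ ≤ ∑ j ∈ range (N n i), ((N n i : ℝ)⁻¹ * (2 * (a ^ (1 - q) *
            mm (D i ω).1.1 (D i ω).1.2.1 ^ q)) +
            2 * ((N n i : ℝ)⁻¹ * midErr a (N n i) ((D i ω).1.2.2 j)) +
            2 * a ^ (1 - q) * (|(D i ω).1.2.2 j| ^ q * ((j : ℝ) + 1) ^ (-q))) :=
            sum_le_sum fun j hj => tail_env_le H.one_le_mm ha0 (by linarith) (Finset.mem_range.1 hj) _
        _ = 2 * ((N n i : ℝ)⁻¹ * ∑ j ∈ range (N n i), midErr a (N n i) ((D i ω).1.2.2 j)) +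
            2 * a ^ (1 - q) * (mm (D i ω).1.1 (D i ω).1.2.1 ^ q +
              ∑ j ∈ range (N n i), |(D i ω).1.2.2 j| ^ q * ((j : ℝ) + 1) ^ (-q)) := by
            rw [sum_add_distrib, sum_add_distrib, sum_const, card_range,
              nsmul_eq_mul, ← mul_sum, ← mul_sum, ← mul_sum]
            field_simp
            ring
        _ ≤ _ := by gcongr
    calc _ ≤ ∑ i ∈ range n, (2 * ((N n i : ℝ)⁻¹ *
            ∑ j ∈ range (N n i), midErr a (N n i) ((D i ω).1.2.2 j)) +
          2 * a ^ (1 - q) * (tailDom mm q (D i ω)).toReal) := sum_le_sum fun i _ => hi i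
      _ = 2 * (∑ i ∈ range n, (N n i : ℝ)⁻¹ * ∑ j ∈ range (N n i), midErr a (N n i) ((D i ω).1.2.2 j)) +
          2 * a ^ (1 - q) * ∑ i ∈ range n, (tailDom mm q (D i ω)).toReal := by
          rw [sum_add_distrib, ← mul_sum, ← mul_sum]
      _ ≤ 2 * (C1 * (n * rateX (meanB N ht hzv) n)) +
          2 * (2 ^ (q - 1) * rateX (meanB N ht hzv) n) * (C2 * n) := by
          have := rateX_nonneg (meanB N ht hzv) n
          rw [haq]
          gcongr
      _ = _ := by ring
  · obtain ⟨C, hC⟩ := H.lintegral_rpow_le (PT := PT) (by linarith : 0 ≤ q)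
    refine ⟨C, C.2, ?_⟩
    filter_upwards [eventually_rateQ_rpow_le hb hq hrate, eventually_ge_atTop 2] with n h3 hn i
    have hQp := rateQ_pos hb hn
    have hRi : ∀ j, Integrable (fun d : Subj S p => env mm j d.1 ^ q) ℒ := fun j =>
      measurePreserving_fst_subjLaw.integrable_comp_of_integrable (H.integrable_env_rpow (by linarith) j)
    have hR : ∀ j, ∫ d, env mm j d.1 ^ q ∂ℒ ≤ C := by
      intro j
      rw [integral_eq_lintegral_of_nonneg_ae (f := fun d : Subj S p => env mm j d.1 ^ q)
        (ae_of_all _ fun d => rpow_nonneg (H.env_nonneg j d.1) q) (hRi j).1]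
      exact toReal_mono coe_ne_top (hC j)
    calc _ ≤ ∫ d, 1 / (N n i : ℝ) * ∑ j ∈ range (N n i),
          rateQ (meanB N ht hzv) n ^ (1 - q) * env mm j d.1 ^ q ∂ℒ := by
          refine integral_mono_of_nonneg (ae_of_all _ fun d => ?_)
            ((integrable_finsetSum _ fun j _ => (hRi j).const_mul _).const_mul _)
            (ae_of_all _ fun d => ?_)
          · exact smp_nonneg (by positivity) (fun j _ => tailW_nonneg
              (fun j d => H.env_nonneg j d.1) j d) fun _ => zero_le_one
          · simp only [smp, Pi.one_apply, mul_one]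
            gcongr with j _
            exact tailW_le_rpow (q := q) hQp (by linarith) (fun j d => H.env_nonneg j d.1) j d
      _ = 1 / (N n i : ℝ) * ∑ j ∈ range (N n i),
          rateQ (meanB N ht hzv) n ^ (1 - q) * ∫ d, env mm j d.1 ^ q ∂ℒ := by
          rw [integral_const_mul, integral_finsetSum _ fun j _ => (hRi j).const_mul _]
          simp only [integral_const_mul]
      _ ≤ rateX (meanB N ht hzv) n * C := mul_sum_le_of_card (by positivity) (hc1 n i) fun j _ =>
          mul_le_mul h3 (hR j) (integral_nonneg fun d => rpow_nonneg (H.env_nonneg j d.1) q)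
            (rateX_nonneg _ n)
      _ = _ := by ring

end Mean

/-! ### The envelope for the covariance estimator -/

lemma offDiag_subset_product (N : ℕ) : (range N).offDiag ⊆ range N ×ˢ range N := fun α hα =>
  mem_product.2 ⟨(Finset.mem_offDiag.1 hα).1, (Finset.mem_offDiag.1 hα).2.1⟩

lemma card_offDiag_range (N : ℕ) : ((range N).offDiag.card : ℝ) = N * ((N : ℝ) - 1) := by
  rw [Finset.offDiag_card, card_range, Nat.cast_sub (Nat.le_mul_self N)]
  push_cast; ring

lemma sum_card_union_pair_le {t : ℝ} (ht : 0 ≤ t) {N : ℕ} (hN : 2 ≤ N) :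
    (1 / ((N : ℝ) * ((N : ℝ) - 1))) ^ 2 * ∑ α ∈ (range N).offDiag,
      ∑ β ∈ (range N).offDiag, t ^ (({α.1, α.2} : Finset ℕ) ∪ {β.1, β.2}).card ≤
      8 * (t ^ 4 + t ^ 3 / N + t ^ 2 / (N : ℝ) ^ 2) := by
  have hN2 : (2 : ℝ) ≤ N := by exact_mod_cast hN
  have hN1 : (0 : ℝ) < (N : ℝ) - 1 := by linarith
  set δ : ℕ → ℕ → ℝ := fun j k => if j = k then 1 else 0 with hδ
  have hδ0 : ∀ j k, 0 ≤ δ j k := fun j k => by simp only [hδ]; split_ifs <;> norm_num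
  have t2 := pow_nonneg ht 2
  have t3 := pow_nonneg ht 3
  have t4 := pow_nonneg ht 4
  set g : ℕ × ℕ → ℕ × ℕ → ℝ := fun α β => t ^ 4 + t ^ 3 * (δ α.1 β.1 + δ α.1 β.2 + δ α.2 β.1 + δ α.2 β.2) +
    t ^ 2 * (δ α.1 β.1 * δ α.2 β.2 + δ α.1 β.2 * δ α.2 β.1) with hg
  have hg0 : ∀ α β, 0 ≤ g α β := fun α β => by
    have := hδ0 α.1 β.1; have := hδ0 α.1 β.2; have := hδ0 α.2 β.1; have := hδ0 α.2 β.2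
    simp only [hg]; positivity
  have h1 : ∀ α ∈ (range N).offDiag, ∀ β ∈ (range N).offDiag,
      t ^ (({α.1, α.2} : Finset ℕ) ∪ {β.1, β.2}).card ≤ g α β := by
    rintro ⟨j, k⟩ hα ⟨j', k'⟩ hβ
    have hjk : j ≠ k := (Finset.mem_offDiag.1 hα).2.2
    have hjk' : j' ≠ k' := (Finset.mem_offDiag.1 hβ).2.2
    clear hα hβ
    simp only [hg, hδ]
    by_cases a1 : j = j' <;> by_cases a2 : j = k' <;> by_cases a3 : k = j' <;>
      by_cases a4 : k = k' <;> first
      | omega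
      | simp [*, card_insert_of_notMem, Ne.symm, Finset.insert_union, eq_comm] <;> nlinarith
  have h2 : ∀ α ∈ (range N).offDiag, ∑ β ∈ (range N).offDiag,
      t ^ (({α.1, α.2} : Finset ℕ) ∪ {β.1, β.2}).card ≤ N ^ 2 * t ^ 4 + 4 * N * t ^ 3 + 2 * t ^ 2 := by
    intro α hα
    have e : ∀ j ∈ range N, ∑ k ∈ range N, δ j k = 1 := fun j hj => by
      simp only [hδ]; rw [sum_ite_eq, if_pos hj]
    refine (sum_le_sum fun β hβ => h1 α hα β hβ).trans ((Finset.sum_le_sum_of_subset_of_nonneg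
      (offDiag_subset_product N) fun β _ _ => hg0 α β).trans (le_of_eq ?_))
    rw [Finset.sum_product]
    simp only [hg, sum_add_distrib, ← mul_sum, ← sum_mul, e _ (Finset.mem_offDiag.1 hα).1,
      e _ (Finset.mem_offDiag.1 hα).2.1, sum_const, card_range, nsmul_eq_mul, mul_one, one_mul]
    ring
  calc _ ≤ (1 / ((N : ℝ) * ((N : ℝ) - 1))) ^ 2 * ∑ α ∈ (range N).offDiag,
        ((N : ℝ) ^ 2 * t ^ 4 + 4 * N * t ^ 3 + 2 * t ^ 2) := by gcongr with α hα; exact h2 α hα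
    _ = (N / (N - 1)) * t ^ 4 + 4 * t ^ 3 / (N - 1) + 2 * t ^ 2 / (N * (N - 1)) := by
        rw [sum_const, nsmul_eq_mul, card_offDiag_range]
        field_simp
    _ ≤ 8 * t ^ 4 + 8 * t ^ 3 / N + 8 * t ^ 2 / (N : ℝ) ^ 2 := by
        have a1 : (N : ℝ) / (N - 1) ≤ 8 := by rw [div_le_iff₀ hN1]; linarith
        have a2 : 4 * t ^ 3 / (N - 1) ≤ 8 * t ^ 3 / N := by
          rw [div_le_div_iff₀ hN1 (by linarith)]; nlinarith
        have a3 : 2 * t ^ 2 / (N * (N - 1)) ≤ 8 * t ^ 2 / (N : ℝ) ^ 2 := by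
          rw [div_le_div_iff₀ (by positivity) (by positivity)]
          nlinarith [show 2 * (N : ℝ) ^ 2 ≤ 8 * (N * (N - 1)) by nlinarith]
        nlinarith
    _ = _ := by ring

/-- The pair of times of a pair of observations. -/
def timePair (α : ℕ × ℕ) (d : Subj S p) : ℝ^2 := ![d.2 α.1, d.2 α.2]

lemma measurable_timePair (α : ℕ × ℕ) : Measurable (timePair α : Subj S p → ℝ^2) := by
  refine measurable_pi_lambda _ fun k => ?_
  fin_cases k <;> simp [timePair] <;> fun_prop

/-- The envelope of the products of two observations of a subject with `N` observations. -/
def covEnv (mm : S → ℝ^p → ℝ) (N : ℕ) (α : ℕ × ℕ) (y : Base S p) : ℝ :=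
  env mm α.1 y * (env mm α.2 y + (N : ℝ)⁻¹ * ∑ m ∈ range N, env mm m y)

/-- The variance proxy of the covariance estimator. -/
def covB (N : ℕ → ℕ → ℕ) (hG : ℕ → ℝ) (n : ℕ) : ℝ := hG n ^ 4 + hG n ^ 3 / gam N 1 n + hG n ^ 2 / gam N 2 n

lemma map_pair_infinitePi {j k : ℕ} (hjk : j ≠ k) : PT^ℕ.map (fun τ => (τ j, τ k)) = PT.prod PT := by
  have h : iIndepFun (fun (j : ℕ) (τ : ℕ → ℝ) => τ j) PT^ℕ :=
    iIndepFun_infinitePi (P := fun _ : ℕ => PT) (X := fun _ x => x) fun _ => measurable_id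
  have h2 := (indepFun_iff_map_prod_eq_prod_map_map (measurable_pi_apply j).aemeasurable
    (measurable_pi_apply k).aemeasurable).1 (h.indepFun hjk)
  rw [h2, infinitePi_map_eval, infinitePi_map_eval]

lemma integral_pair_infinitePi {j k : ℕ} (hjk : j ≠ k) {g : ℝ × ℝ → ℝ} (hg : Measurable g) :
    ∫ τ : ℕ → ℝ, g (τ j, τ k) ∂PT^ℕ = ∫ w, g w ∂PT.prod PT := by
  rw [← map_pair_infinitePi hjk, integral_map (by fun_prop) hg.aestronglyMeasurable]

lemma indicator_box_timePair (l r : ℝ^2) (α : ℕ × ℕ) (d : Subj S p) :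
    (box l r).indicator (1 : ℝ^2 → ℝ) (timePair α d) =
      (Ico (l 0) (r 0)).indicator 1 (d.2 α.1) * (Ico (l 1) (r 1)).indicator 1 (d.2 α.2) := by
  exact (indicator_pi_one (fun k : Fin 2 => Ico (l k) (r k)) (timePair α d)).trans (Fin.prod_univ_two _)

namespace SubjModel

lemma covEnv_nonneg (H : ℳ q) (N : ℕ) (α : ℕ × ℕ) (y) : 0 ≤ covEnv mm N α y :=
  mul_nonneg (H.env_nonneg _ _) (add_nonneg (H.env_nonneg _ _)
    (mul_nonneg (by positivity) (sum_nonneg fun m _ => H.env_nonneg m y)))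

lemma measurable_covEnv (H : ℳ q) (N : ℕ) (α : ℕ × ℕ) : Measurable (covEnv mm N α) :=
  (H.measurable_env _).mul ((H.measurable_env _).add
    ((measurable_sum _ fun m _ => H.measurable_env m).const_mul _))

lemma covEnv_sq_le (H : ℳ q) {N : ℕ} (hN : 1 ≤ N) (α : ℕ × ℕ) (y) :
    covEnv mm N α y ^ 2 ≤ 2 * env mm α.1 y ^ 4 + env mm α.2 y ^ 4 +
      (N : ℝ)⁻¹ * ∑ m ∈ range N, env mm m y ^ 4 := by
  have hN0 : (0 : ℝ) < N := by exact_mod_cast hN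
  have h := Real.pow_arith_mean_le_arith_mean_pow (range N) (fun _ => (N : ℝ)⁻¹)
    (fun m => env mm m y) (fun _ _ => by positivity)
    (by rw [sum_const, card_range, nsmul_eq_mul, mul_inv_cancel₀ hN0.ne'])
    (fun m _ => H.env_nonneg m y) 4
  rw [← mul_sum, ← mul_sum] at h
  unfold covEnv
  set x := env mm α.1 y
  set z := env mm α.2 y
  set w := (N : ℝ)⁻¹ * ∑ m ∈ range N, env mm m y
  have h1 : (x * (z + w)) ^ 2 ≤ 2 * x ^ 4 + z ^ 4 + w ^ 4 := by
    nlinarith [sq_nonneg (x ^ 2 - z ^ 2), sq_nonneg (x ^ 2 - w ^ 2), sq_nonneg (x * (z - w))]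
  linarith

lemma integrable_avg_env_pow (H : ℳ q) (hq : 4 ≤ q) (N : ℕ) (α : ℕ × ℕ) :
    Integrable (fun y => 2 * env mm α.1 y ^ 4 + env mm α.2 y ^ 4 +
      (N : ℝ)⁻¹ * ∑ m ∈ range N, env mm m y ^ 4) ℬ := by
  have h := fun j => H.integrable_env_pow (k := 4) (by push_cast; linarith) j
  exact (((h _).const_mul 2).add (h _)).add ((integrable_finsetSum _ fun m _ => h m).const_mul _)

lemma integrable_covEnv_sq (H : ℳ q) (hq : 4 ≤ q) {N : ℕ} (hN : 1 ≤ N)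
    (α : ℕ × ℕ) : Integrable (fun y => covEnv mm N α y ^ 2) ℬ := by
  refine (H.integrable_avg_env_pow hq N α).mono'
    ((H.measurable_covEnv N α).pow_const 2).aestronglyMeasurable (ae_of_all _ fun y => ?_)
  rw [norm_of_nonneg (sq_nonneg _)]
  exact H.covEnv_sq_le hN α y

lemma integral_covEnv_sq_le (H : ℳ q) (hq : 4 ≤ q) :
    ∃ C : ℝ, 0 ≤ C ∧ ∀ N, 1 ≤ N → ∀ α, ∫ y, covEnv mm N α y ^ 2 ∂ℬ ≤ C := by
  obtain ⟨C, hC0, hC⟩ := H.integral_env_pow_mul_le (k := 4) (by push_cast; linarith)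
  refine ⟨4 * C, by positivity, fun N hN α => ?_⟩
  have hN0 : (0 : ℝ) < N := by exact_mod_cast hN
  have h4 : ∀ j, ∫ y, env mm j y ^ 4 ∂ℬ ≤ C := fun j => by simpa using hC j univ MeasurableSet.univ
  have hi := fun j => H.integrable_env_pow (k := 4) (by push_cast; linarith) j
  refine (integral_mono (H.integrable_covEnv_sq hq hN α) (H.integrable_avg_env_pow hq N α)
    (H.covEnv_sq_le hN α)).trans ?_
  rw [integral_add (f := fun y => 2 * env mm α.1 y ^ 4 + env mm α.2 y ^ 4)
    (g := fun y => (N : ℝ)⁻¹ * ∑ m ∈ range N, env mm m y ^ 4)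
    (((hi _).const_mul 2).add (hi _)) ((integrable_finsetSum _ fun m _ => hi m).const_mul _),
    integral_add ((hi _).const_mul 2) (hi _), integral_const_mul, integral_const_mul,
    integral_finsetSum _ fun m _ => hi m]
  have h5 : (N : ℝ)⁻¹ * ∑ m ∈ range N, ∫ y, env mm m y ^ 4 ∂ℬ ≤ C := by
    exact mul_sum_le_of_card (by positivity) (by rw [card_range, inv_mul_cancel₀ hN0.ne']) fun m _ => h4 m
  linarith [h4 α.1, h4 α.2]

end SubjModel

/-- The centred average of the `L`-th powers of the first `2^k` errors. -/
def dyadicAvg (Pε : Measure ℝ) (L : ℝ) (k : ℕ) (e : ℕ → ℝ) : ℝ :=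
  ((2 : ℝ) ^ k)⁻¹ * ∑ j ∈ range (2 ^ k), (|e j| ^ L - ∫ x, |x| ^ L ∂Pε)

lemma measurable_dyadicAvg (L : ℝ) (k : ℕ) : Measurable (dyadicAvg Pε L k) := by
  unfold dyadicAvg
  refine (measurable_sum _ fun j _ => ?_).const_mul _
  fun_prop

lemma integral_dyadicAvg_sq (hL : 0 ≤ L) (he : Integrable (fun x => |x| ^ (2 * L)) Pε) (k : ℕ) :
    Integrable (fun e => dyadicAvg Pε L k e ^ 2) Pε^ℕ ∧
    ∫ e, dyadicAvg Pε L k e ^ 2 ∂Pε^ℕ ≤ (∫ x, |x| ^ (2 * L) ∂Pε) * (1 / 2) ^ k := by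
  set m := ∫ x, |x| ^ L ∂Pε with hm
  have hmeas : Measurable fun x : ℝ => |x| ^ L - m := by fun_prop
  have hsq : ∀ x : ℝ, (|x| ^ L) ^ 2 = |x| ^ (2 * L) := fun x => by
    rw [← rpow_natCast, ← rpow_mul (abs_nonneg x)]; congr 1; push_cast; ring
  have hL2 : MemLp (fun x : ℝ => |x| ^ L) 2 Pε := by
    rw [memLp_two_iff_integrable_sq (by fun_prop)]
    simpa only [hsq] using he
  have hmp : ∀ j : ℕ, MeasurePreserving (fun e : ℕ → ℝ => e j) Pε^ℕ Pε :=
    fun j => ⟨measurable_pi_apply j, infinitePi_map_eval (fun _ : ℕ => Pε) j⟩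
  set X : ℕ → (ℕ → ℝ) → ℝ := fun j e => |e j| ^ L - m with hX
  have hXL : ∀ j, MemLp (X j) 2 Pε^ℕ := fun j => (hL2.sub (memLp_const m)).comp_measurePreserving (hmp j)
  have hind : iIndepFun X Pε^ℕ :=
    iIndepFun_infinitePi (P := fun _ : ℕ => Pε) (X := fun _ x => |x| ^ L - m) fun _ => hmeas
  have hX0 : ∀ j, ∫ e, X j e ∂Pε^ℕ = 0 := by
    intro j
    have h1 : ∫ e, X j e ∂Pε^ℕ = ∫ x, (|x| ^ L - m) ∂Pε := by
      conv_rhs => rw [← (hmp j).map_eq]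
      rw [integral_map (measurable_pi_apply j).aemeasurable
        (by rw [(hmp j).map_eq]; exact hmeas.aestronglyMeasurable)]
    rw [h1, integral_sub (hL2.integrable one_le_two) (integrable_const m)]
    simp [hm]
  have hXv : ∀ j, variance (X j) Pε^ℕ ≤ ∫ x, |x| ^ (2 * L) ∂Pε := by
    intro j
    have h1 : variance (X j) Pε^ℕ = variance (fun x : ℝ => |x| ^ L - m) Pε := by
      have := variance_map (X := fun x : ℝ => |x| ^ L - m) (Y := fun e : ℕ → ℝ => e j)
        (μ := Pε^ℕ) (by rw [(hmp j).map_eq]; exact hmeas.aemeasurable)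
        (measurable_pi_apply j).aemeasurable
      rw [(hmp j).map_eq] at this
      exact this.symm
    rw [h1, variance_sub_const hL2.1]
    refine (variance_le_expectation_sq hL2.1).trans (le_of_eq ?_)
    refine integral_congr_ae (ae_of_all _ fun x => ?_)
    simp only [Pi.pow_apply]
    exact hsq x
  have hsumL : MemLp (∑ j ∈ range (2 ^ k), X j) 2 Pε^ℕ := memLp_finsetSum' _ fun j _ => hXL j
  have e1 : ∀ e, dyadicAvg Pε L k e ^ 2 =
      (((2 : ℝ) ^ k)⁻¹) ^ 2 * (∑ j ∈ range (2 ^ k), X j) e ^ 2 := fun e => by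
    rw [dyadicAvg, mul_pow, Finset.sum_apply]
  have hvar : ∫ e, (∑ j ∈ range (2 ^ k), X j) e ^ 2 ∂Pε^ℕ ≤ 2 ^ k * ∫ x, |x| ^ (2 * L) ∂Pε := by
    have h0 : ∫ e, (∑ j ∈ range (2 ^ k), X j) e ∂Pε^ℕ = 0 := by
      simp only [Finset.sum_apply]
      rw [integral_finsetSum _ fun j _ => (hXL j).integrable one_le_two]
      exact sum_eq_zero fun j _ => hX0 j
    rw [← variance_of_integral_eq_zero hsumL.1.aemeasurable h0, IndepFun.variance_sum
      (fun j _ => hXL j) fun i _ j _ hij => hind.indepFun hij]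
    refine (sum_le_sum fun j _ => hXv j).trans (le_of_eq ?_)
    rw [sum_const, card_range, nsmul_eq_mul]; push_cast; rfl
  simp only [e1]
  refine ⟨(hsumL.integrable_sq).const_mul _, ?_⟩
  rw [integral_const_mul]
  calc _ ≤ (((2 : ℝ) ^ k)⁻¹) ^ 2 * (2 ^ k * ∫ x, |x| ^ (2 * L) ∂Pε) := by gcongr
    _ = _ := by rw [show ((1 : ℝ) / 2) ^ k = ((2 : ℝ) ^ k)⁻¹ by rw [one_div, inv_pow]]; field_simp

/-- The dominating function for the tails of the envelope of products. -/
def covDom (Pε : Measure ℝ) (mm : S → ℝ^p → ℝ) (L : ℝ) (d : Subj S p) : ENNReal :=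
  ofReal (mm d.1.1 d.1.2.1 ^ (2 * L)) + (ofReal ((∫ x, |x| ^ L ∂Pε) ^ 2) +
    ∑' k : ℕ, ofReal (dyadicAvg Pε L k d.1.2.2 ^ 2))

lemma measurable_dyadicAvg_sq (k : ℕ) :
    Measurable fun d : Subj S p => ofReal (dyadicAvg Pε L k d.1.2.2 ^ 2) :=
  (((measurable_dyadicAvg L k).comp (by fun_prop)).pow_const 2).ennreal_ofReal

lemma SubjModel.measurable_covDom (H : ℳ (2 * L)) : Measurable (covDom Pε mm L) :=
  H.measurable_mm_rpow.add (measurable_const.add (Measurable.tsum measurable_dyadicAvg_sq))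

lemma SubjModel.lintegral_covDom (H : ℳ (2 * L)) (hL : 0 ≤ L) : ∫⁻ d, covDom Pε mm L d ∂ℒ ≠ ⊤ := by
  have hL0 : 0 ≤ 2 * L := by linarith
  unfold covDom
  rw [lintegral_add_left H.measurable_mm_rpow, lintegral_add_left measurable_const]
  refine add_ne_top.2 ⟨H.lintegral_mm_rpow_ne_top hL0, add_ne_top.2 ⟨by simp, ?_⟩⟩
  rw [lintegral_tsum fun k => (measurable_dyadicAvg_sq k).aemeasurable]
  have h3 : ∀ k : ℕ, ∫⁻ d, ofReal (dyadicAvg Pε L k d.1.2.2 ^ 2) ∂ℒ ≤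
      ofReal ((∫ x, |x| ^ (2 * L) ∂Pε) * (1 / 2) ^ k) := by
    intro k
    obtain ⟨h4, h5⟩ := integral_dyadicAvg_sq hL H.moment_e k
    have h6 : ∫⁻ d, ofReal (dyadicAvg Pε L k d.1.2.2 ^ 2) ∂ℒ =
        ∫⁻ e, ofReal (dyadicAvg Pε L k e ^ 2) ∂Pε^ℕ := by
      rw [← map_errors_subjLaw (Pθ := Pθ) (PZ := PZ) (PT := PT), lintegral_map
        ((measurable_dyadicAvg L k).pow_const 2).ennreal_ofReal (by fun_prop)]
    rw [h6, ← ofReal_integral_eq_lintegral_ofReal h4 (ae_of_all _ fun e => sq_nonneg _)]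
    exact ofReal_le_ofReal h5
  refine ne_top_of_le_ne_top ?_ (tsum_le_tsum h3)
  rw [← ENNReal.ofReal_tsum_of_nonneg]
  · exact ofReal_ne_top
  · intro k
    have : 0 ≤ ∫ x, |x| ^ (2 * L) ∂Pε := integral_nonneg fun x => by positivity
    positivity
  · exact (summable_geometric_of_lt_one (by norm_num) (by norm_num)).mul_left _

lemma SubjModel.avg_env_rpow_sq_le (H : ℳ (2 * L)) (hL : 0 ≤ L)
    {N : ℕ} (hN : 2 ≤ N) {d : Subj S p} (hd : covDom Pε mm L d ≠ ⊤) :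
    ((N : ℝ)⁻¹ * ∑ j ∈ range N, env mm j d.1 ^ L) ^ 2 ≤ (2 ^ L) ^ 2 * 12 * (covDom Pε mm L d).toReal := by
  have hN0 : (0 : ℝ) < N := by positivity
  set k := Nat.clog 2 N with hk
  have hk1 : N ≤ 2 ^ k := Nat.le_pow_clog (by norm_num) N
  have hk2 : 2 ^ k ≤ 2 * N := by
    have h1 := Nat.pow_pred_clog_lt_self (b := 2) (x := N) (by norm_num) (by omega)
    have h2 : 0 < k := Nat.clog_pos (by norm_num) hN
    obtain ⟨k', hk'⟩ := Nat.exists_eq_succ_of_ne_zero h2.ne'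
    rw [← hk, hk', Nat.pred_succ] at h1
    rw [hk', pow_succ]; omega
  set m := ∫ x, |x| ^ L ∂Pε with hm
  have hm0 : 0 ≤ m := integral_nonneg fun x => by positivity
  set η := dyadicAvg Pε L k d.1.2.2 with hη
  set μ := mm d.1.1 d.1.2.1 with hμ
  have hμ0 : 0 ≤ μ := zero_le_one.trans (H.one_le_mm _ _)
  have h1 : (N : ℝ)⁻¹ * ∑ j ∈ range N, |d.1.2.2 j| ^ L ≤ 2 * (m + η) := by
    have e1 : ((2 : ℝ) ^ k)⁻¹ * ∑ j ∈ range (2 ^ k), |d.1.2.2 j| ^ L = m + η := by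
      rw [hη, dyadicAvg, sum_sub_distrib, sum_const, card_range, nsmul_eq_mul]
      push_cast
      field_simp
      ring
    rw [← e1, ← mul_assoc]
    refine mul_le_mul ?_ (Finset.sum_le_sum_of_subset_of_nonneg
      (Finset.range_subset_range.2 hk1) fun j _ _ => by positivity) (sum_nonneg fun j _ => by positivity)
      (by positivity)
    rw [← div_eq_mul_inv, inv_le_comm₀ hN0 (by positivity), inv_div, div_le_iff₀ (by norm_num)]
    have : ((2 ^ k : ℕ) : ℝ) ≤ ((2 * N : ℕ) : ℝ) := by exact_mod_cast hk2
    push_cast at this; linarith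
  have h2 : (N : ℝ)⁻¹ * ∑ j ∈ range N, env mm j d.1 ^ L ≤ 2 ^ L * (μ ^ L + 2 * (m + η)) := by
    calc (N : ℝ)⁻¹ * ∑ j ∈ range N, env mm j d.1 ^ L
        ≤ (N : ℝ)⁻¹ * ∑ j ∈ range N, 2 ^ L * (μ ^ L + |d.1.2.2 j| ^ L) := by
          gcongr with j _
          exact SubjModel.add_rpow_le hμ0 (abs_nonneg _) hL
      _ = 2 ^ L * (μ ^ L + (N : ℝ)⁻¹ * ∑ j ∈ range N, |d.1.2.2 j| ^ L) := by
          rw [← mul_sum, sum_add_distrib, sum_const, card_range, nsmul_eq_mul]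
          field_simp
      _ ≤ _ := by gcongr
  have h3 : 0 ≤ (N : ℝ)⁻¹ * ∑ j ∈ range N, env mm j d.1 ^ L :=
    mul_nonneg (by positivity) (sum_nonneg fun j _ => rpow_nonneg (H.env_nonneg j d.1) L)
  have h4 : μ ^ (2 * L) + (m ^ 2 + η ^ 2) ≤ (covDom Pε mm L d).toReal := by
    rw [← ENNReal.ofReal_le_iff_le_toReal hd, ofReal_add (by positivity) (by positivity),
      ofReal_add (by positivity) (by positivity)]
    unfold covDom
    gcongr
    exact ENNReal.le_tsum (f := fun k => ofReal (dyadicAvg Pε L k d.1.2.2 ^ 2)) k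
  have h5 : μ ^ (2 * L) = (μ ^ L) ^ 2 := by
    rw [← rpow_natCast (μ ^ L) 2, ← rpow_mul hμ0]; congr 1; push_cast; ring
  calc _ ≤ (2 ^ L * (μ ^ L + 2 * (m + η))) ^ 2 := pow_le_pow_left₀ h3 h2 2
    _ = (2 ^ L) ^ 2 * (μ ^ L + 2 * (m + η)) ^ 2 := by ring
    _ ≤ (2 ^ L) ^ 2 * (12 * (covDom Pε mm L d).toReal) := by
        gcongr
        rw [h5] at h4
        nlinarith [sq_nonneg (μ ^ L - 2 * m), sq_nonneg (μ ^ L - 2 * η), sq_nonneg (m - η)]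
    _ = _ := by ring

lemma SubjModel.smp_tail_covEnv_le (H : ℳ (2 * L)) (hL : 1 ≤ L)
    {N : ℕ} (hN : 2 ≤ N) {a : ℝ} (ha : 0 < a) {d : Subj S p} (hd : covDom Pε mm L d ≠ ⊤) :
    smp (range N).offDiag (1 / ((N : ℝ) * ((N : ℝ) - 1))) timePair
      (tailW a (fun α d => covEnv mm N α d.1) fun α d => covEnv mm N α d.1) 1 d ≤
      a ^ (1 - L) * (2 ^ L * 4 * ((2 ^ L) ^ 2 * 12)) * (covDom Pε mm L d).toReal := by
  have hN2 : (2 : ℝ) ≤ N := by exact_mod_cast hN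
  have hN0 : (0 : ℝ) < N := by linarith
  have hN1 : (0 : ℝ) < (N : ℝ) - 1 := by linarith
  set A := (N : ℝ)⁻¹ * ∑ j ∈ range N, env mm j d.1 ^ L with hA
  have hR : ∀ j, 0 ≤ env mm j d.1 ^ L := fun j => rpow_nonneg (H.env_nonneg j d.1) L
  have hA0 : 0 ≤ A := mul_nonneg (by positivity) (sum_nonneg fun j _ => hR j)
  have hsum : ∑ j ∈ range N, env mm j d.1 ^ L = N * A := by rw [hA]; field_simp
  have hJ : ((N : ℝ)⁻¹ * ∑ m ∈ range N, env mm m d.1) ^ L ≤ A := by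
    have h := Real.rpow_arith_mean_le_arith_mean_rpow (range N) (fun _ => (N : ℝ)⁻¹)
      (fun m => env mm m d.1) (fun _ _ => by positivity)
      (by rw [sum_const, card_range, nsmul_eq_mul, mul_inv_cancel₀ hN0.ne'])
      (fun m _ => H.env_nonneg m d.1) hL
    rwa [← mul_sum, ← mul_sum] at h
  have hpt : ∀ α : ℕ × ℕ, tailW a (fun α (d : Subj S p) => covEnv mm N α d.1)
      (fun α d => covEnv mm N α d.1) α d ≤
      a ^ (1 - L) * (2 ^ L * (env mm α.1 d.1 ^ L * (env mm α.2 d.1 ^ L + A))) := by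
    intro α
    refine (tailW_le_rpow ha hL (fun α d => H.covEnv_nonneg N α d.1) α d).trans ?_
    have hs0 : 0 ≤ (N : ℝ)⁻¹ * ∑ m ∈ range N, env mm m d.1 :=
      mul_nonneg (by positivity) (sum_nonneg fun m _ => H.env_nonneg m d.1)
    refine mul_le_mul_of_nonneg_left ?_ (by positivity)
    rw [covEnv, Real.mul_rpow (H.env_nonneg _ _) (add_nonneg (H.env_nonneg _ _) hs0)]
    have h1 := SubjModel.add_rpow_le (H.env_nonneg α.2 d.1) hs0 (by linarith : 0 ≤ L)
    calc _ ≤ env mm α.1 d.1 ^ L * (2 ^ L * (env mm α.2 d.1 ^ L + A)) := by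
          refine mul_le_mul_of_nonneg_left (h1.trans ?_) (hR _)
          gcongr
      _ = _ := by ring
  have hc : 0 ≤ 1 / ((N : ℝ) * ((N : ℝ) - 1)) := by positivity
  calc _ ≤ 1 / ((N : ℝ) * ((N : ℝ) - 1)) * ∑ α ∈ range N ×ˢ range N,
          a ^ (1 - L) * (2 ^ L * (env mm α.1 d.1 ^ L * (env mm α.2 d.1 ^ L + A))) := by
        simp only [smp, Pi.one_apply, mul_one]
        refine mul_le_mul_of_nonneg_left ((sum_le_sum fun α _ => hpt α).trans ?_) hc
        refine Finset.sum_le_sum_of_subset_of_nonneg (offDiag_subset_product N) fun α _ _ => ?_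
        have := hR α.1
        have := hR α.2
        positivity
    _ = 1 / ((N : ℝ) * ((N : ℝ) - 1)) * (a ^ (1 - L) * (2 ^ L * (2 * N ^ 2 * A ^ 2))) := by
        congr 1
        rw [← mul_sum, ← mul_sum, Finset.sum_product]
        simp only [← mul_sum, sum_add_distrib, sum_const, card_range, nsmul_eq_mul, hsum, ← sum_mul]
        ring
    _ = a ^ (1 - L) * (2 ^ L * (2 * (N / (N - 1)) * A ^ 2)) := by field_simp
    _ ≤ a ^ (1 - L) * (2 ^ L * (4 * ((2 ^ L) ^ 2 * 12 * (covDom Pε mm L d).toReal))) := by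
        have h1 : (N : ℝ) / (N - 1) ≤ 2 := by rw [div_le_iff₀ hN1]; linarith
        have h2 := H.avg_env_rpow_sq_le (by linarith) hN hd
        gcongr
        linarith
    _ = _ := by ring

local notation "𝔬" => fun n i => Finset.offDiag (range (N n i))
local notation "𝔴" => fun n i => 1 / ((N n i : ℝ) * ((N n i : ℝ) - 1))
local notation "𝔠" => fun n i α (d : Subj S p) => covEnv mm (N n i) α (Prod.fst d)

section Cov

variable {D : ℕ → Ω → Subj S p}

lemma covB_eq (n : ℕ) : covB N hG n = hG n ^ 4 + hG n ^ 3 * invGam N 1 n + hG n ^ 2 * invGam N 2 n := by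
  rw [covB, gam_eq_inv, gam_eq_inv, div_inv_eq_mul, div_inv_eq_mul]

lemma CovBandwidth.covB_pos (hB : CovBandwidth N hG L) (n : ℕ) : 0 < covB N hG n := by
  rw [covB_eq]
  have h2 := hB.pos n
  have h3 := invGam_nonneg N 1 n
  have h4 := invGam_nonneg N 2 n
  positivity

lemma CovBandwidth.eventually_covB_le (hB : CovBandwidth N hG L) (hN : ∀ n i, 2 ≤ N n i) :
    ∀ᶠ n in atTop, covB N hG n ≤ 3 * hG n ^ 2 ∧ covB N hG n ≤ 3 * hG n := by
  filter_upwards [hB.tendsto.eventually_le_const one_pos] with n h1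
  have h0 := hB.pos n
  have g1 := invGam_le_one hN 1 n
  have g2 := invGam_le_one hN 2 n
  have g3 := invGam_nonneg N 1 n
  have g4 := invGam_nonneg N 2 n
  have h2 : hG n ^ 2 ≤ hG n := by nlinarith
  have h3 : hG n ^ 3 ≤ hG n ^ 2 := pow_le_pow_of_le_one h0.le h1 (by norm_num)
  have h4 : hG n ^ 4 ≤ hG n ^ 2 := pow_le_pow_of_le_one h0.le h1 (by norm_num)
  have h5 : covB N hG n ≤ 3 * hG n ^ 2 := by
    rw [covB_eq]
    have a1 : hG n ^ 3 * invGam N 1 n ≤ hG n ^ 2 * 1 := by gcongr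
    have a2 : hG n ^ 2 * invGam N 2 n ≤ hG n ^ 2 * 1 := by gcongr
    linarith
  exact ⟨h5, by linarith⟩

lemma isEnvelope_cov (hD : IsIID P D ℒ) (H : ℳ (2 * L)) (hL : 2 < L)
    (hN : ∀ n i, 2 ≤ N n i) (hB : CovBandwidth N hG L) :
    IsEnvelope P ℒ D 𝔬 𝔴 timePair 𝔠 (fun n _ => hG n) (covB N hG) := by
  have hN2 : ∀ n i, (2 : ℝ) ≤ N n i := fun n i => by exact_mod_cast hN n i
  have hNN : ∀ n i, 0 < (N n i : ℝ) * ((N n i : ℝ) - 1) := fun n i =>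
    mul_pos (by linarith [hN2 n i]) (by linarith [hN2 n i])
  have hN1 : ∀ n i, 1 ≤ N n i := fun n i => by have := hN n i; omega
  have hb := hB.covB_pos
  have hEm : ∀ n i α, Measurable fun d : Subj S p => covEnv mm (N n i) α d.1 := fun n i α =>
    (H.measurable_covEnv _ α).comp measurable_fst
  have hrate : IsRate (covB N hG) L := hB.rate
  have hc0 : ∀ n i, 0 ≤ 1 / ((N n i : ℝ) * ((N n i : ℝ) - 1)) := fun n i => by have := hNN n i; positivity
  have hc1 : ∀ n i, 1 / ((N n i : ℝ) * ((N n i : ℝ) - 1)) * (range (N n i)).offDiag.card = 1 :=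
    fun n i => by rw [card_offDiag_range, one_div_mul_cancel (hNN n i).ne']
  have hL4 : 4 ≤ 2 * L := by linarith
  obtain ⟨CT, hCT0, hCT⟩ := H.exists_PT_real_Ico_le
  obtain ⟨C2, hC20, hC2⟩ := H.integral_covEnv_sq_le hL4
  have hIs := fun n i α => H.integrable_covEnv_sq hL4 (hN1 n i) α
  set K := (2 : ℝ) ^ L * 4 * ((2 ^ L) ^ 2 * 12) with hK
  have hK0 : 0 ≤ K := by positivity
  refine ⟨hD, hc0, fun n i => (hc1 n i).le, measurable_timePair,
    hEm, fun _ _ α d => H.covEnv_nonneg _ α d.1, fun n i α => ?_, hb, fun n _ => hB.pos n,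
    fun _ => hB.tendsto, ?_, eventually_one_div_le_rateX hb hL hrate, ?_, ?_, ?_, ?_⟩
  · rw [memLp_two_iff_integrable_sq (hEm n i α).aestronglyMeasurable]
    exact measurePreserving_fst_subjLaw.integrable_comp_of_integrable (hIs n i α)
  · filter_upwards [hB.eventually_covB_le hN, eventually_one_div_sq_le_of_rate hb hL hrate]
      with n ⟨_, h1⟩ h3 k
    have h4 : 3 / (n : ℝ) ^ 2 = 3 * (1 / (n : ℝ) ^ 2) := by ring
    linarith
  · refine ⟨fun n i => C2 * (8 * ((CT * (8 * hG n)) ^ 4 + (CT * (8 * hG n)) ^ 3 / N n i +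
      (CT * (8 * hG n)) ^ 2 / (N n i : ℝ) ^ 2)),
      C2 * 8 * ((8 * CT) ^ 4 + (8 * CT) ^ 3 + (8 * CT) ^ 2), fun n i => ?_, fun n i l r hlr => ?_, ?_⟩
    · have := (hB.pos n).le
      positivity
    · have h0 := (hB.pos n).le
      have hI : ∀ k : Fin 2, PT.real (Ico (l k) (r k)) ≤ CT * (4 * hG n) := fun k => by
        refine (hCT _ _).trans ?_
        gcongr
        exact max_le (hlr k) (by positivity)
      have hPT : PT.real (Ico (l 0) (r 0) ∪ Ico (l 1) (r 1)) ≤ CT * (8 * hG n) := by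
        refine (measureReal_union_le _ _).trans ?_
        linarith [hI 0, hI 1]
      refine (integral_sum_sq_le (PT := PT) (PZ := PZ) (1 / ((N n i : ℝ) * ((N n i : ℝ) - 1)))
        (range (N n i)).offDiag
        (E := covEnv mm (N n i)) (fun α y => H.covEnv_nonneg _ α y) (hIs n i) MeasurableSet.univ
        (M := C2) (fun α => by simpa using hC2 (N n i) (hN1 n i) α) (fun α => {α.1, α.2})
        (I := Ico (l 0) (r 0) ∪ Ico (l 1) (r 1)) (measurableSet_Ico.union measurableSet_Ico)
        (G := fun α d => (box l r).indicator 1 (timePair α d))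
        (fun α d => indicator_nonneg (fun _ _ => zero_le_one) _)
        (fun α d => by
          rw [indicator_of_mem (mem_univ _), Pi.one_apply, one_mul]
          by_cases hm : d.2 ∈ allIn {α.1, α.2} (Ico (l 0) (r 0) ∪ Ico (l 1) (r 1))
          · rw [indicator_of_mem hm]
            exact indicator_le_self' (fun _ _ => zero_le_one) _
          · have h1 : timePair α d ∉ box l r := fun hc => hm fun m hm' => by
              rcases Finset.mem_insert.1 (mem_coe.1 hm') with rfl | hm'
              · exact Or.inl (hc 0 (mem_univ _))
              · rw [Finset.mem_singleton] at hm'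
                subst hm'
                exact Or.inr (hc 1 (mem_univ _))
            rw [indicator_of_notMem hm, indicator_of_notMem h1])).trans (mul_le_mul_of_nonneg_left ?_ hC20)
      refine (sum_card_union_pair_le measureReal_nonneg (hN n i)).trans ?_
      have := measureReal_nonneg (μ := PT) (s := Ico (l 0) (r 0) ∪ Ico (l 1) (r 1))
      gcongr
    · refine Eventually.of_forall fun n => ?_
      have h0 := (hB.pos n).le
      have g1 := invGam_nonneg N 1 n
      have g2 := invGam_nonneg N 2 n
      have e1 := sum_inv_eq N 1 n
      have e2 := sum_inv_eq N 2 n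
      simp only [pow_one] at e1
      rw [← mul_sum, ← mul_sum, sum_add_distrib, sum_add_distrib, sum_const, card_range, nsmul_eq_mul]
      simp only [div_eq_mul_inv, ← mul_sum]
      rw [e1, e2, covB_eq]
      have : 0 ≤ C2 * 8 * n * (((8 * CT) ^ 3 + (8 * CT) ^ 2) * hG n ^ 4 + ((8 * CT) ^ 4 + (8 * CT) ^ 2) *
        (hG n ^ 3 * invGam N 1 n) + ((8 * CT) ^ 4 + (8 * CT) ^ 3) * (hG n ^ 2 * invGam N 2 n)) := by
        positivity
      linarith
  · refine ⟨(1 + C2) * CT ^ 2, by positivity, fun n i l r hlr => ?_⟩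
    have hEi : ∀ α, Integrable (covEnv mm (N n i) α) ℬ := fun α =>
      ((memLp_two_iff_integrable_sq (H.measurable_covEnv _ α).aestronglyMeasurable).2
        (hIs n i α)).integrable one_le_two
    have hE1 : ∀ α, ∫ y, covEnv mm (N n i) α y ∂ℬ ≤ 1 + C2 := fun α => by
      refine (integral_mono (hEi α) ((integrable_const 1).add (hIs n i α)) fun y => ?_).trans ?_
      · simp only [Pi.add_apply]
        nlinarith [sq_nonneg (covEnv mm (N n i) α y - 1), sq_nonneg (covEnv mm (N n i) α y)]
      · rw [integral_add' (integrable_const 1) (hIs n i α)]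
        simpa using hC2 _ (hN1 n i) α
    have hgm : Measurable fun w : ℝ × ℝ => (Ico (l 0) (r 0)).indicator (1 : ℝ → ℝ) w.1 *
        (Ico (l 1) (r 1)).indicator (1 : ℝ → ℝ) w.2 :=
      ((measurable_const.indicator measurableSet_Ico).comp measurable_fst).mul
        ((measurable_const.indicator measurableSet_Ico).comp measurable_snd)
    have hInt : ∀ α : ℕ × ℕ, Integrable (fun d : Subj S p => covEnv mm (N n i) α d.1 *
        (box l r).indicator 1 (timePair α d)) ℒ := fun α => by
      refine (measurePreserving_fst_subjLaw.integrable_comp_of_integrable (hEi α)).mul_bdd (c := 1)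
        ((measurable_indicator_one (measurableSet_box l r)).comp
          (measurable_timePair α)).aestronglyMeasurable (ae_of_all _ fun d => ?_)
      exact indicator_one_abs_le _ _
    have hα : ∀ α ∈ (range (N n i)).offDiag, ∫ d, covEnv mm (N n i) α d.1 *
        (box l r).indicator 1 (timePair α d) ∂ℒ ≤
        (1 + C2) * CT ^ 2 * ∏ k, (r k - l k) := by
      intro α hα
      have hne : α.1 ≠ α.2 := (Finset.mem_offDiag.1 hα).2.2
      simp only [indicator_box_timePair]
      rw [integral_subjLaw_mul (covEnv mm (N n i) α) (fun τ => (Ico (l 0) (r 0)).indicator 1 (τ α.1) *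
        (Ico (l 1) (r 1)).indicator 1 (τ α.2)), integral_pair_infinitePi hne hgm,
        integral_prod_mul (fun u => (Ico (l 0) (r 0)).indicator (1 : ℝ → ℝ) u)
          (fun u => (Ico (l 1) (r 1)).indicator (1 : ℝ → ℝ) u),
        integral_indicator_one measurableSet_Ico, integral_indicator_one measurableSet_Ico,
        Fin.prod_univ_two]
      have hk : ∀ k, PT.real (Ico (l k) (r k)) ≤ CT * (r k - l k) := fun k => by
        simpa only [max_eq_left (sub_nonneg.2 (hlr k))] using hCT (l k) (r k)
      have s0 := sub_nonneg.2 (hlr 0)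
      calc _ ≤ (1 + C2) * ((CT * (r 0 - l 0)) * (CT * (r 1 - l 1))) := by
            refine mul_le_mul (hE1 α) ?_ (mul_nonneg measureReal_nonneg measureReal_nonneg) (by positivity)
            exact mul_le_mul (hk 0) (hk 1) measureReal_nonneg (by positivity)
        _ = _ := by ring
    unfold smp
    rw [integral_const_mul, integral_finsetSum _ fun α _ => hInt α]
    exact mul_sum_le_of_card (hc0 n i) (hc1 n i) hα
  · have h2 := ae_exists_sum_toReal_le hD H.measurable_covDom (H.lintegral_covDom (by linarith))
    filter_upwards [h2] with ω ⟨hfin, C, hC, h2⟩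
    refine ⟨K * C, ?_⟩
    filter_upwards [h2, eventually_rateQ_rpow_le hb hL hrate, eventually_ge_atTop 2] with n h2 h3 hn
    have hQp := rateQ_pos hb hn
    have hx := rateX_nonneg (covB N hG) n
    calc _ ≤ ∑ i ∈ range n, rateQ (covB N hG) n ^ (1 - L) * K * (covDom Pε mm L (D i ω)).toReal :=
          sum_le_sum fun i _ => H.smp_tail_covEnv_le (by linarith) (hN n i) hQp (hfin i)
      _ = rateQ (covB N hG) n ^ (1 - L) * K * ∑ i ∈ range n, (covDom Pε mm L (D i ω)).toReal := by
          rw [mul_sum]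
      _ ≤ rateX (covB N hG) n * K * (C * n) := by gcongr
      _ = _ := by ring
  · have hVi := integrable_toReal_of_lintegral_ne_top H.measurable_covDom.aemeasurable
      (H.lintegral_covDom (by linarith : 0 ≤ L))
    have hV0 : 0 ≤ ∫ d, (covDom Pε mm L d).toReal ∂ℒ := integral_nonneg fun d => toReal_nonneg
    refine ⟨K * ∫ d, (covDom Pε mm L d).toReal ∂ℒ, by positivity, ?_⟩
    filter_upwards [eventually_rateQ_rpow_le hb hL hrate, eventually_ge_atTop 2] with n h3 hn i
    have hQp := rateQ_pos hb hn
    calc _ ≤ ∫ d, rateQ (covB N hG) n ^ (1 - L) * K * (covDom Pε mm L d).toReal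
          ∂ℒ := by
          refine integral_mono_of_nonneg (ae_of_all _ fun d => ?_) (hVi.const_mul _) ?_
          · exact smp_nonneg (hc0 n i) (fun α _ => tailW_nonneg
              (fun α d => H.covEnv_nonneg _ α d.1) α d) fun _ => zero_le_one
          · filter_upwards [ae_lt_top H.measurable_covDom (H.lintegral_covDom (by linarith : 0 ≤ L))]
              with d hd
            exact H.smp_tail_covEnv_le (by linarith) (hN n i) hQp hd.ne
      _ = rateQ (covB N hG) n ^ (1 - L) * K * ∫ d, (covDom Pε mm L d).toReal ∂ℒ := by
          rw [integral_const_mul]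
      _ ≤ rateX (covB N hG) n * K * ∫ d, (covDom Pε mm L d).toReal ∂ℒ := by gcongr
      _ = _ := by ring

end Cov

/-! ### Algebra of local linear smoothing -/

section LocalLinear

lemma eq_zero_of_forall_quadratic_nonneg {G H : ℝ} (h : ∀ t : ℝ, 0 ≤ -2 * t * G + t ^ 2 * H) : G = 0 := by
  by_contra hG
  have h1 := h (G / (|H| + 1))
  have h2 : 0 < |H| + 1 := by positivity
  have h3 : -2 * (G / (|H| + 1)) * G + (G / (|H| + 1)) ^ 2 * H
      = G ^ 2 / (|H| + 1) ^ 2 * (H - 2 * (|H| + 1)) := by field_simp; ring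
  rw [h3] at h1
  have h4 : H - 2 * (|H| + 1) < 0 := by linarith [le_abs_self H, abs_nonneg H]
  have h5 : 0 < G ^ 2 / (|H| + 1) ^ 2 := by positivity
  nlinarith

/-- The normal equations of weighted least squares. -/
lemma normal_equations {A ε : Type*} [Fintype ε] [DecidableEq ε] (O : Finset A) (w y : A → ℝ)
    (v : A → ε → ℝ) (b : ε → ℝ)
    (hb : ∀ c : ε → ℝ, ∑ o ∈ O, w o * (y o - ∑ e, b e * v o e) ^ 2 ≤
      ∑ o ∈ O, w o * (y o - ∑ e, c e * v o e) ^ 2) (e : ε) :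
    ∑ o ∈ O, w o * (y o - ∑ e, b e * v o e) * v o e = 0 := by
  refine eq_zero_of_forall_quadratic_nonneg (H := ∑ o ∈ O, w o * v o e ^ 2) fun t => ?_
  have h := hb fun e' => b e' + t * if e' = e then 1 else 0
  have e1 : ∀ o, ∑ e', (b e' + t * if e' = e then 1 else 0) * v o e' =
      ∑ e', b e' * v o e' + t * v o e := fun o => by
    simp only [add_mul, sum_add_distrib, mul_assoc, ← mul_sum]
    simp
  simp only [e1] at h
  have e2 : ∑ o ∈ O, w o * (y o - (∑ e', b e' * v o e' + t * v o e)) ^ 2 =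
      ∑ o ∈ O, w o * (y o - ∑ e', b e' * v o e') ^ 2 +
        (-2 * t * ∑ o ∈ O, w o * (y o - ∑ e', b e' * v o e') * v o e
          + t ^ 2 * ∑ o ∈ O, w o * v o e ^ 2) := by
    rw [mul_sum, mul_sum, ← sum_add_distrib, ← sum_add_distrib]
    exact sum_congr rfl fun o _ => by ring
  linarith

variable {ε : Type} [Fintype ε] [DecidableEq ε]

lemma sum_abs_mul_le (c d : ε → ℝ) : (∑ e, |c e|) ^ 2 ≤ Fintype.card ε * ∑ e, c e ^ 2 := by
  have := sq_sum_le_card_mul_sum_sq (s := Finset.univ) (f := fun e => |c e|)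
  simpa using this

lemma abs_le_of_posDef {S : ε → ε → ℝ} {κ ρ : ℝ} (hκ : 0 < κ)
    (hS : ∀ c : ε → ℝ, κ * ∑ e, c e ^ 2 ≤ ∑ e, c e * ∑ e', S e e' * c e') {d r : ε → ℝ}
    (hd : ∀ e, ∑ e', S e e' * d e' = r e) (hr : ∀ e, |r e| ≤ ρ) (e : ε) :
    |d e| ≤ Fintype.card ε * ρ / κ := by
  have hρ : 0 ≤ ρ := (abs_nonneg _).trans (hr e)
  have h1 := hS d
  simp only [hd] at h1
  set A := ∑ e, |d e| with hA
  have hA0 : 0 ≤ A := sum_nonneg fun _ _ => abs_nonneg _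
  have h2 : ∑ e, d e * r e ≤ ρ * A := by
    rw [hA, mul_sum]
    refine sum_le_sum fun e _ => (le_abs_self _).trans ?_
    rw [abs_mul, mul_comm]
    exact mul_le_mul_of_nonneg_right (hr e) (abs_nonneg _)
  have h3 := sum_abs_mul_le d d
  have h4 : |d e| ≤ A := single_le_sum (f := fun e => |d e|) (fun _ _ => abs_nonneg _) (Finset.mem_univ e)
  rw [le_div_iff₀ hκ]
  by_cases hA' : A = 0
  · rw [hA'] at h4
    have : |d e| = 0 := le_antisymm h4 (abs_nonneg _)
    rw [this, zero_mul]; positivity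
  · have hA1 : 0 < A := lt_of_le_of_ne hA0 (Ne.symm hA')
    have h5 : κ * A * A ≤ Fintype.card ε * ρ * A := by
      have : κ * A ^ 2 ≤ Fintype.card ε * (κ * ∑ e, d e ^ 2) := by
        calc κ * A ^ 2 ≤ κ * (Fintype.card ε * ∑ e, d e ^ 2) := by gcongr
          _ = _ := by ring
      have h6 : (Fintype.card ε : ℝ) * (κ * ∑ e, d e ^ 2) ≤ Fintype.card ε * (ρ * A) := by
        exact mul_le_mul_of_nonneg_left (h1.trans h2) (Nat.cast_nonneg _)
      nlinarith
    have h7 := le_of_mul_le_mul_right h5 hA1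
    nlinarith

lemma posDef_of_close {S S' : ε → ε → ℝ} {κ η : ℝ} (hη : 0 ≤ η)
    (hS : ∀ c : ε → ℝ, κ * ∑ e, c e ^ 2 ≤ ∑ e, c e * ∑ e', S e e' * c e')
    (hSS : ∀ e e', |S' e e' - S e e'| ≤ η) (hκη : Fintype.card ε * η ≤ κ / 2) (c : ε → ℝ) :
    κ / 2 * ∑ e, c e ^ 2 ≤ ∑ e, c e * ∑ e', S' e e' * c e' := by
  have h1 : |∑ e, c e * ∑ e', S' e e' * c e' - ∑ e, c e * ∑ e', S e e' * c e'| ≤ η * (∑ e, |c e|) ^ 2 := by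
    rw [← sum_sub_distrib, pow_two, sum_mul_sum, mul_sum]
    refine (abs_sum_le_sum_abs _ _).trans (sum_le_sum fun e _ => ?_)
    rw [← mul_sub, ← sum_sub_distrib, mul_sum, mul_sum]
    refine (abs_sum_le_sum_abs _ _).trans (sum_le_sum fun e' _ => ?_)
    rw [← sub_mul, abs_mul, abs_mul]
    calc |c e| * (|S' e e' - S e e'| * |c e'|) ≤ |c e| * (η * |c e'|) := by
          gcongr; exact hSS e e'
      _ = _ := by ring
  have h2 := sum_abs_mul_le c c
  have h3 := (abs_le.1 h1).1
  have h4 : 0 ≤ ∑ e, c e ^ 2 := sum_nonneg fun _ _ => sq_nonneg _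
  have h5 : η * (∑ e, |c e|) ^ 2 ≤ κ / 2 * ∑ e, c e ^ 2 := by
    calc _ ≤ η * (Fintype.card ε * ∑ e, c e ^ 2) := by gcongr
      _ = (Fintype.card ε * η) * ∑ e, c e ^ 2 := by ring
      _ ≤ _ := by gcongr
  linarith [hS c]

/-- A column of the inverse of a matrix, as a function of its entries. -/
def invCol (e₀ : ε) (S : ε → ε → ℝ) (e : ε) : ℝ := (Matrix.of S)⁻¹ e e₀

lemma measurable_invCol (e₀ e : ε) : Measurable fun S : ε → ε → ℝ => invCol e₀ S e := by
  have h : ∀ S : ε → ε → ℝ, invCol e₀ S e =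
      ((Matrix.of S).det)⁻¹ * (Matrix.of S).adjugate e e₀ := fun S => by
    rw [invCol, Matrix.inv_def, Matrix.smul_apply, Ring.inverse_eq_inv', smul_eq_mul]
  simp only [h]
  have hc : Continuous fun S : ε → ε → ℝ => (Matrix.of S : Matrix ε ε ℝ) := continuous_id
  exact (hc.matrix_det.measurable.inv).mul ((hc.matrix_adjugate.matrix_elem e e₀).measurable)

lemma sum_mul_invCol {S : ε → ε → ℝ} {κ : ℝ} (hκ : 0 < κ)
    (hS : ∀ c : ε → ℝ, κ * ∑ e, c e ^ 2 ≤ ∑ e, c e * ∑ e', S e e' * c e') (e₀ e : ε) :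
    ∑ e', S e e' * invCol e₀ S e' = if e = e₀ then 1 else 0 := by
  have hinj : IsUnit (Matrix.of S).det := by
    rw [isUnit_iff_ne_zero]
    intro hdet
    obtain ⟨v, hv, hv0⟩ := Matrix.exists_mulVec_eq_zero_iff.2 hdet
    have h1 := abs_le_of_posDef (ρ := 0) hκ hS (d := v) (r := 0) (fun e => by
      have := congrFun hv0 e
      simpa [Matrix.mulVec, dotProduct] using this) (fun e => by simp)
    refine hv (funext fun e => ?_)
    have := h1 e
    simpa using this
  have := congrFun (congrFun (Matrix.mul_nonsing_inv _ hinj) e) e₀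
  rw [Matrix.mul_apply, Matrix.one_apply] at this
  exact this

lemma abs_sub_sum_invCol_le {S S' : ε → ε → ℝ} {κ η ρ : ℝ} (hκ : 0 < κ) (hη : 0 ≤ η)
    (hsymm : ∀ e e', S e e' = S e' e)
    (hS : ∀ c : ε → ℝ, κ * ∑ e, c e ^ 2 ≤ ∑ e, c e * ∑ e', S e e' * c e')
    (hSS : ∀ e e', |S' e e' - S e e'| ≤ η) (hκη : Fintype.card ε * η ≤ κ / 2) {d r : ε → ℝ}
    (hd : ∀ e, ∑ e', S' e e' * d e' = r e) (hr : ∀ e, |r e| ≤ ρ) (e₀ : ε) :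
    |d e₀ - ∑ e, invCol e₀ S e * r e| ≤ 2 * (Fintype.card ε) ^ 4 / κ ^ 2 * (η * ρ) := by
  set M : ℝ := (Fintype.card ε : ℝ) with hM
  have hM0 : 0 ≤ M := Nat.cast_nonneg _
  have hρ : 0 ≤ ρ := (abs_nonneg _).trans (hr e₀)
  have ha : ∀ e, |invCol e₀ S e| ≤ M / κ := fun e => by
    have := abs_le_of_posDef (ρ := 1) hκ hS (sum_mul_invCol hκ hS e₀) (fun e => by split_ifs <;> simp) e
    rwa [mul_one] at this
  have hd' : ∀ e, |d e| ≤ 2 * M * ρ / κ := fun e => by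
    have := abs_le_of_posDef (half_pos hκ) (posDef_of_close hη hS hSS hκη) hd hr e
    refine this.trans (le_of_eq ?_)
    rw [hM]; field_simp
  have h1 : d e₀ - ∑ e, invCol e₀ S e * r e = ∑ e, invCol e₀ S e * ∑ e', (S e e' - S' e e') * d e' := by
    have h2 : d e₀ = ∑ e, invCol e₀ S e * ∑ e', S e e' * d e' := by
      have h3 : ∑ e, invCol e₀ S e * ∑ e', S e e' * d e' = ∑ e', (∑ e, S e' e * invCol e₀ S e) * d e' := by
        simp only [mul_sum, sum_mul]
        rw [sum_comm]
        exact sum_congr rfl fun e' _ => sum_congr rfl fun e _ => by rw [hsymm e' e]; ring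
      rw [h3]
      simp only [sum_mul_invCol hκ hS]
      simp
    conv_lhs => rw [h2]
    rw [← sum_sub_distrib]
    refine sum_congr rfl fun e _ => ?_
    rw [← hd e, ← mul_sub, ← sum_sub_distrib]
    simp only [sub_mul]
  rw [h1]
  calc |∑ e, invCol e₀ S e * ∑ e', (S e e' - S' e e') * d e'|
      ≤ ∑ _e : ε, M / κ * ∑ _e' : ε, η * (2 * M * ρ / κ) := by
        refine (abs_sum_le_sum_abs _ _).trans (sum_le_sum fun e _ => ?_)
        rw [abs_mul]
        refine mul_le_mul (ha e) ?_ (abs_nonneg _) (by positivity)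
        refine (abs_sum_le_sum_abs _ _).trans (sum_le_sum fun e' _ => ?_)
        rw [abs_mul]
        refine mul_le_mul ?_ (hd' e') (abs_nonneg _) hη
        rw [abs_sub_comm]; exact hSS e e'
    _ = _ := by
        simp only [sum_const, card_univ, nsmul_eq_mul, ← hM]
        field_simp

end LocalLinear

/-! ### Kernel moments of the design -/

variable [DecidableEq ι]

/-- The multiplicity of the coordinate `k` in the design index `e`. -/
def cnt (e : Option ι) (k : ι) : ℕ := if e = some k then 1 else 0

/-- The design function with index `e`: the constant one or a rescaled coordinate. -/
def dsg (h x : ι → ℝ) (e : Option ι) (u : ι → ℝ) : ℝ := e.elim 1 fun k => (u k - x k) / h k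

/-- The kernel factors of the product of two design functions. -/
def momKer (K : ℝ → ℝ) (e e' : Option ι) (k : ι) : ℝ → ℝ := kerPow K (cnt e k + cnt e' k)

lemma momKer_comm (K : ℝ → ℝ) (e e' : Option ι) : momKer K e e' = momKer K e' e := by
  funext k; rw [momKer, momKer, add_comm]

lemma prod_pow_cnt (e : Option ι) (v : ι → ℝ) : ∏ k, v k ^ cnt e k = e.elim 1 v := by
  cases e with
  | none => simp [cnt]
  | some k =>
    rw [prod_eq_single k]
    · simp [cnt]
    · intro l _ hl; simp [cnt, hl.symm]
    · simp

lemma prodKer_momKer (K : ℝ → ℝ) (e e' : Option ι) (h x u : ι → ℝ) :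
    prodKer (momKer K e e') h x u = prodKer (fun _ => K) h x u * (dsg h x e u * dsg h x e' u) := by
  unfold prodKer momKer kerPow dsg
  rw [prod_mul_distrib]
  congr 1
  simp only [pow_add]
  rw [prod_mul_distrib, prod_pow_cnt, prod_pow_cnt]

lemma IsKernel.exists_stepApprox_momKer {K : ℝ → ℝ} (hK : IsKernel K) :
    ∃ M : ℝ, 0 ≤ M ∧ ∀ (e e' : Option ι), ∃ M' : ι → ℝ, (∀ k, StepApprox (momKer K e e' k) (M' k)) ∧
      ∏ k, M' k ≤ M := by
  choose m hm using hK.exists_stepApprox_kerPow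
  have hm0 : ∀ j, 0 ≤ m j := fun j => (hm j).nonneg
  refine ⟨∑ e : Option ι, ∑ e' : Option ι, ∏ k, m (cnt e k + cnt e' k),
    sum_nonneg fun e _ => sum_nonneg fun e' _ => prod_nonneg fun k _ => hm0 _,
    fun e e' => ⟨fun k => m (cnt e k + cnt e' k), fun k => hm _, ?_⟩⟩
  have h1 : ∀ e e' : Option ι, 0 ≤ ∏ k, m (cnt e k + cnt e' k) := fun e e' => prod_nonneg fun k _ => hm0 _
  refine le_trans ?_ (single_le_sum (f := fun e => ∑ e' : Option ι, ∏ k, m (cnt e k + cnt e' k))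
    (fun e _ => sum_nonneg fun e' _ => h1 e e') (Finset.mem_univ e))
  exact single_le_sum (f := fun e' => ∏ k, m (cnt e k + cnt e' k)) (fun e' _ => h1 e e')
    (Finset.mem_univ _)

/-- The moments of the right half of the kernel. -/
def halfMom (K : ℝ → ℝ) (j : ℕ) : ℝ := ∫ v in (0 : ℝ)..1, kerPow K j v

variable {K : ℝ → ℝ}

lemma IsKernel.intervalIntegrable_kerPow (hK : IsKernel K) (j : ℕ) (a b : ℝ) :
    IntervalIntegrable (kerPow K j) volume a b := by
  obtain ⟨M, hM⟩ := hK.exists_stepApprox_kerPow j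
  refine (intervalIntegrable_const (c := M)).mono_fun hM.measurable.aestronglyMeasurable
    (ae_of_all _ fun v => ?_)
  simp only [norm_eq_abs]
  exact (hM.abs_le v).trans (le_abs_self M)

lemma IsKernel.halfMom_zero (hK : IsKernel K) : halfMom K 0 = 1 / 2 := by
  have h0 : kerPow K 0 = K := by funext v; simp [kerPow]
  have hi := hK.intervalIntegrable_kerPow 0
  rw [h0] at hi
  have h1 := intervalIntegral.integral_add_adjacent_intervals (hi (-1) 0) (hi 0 1)
  rw [hK.integral_eq_one] at h1
  have h2 : ∫ v in (-1 : ℝ)..0, K v = ∫ v in (0 : ℝ)..1, K v := by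
    have := intervalIntegral.integral_comp_neg (a := 0) (b := 1) K
    simp only [hK.symm, neg_zero] at this
    exact this.symm
  rw [halfMom, h0]
  linarith

lemma IsKernel.halfMom_var_pos (hK : IsKernel K) : 0 < halfMom K 2 * halfMom K 0 - halfMom K 1 ^ 2 := by
  have hm0 := hK.halfMom_zero
  set m := halfMom K 1 / halfMom K 0 with hm
  have h1 : ∫ v in (0 : ℝ)..1, K v * (v - m) ^ 2 =
      halfMom K 2 - 2 * m * halfMom K 1 + m ^ 2 * halfMom K 0 := by
    have e : ∀ v, K v * (v - m) ^ 2 = kerPow K 2 v - 2 * m * kerPow K 1 v + m ^ 2 * kerPow K 0 v :=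
      fun v => by simp only [kerPow]; ring
    have i := fun j => hK.intervalIntegrable_kerPow j 0 1
    simp only [e]
    rw [intervalIntegral.integral_add ((i 2).sub ((i 1).const_mul _)) ((i 0).const_mul _),
      intervalIntegral.integral_sub (i 2) ((i 1).const_mul _), intervalIntegral.integral_const_mul,
      intervalIntegral.integral_const_mul]
    rfl
  have h2 : 0 < ∫ v in (0 : ℝ)..1, K v * (v - m) ^ 2 := by
    have hnn : ∀ v, 0 ≤ K v * (v - m) ^ 2 := fun v => mul_nonneg (hK.nonneg v) (sq_nonneg _)
    refine lt_of_le_of_ne (intervalIntegral.integral_nonneg zero_le_one fun v _ => hnn v) fun h0 => ?_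
    have hInt : IntervalIntegrable (fun v => K v * (v - m) ^ 2) volume 0 1 := by
      have i := fun j => hK.intervalIntegrable_kerPow j 0 1
      refine (((i 2).sub ((i 1).const_mul (2 * m))).add ((i 0).const_mul (m ^ 2))).congr (fun v _ => ?_)
      simp only [kerPow]; ring
    rw [intervalIntegral.integral_of_le zero_le_one] at h0
    rw [intervalIntegrable_iff_integrableOn_Ioc_of_le zero_le_one] at hInt
    have h3 := (integral_eq_zero_iff_of_nonneg_ae (ae_of_all _ hnn) hInt).1 h0.symm
    have h4 : ∀ᵐ v ∂volume.restrict (Ioc (0 : ℝ) 1), K v = 0 := by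
      have h5 : ∀ᵐ v ∂volume.restrict (Ioc (0 : ℝ) 1), v ≠ m := ae_restrict_of_ae (by simp [ae_iff])
      filter_upwards [h3, h5] with v hv hvm
      rcases mul_eq_zero.1 hv with h | h
      · exact h
      · exact absurd (sub_eq_zero.1 (pow_eq_zero_iff (by norm_num) |>.1 h)) hvm
    have h6 : halfMom K 0 = 0 := by
      rw [halfMom, intervalIntegral.integral_of_le zero_le_one]
      exact integral_eq_zero_of_ae (by filter_upwards [h4] with v hv; simp [kerPow, hv])
    rw [hm0] at h6
    norm_num at h6
  rw [h1, hm, hm0] at h2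
  rw [hm0]
  nlinarith

/-- The integral of a moment kernel over the half of the kernel window given by the sign `s`. -/
lemma integral_half_kerPow (hK : IsKernel K) (j : ℕ) {h : ℝ} (hh : 0 < h) (x : ℝ) {s : ℝ}
    (hs : s = 1 ∨ s = -1) :
    ∫ u, kerPow K j ((u - x) / h) * (Icc (0 : ℝ) 1).indicator 1 (s * ((u - x) / h)) =
      h * (s ^ j * halfMom K j) := by
  have h1 : ∫ u, kerPow K j ((u - x) / h) * (Icc (0 : ℝ) 1).indicator 1 (s * ((u - x) / h)) =
      h * ∫ v, kerPow K j v * (Icc (0 : ℝ) 1).indicator 1 (s * v) := by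
    rw [integral_sub_right_eq_self (fun u => kerPow K j (u / h) * (Icc (0 : ℝ) 1).indicator 1
      (s * (u / h))) x, Measure.integral_comp_div (fun v => kerPow K j v *
        (Icc (0 : ℝ) 1).indicator 1 (s * v)) h, abs_of_pos hh, smul_eq_mul]
  have h3 : ∫ v, kerPow K j v * (Icc (0 : ℝ) 1).indicator 1 v = halfMom K j := by
    have : ∀ v, kerPow K j v * (Icc (0 : ℝ) 1).indicator 1 v = (Icc (0 : ℝ) 1).indicator (kerPow K j) v :=
      fun v => by by_cases hv : v ∈ Icc (0 : ℝ) 1 <;> simp [hv]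
    simp only [this]
    rw [integral_indicator measurableSet_Icc, integral_Icc_eq_integral_Ioc, halfMom,
      intervalIntegral.integral_of_le zero_le_one]
  have h2 : ∫ v, kerPow K j v * (Icc (0 : ℝ) 1).indicator 1 (s * v) = s ^ j * halfMom K j := by
    rcases hs with rfl | rfl
    · simpa using h3
    · rw [← integral_neg_eq_self, ← h3, ← integral_const_mul]
      refine integral_congr_ae (ae_of_all _ fun v => ?_)
      simp only [kerPow, hK.symm, neg_mul, one_mul, neg_neg]
      rw [show (-v) ^ j = (-1) ^ j * v ^ j by rw [← mul_pow]; simp]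
      ring
  rw [h1, h2]

lemma sum_prod_halfMom_ge (hK : IsKernel K) : ∃ κ : ℝ, 0 < κ ∧ ∀ c : Option ι → ℝ, κ * ∑ e, c e ^ 2 ≤
      ∑ e, ∑ e', c e * c e' * ∏ k : ι, halfMom K (cnt e k + cnt e' k) := by
  have hm0 := hK.halfMom_zero
  have hvar := hK.halfMom_var_pos
  set m := 2 * halfMom K 1 with hm
  set s2 := 4 * (halfMom K 2 * halfMom K 0 - halfMom K 1 ^ 2) with hs2
  have hs20 : 0 < s2 := by positivity
  set M : Option ι → ℝ := fun e => e.elim 1 fun _ => m with hM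
  set n : ℝ := (Fintype.card ι : ℝ) with hn
  set p0 := (1 / 2 : ℝ) ^ Fintype.card ι with hp0
  have key : ∀ e e' : Option ι, ∏ k : ι, halfMom K (cnt e k + cnt e' k) =
      p0 * (M e * M e' + if e = e' then e.elim 0 fun _ => s2 else 0) := by
    intro e e'
    have h1 : ∀ j, halfMom K j = 1 / 2 * (2 * halfMom K j) := fun j => by ring
    rw [prod_congr rfl fun k _ => h1 _, prod_mul_distrib, prod_const, card_univ, ← hp0]
    congr 1
    set t : ℕ → ℝ := fun j => 2 * halfMom K j with ht
    have ht0 : t 0 = 1 := by simp only [ht, hm0]; norm_num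
    have ht1 : t 1 = m := rfl
    have ht2 : t 2 = m * m + s2 := by simp only [ht, hm, hs2, hm0]; ring
    change ∏ k : ι, t (cnt e k + cnt e' k) = _
    cases e with
    | none =>
      cases e' with
      | none => simp [cnt, ht0, hM]
      | some k =>
        rw [prod_eq_single k (fun l _ hl => by simp [cnt, hl.symm, ht0]) (by simp)]
        simp [cnt, hM, ht1]
    | some k =>
      cases e' with
      | none =>
        rw [prod_eq_single k (fun l _ hl => by simp [cnt, hl.symm, ht0]) (by simp)]
        simp [cnt, hM, ht1]
      | some l =>
        by_cases hkl : k = l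
        · subst hkl
          rw [prod_eq_single k (fun l _ hl => by simp [cnt, hl.symm, ht0]) (by simp)]
          simp [cnt, hM, ht2]
        · rw [Finset.prod_eq_mul k l hkl
            (fun j _ hj => by simp [cnt, hj.1.symm, hj.2.symm, ht0]) (by simp) (by simp)]
          simp [cnt, hM, ht1, hkl, Ne.symm hkl]
  refine ⟨p0 * (min (1 / 2) (s2 / (2 * m ^ 2 * n + 1))), by positivity, fun c => ?_⟩
  set κ := min (1 / 2) (s2 / (2 * m ^ 2 * n + 1)) with hκ
  set Y := ∑ e, c e * M e with hY
  set Q2 := ∑ k : ι, c (some k) ^ 2 with hQ2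
  have h2 : ∑ e, ∑ e', c e * c e' * ∏ k : ι, halfMom K (cnt e k + cnt e' k) = p0 * (Y ^ 2 + s2 * Q2) := by
    simp only [key]
    have h3 : ∀ e e' : Option ι, c e * c e' * (p0 * (M e * M e' + if e = e' then e.elim 0 fun _ => s2 else 0))
        = p0 * ((c e * M e) * (c e' * M e')) + if e = e' then p0 * (c e * c e' * e.elim 0 fun _ => s2) else 0 := by
      intro e e'; split_ifs <;> ring
    simp only [h3, sum_add_distrib, ← mul_sum, ← sum_mul, sum_ite_eq, Finset.mem_univ, if_true]
    rw [← hY, Fintype.sum_option]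
    simp only [Option.elim_none, Option.elim_some, mul_zero, zero_add]
    rw [mul_add, hQ2, mul_sum]
    congr 1
    · simp only [mul_assoc, ← mul_sum]
      rw [← hY]; ring
    · congr 1
      rw [mul_sum]
      exact sum_congr rfl fun k _ => by ring
  rw [h2, mul_assoc]
  refine mul_le_mul_of_nonneg_left ?_ (by positivity)
  rw [Fintype.sum_option, ← hQ2]
  have hYe : c none = Y - m * ∑ k : ι, c (some k) := by
    rw [hY, Fintype.sum_option, mul_sum]
    simp only [hM, Option.elim_none, Option.elim_some, mul_one]
    rw [sum_congr rfl fun k _ => mul_comm (c (some k)) m]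
    ring
  have hcs : (∑ k : ι, c (some k)) ^ 2 ≤ n * Q2 := by
    have := sq_sum_le_card_mul_sum_sq (s := Finset.univ) (f := fun k : ι => c (some k))
    simpa using this
  have hQ20 : 0 ≤ Q2 := sum_nonneg fun _ _ => sq_nonneg _
  have hn0 : 0 ≤ n := Nat.cast_nonneg _
  have h4 : c none ^ 2 + Q2 ≤ 2 * Y ^ 2 + (2 * m ^ 2 * n + 1) * Q2 := by
    have h5 : c none ^ 2 ≤ 2 * Y ^ 2 + 2 * (m ^ 2 * (∑ k : ι, c (some k)) ^ 2) := by
      rw [hYe]; nlinarith [sq_nonneg (Y + m * ∑ k : ι, c (some k))]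
    have h6 : m ^ 2 * (∑ k : ι, c (some k)) ^ 2 ≤ m ^ 2 * (n * Q2) := by gcongr
    nlinarith
  have hκ1 : κ ≤ 1 / 2 := min_le_left _ _
  have hκ2 : κ * (2 * m ^ 2 * n + 1) ≤ s2 := by
    have h7 : κ ≤ s2 / (2 * m ^ 2 * n + 1) := min_le_right _ _
    rwa [le_div_iff₀ (by positivity)] at h7
  have hκ0 : 0 ≤ κ := by positivity
  calc κ * (c none ^ 2 + Q2) ≤ κ * (2 * Y ^ 2 + (2 * m ^ 2 * n + 1) * Q2) := by gcongr
    _ = (2 * κ) * Y ^ 2 + κ * (2 * m ^ 2 * n + 1) * Q2 := by ring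
    _ ≤ 1 * Y ^ 2 + s2 * Q2 := by gcongr; linarith
    _ = _ := by ring

/-- The population moments of the design. -/
def designMom (K : ℝ → ℝ) (ν : Measure (ι → ℝ)) (h x : ι → ℝ) (e e' : Option ι) : ℝ :=
  (∏ k, h k)⁻¹ * ∫ u, prodKer (momKer K e e') h x u ∂ν

lemma designMom_symm (ν : Measure (ι → ℝ)) (h x : ι → ℝ) (e e' : Option ι) :
    designMom K ν h x e e' = designMom K ν h x e' e := by
  rw [designMom, designMom, momKer_comm]

lemma IsKernel.measurable_momKer (hK : IsKernel K) (e e' : Option ι) (k : ι) :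
    Measurable (momKer K e e' k) := by
  obtain ⟨M, hM⟩ := hK.exists_stepApprox_kerPow (cnt e k + cnt e' k)
  exact hM.measurable

lemma IsKernel.measurable_designMom (hK : IsKernel K) (ν : Measure (ι → ℝ)) [SFinite ν] (h : ι → ℝ)
    (e e' : Option ι) : Measurable fun x => designMom K ν h x e e' := by
  unfold designMom
  refine Measurable.const_mul ?_ _
  have := (measurable_prodKer (hK.measurable_momKer e e') h).stronglyMeasurable
  exact (this.integral_prod_right (ν := ν)).measurable

lemma exists_designMom_ge (hK : IsKernel K) {ν : Measure (ι → ℝ)} [IsFiniteMeasure ν] {κ₀ : NNReal}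
    (hκ₀ : 0 < κ₀) {lo hi : ι → ℝ} (hν : κ₀ • volume.restrict (Icc lo hi) ≤ ν) :
    ∃ κ : ℝ, 0 < κ ∧ ∀ h x : ι → ℝ, (∀ k, 0 < h k) → (∀ k, 2 * h k ≤ hi k - lo k) → x ∈ Icc lo hi →
      ∀ c : Option ι → ℝ, κ * ∑ e, c e ^ 2 ≤ ∑ e, c e * ∑ e', designMom K ν h x e e' * c e' := by
  obtain ⟨κ, hκ, hκ'⟩ := sum_prod_halfMom_ge (ι := ι) hK
  obtain ⟨M, hM0, hM⟩ := hK.exists_stepApprox_momKer (ι := ι)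
  refine ⟨κ₀ * κ, by positivity, fun h x hh hhi hx c => ?_⟩
  have hH : 0 < ∏ k, h k := prod_pos fun k _ => hh k
  have hbd : ∀ e e' : Option ι, ∀ u, |prodKer (momKer K e e') h x u| ≤ M := fun e e' u => by
    obtain ⟨M', hM', hle⟩ := hM e e'
    exact (abs_prodKer_le (fun k v => (hM' k).abs_le v) h x u).trans hle
  have hmeas : ∀ e e' : Option ι, Measurable (prodKer (momKer K e e') h x) := fun e e' =>
    (measurable_prodKer (hK.measurable_momKer e e') h).comp measurable_prodMk_left
  set s : ι → ℝ := fun k => if x k + h k ≤ hi k then 1 else -1 with hs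
  have hs1 : ∀ k, s k = 1 ∨ s k = -1 := fun k => by simp only [hs]; split_ifs <;> simp
  set J : (ι → ℝ) → ℝ := fun u => ∏ k, (Icc (0 : ℝ) 1).indicator 1 (s k * ((u k - x k) / h k)) with hJ
  have hJ0 : ∀ u, 0 ≤ J u := fun u => prod_nonneg fun k _ => indicator_nonneg (fun _ _ => zero_le_one) _
  have hJ1 : ∀ u, J u ≤ 1 := fun u => Finset.prod_le_one (fun k _ =>
    indicator_nonneg (fun _ _ => zero_le_one) _) fun k _ => indicator_le_self' (fun _ _ => zero_le_one) _
  have hJm : Measurable J := Finset.measurable_prod _ fun k _ =>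
    (measurable_const.indicator measurableSet_Icc).comp (by fun_prop)
  have hJbox : ∀ u, u ∉ Icc lo hi → J u = 0 := by
    intro u hu
    by_contra hne
    refine hu ⟨fun k => ?_, fun k => ?_⟩ <;>
    · have h1 : s k * ((u k - x k) / h k) ∈ Icc (0 : ℝ) 1 := by
        by_contra hc
        exact hne (prod_eq_zero (Finset.mem_univ k) (indicator_of_notMem hc _))
      have h2 := hh k
      have h3 := hhi k
      have h4 := hx.1 k
      have h5 := hx.2 k
      simp only [hs] at h1
      split_ifs at h1 with hc
      · rw [one_mul, mem_Icc, div_nonneg_iff, div_le_one h2] at h1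
        obtain ⟨h6 | h6, h7⟩ := h1 <;> linarith
      · have h1' : 0 ≤ (x k - u k) / h k ∧ (x k - u k) / h k ≤ 1 := by
          rw [show (x k - u k) / h k = -1 * ((u k - x k) / h k) by ring]; exact h1
        rw [div_nonneg_iff, div_le_one h2] at h1'
        obtain ⟨h6 | h6, h7⟩ := h1' <;> linarith
  set F : (ι → ℝ) → ℝ := fun u => ∑ e, ∑ e', c e * c e' * prodKer (momKer K e e') h x u with hF
  have hF0 : ∀ u, 0 ≤ F u := by
    intro u
    have : F u = prodKer (fun _ => K) h x u * (∑ e, c e * dsg h x e u) ^ 2 := by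
      simp only [hF, prodKer_momKer]
      rw [pow_two, sum_mul_sum, mul_sum]
      refine sum_congr rfl fun e _ => ?_
      rw [mul_sum]
      exact sum_congr rfl fun e' _ => by ring
    rw [this]
    exact mul_nonneg (prod_nonneg fun k _ => hK.nonneg _) (sq_nonneg _)
  have hFm : Measurable F := measurable_sum _ fun e _ => measurable_sum _ fun e' _ =>
    (hmeas e e').const_mul _
  have hFi : ∀ (ρ : Measure (ι → ℝ)) [IsFiniteMeasure ρ], ∀ e e', Integrable (prodKer (momKer K e e') h x) ρ :=
    fun ρ _ e e' => .of_bound (hmeas e e').aestronglyMeasurable M (ae_of_all _ (hbd e e'))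
  have hFi' : ∀ (ρ : Measure (ι → ℝ)) [IsFiniteMeasure ρ], Integrable F ρ := fun ρ _ =>
    integrable_finsetSum _ fun e _ => integrable_finsetSum _ fun e' _ => (hFi ρ e e').const_mul _
  have hlhs : ∑ e, c e * ∑ e', designMom K ν h x e e' * c e' = (∏ k, h k)⁻¹ * ∫ u, F u ∂ν := by
    simp only [hF]
    rw [integral_finsetSum _ fun e _ => integrable_finsetSum _ fun e' _ => (hFi ν e e').const_mul _,
      mul_sum]
    refine sum_congr rfl fun e _ => ?_
    rw [integral_finsetSum _ fun e' _ => (hFi ν e e').const_mul _, mul_sum, mul_sum]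
    refine sum_congr rfl fun e' _ => ?_
    rw [integral_const_mul, designMom]; ring
  haveI : IsFiniteMeasure (volume.restrict (Icc lo hi)) := ⟨by
    rw [Measure.restrict_apply_univ]; exact (isCompact_Icc).measure_lt_top⟩
  have hge : κ₀ * ∫ u, F u * J u ≤ ∫ u, F u ∂ν := by
    have h1 : ∫ u, F u * J u = ∫ u in Icc lo hi, F u * J u := by
      rw [setIntegral_eq_integral_of_forall_compl_eq_zero fun u hu => by rw [hJbox u hu, mul_zero]]
    rw [h1]
    calc (κ₀ : ℝ) * ∫ u in Icc lo hi, F u * J u ≤ κ₀ * ∫ u in Icc lo hi, F u := by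
          gcongr ?_ * ?_
          refine integral_mono_of_nonneg (ae_of_all _ fun u => mul_nonneg (hF0 u) (hJ0 u))
            (hFi' _) (ae_of_all _ fun u => ?_)
          exact mul_le_of_le_one_right (hF0 u) (hJ1 u)
      _ = ∫ u, F u ∂(κ₀ • volume.restrict (Icc lo hi)) := by rw [integral_smul_nnreal_measure]; rfl
      _ ≤ ∫ u, F u ∂ν := integral_mono_measure hν (ae_of_all _ hF0) (hFi' ν)
  have hval : ∫ u, F u * J u = (∏ k, h k) * ∑ e, ∑ e', (c e * e.elim 1 s) * (c e' * e'.elim 1 s) *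
      ∏ k : ι, halfMom K (cnt e k + cnt e' k) := by
    have hprod : ∀ e e' : Option ι, ∀ u, prodKer (momKer K e e') h x u * J u =
        ∏ k, (kerPow K (cnt e k + cnt e' k) ((u k - x k) / h k) *
          (Icc (0 : ℝ) 1).indicator 1 (s k * ((u k - x k) / h k))) := fun e e' u => by
      rw [prod_mul_distrib]; rfl
    have hInt : ∀ e e' : Option ι, Integrable fun u => prodKer (momKer K e e') h x u * J u := by
      intro e e'
      have h1 : IntegrableOn (fun u => prodKer (momKer K e e') h x u * J u) (Icc lo hi) :=
        (hFi _ e e').mul_bdd (c := 1) hJm.aestronglyMeasurable (ae_of_all _ fun u => by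
          rw [norm_of_nonneg (hJ0 u)]; exact hJ1 u)
      refine (integrableOn_iff_integrable_of_support_subset fun u hu => ?_).1 h1
      by_contra hc
      exact hu (by simp [hJbox u hc])
    simp only [hF, sum_mul]
    rw [integral_finsetSum _ fun e _ => integrable_finsetSum _ fun e' _ => by
      simpa only [mul_assoc] using (hInt e e').const_mul (c e * c e'), mul_sum]
    refine sum_congr rfl fun e _ => ?_
    rw [integral_finsetSum _ fun e' _ => by
      simpa only [mul_assoc] using (hInt e e').const_mul (c e * c e'), mul_sum]
    refine sum_congr rfl fun e' _ => ?_
    have h2 : ∀ u, c e * c e' * prodKer (momKer K e e') h x u * J u =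
        c e * c e' * ∏ k, (kerPow K (cnt e k + cnt e' k) ((u k - x k) / h k) *
          (Icc (0 : ℝ) 1).indicator 1 (s k * ((u k - x k) / h k))) := fun u => by
      rw [mul_assoc, hprod]
    simp only [h2]
    rw [integral_const_mul, integral_fintype_prod_volume_eq_prod (𝕜 := ℝ) (fun k v =>
      kerPow K (cnt e k + cnt e' k) ((v - x k) / h k) *
        (Icc (0 : ℝ) 1).indicator 1 (s k * ((v - x k) / h k)))]
    simp only [integral_half_kerPow hK _ (hh _) _ (hs1 _)]
    rw [prod_mul_distrib, prod_mul_distrib]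
    simp only [pow_add]
    rw [prod_mul_distrib, prod_pow_cnt, prod_pow_cnt]
    ring
  have hfin := hκ' fun e => c e * e.elim 1 s
  have hsq : ∀ e : Option ι, (c e * e.elim 1 s) ^ 2 = c e ^ 2 := fun e => by
    cases e with
    | none => simp
    | some k => rcases hs1 k with h | h <;> simp [h]
  simp only [hsq] at hfin
  rw [hlhs]
  rw [hval] at hge
  calc (κ₀ : ℝ) * κ * ∑ e, c e ^ 2 = κ₀ * (κ * ∑ e, c e ^ 2) := by ring
    _ ≤ κ₀ * ∑ e, ∑ e', (c e * e.elim 1 s) * (c e' * e'.elim 1 s) *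
      ∏ k : ι, halfMom K (cnt e k + cnt e' k) := by gcongr
    _ = (∏ k, h k)⁻¹ * (κ₀ * ((∏ k, h k) * ∑ e, ∑ e', (c e * e.elim 1 s) * (c e' * e'.elim 1 s) *
      ∏ k : ι, halfMom K (cnt e k + cnt e' k))) := by field_simp
    _ ≤ _ := by gcongr

/-! ### Residuals of the curves -/

variable {xc : S → ℝ → ℝ^p → ℝ}

/-- The mean curve. -/
def curveMean (Pθ : Measure S) (xc : S → ℝ → ℝ^p → ℝ) (t : ℝ) (z : ℝ^p) : ℝ := ∫ θ, xc θ t z ∂Pθ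

/-- The pooled covariance of the curves. -/
def curveCov (Pθ : Measure S) (PZ : Measure ℝ^p) (xc : S → ℝ → ℝ^p → ℝ) (w : ℝ × ℝ) : ℝ :=
  ∫ z, ∫ θ, (xc θ w.1 z - curveMean Pθ xc w.1 z) * (xc θ w.2 z - curveMean Pθ xc w.2 z) ∂Pθ ∂PZ

/-- The deviation of the curve from its mean at the `j`-th observation time. -/
def curveDev (Pθ : Measure S) (xc : S → ℝ → ℝ^p → ℝ) (j : ℕ) (w : Base S p) : ℝ :=
  xc w.1 (w.2.2 j) w.2.1 - curveMean Pθ xc (w.2.2 j) w.2.1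

/-- The `j`-th observation. -/
def obsC (xc : S → ℝ → ℝ^p → ℝ) (j : ℕ) (d : Subj S p) : ℝ := xc d.1.1 (d.2 j) d.1.2.1 + d.1.2.2 j

/-- The deviation of the `j`-th observation from the mean. -/
def resid (Pθ : Measure S) (xc : S → ℝ → ℝ^p → ℝ) (j : ℕ) (d : Subj S p) : ℝ :=
  curveDev Pθ xc j (d.1.1, d.1.2.1, d.2) + d.1.2.2 j

lemma obsC_eq (j : ℕ) (d : Subj S p) : obsC xc j d = resid Pθ xc j d + curveMean Pθ xc (d.2 j) d.1.2.1 := by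
  simp only [obsC, resid, curveDev]; ring

/-- Conditions on the random curves. -/
structure CurveModel (Pθ : Measure S) (Pε : Measure ℝ) (mm : S → ℝ^p → ℝ)
    (xc : S → ℝ → ℝ^p → ℝ) : Prop where
  measurable_xc : Measurable fun v : S × ℝ × ℝ^p => xc v.1 v.2.1 v.2.2
  abs_xc_le : ∀ θ t z, |xc θ t z| ≤ mm θ z
  abs_dev_le : ∀ θ t z, |xc θ t z - curveMean Pθ xc t z| ≤ mm θ z
  integral_e : ∫ e, e ∂Pε = 0

local notation "𝒞" => CurveModel Pθ Pε mm xc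

/-- Regrouping of the data of a subject. -/
def regroup (d : Subj S p) : (Base S p) × (ℕ → ℝ) := ((d.1.1, d.1.2.1, d.2), d.1.2.2)

lemma measurePreserving_regroup : MeasurePreserving (regroup : Subj S p → _) ℒ
    ((Pθ.prod (PZ.prod PT^ℕ)).prod Pε^ℕ) := by
  set E := Pε^ℕ
  set T := PT^ℕ
  have h1 : MeasurePreserving (fun d : Subj S p => (d.1.1, (d.1.2, d.2))) ℒ
      (Pθ.prod ((PZ.prod E).prod T)) := measurePreserving_prodAssoc _ _ _
  have h2 : MeasurePreserving (fun w : (ℝ^p × (ℕ → ℝ)) × (ℕ → ℝ) => (w.1.1, (w.1.2, w.2)))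
      ((PZ.prod E).prod T) (PZ.prod (E.prod T)) := measurePreserving_prodAssoc _ _ _
  have h3 : MeasurePreserving (fun w : ℝ^p × (ℕ → ℝ) × (ℕ → ℝ) => (w.1, (w.2.2, w.2.1)))
      (PZ.prod (E.prod T)) (PZ.prod (T.prod E)) :=
    (MeasurePreserving.id PZ).prod Measure.measurePreserving_swap
  have h4 : MeasurePreserving (fun w : ℝ^p × (ℕ → ℝ) × (ℕ → ℝ) => ((w.1, w.2.1), w.2.2))
      (PZ.prod (T.prod E)) ((PZ.prod T).prod E) :=
    (measurePreserving_prodAssoc PZ T E).symm MeasurableEquiv.prodAssoc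
  have h5 : MeasurePreserving (fun w : S × (ℝ^p × (ℕ → ℝ)) × (ℕ → ℝ) => ((w.1, w.2.1), w.2.2))
      (Pθ.prod ((PZ.prod T).prod E)) ((Pθ.prod (PZ.prod T)).prod E) :=
    (measurePreserving_prodAssoc Pθ (PZ.prod T) E).symm MeasurableEquiv.prodAssoc
  exact h5.comp (((MeasurePreserving.id Pθ).prod (h4.comp (h3.comp h2))).comp h1)

lemma measurePreserving_regroup_fst : MeasurePreserving (fun d : Subj S p => (d.1.1, d.1.2.1, d.2)) ℒ
    (Pθ.prod (PZ.prod PT^ℕ)) :=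
  measurePreserving_fst.comp measurePreserving_regroup

lemma integral_regroup_mul {f : Base S p → ℝ} {φ : (ℕ → ℝ) → ℝ} (hf : Measurable f) (hφ : Measurable φ) :
    ∫ d, f (d.1.1, d.1.2.1, d.2) * φ d.1.2.2 ∂ℒ = (∫ w, f w ∂Pθ.prod (PZ.prod PT^ℕ)) * ∫ e, φ e ∂Pε^ℕ := by
  rw [← integral_prod_mul, ← (measurePreserving_regroup (Pθ := Pθ) (PZ := PZ) (PT := PT)
    (Pε := Pε)).map_eq, integral_map (measurePreserving_regroup (Pθ := Pθ) (PZ := PZ) (PT := PT)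
      (Pε := Pε)).measurable.aemeasurable
    (f := fun w : (Base S p) × (ℕ → ℝ) => f w.1 * φ w.2)
    ((hf.comp measurable_fst).mul (hφ.comp measurable_snd)).aestronglyMeasurable]
  rfl

lemma integral_regroup_fst {f : Base S p → ℝ} (hf : Measurable f) : ∫ d, f (d.1.1, d.1.2.1, d.2) ∂ℒ =
      ∫ w, f w ∂Pθ.prod (PZ.prod PT^ℕ) := by
  have := integral_regroup_mul (Pθ := Pθ) (PZ := PZ) (PT := PT) (Pε := Pε) hf
    (φ := fun _ => 1) measurable_const
  simpa using this

lemma integral_eval_infinitePi (hPε : ∫ e, e ∂Pε = 0) (j : ℕ) : ∫ e : ℕ → ℝ, e j ∂Pε^ℕ = 0 := by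
  have h : ∫ x, x ∂(Pε^ℕ.map fun e : ℕ → ℝ => e j) = ∫ e : ℕ → ℝ, e j ∂Pε^ℕ :=
    integral_map (measurable_pi_apply j).aemeasurable measurable_id.aestronglyMeasurable
  rw [← h, infinitePi_map_eval (fun _ : ℕ => Pε) j, hPε]

lemma SubjModel.integrable_mm_rpow (H : ℳ q) (z : ℝ^p) : Integrable (fun θ => mm θ z ^ q) Pθ := by
  obtain ⟨M, hM⟩ := H.moment_mm
  refine ⟨((H.measurable_mm.comp measurable_prodMk_right).pow_const q).aestronglyMeasurable, ?_⟩
  rw [hasFiniteIntegral_iff_ofReal (ae_of_all _ fun θ =>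
    rpow_nonneg (zero_le_one.trans (H.one_le_mm θ z)) q)]
  exact (hM z).trans_lt coe_lt_top

namespace CurveModel

lemma measurable_curveMean (C : 𝒞) : Measurable fun w : ℝ × ℝ^p => curveMean Pθ xc w.1 w.2 := by
  have h : StronglyMeasurable fun v : (ℝ × ℝ^p) × S => xc v.2 v.1.1 v.1.2 :=
    (C.measurable_xc.comp (by fun_prop : Measurable fun v : (ℝ × ℝ^p) × S =>
      (v.2, v.1.1, v.1.2))).stronglyMeasurable
  exact h.integral_prod_right.measurable

lemma measurable_curveDev (C : 𝒞) (j : ℕ) : Measurable (curveDev Pθ xc j) :=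
  (C.measurable_xc.comp (by fun_prop : Measurable fun w : Base S p =>
    (w.1, w.2.2 j, w.2.1))).sub (C.measurable_curveMean.comp
      (by fun_prop : Measurable fun w : Base S p => (w.2.2 j, w.2.1)))

lemma measurable_resid (C : 𝒞) (j : ℕ) : Measurable (resid Pθ xc j) :=
  ((C.measurable_curveDev j).comp (by fun_prop : Measurable fun d : Subj S p =>
    (d.1.1, d.1.2.1, d.2))).add (by fun_prop)

lemma measurable_obsC (C : 𝒞) (j : ℕ) : Measurable (obsC (p := p) xc j) :=
  (C.measurable_xc.comp (by fun_prop : Measurable fun d : Subj S p =>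
    (d.1.1, d.2 j, d.1.2.1))).add (by fun_prop)

lemma abs_resid_le (C : 𝒞) (j : ℕ) (d : Subj S p) : |resid Pθ xc j d| ≤ env mm j d.1 :=
  (abs_add_le _ _).trans (add_le_add (C.abs_dev_le _ _ _) le_rfl)

lemma abs_obsC_le (C : 𝒞) (j : ℕ) (d : Subj S p) : |obsC xc j d| ≤ env mm j d.1 :=
  (abs_add_le _ _).trans (add_le_add (C.abs_xc_le _ _ _) le_rfl)

lemma integral_error_mul (C : 𝒞) {f : Base S p → ℝ} (hf : Measurable f) (j : ℕ) :
    ∫ d, d.1.2.2 j * f (d.1.1, d.1.2.1, d.2) ∂ℒ = 0 := by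
  simp only [mul_comm _ (f _)]
  rw [integral_regroup_mul hf (measurable_pi_apply j), integral_eval_infinitePi C.integral_e, mul_zero]

lemma integrable_xc (C : 𝒞) (H : ℳ q) (hq : 1 ≤ q) (t : ℝ) (z : ℝ^p) :
    Integrable (fun θ => xc θ t z) Pθ := by
  refine (H.integrable_mm_rpow z).mono' (C.measurable_xc.comp (by fun_prop : Measurable fun θ : S =>
    (θ, t, z))).aestronglyMeasurable (ae_of_all _ fun θ => ?_)
  refine (C.abs_xc_le θ t z).trans ?_
  calc mm θ z = mm θ z ^ (1 : ℝ) := (rpow_one _).symm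
    _ ≤ _ := Real.rpow_le_rpow_of_exponent_le (H.one_le_mm θ z) hq

lemma integral_resid_mul (C : 𝒞) (H : ℳ q) (hq : 2 ≤ q) (j : ℕ)
    {G : ℝ^p × (ℕ → ℝ) → ℝ} (hG : Measurable G) {B : ℝ} (hB : ∀ w, |G w| ≤ B) :
    ∫ d, resid Pθ xc j d * G (d.1.2.1, d.2) ∂ℒ = 0 := by
  have hB0 : 0 ≤ B := (abs_nonneg _).trans (hB ((fun _ => 0), fun _ => 0))
  have hGm : Measurable fun w : Base S p => G w.2 := hG.comp measurable_snd
  have henv : Integrable (fun d : Subj S p => env mm j d.1) ℒ := by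
    have := measurePreserving_fst_subjLaw (PT := PT) |>.integrable_comp_of_integrable
      (H.integrable_env_pow (k := 1) (by push_cast; linarith) j)
    simpa [Function.comp_def] using this
  have hi1 : Integrable (fun d : Subj S p => curveDev Pθ xc j (d.1.1, d.1.2.1, d.2) *
      G (d.1.2.1, d.2)) ℒ := by
    refine (henv.mul_const B).mono' (((C.measurable_curveDev j).mul hGm).comp
      (by fun_prop : Measurable fun d : Subj S p => (d.1.1, d.1.2.1, d.2))).aestronglyMeasurable
      (ae_of_all _ fun d => ?_)
    rw [norm_mul]
    refine mul_le_mul ((C.abs_dev_le _ _ _).trans ?_) (hB _) (abs_nonneg _) (H.env_nonneg _ _)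
    simp only [env]; linarith [abs_nonneg (d.1.2.2 j)]
  have hi2 : Integrable (fun d : Subj S p => d.1.2.2 j * G (d.1.2.1, d.2)) ℒ := by
    refine (henv.mul_const B).mono' ((by fun_prop : Measurable fun d : Subj S p => d.1.2.2 j).mul
      (hG.comp (by fun_prop))).aestronglyMeasurable (ae_of_all _ fun d => ?_)
    rw [norm_mul]
    refine mul_le_mul ?_ (hB _) (abs_nonneg _) (H.env_nonneg _ _)
    simp only [env, norm_eq_abs]; linarith [H.one_le_mm d.1.1 d.1.2.1]
  have e : ∀ d : Subj S p, resid Pθ xc j d * G (d.1.2.1, d.2) =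
      curveDev Pθ xc j (d.1.1, d.1.2.1, d.2) * G (d.1.2.1, d.2) + d.1.2.2 j * G (d.1.2.1, d.2) :=
    fun d => by simp only [resid]; ring
  simp only [e]
  rw [integral_add hi1 hi2]
  have h1 : ∫ d, curveDev Pθ xc j (d.1.1, d.1.2.1, d.2) * G (d.1.2.1, d.2) ∂ℒ = 0 := by
    have hm := (C.measurable_curveDev j).mul hGm
    have hi3 := (measurePreserving_regroup_fst.integrable_comp hm.aestronglyMeasurable).1 hi1
    refine (integral_regroup_fst hm).trans ?_
    rw [integral_prod_symm _ hi3]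
    refine integral_eq_zero_of_ae (ae_of_all _ fun w => ?_)
    simp only [Pi.mul_apply, Pi.zero_apply, curveDev]
    rw [integral_mul_const, integral_sub (C.integrable_xc H (by linarith) _ _) (integrable_const _)]
    simp [curveMean]
  rw [h1, C.integral_error_mul hGm, add_zero]

lemma stronglyMeasurable_integral_dev (C : 𝒞) :
    StronglyMeasurable fun v : (ℝ × ℝ) × ℝ^p => ∫ θ, (xc θ v.1.1 v.2 - curveMean Pθ xc v.1.1 v.2) *
      (xc θ v.1.2 v.2 - curveMean Pθ xc v.1.2 v.2) ∂Pθ := by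
  have h : StronglyMeasurable fun v : ((ℝ × ℝ) × ℝ^p) × S =>
      (xc v.2 v.1.1.1 v.1.2 - curveMean Pθ xc v.1.1.1 v.1.2) *
        (xc v.2 v.1.1.2 v.1.2 - curveMean Pθ xc v.1.1.2 v.1.2) := by
    refine (Measurable.mul ?_ ?_).stronglyMeasurable
    · exact (C.measurable_xc.comp (by fun_prop : Measurable fun v : ((ℝ × ℝ) × ℝ^p) × S =>
        (v.2, v.1.1.1, v.1.2))).sub (C.measurable_curveMean.comp
          (by fun_prop : Measurable fun v : ((ℝ × ℝ) × ℝ^p) × S => (v.1.1.1, v.1.2)))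
    · exact (C.measurable_xc.comp (by fun_prop : Measurable fun v : ((ℝ × ℝ) × ℝ^p) × S =>
        (v.2, v.1.1.2, v.1.2))).sub (C.measurable_curveMean.comp
          (by fun_prop : Measurable fun v : ((ℝ × ℝ) × ℝ^p) × S => (v.1.1.2, v.1.2)))
  exact h.integral_prod_right

lemma measurable_curveCov (C : 𝒞) : Measurable (curveCov Pθ PZ xc) :=
  (C.stronglyMeasurable_integral_dev.integral_prod_right (ν := PZ)).measurable

lemma integral_resid_mul_resid (C : 𝒞) (H : ℳ q) (hq : 2 ≤ q) {j k : ℕ} (hjk : j ≠ k)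
    {g : ℝ × ℝ → ℝ} (hg : Measurable g) {B : ℝ} (hB : ∀ w, |g w| ≤ B) :
    ∫ d, resid Pθ xc j d * resid Pθ xc k d * g (d.2 j, d.2 k) ∂ℒ =
      ∫ w, curveCov Pθ PZ xc w * g w ∂PT.prod PT := by
  have hB0 : 0 ≤ B := (abs_nonneg _).trans (hB 0)
  have henv : ∀ j, Integrable (fun d : Subj S p => env mm j d.1 ^ 2) ℒ := fun j =>
    measurePreserving_fst_subjLaw (PT := PT) |>.integrable_comp_of_integrable
      (H.integrable_env_pow (k := 2) (by push_cast; linarith) j)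
  have hgm : Measurable fun d : Subj S p => g (d.2 j, d.2 k) := hg.comp (by fun_prop)
  have hdom : ∀ {f₁ f₂ : Subj S p → ℝ}, Measurable f₁ → Measurable f₂ → (∀ d, |f₁ d| ≤ env mm j d.1) →
      (∀ d, |f₂ d| ≤ env mm k d.1) → Integrable (fun d => f₁ d * f₂ d * g (d.2 j, d.2 k)) ℒ := by
    intro f₁ f₂ m₁ m₂ h₁ h₂
    refine (((henv j).add (henv k)).mul_const B).mono' ((m₁.mul m₂).mul hgm).aestronglyMeasurable
      (ae_of_all _ fun d => ?_)
    rw [norm_mul, norm_mul]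
    refine mul_le_mul ?_ (hB _) (abs_nonneg _) (by simp only [Pi.add_apply]; positivity)
    refine (mul_le_mul (h₁ d) (h₂ d) (abs_nonneg _) (H.env_nonneg _ _)).trans ?_
    simp only [Pi.add_apply]
    nlinarith [sq_nonneg (env mm j d.1 - env mm k d.1), sq_nonneg (env mm j d.1 + env mm k d.1)]
  have hAm : ∀ j, Measurable fun d : Subj S p => curveDev Pθ xc j (d.1.1, d.1.2.1, d.2) := fun j =>
    (C.measurable_curveDev j).comp (by fun_prop)
  have hAb : ∀ j, ∀ d : Subj S p, |curveDev Pθ xc j (d.1.1, d.1.2.1, d.2)| ≤ env mm j d.1 := fun j d => by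
    refine (C.abs_dev_le _ _ _).trans ?_
    simp only [env]; linarith [abs_nonneg (d.1.2.2 j)]
  have hem : ∀ j, Measurable fun d : Subj S p => d.1.2.2 j := fun j => by fun_prop
  have heb : ∀ j, ∀ d : Subj S p, |d.1.2.2 j| ≤ env mm j d.1 := fun j d => by
    simp only [env]; linarith [H.one_le_mm d.1.1 d.1.2.1]
  set A : ℕ → Subj S p → ℝ := fun j d => curveDev Pθ xc j (d.1.1, d.1.2.1, d.2) with hA
  have e : ∀ d : Subj S p, resid Pθ xc j d * resid Pθ xc k d * g (d.2 j, d.2 k) =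
      A j d * A k d * g (d.2 j, d.2 k) + (A j d * d.1.2.2 k * g (d.2 j, d.2 k) +
        (d.1.2.2 j * A k d * g (d.2 j, d.2 k) + d.1.2.2 j * d.1.2.2 k * g (d.2 j, d.2 k))) :=
    fun d => by simp only [resid, hA]; ring
  have i1 := hdom (hAm j) (hAm k) (hAb j) (hAb k)
  have i2 := hdom (hAm j) (hem k) (hAb j) (heb k)
  have i3 := hdom (hem j) (hAm k) (heb j) (hAb k)
  have i4 := hdom (hem j) (hem k) (heb j) (heb k)
  have i34 : Integrable (fun d : Subj S p => d.1.2.2 j * A k d * g (d.2 j, d.2 k) +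
      d.1.2.2 j * d.1.2.2 k * g (d.2 j, d.2 k)) ℒ := i3.add i4
  have i234 : Integrable (fun d : Subj S p => A j d * d.1.2.2 k * g (d.2 j, d.2 k) +
      (d.1.2.2 j * A k d * g (d.2 j, d.2 k) + d.1.2.2 j * d.1.2.2 k * g (d.2 j, d.2 k)))
      ℒ := i2.add i34
  simp only [e]
  rw [integral_add i1 i234, integral_add i2 i34, integral_add i3 i4]
  have hgw : Measurable fun w : Base S p => g (w.2.2 j, w.2.2 k) := hg.comp (by fun_prop)
  have z2 : ∫ d, A j d * d.1.2.2 k * g (d.2 j, d.2 k) ∂ℒ = 0 := by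
    refine (integral_congr_ae (ae_of_all _ fun d => ?_)).trans
      (C.integral_error_mul ((C.measurable_curveDev j).mul hgw) k)
    simp only [hA, Pi.mul_apply]; ring
  have z3 : ∫ d, d.1.2.2 j * A k d * g (d.2 j, d.2 k) ∂ℒ = 0 := by
    refine (integral_congr_ae (ae_of_all _ fun d => ?_)).trans
      (C.integral_error_mul ((C.measurable_curveDev k).mul hgw) j)
    simp only [hA, Pi.mul_apply]; ring
  have z4 : ∫ d, d.1.2.2 j * d.1.2.2 k * g (d.2 j, d.2 k) ∂ℒ = 0 := by
    have := integral_regroup_mul (Pθ := Pθ) (PZ := PZ) (PT := PT) (Pε := Pε)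
      hgw (φ := fun e => e j * e k) ((measurable_pi_apply j).mul (measurable_pi_apply k))
    rw [integral_pair_infinitePi hjk (g := fun w => w.1 * w.2) (measurable_fst.mul measurable_snd),
      integral_prod_mul (fun x : ℝ => x) (fun x : ℝ => x), C.integral_e, mul_zero, mul_zero] at this
    rw [← this]
    exact integral_congr_ae (ae_of_all _ fun d => mul_comm _ _)
  rw [z2, z3, z4, add_zero, add_zero, add_zero]
  have hm := ((C.measurable_curveDev j).mul (C.measurable_curveDev k)).mul hgw
  have hi := (measurePreserving_regroup_fst.integrable_comp hm.aestronglyMeasurable).1 i1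
  refine (integral_regroup_fst hm).trans ?_
  rw [integral_prod_symm _ hi]
  have hi' : Integrable (fun y => ∫ θ, ((curveDev Pθ xc j * curveDev Pθ xc k) *
      fun w : Base S p => g (w.2.2 j, w.2.2 k)) (θ, y) ∂Pθ)
      (PZ.prod PT^ℕ) := hi.swap.integral_prod_left
  rw [integral_prod_symm _ hi']
  have h5 : ∀ τ : ℕ → ℝ, ∫ z, ∫ θ, ((curveDev Pθ xc j * curveDev Pθ xc k) *
      fun w : Base S p => g (w.2.2 j, w.2.2 k)) (θ, z, τ) ∂Pθ ∂PZ =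
      (fun w : ℝ × ℝ => curveCov Pθ PZ xc w * g w) (τ j, τ k) := by
    intro τ
    simp only [Pi.mul_apply, integral_mul_const, curveDev, curveCov]
  simp only [h5]
  exact integral_pair_infinitePi hjk (C.measurable_curveCov.mul hg)

end CurveModel

/-! ### Local linear smoothing of weights with a smooth conditional mean -/

lemma tendsto_rateX_div {b H : ℕ → ℝ} {q C : ℝ} (hb : ∀ n, 0 < b n) (hH : ∀ n, 0 < H n) (hq : 2 < q)
    (hr : IsRate b q)
    (hle : ∀ᶠ n in atTop, b n ≤ C * H n) : Tendsto (fun n => rateX b n / H n) atTop (𝓝 0) := by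
  have h1 : Tendsto (fun n : ℕ => sqrt (C ^ 2 * ((b n)⁻¹ * (log n / n) ^ (1 - 2 / q)))) atTop (𝓝 0) := by
    have := (hr.const_mul (C ^ 2)).sqrt
    simpa using this
  refine squeeze_zero' (Eventually.of_forall fun n => div_nonneg (rateX_nonneg b n) (hH n).le) ?_ h1
  filter_upwards [hle, eventually_ge_atTop 2] with n hn hn2
  have hL := log_div_pos hn2
  have hL1 := log_div_le_one n
  have hbn := hb n
  have hHn := hH n
  refine Real.le_sqrt_of_sq_le ?_
  rw [div_pow, rateX, sq_sqrt (by positivity)]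
  have h2 : log n / n ≤ (log n / n) ^ (1 - 2 / q) := by
    calc log n / n = (log n / n) ^ (1 : ℝ) := (rpow_one _).symm
      _ ≤ _ := Real.rpow_le_rpow_of_exponent_ge hL hL1 (by
          have : 0 < 2 / q := by positivity
          linarith)
  rw [div_le_iff₀ (by positivity)]
  calc b n * (log n / n) = b n ^ 2 * ((b n)⁻¹ * (log n / n)) := by field_simp
    _ ≤ (C * H n) ^ 2 * ((b n)⁻¹ * (log n / n) ^ (1 - 2 / q)) := by gcongr
    _ = _ := by ring

variable {lo hi : ι → ℝ} {ν : Measure (ι → ℝ)} [IsProbabilityMeasure ν]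

lemma exists_nat_abs_le (lo hi : ι → ℝ) : ∃ Λ : ℕ, ∀ x ∈ Icc lo hi, ∀ k, |x k| ≤ Λ := by
  refine ⟨⌈∑ k, (|lo k| + |hi k|)⌉₊, fun x hx k => le_trans ?_ (Nat.le_ceil _)⟩
  have h1 : |x k| ≤ |lo k| + |hi k| := by
    rw [abs_le]
    constructor
    · linarith [hx.1 k, neg_abs_le (lo k), abs_nonneg (hi k)]
    · linarith [hx.2 k, le_abs_self (hi k), abs_nonneg (lo k)]
  exact h1.trans (single_le_sum (f := fun k => |lo k| + |hi k|) (fun _ _ => by positivity)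
    (Finset.mem_univ k))

local notation:max "𝓚" e:max f:max => prodKer (momKer K e f)
local notation "𝟙" => fun _ _ => 1

lemma IsEnvelope.ae_momKer_le (H : ℰ) (hK : IsKernel K)
    (W : (n i : ℕ) → A → Ξ → ℝ) (hWm : ∀ n i α, Measurable (W n i α))
    (hW : ∀ n i α d, |W n i α d| ≤ E n i α d) (lo hi : ι → ℝ) :
    ∀ᵐ ω ∂P, ∃ C : ℝ, 0 ≤ C ∧ ∀ᶠ n : ℕ in atTop, ∀ m ≤ n, ∀ x ∈ Icc lo hi, ∀ e e' : Option ι,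
      |∑ i ∈ range m, (Ψ n i (W n i) (𝓚 e e' (h n) x) (D i ω) - ∫ d, Ψ n i (W n i) (𝓚 e e' (h n) x) d ∂Q)|
        ≤ C * (n * rateX b n) := by
  obtain ⟨Λ, hΛ⟩ := exists_nat_abs_le lo hi
  obtain ⟨M, -, hM⟩ := hK.exists_stepApprox_momKer (ι := ι)
  choose M' hM' _ using hM
  have h1 := ae_all_iff.2 fun e : Option ι => ae_all_iff.2 fun e' : Option ι =>
    H.ae_prodKer_le Λ W hWm hW (hM' e e')
  filter_upwards [h1] with ω h1
  choose C hC0 hC using h1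
  refine ⟨∑ e, ∑ e', C e e', sum_nonneg fun e _ => sum_nonneg fun e' _ => hC0 e e', ?_⟩
  have h2 := eventually_all.2 fun e => eventually_all.2 fun e' => hC e e'
  filter_upwards [h2] with n hn m hm x hx e e'
  refine (hn e e' m hm x (hΛ x hx)).trans ?_
  have := rateX_nonneg b n
  gcongr
  refine le_trans ?_ (single_le_sum (f := fun e => ∑ e', C e e')
    (fun e _ => sum_nonneg fun e' _ => hC0 e e') (Finset.mem_univ e))
  exact single_le_sum (f := fun e' => C e e') (fun e' _ => hC0 e e') (Finset.mem_univ _)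

/-- The points `ξ_α` have the law `ν`, comparable with Lebesgue measure on a box. -/
structure IsDesign (Q : Measure Ξ) (s : ℕ → ℕ → Finset A) (c : ℕ → ℕ → ℝ) (ξ : A → Ξ → ι → ℝ)
    (ν : Measure (ι → ℝ)) (lo hi : ι → ℝ) : Prop where
  c_card : ∀ n i, c n i * (s n i).card = 1
  law : ∀ n i, ∀ α ∈ s n i, Q.map (ξ α) = ν
  upper : ∃ C : NNReal, ν ≤ C • volume
  lower : ∃ κ : NNReal, 0 < κ ∧ κ • volume.restrict (Icc lo hi) ≤ ν
  supp : ∀ᵐ u ∂ν, u ∈ Icc lo hi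
  lt : ∀ k, lo k < hi k

lemma IsEnvelope.integral_smp_eq (H : ℰ)
    (hc : ∀ n i, c n i * (s n i).card = 1) {n i : ℕ} {W : A → Ξ → ℝ} (hWm : ∀ α, Measurable (W α))
    (hW : ∀ α d, |W α d| ≤ E n i α d) {f : (ι → ℝ) → ℝ} (hf : Measurable f) {M : ℝ}
    (hM : ∀ u, |f u| ≤ M) {I : ℝ} (hI : ∀ α ∈ s n i, ∫ d, W α d * f (ξ α d) ∂Q = I) :
    ∫ d, Ψ n i W f d ∂Q = I := by
  have hInt : ∀ α, Integrable (fun d => W α d * f (ξ α d)) Q := fun α => by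
    refine ((H.integrable_E n i α).mul_const M).mono'
      ((hWm α).mul (hf.comp (H.measurable_ξ α))).aestronglyMeasurable (ae_of_all _ fun d => ?_)
    rw [norm_mul]
    exact mul_le_mul (hW α d) (hM _) (abs_nonneg _) ((abs_nonneg _).trans (hW α d))
  unfold smp
  rw [integral_const_mul, integral_finsetSum _ fun α _ => hInt α, sum_congr rfl hI,
    sum_const, nsmul_eq_mul, ← mul_assoc, hc, one_mul]

lemma abs_sub_le_of_prodKer_ne_zero {f : ι → ℝ → ℝ} {M : ι → ℝ} (hf : ∀ k, StepApprox (f k) (M k))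
    {h x u : ι → ℝ} (hh : ∀ k, 0 < h k) (hne : prodKer f h x u ≠ 0) (k : ι) : |u k - x k| ≤ h k := by
  by_contra hc
  refine hne (prod_eq_zero (Finset.mem_univ k) ((hf k).eq_zero fun hm => hc ?_))
  rw [mem_Icc, le_div_iff₀ (hh k), div_le_iff₀ (hh k)] at hm
  rw [abs_le]; constructor <;> linarith [hm.1, hm.2]

lemma IsDesign.exists_real_Icc_le (Hd : IsDesign Q s c ξ ν lo hi) :
    ∃ C : ℝ, 0 ≤ C ∧ ∀ h x : ι → ℝ, (∀ k, 0 < h k) →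
      ν.real (Icc (fun k => x k - h k) fun k => x k + h k) ≤ C * ∏ k, h k := by
  obtain ⟨C, hC⟩ := Hd.upper
  refine ⟨C * 2 ^ Fintype.card ι, by positivity, fun h x hh => ?_⟩
  have h1 : ν (Icc (fun k => x k - h k) fun k => x k + h k) ≤ C * ∏ k, ofReal (2 * h k) := by
    refine (hC _).trans (le_of_eq ?_)
    rw [Measure.smul_apply, Real.volume_Icc_pi, ENNReal.smul_def, smul_eq_mul]
    congr 1
    exact prod_congr rfl fun k _ => by congr 1; ring
  have h2 := toReal_mono (mul_ne_top coe_ne_top (ENNReal.prod_ne_top fun k _ => ofReal_ne_top)) h1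
  rw [toReal_mul, ENNReal.toReal_prod, ENNReal.coe_toReal] at h2
  rw [prod_congr rfl fun k _ => ENNReal.toReal_ofReal (by have := hh k; positivity),
    prod_mul_distrib, prod_const, card_univ] at h2
  calc _ ≤ _ := h2
    _ = _ := by ring

/-- `φ` is bounded, and smooth of second order on a box with gradient `G`. -/
structure HasTaylor (φ : (ι → ℝ) → ℝ) (G : (ι → ℝ) → ι → ℝ) (lo hi : ι → ℝ) (C : ℝ) : Prop where
  measurable : Measurable φ
  abs_le : ∀ u, |φ u| ≤ C
  abs_grad_le : ∀ x k, |G x k| ≤ C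
  taylor : ∀ x ∈ Icc lo hi, ∀ u ∈ Icc lo hi,
    |φ u - φ x - ∑ k, G x k * (u k - x k)| ≤ C * ∑ k, (u k - x k) ^ 2

/-- The coefficients of the first-order expansion in the rescaled coordinates. -/
def taylorCoef (φ : (ι → ℝ) → ℝ) (G : (ι → ℝ) → ι → ℝ) (h x : ι → ℝ) (e : Option ι) : ℝ :=
  e.elim (φ x) fun k => G x k * h k

/-- The residual of the weights `W` after subtracting the local linear function with
coefficients `β`, smoothed with the kernel of index `e`. -/
def locRes (K : ℝ → ℝ) (s : Finset A) (c : ℝ) (ξ : A → Ξ → ι → ℝ) (W : A → Ξ → ℝ) (h x : ι → ℝ)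
    (β : Option ι → ℝ) (e : Option ι) (d : Ξ) : ℝ :=
  smp s c ξ W (prodKer (momKer K e none) h x) d -
    ∑ e', β e' * smp s c ξ (fun _ _ => 1) (prodKer (momKer K e e') h x) d

/-- The integrated remainder of the first-order expansion. -/
def biasInt (K : ℝ → ℝ) (ν : Measure (ι → ℝ)) (φ : (ι → ℝ) → ℝ) (G : (ι → ℝ) → ι → ℝ) (h x : ι → ℝ)
    (e : Option ι) : ℝ :=
  ∫ u, (φ u - ∑ e', taylorCoef φ G h x e' * dsg h x e' u) * prodKer (momKer K e none) h x u ∂ν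

/-- The empirical moments of the design. -/
def empMom (K : ℝ → ℝ) (s : ℕ → ℕ → Finset A) (c : ℕ → ℕ → ℝ) (ξ : A → Ξ → ι → ℝ) (h : ℕ → ι → ℝ)
    (D : ℕ → Ξ) (n : ℕ) (x : ι → ℝ) (e e' : Option ι) : ℝ :=
  (n * ∏ k, h n k)⁻¹ * ∑ i ∈ range n,
    smp (s n i) (c n i) ξ (fun _ _ => 1) (prodKer (momKer K e e') (h n) x) (D i)

lemma IsKernel.exists_abs_prodKer_momKer_le (hK : IsKernel K) :
    ∃ M : ℝ, 0 ≤ M ∧ ∀ (e e' : Option ι) (h x u : ι → ℝ), |𝓚 e e' h x u| ≤ M ∧ ((∀ k, 0 < h k) →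
      |𝓚 e e' h x u| ≤ M * (Icc (fun k => x k - h k) fun k => x k + h k).indicator 1 u) := by
  obtain ⟨M, hM0, hM⟩ := hK.exists_stepApprox_momKer (ι := ι)
  refine ⟨M, hM0, fun e e' h x u => ?_⟩
  obtain ⟨M', hM', hle⟩ := hM e e'
  have hle := (abs_prodKer_le (fun k v => (hM' k).abs_le v) h x u).trans hle
  refine ⟨hle, fun hh => ?_⟩
  by_cases hne : 𝓚 e e' h x u = 0
  · rw [hne, abs_zero]
    exact mul_nonneg hM0 (indicator_nonneg (fun _ _ => zero_le_one) _)
  · have h1 := abs_sub_le_of_prodKer_ne_zero hM' hh hne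
    have hm : u ∈ Icc (fun k => x k - h k) fun k => x k + h k :=
      ⟨fun k => by linarith [(abs_le.1 (h1 k)).1], fun k => by linarith [(abs_le.1 (h1 k)).2]⟩
    rwa [indicator_of_mem hm, Pi.one_apply, mul_one]

variable {W : ℕ → ℕ → A → Ξ → ℝ} {φ : (ι → ℝ) → ℝ} {G : (ι → ℝ) → ι → ℝ} {Cφ : ℝ}

/-- The setting of local linear smoothing of the responses `W` with regression function `φ`. -/
structure IsSmoother (P : Measure Ω) (Q : Measure Ξ) (D : ℕ → Ω → Ξ) (s : ℕ → ℕ → Finset A)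
    (c : ℕ → ℕ → ℝ) (ξ : A → Ξ → ι → ℝ) (E : ℕ → ℕ → A → Ξ → ℝ) (h : ℕ → ι → ℝ) (b : ℕ → ℝ)
    (K : ℝ → ℝ) (lo hi : ι → ℝ) (ν : Measure (ι → ℝ)) (W : ℕ → ℕ → A → Ξ → ℝ) (φ : (ι → ℝ) → ℝ)
    (G : (ι → ℝ) → ι → ℝ) (Cφ : ℝ) : Prop where
  env : IsEnvelope P Q D s c ξ E h b
  one_le : ∀ n i α d, 1 ≤ E n i α d
  design : IsDesign Q s c ξ ν lo hi
  kernel : IsKernel K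
  measurable_W : ∀ n i α, Measurable (W n i α)
  abs_W_le : ∀ n i α d, |W n i α d| ≤ E n i α d
  cond : ∀ n i, ∀ α ∈ s n i, ∀ f : (ι → ℝ) → ℝ, Measurable f → (∃ M, ∀ u, |f u| ≤ M) →
    ∫ d, W n i α d * f (ξ α d) ∂Q = ∫ u, φ u * f u ∂ν
  taylor : HasTaylor φ G lo hi Cφ
  measurable_G : ∀ k, Measurable fun x => G x k
  rate : Tendsto (fun n => rateX b n / ∏ k, h n k) atTop (𝓝 0)

local notation "ℐ" => IsSmoother P Q D s c ξ E h b K lo hi ν W φ G Cφ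
local notation:max "𝒯" n:max x:max => taylorCoef φ G (h n) x
local notation:max "ℛ" n:max i:max x:max e:max => locRes K (s n i) (c n i) ξ (W n i) (h n) x (taylorCoef φ G (h n) x) e

namespace IsSmoother

lemma abs_one_le (I : ℐ) (n i : ℕ) (α : A) (d : Ξ) : |(1 : ℝ)| ≤ E n i α d := by
  rw [abs_one]; exact I.one_le n i α d

lemma measurable_momKer (I : ℐ) (n : ℕ) (e e' : Option ι) (x : ι → ℝ) : Measurable (𝓚 e e' (h n) x) :=
  (measurable_prodKer (I.kernel.measurable_momKer e e') _).comp measurable_prodMk_left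

lemma integral_smp_one (I : ℐ) (n i : ℕ) (x : ι → ℝ) (e e' : Option ι) :
    ∫ d, Ψ n i 𝟙 (𝓚 e e' (h n) x) d ∂Q = ∫ u, 𝓚 e e' (h n) x u ∂ν := by
  obtain ⟨M, -, hM⟩ := I.kernel.exists_abs_prodKer_momKer_le (ι := ι)
  refine I.env.integral_smp_eq I.design.c_card (fun _ => measurable_const) (I.abs_one_le n i)
    (I.measurable_momKer n e e' x) (fun u => (hM e e' _ x u).1) fun α hα => ?_
  simp only [one_mul]
  rw [← I.design.law n i α hα, integral_map (I.env.measurable_ξ α).aemeasurable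
    (I.measurable_momKer n e e' x).aestronglyMeasurable]

lemma integral_locRes (I : ℐ) (n i : ℕ) (x : ι → ℝ) (e : Option ι) :
    ∫ d, ℛ n i x e d ∂Q = ∫ d, Ψ n i (W n i) (𝓚 e none (h n) x) d ∂Q -
      ∑ e', 𝒯 n x e' * ∫ d, Ψ n i 𝟙 (𝓚 e e' (h n) x) d ∂Q := by
  obtain ⟨M, -, hM⟩ := I.kernel.exists_abs_prodKer_momKer_le (ι := ι)
  have i2 := fun e' => (I.env.integrable_smp n i (fun _ => measurable_const) (I.abs_one_le n i)
    (I.measurable_momKer n e e' x) fun u => (hM e e' _ x u).1).const_mul (𝒯 n x e')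
  unfold locRes
  rw [integral_sub (I.env.integrable_smp n i (I.measurable_W n i) (I.abs_W_le n i)
    (I.measurable_momKer n e none x) fun u => (hM e none _ x u).1)
    (integrable_finsetSum _ fun e' _ => i2 e'), integral_finsetSum _ fun e' _ => i2 e']
  simp only [integral_const_mul]

lemma integral_locRes_eq (I : ℐ) (n i : ℕ) (x : ι → ℝ) (e : Option ι) :
    ∫ d, ℛ n i x e d ∂Q = biasInt K ν φ G (h n) x e := by
  obtain ⟨M, -, hM⟩ := I.kernel.exists_abs_prodKer_momKer_le (ι := ι)
  have hm := fun e' => I.measurable_momKer n e e' x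
  have hM := fun e' u => (hM e e' (h n) x u).1
  have hφ := I.taylor.abs_le
  have j1 : Integrable (fun u => φ u * 𝓚 e none (h n) x u) ν :=
    .of_bound (I.taylor.measurable.mul (hm none)).aestronglyMeasurable (Cφ * M) (ae_of_all _ fun u => by
      rw [norm_mul]
      exact mul_le_mul (hφ u) (hM _ _) (abs_nonneg _) ((abs_nonneg _).trans (hφ u)))
  have j2 : ∀ e', Integrable (fun u => 𝒯 n x e' * 𝓚 e e' (h n) x u) ν := fun e' =>
    (Integrable.of_bound (hm e').aestronglyMeasurable M (ae_of_all _ (hM e'))).const_mul _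
  have h3 : ∀ u, (φ u - ∑ e', 𝒯 n x e' * dsg (h n) x e' u) * 𝓚 e none (h n) x u =
      φ u * 𝓚 e none (h n) x u - ∑ e', 𝒯 n x e' * 𝓚 e e' (h n) x u := fun u => by
    rw [sub_mul, sum_mul]
    congr 1
    refine sum_congr rfl fun e' _ => ?_
    rw [prodKer_momKer, prodKer_momKer]
    simp only [dsg, Option.elim_none]; ring
  rw [I.integral_locRes, I.env.integral_smp_eq I.design.c_card (I.measurable_W n i) (I.abs_W_le n i)
    (hm none) (hM none) fun α hα => I.cond n i α hα _ (hm none) ⟨M, hM none⟩]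
  simp only [biasInt, I.integral_smp_one, h3]
  rw [integral_sub j1 (integrable_finsetSum _ fun e' _ => j2 e'), integral_finsetSum _ fun e' _ => j2 e']
  simp only [integral_const_mul]

lemma prod_h_pos (I : ℐ) (n : ℕ) : 0 < ∏ k, h n k := prod_pos fun k _ => I.env.h_pos n k

lemma nonneg (I : ℐ) : 0 ≤ Cφ := (abs_nonneg _).trans (I.taylor.abs_le 0)

lemma exists_biasInt_le (I : ℐ) : ∃ C : ℝ, 0 ≤ C ∧ ∀ n, ∀ x ∈ Icc lo hi, ∀ e,
    |(∏ k, h n k)⁻¹ * biasInt K ν φ G (h n) x e| ≤ C * ∑ k, h n k ^ 2 := by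
  obtain ⟨M, hM0, hM⟩ := I.kernel.exists_abs_prodKer_momKer_le (ι := ι)
  obtain ⟨Cν, hCν0, hCν⟩ := I.design.exists_real_Icc_le
  have hCφ := I.nonneg
  refine ⟨Cφ * M * Cν, by positivity, fun n x hx e => ?_⟩
  have hh := I.env.h_pos n
  have hH := I.prod_h_pos n
  rw [abs_mul, abs_of_pos (inv_pos.2 hH), inv_mul_le_iff₀ hH, mul_comm (∏ k, h n k)]
  set h := h n
  set B := Icc (fun k => x k - h k) fun k => x k + h k with hB
  rw [← norm_eq_abs]
  refine (norm_integral_le_of_norm_le (g := fun u => Cφ * (∑ k, h k ^ 2) * (M * B.indicator 1 u)) ?_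
    ?_).trans ?_
  · exact (((integrable_indicator_iff measurableSet_Icc).2
      (integrable_const (1 : ℝ)).integrableOn).const_mul M).const_mul _
  · filter_upwards [I.design.supp] with u hu
    rw [norm_mul]
    by_cases huB : u ∈ B
    · refine mul_le_mul ?_ ((hM e none h x u).2 hh) (abs_nonneg _) (by positivity)
      have h1 : φ u - ∑ e', taylorCoef φ G h x e' * dsg h x e' u =
          φ u - φ x - ∑ k, G x k * (u k - x k) := by
        rw [Fintype.sum_option]
        simp only [taylorCoef, dsg, Option.elim_none, Option.elim_some, mul_one]
        rw [← sub_sub]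
        congr 1
        refine sum_congr rfl fun k _ => ?_
        have := (hh k).ne'
        field_simp
      rw [h1, norm_eq_abs]
      refine (I.taylor.taylor x hx u hu).trans ?_
      gcongr Cφ * ∑ k, ?_ with k
      have a1 := huB.1 k
      have a2 := huB.2 k
      simp only at a1 a2
      exact sq_le_sq' (by linarith) (by linarith)
    · have h2 := (hM e none h x u).2 hh
      rw [indicator_of_notMem huB, mul_zero] at h2
      rw [norm_eq_abs (prodKer _ _ _ _), le_antisymm h2 (abs_nonneg _), mul_zero]
      exact mul_nonneg (by positivity) (mul_nonneg hM0 (indicator_nonneg (fun _ _ => zero_le_one) _))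
  · rw [integral_const_mul, integral_const_mul, integral_indicator_one measurableSet_Icc]
    calc Cφ * (∑ k, h k ^ 2) * (M * ν.real B) ≤ Cφ * (∑ k, h k ^ 2) * (M * (Cν * ∏ k, h k)) := by
          gcongr; exact hCν h x hh
      _ = _ := by ring

lemma eventually_abs_taylorCoef_le (I : ℐ) : ∀ᶠ n in atTop, ∀ x e, |𝒯 n x e| ≤ Cφ := by
  filter_upwards [eventually_all.2 fun k => (I.env.h_tendsto k).eventually_le_const one_pos] with n hh x e
  cases e with
  | none => exact I.taylor.abs_le x
  | some k =>
    simp only [taylorCoef, Option.elim_some]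
    rw [abs_mul, abs_of_pos (I.env.h_pos n k)]
    exact (mul_le_of_le_one_right (abs_nonneg _) (hh k)).trans (I.taylor.abs_grad_le x k)

/-- Uniform control of the centred smoothed residuals. -/
lemma ae_locRes_le (I : ℐ) :
    ∀ᵐ ω ∂P, ∃ C : ℝ, 0 ≤ C ∧ ∀ᶠ n : ℕ in atTop, ∀ m ≤ n, ∀ x ∈ Icc lo hi, ∀ e : Option ι,
      |∑ i ∈ range m, (ℛ n i x e (D i ω) - ∫ d, ℛ n i x e d ∂Q)| ≤ C * (n * rateX b n) := by
  have hCφ := I.nonneg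
  filter_upwards [I.env.ae_momKer_le I.kernel W I.measurable_W I.abs_W_le lo hi, I.env.ae_momKer_le
    I.kernel (fun _ _ => 𝟙) (fun _ _ _ => measurable_const) I.abs_one_le lo hi] with ω ⟨C1, hC1, h1⟩ ⟨C2, hC2, h2⟩
  refine ⟨C1 + ∑ _e : Option ι, Cφ * C2, by positivity, ?_⟩
  filter_upwards [h1, h2, I.eventually_abs_taylorCoef_le] with n h1 h2 hβ m hm x hx e
  have key : ∑ i ∈ range m, (ℛ n i x e (D i ω) - ∫ d, ℛ n i x e d ∂Q) =
      ∑ i ∈ range m, (Ψ n i (W n i) (𝓚 e none (h n) x) (D i ω) - ∫ d, Ψ n i (W n i) (𝓚 e none (h n) x) d ∂Q) -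
      ∑ e', 𝒯 n x e' * ∑ i ∈ range m,
        (Ψ n i 𝟙 (𝓚 e e' (h n) x) (D i ω) - ∫ d, Ψ n i 𝟙 (𝓚 e e' (h n) x) d ∂Q) := by
    simp only [I.integral_locRes, mul_sum]
    rw [sum_comm, ← sum_sub_distrib]
    refine sum_congr rfl fun i _ => ?_
    simp only [locRes, mul_sub, sum_sub_distrib]
    ring
  rw [key]
  refine (abs_sub _ _).trans ?_
  rw [add_mul, sum_mul]
  refine add_le_add (h1 m hm x hx e none) ((abs_sum_le_sum_abs _ _).trans (sum_le_sum fun e' _ => ?_))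
  rw [abs_mul, mul_assoc]
  exact mul_le_mul (hβ x e') (h2 m hm x hx e e') (abs_nonneg _) hCφ

/-- The empirical moments of the design are uniformly close to the population moments. -/
lemma ae_empMom_le (I : ℐ) :
    ∀ᵐ ω ∂P, ∃ C : ℝ, 0 ≤ C ∧ ∀ᶠ n : ℕ in atTop, ∀ x ∈ Icc lo hi, ∀ e e' : Option ι,
      |empMom K s c ξ h (fun i => D i ω) n x e e' - designMom K ν (h n) x e e'| ≤
        C * (rateX b n / ∏ k, h n k) := by
  filter_upwards [I.env.ae_momKer_le I.kernel (fun _ _ => 𝟙) (fun _ _ _ => measurable_const)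
    I.abs_one_le lo hi] with ω ⟨C, hC, h1⟩
  refine ⟨C, hC, ?_⟩
  filter_upwards [h1, eventually_gt_atTop 0] with n h1 hn x hx e e'
  have hn0 : (0 : ℝ) < n := by exact_mod_cast hn
  have hH := I.prod_h_pos n
  have h2 := h1 n le_rfl x hx e e'
  simp only [I.integral_smp_one, sum_sub_distrib, sum_const, card_range, nsmul_eq_mul] at h2
  have h4 : empMom K s c ξ h (fun i => D i ω) n x e e' - designMom K ν (h n) x e e' =
      (n * ∏ k, h n k)⁻¹ * (∑ i ∈ range n, Ψ n i 𝟙 (𝓚 e e' (h n) x) (D i ω) -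
        n * ∫ u, 𝓚 e e' (h n) x u ∂ν) := by
    rw [empMom, designMom]; field_simp
  rw [h4, abs_mul, abs_of_pos (by positivity)]
  calc _ ≤ (n * ∏ k, h n k)⁻¹ * (C * (n * rateX b n)) := by gcongr
    _ = _ := by field_simp

end IsSmoother

/-- `bh` minimizes the local least squares criterion at `x` for the responses `y`. -/
def IsLocalFit {Ξ A : Type*} {ι : Type} [Fintype ι] (K : ℝ → ℝ) (n : ℕ) (s : ℕ → Finset A) (c : ℕ → ℝ)
    (ξ : A → Ξ → ι → ℝ) (D : ℕ → Ξ) (y : ℕ → A → ℝ) (h x : ι → ℝ) (bh : Option ι → ℝ) : Prop :=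
  ∀ b' : Option ι → ℝ, ∑ i ∈ range n, c i * ∑ α ∈ s i,
      (y i α - ∑ e, bh e * dsg h x e (ξ α (D i))) ^ 2 * prodKer (fun _ => K) h x (ξ α (D i)) ≤
    ∑ i ∈ range n, c i * ∑ α ∈ s i,
      (y i α - ∑ e, b' e * dsg h x e (ξ α (D i))) ^ 2 * prodKer (fun _ => K) h x (ξ α (D i))

/-- Local linear fits solve a linear system for their deviation from given coefficients `β`. -/
lemma localLinear_system {s : ℕ → Finset A} {c : ℕ → ℝ} {ξ : A → Ξ → ι → ℝ} {D : ℕ → Ξ}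
    {y : ℕ → A → ℝ} {n : ℕ} {h x : ι → ℝ} {bh : Option ι → ℝ} (hmin : IsLocalFit K n s c ξ D y h x bh)
    (κ : ℝ) (β : Option ι → ℝ) (e : Option ι) :
    ∑ e', (κ * ∑ i ∈ range n, c i * ∑ α ∈ s i, 𝓚 e e' h x (ξ α (D i))) * (bh e' - β e') =
    κ * ∑ i ∈ range n, c i * ∑ α ∈ s i, (y i α - ∑ e', β e' * dsg h x e' (ξ α (D i))) *
      𝓚 e none h x (ξ α (D i)) := by
  have hNE := normal_equations ((range n).sigma s)
    (fun o => c o.1 * prodKer (fun _ => K) h x (ξ o.2 (D o.1))) (fun o => y o.1 o.2)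
    (fun o e => dsg h x e (ξ o.2 (D o.1))) bh (fun b' => by
      have := hmin b'
      rw [sum_sigma, sum_sigma]
      simp only [mul_sum] at this
      refine le_trans (le_of_eq ?_) (this.trans (le_of_eq ?_)) <;>
      exact sum_congr rfl fun i _ => sum_congr rfl fun α _ => by ring) e
  rw [sum_sigma] at hNE
  have h1 : ∀ i α, 𝓚 e none h x (ξ α (D i)) =
      prodKer (fun _ => K) h x (ξ α (D i)) * dsg h x e (ξ α (D i)) := fun i α => by
    rw [prodKer_momKer]; simp [dsg]
  have h2 : ∑ e', (κ * ∑ i ∈ range n, c i * ∑ α ∈ s i, 𝓚 e e' h x (ξ α (D i))) *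
      (bh e' - β e') = κ * ∑ i ∈ range n, c i * ∑ α ∈ s i,
        (∑ e', bh e' * dsg h x e' (ξ α (D i)) - ∑ e', β e' * dsg h x e' (ξ α (D i))) *
        𝓚 e none h x (ξ α (D i)) := by
    simp only [mul_sum, sum_mul, ← sum_sub_distrib]
    rw [sum_comm]
    refine sum_congr rfl fun i _ => ?_
    rw [sum_comm]
    refine sum_congr rfl fun α _ => sum_congr rfl fun e' _ => ?_
    rw [h1, prodKer_momKer]; ring
  rw [h2, ← sub_eq_zero, ← mul_sub, ← sum_sub_distrib, mul_eq_zero]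
  right
  rw [← neg_eq_zero, ← sum_neg_distrib, ← hNE]
  refine sum_congr rfl fun i _ => ?_
  rw [← mul_sub, ← sum_sub_distrib, ← mul_neg, ← sum_neg_distrib, mul_sum]
  exact sum_congr rfl fun α _ => by rw [h1]; ring

/-! ### Expansion of local linear fits -/

lemma abs_sum_invCol_mul_le {ε : Type} [Fintype ε] [DecidableEq ε] {S : ε → ε → ℝ} {κ R : ℝ}
    (hκ : 0 < κ) (hS : ∀ c : ε → ℝ, κ * ∑ e, c e ^ 2 ≤ ∑ e, c e * ∑ e', S e e' * c e') (e₀ : ε)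
    {r : ε → ℝ} (hr : ∀ e, |r e| ≤ R) : |∑ e, invCol e₀ S e * r e| ≤ Fintype.card ε ^ 2 / κ * R := by
  refine (abs_sum_le_sum_abs _ _).trans ((Finset.sum_le_card_nsmul _ _ (Fintype.card ε / κ * R)
    fun e _ => ?_).trans (le_of_eq ?_))
  · rw [abs_mul]
    have := abs_le_of_posDef hκ hS (sum_mul_invCol hκ hS e₀) (ρ := 1) (fun e => by split_ifs <;> simp) e
    exact mul_le_mul (by simpa using this) (hr e) (abs_nonneg _) (by positivity)
  · simp only [card_univ, nsmul_eq_mul]; ring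

/-- The leading bias of the local linear fit. -/
def llBias (K : ℝ → ℝ) (ν : Measure (ι → ℝ)) (φ : (ι → ℝ) → ℝ) (G : (ι → ℝ) → ι → ℝ) (h x : ι → ℝ) : ℝ :=
  ∑ e, invCol none (designMom K ν h x) e * ((∏ k, h k)⁻¹ * biasInt K ν φ G h x e)

/-- The influence of the data `d` on the local linear fit. -/
def infl (K : ℝ → ℝ) (Q : Measure Ξ) (ν : Measure (ι → ℝ)) (s : Finset A) (c : ℝ)
    (ξ : A → Ξ → ι → ℝ) (W : A → Ξ → ℝ) (φ : (ι → ℝ) → ℝ) (G : (ι → ℝ) → ι → ℝ)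
    (h x : ι → ℝ) (d : Ξ) : ℝ :=
  ∑ e, invCol none (designMom K ν h x) e * ((∏ k, h k)⁻¹ * (locRes K s c ξ W h x (taylorCoef φ G h x) e d -
      ∫ d, locRes K s c ξ W h x (taylorCoef φ G h x) e d ∂Q))

local notation:max "𝓘" n:max i:max => infl K Q ν (s n i) (c n i) ξ (W n i) φ G (h n)

namespace IsSmoother

lemma exists_posDef (I : ℐ) : ∃ κ : ℝ, 0 < κ ∧ ∀ᶠ n in atTop, ∀ x ∈ Icc lo hi, ∀ c : Option ι → ℝ,
      κ * ∑ e, c e ^ 2 ≤ ∑ e, c e * ∑ e', designMom K ν (h n) x e e' * c e' := by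
  obtain ⟨κ₀, hκ₀, hν⟩ := I.design.lower
  obtain ⟨κ, hκ, hd⟩ := exists_designMom_ge I.kernel hκ₀ hν
  refine ⟨κ, hκ, ?_⟩
  have h1 := eventually_all.2 fun k => (I.env.h_tendsto k).eventually_le_const
    (show 0 < (hi k - lo k) / 2 by linarith [I.design.lt k])
  filter_upwards [h1] with n hn x hx
  exact hd (h n) x (I.env.h_pos n) (fun k => by linarith [hn k]) hx

lemma measurable_prodKer_comp (I : ℐ) (n : ℕ) (e e' : Option ι) (α : A) :
    Measurable fun v : (ι → ℝ) × Ξ => 𝓚 e e' (h n) v.1 (ξ α v.2) :=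
  (measurable_prodKer (I.kernel.measurable_momKer e e') (h n)).comp
    (measurable_fst.prodMk ((I.env.measurable_ξ α).comp measurable_snd))

lemma measurable_taylorCoef (I : ℐ) (n : ℕ) (e : Option ι) : Measurable fun x => 𝒯 n x e := by
  cases e with
  | none => exact I.taylor.measurable
  | some k => exact (I.measurable_G k).mul_const _

lemma measurable_locRes (I : ℐ) (n i : ℕ) (e : Option ι) : Measurable fun v : (ι → ℝ) × Ξ =>
      ℛ n i v.1 e v.2 := by
  unfold locRes smp
  refine Measurable.sub ?_ (measurable_sum _ fun e' _ =>
    ((I.measurable_taylorCoef n e').comp measurable_fst).mul ?_)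
  · exact (measurable_sum _ fun α _ => ((I.measurable_W n i α).comp measurable_snd).mul
      (I.measurable_prodKer_comp n e none α)).const_mul _
  · exact (measurable_sum _ fun α _ => (I.measurable_prodKer_comp n e e' α).const_mul _).const_mul _

lemma measurable_invCol_designMom (I : ℐ) (n : ℕ)
    (e : Option ι) : Measurable fun x => invCol none (designMom K ν (h n) x) e :=
  (measurable_invCol none e).comp (measurable_pi_lambda _ fun e => measurable_pi_lambda _ fun e' =>
    I.kernel.measurable_designMom ν (h n) e e')

lemma measurable_infl (I : ℐ) (n i : ℕ) : Measurable fun v : (ι → ℝ) × Ξ => 𝓘 n i v.1 v.2 := by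
  unfold infl
  refine measurable_sum _ fun e _ =>
    ((I.measurable_invCol_designMom n e).comp measurable_fst).mul (Measurable.const_mul ?_ _)
  refine (I.measurable_locRes n i e).sub ?_
  exact ((I.measurable_locRes n i e).stronglyMeasurable.integral_prod_right').measurable.comp measurable_fst

lemma measurable_llBias (I : ℐ) (n : ℕ) : Measurable fun x => llBias K ν φ G (h n) x := by
  unfold llBias
  refine measurable_sum _ fun e _ => (I.measurable_invCol_designMom n e).mul (Measurable.const_mul ?_ _)
  have hm : Measurable fun v : (ι → ℝ) × (ι → ℝ) =>
      (φ v.2 - ∑ e', 𝒯 n v.1 e' * dsg (h n) v.1 e' v.2) * 𝓚 e none (h n) v.1 v.2 := by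
    refine ((I.taylor.measurable.comp measurable_snd).sub (measurable_sum _ fun e' _ =>
      ((I.measurable_taylorCoef n e').comp measurable_fst).mul ?_)).mul
        (measurable_prodKer (I.kernel.measurable_momKer e none) (h n))
    cases e' with
    | none => exact measurable_const
    | some k => simp only [dsg, Option.elim_some]; fun_prop
  exact hm.stronglyMeasurable.integral_prod_right'.measurable

lemma abs_llBias_le (I : ℐ) : ∃ C : ℝ, 0 ≤ C ∧ ∀ᶠ n in atTop, ∀ x ∈ Icc lo hi,
      |llBias K ν φ G (h n) x| ≤ C * ∑ k, h n k ^ 2 := by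
  obtain ⟨κ, hκ, hd⟩ := I.exists_posDef
  obtain ⟨C, hC, hb⟩ := I.exists_biasInt_le
  refine ⟨Fintype.card (Option ι) ^ 2 / κ * C, by positivity, ?_⟩
  filter_upwards [hd] with n hd x hx
  rw [mul_assoc]
  exact abs_sum_invCol_mul_le hκ (hd x hx) none (hb n x hx)

/-- The influence is dominated by a local average of the envelope. -/
lemma abs_infl_le (I : ℐ) : ∃ C : ℝ, 0 ≤ C ∧ ∀ᶠ n in atTop, ∀ x ∈ Icc lo hi, ∀ i d,
      |𝓘 n i x d| ≤ C * ((∏ k, h n k)⁻¹ * Ψ n i (E n i)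
          ((Icc (fun k => x k - h n k) fun k => x k + h n k).indicator 1) d + 1) := by
  obtain ⟨κ, hκ, hd⟩ := I.exists_posDef
  obtain ⟨C, hC, hb⟩ := I.exists_biasInt_le
  obtain ⟨M, hM0, hM⟩ := I.kernel.exists_abs_prodKer_momKer_le (ι := ι)
  have hCφ := I.nonneg
  set C' : ℝ := M + (∑ _e : Option ι, Cφ * M) + C * Fintype.card ι with hC'
  refine ⟨Fintype.card (Option ι) ^ 2 / κ * C', by positivity, ?_⟩
  filter_upwards [hd, I.eventually_abs_taylorCoef_le,
    eventually_all.2 fun k => (I.env.h_tendsto k).eventually_le_const one_pos] with n hd hβ hh x hx i d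
  have hH := I.prod_h_pos n
  rw [mul_assoc]
  refine abs_sum_invCol_mul_le hκ (hd x hx) none fun e => ?_
  set B := Icc (fun k => x k - h n k) fun k => x k + h n k with hB
  set V := Ψ n i (E n i) (B.indicator 1) d with hV
  have hV0 : 0 ≤ V := smp_nonneg (I.env.c_nonneg n i) (fun α _ => I.env.E_nonneg n i α d)
    fun u => indicator_nonneg (fun _ _ => zero_le_one) _
  have hs : ∀ (W' : A → Ξ → ℝ) (e' : Option ι), (∀ α, |W' α d| ≤ E n i α d) →
      |Ψ n i W' (𝓚 e e' (h n) x) d| ≤ M * V := fun W' e' hW' => by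
    refine (abs_smp_le (I.env.c_nonneg n i) (fun α _ => hW' α)
      fun u => (hM e e' (h n) x u).2 (I.env.h_pos n)).trans (le_of_eq ?_)
    rw [hV, smp, smp]
    simp only [mul_sum]
    exact sum_congr rfl fun α _ => by ring
  have h1 : |ℛ n i x e d| ≤ (M + ∑ _e : Option ι, Cφ * M) * V := by
    refine (abs_sub _ _).trans ?_
    rw [add_mul, sum_mul]
    refine add_le_add (hs _ _ fun α => I.abs_W_le n i α d) ((abs_sum_le_sum_abs _ _).trans
      (sum_le_sum fun e' _ => ?_))
    rw [abs_mul, mul_assoc]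
    exact mul_le_mul (hβ x e') (hs _ _ fun α => by rw [abs_one]; exact I.one_le n i α d) (abs_nonneg _) hCφ
  have h2 : ∑ k, h n k ^ 2 ≤ Fintype.card ι := by
    refine (sum_le_sum fun k _ => pow_le_one₀ (n := 2) (I.env.h_pos n k).le (hh k)).trans ?_
    simp
  have h3 := hb n x hx e
  rw [mul_sub, I.integral_locRes_eq]
  refine (abs_sub _ _).trans ?_
  rw [abs_mul, abs_of_pos (inv_pos.2 hH)]
  have h4 : (∏ k, h n k)⁻¹ * |ℛ n i x e d| ≤ (M + ∑ _e : Option ι, Cφ * M) * ((∏ k, h n k)⁻¹ * V) := by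
    rw [mul_left_comm]; gcongr
  have h5 : 0 ≤ C * (Fintype.card ι : ℝ) * ((∏ k, h n k)⁻¹ * V) + (M + ∑ _e : Option ι, Cφ * M) := by positivity
  have h6 := mul_le_mul_of_nonneg_left h2 hC
  rw [hC']
  linarith

lemma ae_infl_le (I : ℐ) : ∀ᵐ ω ∂P, ∃ C : ℝ, 0 ≤ C ∧ ∀ᶠ n : ℕ in atTop, ∀ m ≤ n, ∀ x ∈ Icc lo hi,
      |(n : ℝ)⁻¹ * ∑ i ∈ range m, 𝓘 n i x (D i ω)| ≤ C * (rateX b n / ∏ k, h n k) := by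
  obtain ⟨κ, hκ, hd⟩ := I.exists_posDef
  filter_upwards [I.ae_locRes_le] with ω ⟨C, hC, h1⟩
  refine ⟨Fintype.card (Option ι) ^ 2 / κ * C, by positivity, ?_⟩
  filter_upwards [h1, hd, eventually_gt_atTop 0] with n h1 hd hn m hm x hx
  have hH := I.prod_h_pos n
  have hn0 : (0 : ℝ) < n := by exact_mod_cast hn
  have e1 : (n : ℝ)⁻¹ * ∑ i ∈ range m, 𝓘 n i x (D i ω) = ∑ e, invCol none (designMom K ν (h n) x) e *
      ((n : ℝ)⁻¹ * ((∏ k, h n k)⁻¹ * ∑ i ∈ range m, (ℛ n i x e (D i ω) - ∫ d, ℛ n i x e d ∂Q))) := by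
    simp only [infl, mul_sum]
    rw [sum_comm]
    exact sum_congr rfl fun e _ => sum_congr rfl fun i _ => by ring
  rw [e1, mul_assoc]
  refine abs_sum_invCol_mul_le hκ (hd x hx) none fun e => ?_
  rw [abs_mul, abs_mul, abs_of_pos (inv_pos.2 hH), abs_of_pos (inv_pos.2 hn0)]
  calc _ ≤ (n : ℝ)⁻¹ * ((∏ k, h n k)⁻¹ * (C * (n * rateX b n))) := by gcongr; exact h1 m hm x hx e
    _ = _ := by field_simp

/-- Expansion of local linear fits to perturbed responses. -/
lemma ae_fit_le (I : ℐ) : ∀ᵐ ω ∂P, ∃ C : ℝ, 0 ≤ C ∧ ∀ᶠ n : ℕ in atTop, ∀ x ∈ Icc lo hi,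
      ∀ (y : ℕ → A → ℝ) (bh : Option ι → ℝ) (η : ℝ),
      IsLocalFit K n (s n) (c n) ξ (fun i => D i ω) y (h n) x bh →
      (∀ e, |(n * ∏ k, h n k)⁻¹ * ∑ i ∈ range n, c n i * ∑ α ∈ s n i,
        (y i α - W n i α (D i ω)) * 𝓚 e none (h n) x (ξ α (D i ω))| ≤ η) →
      |bh none - φ x| ≤ C * (rateX b n / (∏ k, h n k) + ∑ k, h n k ^ 2 + η) ∧
      |bh none - φ x - llBias K ν φ G (h n) x - (n : ℝ)⁻¹ * ∑ i ∈ range n, 𝓘 n i x (D i ω)| ≤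
        C * (rateX b n / (∏ k, h n k) * (rateX b n / (∏ k, h n k) + ∑ k, h n k ^ 2) + η) := by
  obtain ⟨κ, hκ, hd⟩ := I.exists_posDef
  obtain ⟨C₂, hC₂, hb⟩ := I.exists_biasInt_le
  filter_upwards [I.ae_locRes_le, I.ae_empMom_le] with ω ⟨C₁, hC₁, h1⟩ ⟨C₃, hC₃, h3⟩
  set k₀ : ℝ := (Fintype.card (Option ι) : ℝ) with hk₀
  have hk0 : 0 ≤ k₀ := by positivity
  set Ca : ℝ := k₀ * (C₁ + C₂ + 1) / (κ / 2)
  set Cb : ℝ := 2 * k₀ ^ 4 / κ ^ 2 * (C₃ * (C₁ + C₂ + 1))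
  set Cc : ℝ := k₀ ^ 2 / κ
  have hCa : 0 ≤ Ca := by positivity
  have hCb : 0 ≤ Cb := by positivity
  have hCc : 0 ≤ Cc := by positivity
  refine ⟨Ca + Cb + Cc, by positivity, ?_⟩
  have hsm : ∀ᶠ n in atTop, k₀ * (C₃ * (rateX b n / ∏ k, h n k)) ≤ κ / 2 := by
    have := (I.rate.const_mul C₃).const_mul k₀
    simp only [mul_zero] at this
    exact this.eventually_le_const (by positivity)
  filter_upwards [h1, h3, hd, hsm, I.rate.eventually_le_const one_pos, eventually_gt_atTop 0]
    with n h1 h3 hd hsm hδ1 hn x hx y bh η hmin hη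
  have hH := I.prod_h_pos n
  have hn0 : (0 : ℝ) < n := by exact_mod_cast hn
  set δ := rateX b n / ∏ k, h n k with hδ
  have hδ0 : 0 ≤ δ := div_nonneg (rateX_nonneg b n) hH.le
  set hh := ∑ k, h n k ^ 2 with hhh
  have hh0 : 0 ≤ hh := by positivity
  have hη0 : 0 ≤ η := (abs_nonneg _).trans (hη none)
  set r0 : Option ι → ℝ := fun e => (n * ∏ k, h n k)⁻¹ * ∑ i ∈ range n, (ℛ n i x e (D i ω) -
      ∫ d, ℛ n i x e d ∂Q) with hr0
  set r1 : Option ι → ℝ := fun e => (∏ k, h n k)⁻¹ * biasInt K ν φ G (h n) x e with hr1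
  set r2 : Option ι → ℝ := fun e => (n * ∏ k, h n k)⁻¹ * ∑ i ∈ range n, c n i *
    ∑ α ∈ s n i, (y i α - W n i α (D i ω)) * 𝓚 e none (h n) x (ξ α (D i ω)) with hr2
  have hsys : ∀ e, ∑ e', empMom K s c ξ h (fun i => D i ω) n x e e' *
      (bh e' - 𝒯 n x e') = r0 e + r1 e + r2 e := fun e => by
    have hs := localLinear_system hmin (n * ∏ k, h n k)⁻¹ (𝒯 n x) e
    simp only [empMom, smp, one_mul]
    rw [hs]
    have e1 : r1 e = (n * ∏ k, h n k)⁻¹ * ∑ i ∈ range n, ∫ d, ℛ n i x e d ∂Q := by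
      simp only [I.integral_locRes_eq, sum_const, card_range, nsmul_eq_mul, hr1]
      field_simp
    rw [e1]
    simp only [hr0, hr2]
    rw [← mul_add, ← mul_add, ← sum_add_distrib, ← sum_add_distrib]
    congr 1
    refine sum_congr rfl fun i _ => ?_
    rw [sub_add_cancel, locRes, smp]
    simp only [smp, one_mul]
    have e2 : ∀ e', 𝒯 n x e' * (c n i * ∑ α ∈ s n i, 𝓚 e e' (h n) x (ξ α (D i ω))) = c n i * ∑ α ∈ s n i,
        𝒯 n x e' * dsg (h n) x e' (ξ α (D i ω)) * 𝓚 e none (h n) x (ξ α (D i ω)) := fun e' => by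
      rw [mul_left_comm, mul_sum]
      congr 1
      refine sum_congr rfl fun α _ => ?_
      rw [prodKer_momKer, prodKer_momKer]
      simp only [dsg, Option.elim_none]; ring
    simp only [e2]
    rw [← mul_sum, ← mul_sub, ← mul_add, sum_comm, ← sum_sub_distrib, ← sum_add_distrib]
    congr 1
    refine sum_congr rfl fun α _ => ?_
    rw [← sum_mul]; ring
  have b0 : ∀ e, |r0 e| ≤ C₁ * δ := fun e => by
    rw [hr0, abs_mul, abs_of_pos (by positivity)]
    calc _ ≤ (n * ∏ k, h n k)⁻¹ * (C₁ * (n * rateX b n)) := by gcongr; exact h1 n le_rfl x hx e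
      _ = _ := by rw [hδ]; field_simp
  have b1 : ∀ e, |r1 e| ≤ C₂ * hh := hb n x hx
  set ρ := (C₁ + C₂ + 1) * (δ + hh + η) with hρ
  have hr : ∀ e, |r0 e + r1 e + r2 e| ≤ ρ := fun e => by
    have a := abs_add_three (r0 e) (r1 e) (r2 e)
    have := b0 e
    have := b1 e
    have := hη e
    have : 0 ≤ C₁ * hh + C₁ * η + C₂ * δ + C₂ * η + δ + hh := by positivity
    rw [hρ]
    linarith
  have hpd := posDef_of_close (η := C₃ * δ) (by positivity) (hd x hx) (h3 x hx) hsm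
  have hd0 := abs_le_of_posDef (half_pos hκ) hpd hsys hr none
  have hd1 := abs_sub_sum_invCol_le hκ (by positivity) (designMom_symm ν (h n) x) (hd x hx) (h3 x hx)
    hsm hsys hr none
  have t0 : 𝒯 n x none = φ x := rfl
  rw [t0, ← hk₀] at hd0 hd1
  refine ⟨hd0.trans ?_, ?_⟩
  · calc k₀ * ρ / (κ / 2) = Ca * (δ + hh + η) := by simp only [hρ, Ca]; ring
      _ ≤ _ := by gcongr; linarith
  · have e3 : ∑ e, invCol none (designMom K ν (h n) x) e * (r0 e + r1 e + r2 e) =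
        llBias K ν φ G (h n) x + (n : ℝ)⁻¹ * ∑ i ∈ range n, 𝓘 n i x (D i ω) +
        ∑ e, invCol none (designMom K ν (h n) x) e * r2 e := by
      simp only [llBias, infl, mul_add, sum_add_distrib]
      rw [sum_comm, mul_sum, add_comm (∑ e, _ * r0 e)]
      congr 2
      refine sum_congr rfl fun e _ => ?_
      rw [← mul_sum, ← mul_sum, hr0]
      field_simp
    rw [e3] at hd1
    have b2 : |∑ e, invCol none (designMom K ν (h n) x) e * r2 e| ≤ Cc * η :=
      abs_sum_invCol_mul_le hκ (hd x hx) none hη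
    have b3 : 2 * k₀ ^ 4 / κ ^ 2 * (C₃ * δ * ρ) ≤ Cb * (δ * (δ + hh) + η) := by
      calc _ = Cb * (δ * (δ + hh) + δ * η) := by simp only [hρ, Cb]; ring
        _ ≤ _ := by gcongr; exact mul_le_of_le_one_left hη0 hδ1
    have b4 : 0 ≤ δ * (δ + hh) := by positivity
    rw [abs_le] at hd1 b2 ⊢
    have b5 : 0 ≤ Ca * (δ * (δ + hh) + η) + Cc * (δ * (δ + hh)) := by positivity
    constructor <;> linarith [hd1.1, hd1.2, b2.1, b2.2]

lemma ae_mem [Countable A] (I : ℐ) : ∀ᵐ ω ∂P, ∀ n i, ∀ α ∈ s n i, ξ α (D i ω) ∈ Icc lo hi := by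
  refine ae_all_iff.2 fun n => ae_all_iff.2 fun i => ae_all_iff.2 fun α => ?_
  by_cases hα : α ∈ s n i
  · have h1 := I.design.supp
    rw [← I.design.law n i α hα, ← I.env.iid.law i, Measure.map_map (I.env.measurable_ξ α)
      (I.env.iid.measurable i)] at h1
    filter_upwards [ae_of_ae_map ((I.env.measurable_ξ α).comp (I.env.iid.measurable i)).aemeasurable h1]
      with ω hω _ using hω
  · exact ae_of_all _ fun ω h => absurd h hα

end IsSmoother

/-! ### Products of residuals with the error of the mean estimate -/

/-- The uniform kernel. -/
def boxKer : ℝ → ℝ := (Icc (-1 : ℝ) 1).indicator fun _ => 1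

lemma boxKer_nonneg (v : ℝ) : 0 ≤ boxKer v := indicator_nonneg (fun _ _ => zero_le_one) _

lemma boxKer_le_one (v : ℝ) : boxKer v ≤ 1 := indicator_le' (fun _ _ => le_rfl) (fun _ _ => zero_le_one) v

lemma boxKer_mul_nonneg (u v : ℝ) : 0 ≤ boxKer u * boxKer v := mul_nonneg (boxKer_nonneg u) (boxKer_nonneg v)

lemma norm_boxKer_mul_le (u v : ℝ) : ‖boxKer u * boxKer v‖ ≤ 1 := by
  rw [norm_of_nonneg (boxKer_mul_nonneg u v)]
  exact mul_le_one₀ (boxKer_le_one _) (boxKer_nonneg _) (boxKer_le_one _)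

lemma norm_boxKer_mul_mul_le (u v w : ℝ) : ‖boxKer u * (boxKer v * boxKer w)‖ ≤ 1 := by
  rw [norm_mul, norm_of_nonneg (boxKer_nonneg u)]
  exact mul_le_one₀ (boxKer_le_one _) (norm_nonneg _) (norm_boxKer_mul_le v w)

lemma stepApprox_boxKer : StepApprox boxKer 1 := by
  have := stepApprox_const_indicator 1
  rwa [abs_one] at this

lemma measurable_boxKer : Measurable boxKer := stepApprox_boxKer.measurable

lemma boxKer_div_le {h : ℝ} (hh : 0 < h) (u t : ℝ) :
    boxKer ((u - t) / h) ≤ (Ico (t - h) (t + 2 * h)).indicator 1 u := by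
  by_cases hm : (u - t) / h ∈ Icc (-1 : ℝ) 1
  · have hm' := hm
    rw [mem_Icc, le_div_iff₀ hh, div_le_iff₀ hh] at hm'
    have hu : u ∈ Ico (t - h) (t + 2 * h) := ⟨by linarith [hm'.1], by linarith [hm'.2]⟩
    rw [boxKer, indicator_of_mem hm, indicator_of_mem hu]
    rfl
  · rw [boxKer, indicator_of_notMem hm]
    exact indicator_nonneg (fun _ _ => zero_le_one) _

local notation "𝓑" => prodKer fun _ => boxKer

lemma prodKer_boxKer_nonneg (h t u : ι → ℝ) : 0 ≤ 𝓑 h t u := prod_nonneg fun _ _ => boxKer_nonneg _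

lemma abs_prodKer_le_boxKer {f : ι → ℝ → ℝ} {M : ι → ℝ} (hf : ∀ k, StepApprox (f k) (M k))
    (h t u : ι → ℝ) : |prodKer f h t u| ≤ (∏ k, M k) * 𝓑 h t u := by
  unfold prodKer
  rw [abs_prod, ← prod_mul_distrib]
  refine Finset.prod_le_prod (fun _ _ => abs_nonneg _) fun k _ => ?_
  simp only [boxKer]
  by_cases hm : (u k - t k) / h k ∈ Icc (-1 : ℝ) 1
  · rw [indicator_of_mem hm, mul_one]
    exact (hf k).abs_le _
  · rw [(hf k).eq_zero hm, indicator_of_notMem hm, abs_zero, mul_zero]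

lemma abs_prodKer_boxKer_le (h t u : ι → ℝ) : |𝓑 h t u| ≤ 1 :=
  (abs_prodKer_le (fun _ => stepApprox_boxKer.abs_le) h t u).trans (by simp)

lemma measurable_prodKer_boxKer (h t : ι → ℝ) : Measurable (prodKer (fun _ : ι => boxKer) h t) := by
  unfold prodKer
  exact Finset.measurable_prod _ fun k _ => measurable_boxKer.comp (by fun_prop)

/-- Local sums of the envelope are of the order of their means. -/
lemma IsEnvelope.ae_smp_boxKer_le (H : ℰ) (Λ : ℕ) :
    ∀ᵐ ω ∂P, ∃ C : ℝ, 0 ≤ C ∧ ∀ᶠ n : ℕ in atTop, ∀ t : ι → ℝ, (∀ k, |t k| ≤ Λ) →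
      ∑ i ∈ range n, Ψ n i (E n i) (𝓑 (h n) t) (D i ω) ≤ C * (n * (∏ k, h n k + rateX b n)) := by
  obtain ⟨C₁, hC₁, h1⟩ := H.first_moment
  have hE : ∀ n i α d, |E n i α d| ≤ E n i α d := fun n i α d => (abs_of_nonneg (H.E_nonneg n i α d)).le
  filter_upwards [H.ae_prodKer_le Λ E H.measurable_E hE (f := fun _ => boxKer)
    fun _ => stepApprox_boxKer] with ω ⟨C, hC, h2⟩
  refine ⟨C + C₁ * 3 ^ Fintype.card ι, by positivity, ?_⟩
  filter_upwards [h2] with n h2 t ht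
  have h3 := (abs_le.1 (h2 n le_rfl t ht)).2
  rw [sum_sub_distrib] at h3
  have h4 : ∀ i, ∫ d, Ψ n i (E n i) (𝓑 (h n) t) d ∂Q ≤ C₁ * 3 ^ Fintype.card ι * ∏ k, h n k := fun i => by
    set l : ι → ℝ := fun k => t k - h n k
    set r : ι → ℝ := fun k => t k + 2 * h n k
    have hI : ∀ u, 𝓑 (h n) t u ≤ (box l r).indicator 1 u := fun u => by
      rw [box, indicator_pi_one]
      exact Finset.prod_le_prod (fun _ _ => boxKer_nonneg _) fun k _ => boxKer_div_le (H.h_pos n k) _ _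
    refine (integral_mono (H.integrable_smp n i (H.measurable_E n i) (hE n i)
      (measurable_prodKer_boxKer _ _) (abs_prodKer_boxKer_le _ _))
      ((H.memLp_smp n i (measurableSet_box l r)).integrable one_le_two)
      fun d => smp_mono (H.c_nonneg n i) (fun α _ => H.E_nonneg n i α d) (fun _ _ => le_rfl)
        (prodKer_boxKer_nonneg _ _) hI).trans ?_
    refine (h1 n i l r fun k => by have := H.h_pos n k; simp only [l, r]; linarith).trans (le_of_eq ?_)
    rw [mul_assoc, prod_congr rfl fun k _ => (by simp only [l, r]; ring : r k - l k = 3 * h n k),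
      prod_mul_distrib, prod_const, card_univ]
  have h5 := sum_le_sum fun i (_ : i ∈ range n) => h4 i
  rw [sum_const, card_range, nsmul_eq_mul] at h5
  have h6 : 0 ≤ C * (n * ∏ k, h n k) := mul_nonneg hC (mul_nonneg (by positivity)
    (prod_nonneg fun k _ => (H.h_pos n k).le))
  have h7 : 0 ≤ C₁ * 3 ^ Fintype.card ι * (n * rateX b n) := by
    have := rateX_nonneg b n
    positivity
  linarith

/-- Truncation to `[-1,1]`. -/
def clip (v : ℝ) : ℝ := max (-1) (min 1 v)

lemma abs_clip_le (v : ℝ) : |clip v| ≤ 1 :=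
  abs_le.2 ⟨le_max_left _ _, max_le (by norm_num) (min_le_left _ _)⟩

lemma clip_eq {v : ℝ} (hv : |v| ≤ 1) : clip v = v := by
  rw [clip, min_eq_right (abs_le.1 hv).2, max_eq_right (abs_le.1 hv).1]

lemma measurable_clip : Measurable clip := by unfold clip; fun_prop

section Cross

variable {D : ℕ → Ω → Subj S p} {b : ℕ → ℝ}

local notation "𝓔" => IsEnvelope P ℒ D 𝔬 𝔴 timePair 𝔠 (fun n _ => hG n) b
local notation:max "Φ" n:max i:max => smp (Finset.offDiag (range (N n i))) (1 / ((N n i : ℝ) * ((N n i : ℝ) - 1))) timePair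

lemma SubjModel.env_le_covEnv (H : ℳ q) (N : ℕ) (α : ℕ × ℕ) (y) : env mm α.1 y ≤ covEnv mm N α y := by
  refine le_mul_of_one_le_right (H.env_nonneg _ _) ((H.one_le_env α.2 y).trans
    (le_add_of_nonneg_right (mul_nonneg (by positivity) (sum_nonneg fun m _ => H.env_nonneg m y))))

lemma measurable_cons (j : ℕ) : Measurable fun w : ℝ^p × (ℕ → ℝ) => (Fin.cons (w.2 j) w.1 : ℝ^(p + 1)) :=
  measurable_pi_lambda _ fun i => by
    refine Fin.cases ?_ (fun i => ?_) i
    · simp only [Fin.cons_zero]; fun_prop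
    · simp only [Fin.cons_succ]; fun_prop

/-- Residuals multiplied by truncated functions of the past. -/
lemma ae_adapted_resid_le (Cm : 𝒞) (H : ℳ q) (hq : 2 ≤ q) (Hc : 𝓔) (Λ : ℕ)
    (σ : ℕ → ℕ → ℕ) (hσ : ∀ n, Function.Injective (σ n)) (hσn : ∀ n, ∀ i < n, σ n i < n)
    (L : (n i : ℕ) → ℝ^(p + 1) → (Fin i → Subj S p) → ℝ)
    (hL : ∀ n i, Measurable fun v : ℝ^(p + 1) × (Fin i → Subj S p) => L n i v.1 v.2)
    {f : Fin 2 → ℝ → ℝ} {M : ℝ^2} (hf : ∀ k, StepApprox (f k) (M k)) :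
    ∀ᵐ ω ∂P, ∃ C : ℝ, 0 ≤ C ∧ ∀ᶠ n : ℕ in atTop, ∀ t : ℝ^2, (∀ k, |t k| ≤ Λ) → |∑ i ∈ range n, Φ n (σ n i)
          (fun α d => resid Pθ xc α.1 d * clip (L n i (timeCov α.2 d) fun l => D (σ n l) ω))
          (prodKer f (fun _ => hG n) t) (D (σ n i) ω)| ≤ C * (n * rateX b n) := by
  have hvec : ∀ α : ℕ × ℕ, Measurable fun w : ℝ^p × (ℕ → ℝ) => ![w.2 α.1, w.2 α.2] :=
    fun α => measurable_pi_lambda _ fun i => by fin_cases i <;> simp <;> fun_prop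
  have hLm : ∀ n i y, Measurable fun x => L n i x y := fun n i y =>
    (hL n i).comp (measurable_id.prodMk measurable_const)
  have hA : IsAdapted 𝔠 σ fun n i α y d => resid Pθ xc α.1 d * clip (L n i (timeCov α.2 d) y) := by
    refine ⟨hσ, hσn, fun n i α => ?_, fun n i α y d => ?_⟩
    · exact ((Cm.measurable_resid α.1).comp measurable_snd).mul (measurable_clip.comp
        ((hL n i).comp (((measurable_timeCov α.2).comp measurable_snd).prodMk measurable_fst)))
    · rw [abs_mul]
      exact (mul_le_of_le_one_right (abs_nonneg _) (abs_clip_le _)).trans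
        ((Cm.abs_resid_le α.1 d).trans (H.env_le_covEnv _ α d.1))
  filter_upwards [Hc.ae_adapted_prodKer_le hA Λ hf] with ω ⟨C, hC, h1⟩
  refine ⟨C, hC, h1.mono fun n h1 t ht => ?_⟩
  have hm : Measurable (prodKer f (fun _ => hG n) t) :=
    (measurable_prodKer (fun k => (hf k).measurable) _).comp measurable_prodMk_left
  have hb := abs_prodKer_le (fun k => (hf k).abs_le) (fun _ => hG n) t
  have hz : ∀ i (y : Fin i → Subj S p), ∫ d, Φ n (σ n i)
      (fun α d => resid Pθ xc α.1 d * clip (L n i (timeCov α.2 d) y))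
      (prodKer f (fun _ => hG n) t) d ∂ℒ = 0 := fun i y => by
    unfold smp
    rw [integral_const_mul, integral_finsetSum _ fun α _ => ?_, sum_eq_zero fun α _ => ?_, mul_zero]
    · have h1 := Cm.integral_resid_mul H hq α.1 (G := fun w =>
        clip (L n i (Fin.cons (w.2 α.2) w.1) y) * prodKer f (fun _ => hG n) t ![w.2 α.1, w.2 α.2])
        ((measurable_clip.comp ((hLm n i y).comp (measurable_cons α.2))).mul (hm.comp (hvec α)))
        (B := 1 * ∏ k, M k) fun w => by
          rw [abs_mul]; exact mul_le_mul (abs_clip_le _) (hb _) (abs_nonneg _) zero_le_one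
      simp only [← mul_assoc] at h1
      exact h1
    · refine ((Hc.integrable_E n (σ n i) α).mul_const (∏ k, M k)).mono' (((hA.measurable n i α).comp
        measurable_prodMk_left).mul (hm.comp (measurable_timePair α))).aestronglyMeasurable
        (ae_of_all _ fun d => ?_)
      rw [norm_mul]
      exact mul_le_mul (hA.abs_le n i α y d) (hb _) (abs_nonneg _) (H.covEnv_nonneg _ _ _)
  simpa only [hz, sub_zero] using h1 n le_rfl t ht

lemma SubjModel.integral_boxKer_le (H : ℳ q) :
    ∃ C : ℝ, 0 ≤ C ∧ ∀ h, 0 < h → ∀ t, ∫ v, boxKer ((v - t) / h) ∂PT ≤ C * h := by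
  obtain ⟨C, hC, h1⟩ := H.exists_PT_real_Ico_le
  refine ⟨C * 3, by positivity, fun h hh t => ?_⟩
  have hi : Integrable ((Ico (t - h) (t + 2 * h)).indicator (1 : ℝ → ℝ)) PT :=
    (integrable_indicator_iff measurableSet_Ico).2 (integrable_const (1 : ℝ)).integrableOn
  refine (integral_mono_of_nonneg (ae_of_all _ fun v => boxKer_nonneg _) hi
    (ae_of_all _ fun v => boxKer_div_le hh v t)).trans ?_
  rw [integral_indicator_one measurableSet_Ico]
  refine (h1 _ _).trans (le_of_eq ?_)
  rw [max_eq_left (by linarith)]; ring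

lemma map_triple_infinitePi {j k m : ℕ} (hjk : j ≠ k) (hjm : j ≠ m) (hkm : k ≠ m) :
    PT^ℕ.map (fun τ => ((τ j, τ k), τ m)) = (PT.prod PT).prod PT := by
  have h : iIndepFun (fun (j : ℕ) (τ : ℕ → ℝ) => τ j) PT^ℕ :=
    iIndepFun_infinitePi (P := fun _ : ℕ => PT) (X := fun _ x => x) fun _ => measurable_id
  have h2 := (indepFun_iff_map_prod_eq_prod_map_map (f := fun τ : ℕ → ℝ => (τ j, τ k))
    (g := fun τ => τ m) (by fun_prop) (measurable_pi_apply m).aemeasurable).1 (h.indepFun_prodMk (fun _ => measurable_pi_apply _) j k m hjm hkm)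
  rw [h2, map_pair_infinitePi hjk]
  congr 1
  exact infinitePi_map_eval (fun _ : ℕ => PT) m

/-- The probability that two observation times are close to given points and a third one is close
to the second. -/
lemma SubjModel.integral_triple_le (H : ℳ q) :
    ∃ C : ℝ, 0 ≤ C ∧ ∀ (h h' : ℝ), 0 < h → 0 < h' → ∀ (t : ℝ^2) (j k m : ℕ), j ≠ k →
      ∫ τ : ℕ → ℝ, boxKer ((τ m - τ k) / h') * (boxKer ((τ j - t 0) / h) * boxKer ((τ k - t 1) / h)) ∂PT^ℕ ≤
      C * h ^ 2 * (h' + ((if m = j then 1 else 0) + if m = k then 1 else 0)) := by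
  obtain ⟨C, hC, h1⟩ := H.integral_boxKer_le
  refine ⟨C ^ 2 * (C + 1), by positivity, fun h h' hh hh' t j k m hjk => ?_⟩
  have hb := measurable_boxKer
  have hp : ∫ w : ℝ × ℝ, boxKer ((w.1 - t 0) / h) * boxKer ((w.2 - t 1) / h) ∂PT.prod PT ≤
      C ^ 2 * h ^ 2 := by
    rw [integral_prod_mul (fun v => boxKer ((v - t 0) / h)) fun v => boxKer ((v - t 1) / h)]
    calc _ ≤ (C * h) * (C * h) := mul_le_mul (h1 h hh _) (h1 h hh _)
          (integral_nonneg fun _ => boxKer_nonneg _) (by positivity)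
      _ = _ := by ring
  have hpm : Measurable fun w : ℝ × ℝ => boxKer ((w.1 - t 0) / h) * boxKer ((w.2 - t 1) / h) := by fun_prop
  have hpi : Integrable (fun w : ℝ × ℝ => boxKer ((w.1 - t 0) / h) * boxKer ((w.2 - t 1) / h))
      (PT.prod PT) := .of_bound hpm.aestronglyMeasurable 1 (ae_of_all _ fun w => norm_boxKer_mul_le _ _)
  by_cases hm : m = j ∨ m = k
  · have h2 : ∫ τ : ℕ → ℝ, boxKer ((τ m - τ k) / h') * (boxKer ((τ j - t 0) / h) *
        boxKer ((τ k - t 1) / h)) ∂PT^ℕ ≤ C ^ 2 * h ^ 2 := by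
      refine le_trans ?_ hp
      rw [← integral_pair_infinitePi hjk hpm]
      refine integral_mono_of_nonneg (ae_of_all _ fun τ => mul_nonneg (boxKer_nonneg _)
        (boxKer_mul_nonneg _ _)) ?_ (ae_of_all _ fun τ =>
          mul_le_of_le_one_left (boxKer_mul_nonneg _ _) (boxKer_le_one _))
      refine .of_bound (by fun_prop) 1 (ae_of_all _ fun τ => norm_boxKer_mul_le _ _)
    have h3 : (1 : ℝ) ≤ (if m = j then 1 else 0) + if m = k then 1 else 0 := by
      rcases hm with hm | hm <;> simp [hm] <;> split_ifs <;> norm_num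
    calc _ ≤ C ^ 2 * h ^ 2 := h2
      _ = C ^ 2 * 1 * h ^ 2 * (0 + 1) := by ring
      _ ≤ _ := by gcongr; linarith
  · push Not at hm
    have h4 := map_triple_infinitePi (PT := PT) hjk hm.1.symm hm.2.symm
    have hF : Measurable fun w : (ℝ × ℝ) × ℝ => boxKer ((w.2 - w.1.2) / h') *
        (boxKer ((w.1.1 - t 0) / h) * boxKer ((w.1.2 - t 1) / h)) := by fun_prop
    have hFi : Integrable (fun w : (ℝ × ℝ) × ℝ => boxKer ((w.2 - w.1.2) / h') *
        (boxKer ((w.1.1 - t 0) / h) * boxKer ((w.1.2 - t 1) / h))) ((PT.prod PT).prod PT) :=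
      .of_bound hF.aestronglyMeasurable 1 (ae_of_all _ fun w => norm_boxKer_mul_mul_le _ _ _)
    have h5 : ∫ τ : ℕ → ℝ, boxKer ((τ m - τ k) / h') * (boxKer ((τ j - t 0) / h) *
        boxKer ((τ k - t 1) / h)) ∂PT^ℕ =
        ∫ w, boxKer ((w.2 - w.1.2) / h') * (boxKer ((w.1.1 - t 0) / h) *
          boxKer ((w.1.2 - t 1) / h)) ∂(PT.prod PT).prod PT := by
      rw [← h4, integral_map (by fun_prop) hF.aestronglyMeasurable]
    rw [h5, integral_prod _ hFi]
    simp only [integral_mul_const]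
    calc _ ≤ ∫ w : ℝ × ℝ, C * h' * (boxKer ((w.1 - t 0) / h) * boxKer ((w.2 - t 1) / h)) ∂PT.prod PT := by
          refine integral_mono_of_nonneg (ae_of_all _ fun w => mul_nonneg
            (integral_nonneg fun _ => boxKer_nonneg _) (boxKer_mul_nonneg _ _))
            (hpi.const_mul _) (ae_of_all _ fun w => mul_le_mul_of_nonneg_right (h1 h' hh' _)
              (boxKer_mul_nonneg _ _))
      _ ≤ C * h' * (C ^ 2 * h ^ 2) := by rw [integral_const_mul]; gcongr
      _ ≤ C ^ 2 * (C + 1) * h ^ 2 * h' := by nlinarith [show 0 ≤ C ^ 2 * h ^ 2 * h' by positivity]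
      _ ≤ _ := by
        gcongr
        exact le_add_of_nonneg_right (by positivity)

/-- The residual of an observation times the observations of the same subject at times close to
a second observation time. -/
def nearEnv (mm : S → ℝ^p → ℝ) (N : ℕ) (h : ℝ) (α : ℕ × ℕ) (d : Subj S p) : ℝ :=
  env mm α.1 d.1 * ((N : ℝ)⁻¹ * ∑ m ∈ range N, env mm m d.1 * boxKer ((d.2 m - d.2 α.2) / h))

lemma SubjModel.nearEnv_nonneg (H : ℳ q) (N : ℕ) (h : ℝ) (α : ℕ × ℕ) (d) : 0 ≤ nearEnv mm N h α d :=
  mul_nonneg (H.env_nonneg _ _) (mul_nonneg (by positivity) (sum_nonneg fun m _ =>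
    mul_nonneg (H.env_nonneg _ _) (boxKer_nonneg _)))

lemma SubjModel.nearEnv_le (H : ℳ q) (N : ℕ) (h : ℝ) (α : ℕ × ℕ) (d) :
    nearEnv mm N h α d ≤ covEnv mm N α d.1 := by
  refine mul_le_mul_of_nonneg_left (le_add_of_nonneg_of_le (H.env_nonneg _ _) ?_) (H.env_nonneg _ _)
  gcongr with m
  exact mul_le_of_le_one_right (H.env_nonneg _ _) (boxKer_le_one _)

lemma SubjModel.measurable_nearEnv (H : ℳ q) (N : ℕ) (h : ℝ) (α : ℕ × ℕ) :
    Measurable (nearEnv mm N h α) := by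
  have hm : ∀ j, Measurable fun d : Subj S p => env mm j d.1 := fun j =>
    (H.measurable_env j).comp measurable_fst
  have hb := measurable_boxKer
  unfold nearEnv
  exact (hm _).mul ((measurable_sum _ fun m _ => (hm m).mul (by fun_prop)).const_mul _)

lemma SubjModel.integral_env_mul_env_le (H : ℳ q) (hq : 2 ≤ q) :
    ∃ C : ℝ, 0 ≤ C ∧ ∀ j m, Integrable (fun y => env mm j y * env mm m y) ℬ ∧
      ∫ y, env mm j y * env mm m y ∂ℬ ≤ C := by
  obtain ⟨C, hC, h1⟩ := H.integral_env_pow_mul_le (k := 2) (by push_cast; linarith)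
  have h2 : ∀ j, ∫ y, env mm j y ^ 2 ∂ℬ ≤ C := fun j => by simpa using h1 j univ MeasurableSet.univ
  have hi := fun j => H.integrable_env_pow (k := 2) (by push_cast; linarith) j
  refine ⟨C, hC, fun j m => ?_⟩
  have hle : ∀ y, env mm j y * env mm m y ≤ 2⁻¹ * (env mm j y ^ 2 + env mm m y ^ 2) := fun y => by
    nlinarith [sq_nonneg (env mm j y - env mm m y)]
  have hI := ((hi j).add (hi m)).const_mul 2⁻¹
  refine ⟨hI.mono' ((H.measurable_env j).mul (H.measurable_env m)).aestronglyMeasurable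
    (ae_of_all _ fun y => ?_), ?_⟩
  · rw [norm_of_nonneg (mul_nonneg (H.env_nonneg _ _) (H.env_nonneg _ _))]
    exact hle y
  · refine (integral_mono_of_nonneg (ae_of_all _ fun y => mul_nonneg (H.env_nonneg _ _)
      (H.env_nonneg _ _)) hI (ae_of_all _ hle)).trans ?_
    simp only [Pi.add_apply]
    rw [integral_const_mul, integral_add (hi j) (hi m)]
    linarith [h2 j, h2 m]

lemma prodKer_boxKer_timePair (h : ℝ) (t : ℝ^2) (α : ℕ × ℕ) (d : Subj S p) :
    𝓑 (fun _ => h) t (timePair α d) = boxKer ((d.2 α.1 - t 0) / h) * boxKer ((d.2 α.2 - t 1) / h) := by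
  rw [prodKer, Fin.prod_univ_two]; rfl

lemma SubjModel.integral_smp_nearEnv_le (H : ℳ q) (hq : 2 ≤ q) :
    ∃ C : ℝ, 0 ≤ C ∧ ∀ (h h' : ℝ), 0 < h → 0 < h' → ∀ (t : ℝ^2) (N : ℕ), 2 ≤ N →
      ∫ d, smp (range N).offDiag (1 / ((N : ℝ) * ((N : ℝ) - 1))) timePair (nearEnv mm N h')
        (𝓑 (fun _ => h) t) d ∂ℒ ≤
      C * h ^ 2 * (h' + (N : ℝ)⁻¹) := by
  obtain ⟨C₁, hC₁, h1⟩ := H.integral_env_mul_env_le hq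
  obtain ⟨C₂, hC₂, h2⟩ := H.integral_triple_le
  refine ⟨C₁ * C₂ * 2, by positivity, fun h h' hh hh' t N hN => ?_⟩
  have hN0 : (0 : ℝ) < N := by positivity
  have hNN : 0 < (N : ℝ) * ((N : ℝ) - 1) := mul_pos hN0 (by
    have : (2 : ℝ) ≤ N := by exact_mod_cast hN
    linarith)
  set g : ℕ → ℕ × ℕ → (ℕ → ℝ) → ℝ := fun m α τ => boxKer ((τ m - τ α.2) / h') *
    (boxKer ((τ α.1 - t 0) / h) * boxKer ((τ α.2 - t 1) / h)) with hg
  have hb := measurable_boxKer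
  have hgi : ∀ m α, Integrable (g m α) PT^ℕ := fun m α =>
    .of_bound (by simp only [hg]; fun_prop) 1 (ae_of_all _ fun τ => norm_boxKer_mul_mul_le _ _ _)
  have hInt : ∀ m (α : ℕ × ℕ), Integrable (fun d : Subj S p => env mm α.1 d.1 * env mm m d.1 * g m α d.2)
      ℒ := fun m α => integrable_subjLaw_mul (h1 α.1 m).1 (hgi m α)
  have hpt : ∀ d : Subj S p, smp (range N).offDiag (1 / ((N : ℝ) * ((N : ℝ) - 1))) timePair
      (nearEnv mm N h') (𝓑 (fun _ => h) t) d =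
      1 / ((N : ℝ) * ((N : ℝ) - 1)) * ∑ α ∈ (range N).offDiag, (N : ℝ)⁻¹ *
        ∑ m ∈ range N, env mm α.1 d.1 * env mm m d.1 * g m α d.2 := fun d => by
    unfold smp
    congr 1
    refine sum_congr rfl fun α _ => ?_
    rw [prodKer_boxKer_timePair, nearEnv, mul_sum, mul_sum, mul_sum, sum_mul]
    exact sum_congr rfl fun m _ => by simp only [hg]; ring
  simp only [hpt]
  rw [integral_const_mul, integral_finsetSum _ fun α _ => (integrable_finsetSum _ fun m _ =>
    hInt m α).const_mul _]
  have hα : ∀ α ∈ (range N).offDiag, ∫ d, (N : ℝ)⁻¹ *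
      ∑ m ∈ range N, env mm α.1 d.1 * env mm m d.1 * g m α d.2 ∂ℒ ≤
      C₁ * C₂ * 2 * h ^ 2 * (h' + (N : ℝ)⁻¹) := fun α hα => by
    rw [Finset.mem_offDiag] at hα
    rw [integral_const_mul, integral_finsetSum _ fun m _ => hInt m α]
    have hm : ∀ m ∈ range N, ∫ d, env mm α.1 d.1 * env mm m d.1 * g m α d.2 ∂ℒ ≤
        C₁ * (C₂ * h ^ 2) * (h' + ((if m = α.1 then 1 else 0) + if m = α.2 then 1 else 0)) := by
      intro m _
      rw [integral_subjLaw_mul (fun y => env mm α.1 y * env mm m y) (g m α), mul_assoc]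
      exact mul_le_mul (h1 α.1 m).2 (h2 h h' hh hh' t α.1 α.2 m hα.2.2)
        (integral_nonneg fun τ => mul_nonneg (boxKer_nonneg _) (boxKer_mul_nonneg _ _)) hC₁
    refine (mul_le_mul_of_nonneg_left (sum_le_sum hm) (by positivity)).trans ?_
    rw [← mul_sum, sum_add_distrib, sum_add_distrib, sum_const,
      card_range, nsmul_eq_mul, Finset.sum_ite_eq', Finset.sum_ite_eq', if_pos hα.1,
      if_pos hα.2.1]
    have : (N : ℝ)⁻¹ * (C₁ * (C₂ * h ^ 2) * (N * h' + (1 + 1))) =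
        C₁ * C₂ * h ^ 2 * (h' + 2 * (N : ℝ)⁻¹) := by field_simp; ring
    rw [this]
    have : 0 ≤ C₁ * C₂ * h ^ 2 * h' := by positivity
    linarith
  refine (mul_le_mul_of_nonneg_left (sum_le_sum hα) (by positivity)).trans (le_of_eq ?_)
  rw [sum_const, nsmul_eq_mul, card_offDiag_range, ← mul_assoc, one_div_mul_cancel hNN.ne', one_mul]

lemma SubjModel.ae_smp_nearEnv_le (H : ℳ q) (hq : 2 ≤ q) (Hc : 𝓔) (hN : ∀ n i, 2 ≤ N n i)
    {ht : ℕ → ℝ} (hht : ∀ n, 0 < ht n) (Λ : ℕ) :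
    ∀ᵐ ω ∂P, ∃ C : ℝ, 0 ≤ C ∧ ∀ᶠ n : ℕ in atTop, ∀ t : ℝ^2, (∀ k, |t k| ≤ Λ) →
      ∑ i ∈ range n, Φ n i (nearEnv mm (N n i) (ht n)) (𝓑 (fun _ => hG n) t) (D i ω) ≤
      C * (n * (hG n ^ 2 * (ht n + invGam N 1 n) + rateX b n)) := by
  obtain ⟨C₁, hC₁, h1⟩ := H.integral_smp_nearEnv_le hq
  filter_upwards [Hc.ae_prodKer_le Λ (fun n i => nearEnv mm (N n i) (ht n))
    (fun n i α => H.measurable_nearEnv _ _ α) (fun n i α d => by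
      rw [abs_of_nonneg (H.nearEnv_nonneg _ _ _ _)]; exact H.nearEnv_le _ _ _ _)
    (f := fun _ => boxKer) fun _ => stepApprox_boxKer] with ω ⟨C, hC, h2⟩
  refine ⟨C + C₁, by positivity, ?_⟩
  filter_upwards [h2] with n h2 t htΛ
  have h3 := (abs_le.1 (h2 n le_rfl t htΛ)).2
  rw [sum_sub_distrib] at h3
  have h5 := sum_le_sum fun i (_ : i ∈ range n) =>
    h1 (hG n) (ht n) (Hc.h_pos n 0) (hht n) t (N n i) (hN n i)
  have h6 : ∑ i ∈ range n, ((N n i : ℝ))⁻¹ = n * invGam N 1 n := by simpa using sum_inv_eq N 1 n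
  rw [← mul_sum, sum_add_distrib, h6, sum_const, card_range, nsmul_eq_mul, ← mul_add] at h5
  have h7 : 0 ≤ C * (n * (hG n ^ 2 * (ht n + invGam N 1 n))) := by
    have := (hht n).le
    have := invGam_nonneg N 1 n
    positivity
  have h8 : 0 ≤ C₁ * (n * rateX b n) := by
    have := rateX_nonneg b n
    positivity
  linarith

/-- The reversal of the first `n` natural numbers. -/
def revPerm (n i : ℕ) : ℕ := if i < n then n - 1 - i else i

lemma revPerm_injective (n : ℕ) : Function.Injective (revPerm n) := by
  intro i j hij
  simp only [revPerm] at hij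
  split_ifs at hij <;> omega

lemma revPerm_lt (n i : ℕ) (hi : i < n) : revPerm n i < n := by simp only [revPerm, if_pos hi]; omega

lemma sum_revPerm (g : ℕ → ℝ) {n j : ℕ} (hj : j < n) :
    ∑ l : Fin j, g (revPerm n l) = ∑ l ∈ range n, g l - ∑ l ∈ range (n - 1 - j + 1), g l := by
  rw [Fin.sum_univ_eq_sum_range (fun l => g (revPerm n l)) j,
    ← Finset.sum_range_add_sum_Ico g (show n - 1 - j + 1 ≤ n by omega), add_sub_cancel_left]
  have h := Finset.sum_Ico_reflect g 0 (m := j) (n := n - 1) (by omega)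
  rw [show n - 1 + 1 - j = n - 1 - j + 1 by omega, show n - 1 + 1 - 0 = n by omega] at h
  rw [← h, Finset.range_eq_Ico]
  refine sum_congr rfl fun l hl => ?_
  rw [Finset.mem_Ico] at hl
  rw [revPerm, if_pos (by omega)]

variable {lo hi : ℝ^(p + 1)} {ν : Measure ℝ^(p + 1)} [IsProbabilityMeasure ν]
  {φ : ℝ^(p + 1) → ℝ} {G : ℝ^(p + 1) → ℝ^(p + 1)} {Cφ : ℝ} {bμ : ℕ → ℝ}

set_option maxHeartbeats 400000 in
/-- The local sum of the residuals times a function with expansion `B + n⁻¹ ∑ ℓ`. -/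
theorem ae_resid_mul_error_le (Cm : 𝒞) (H : ℳ q) (hq : 2 ≤ q) (hN : ∀ n i, 2 ≤ N n i) (Hc : 𝓔)
    (hrate : Tendsto (fun n => rateX b n / hG n ^ 2) atTop (𝓝 0)) {hμ : ℕ → ℝ^(p + 1)}
    (hμ0 : ∀ n k, 0 < hμ n k) {δ : ℕ → ℝ} (hδ : Tendsto δ atTop (𝓝 0))
    (hnH : ∀ᶠ n : ℕ in atTop, (n * ∏ k, hμ n k)⁻¹ ≤ 1)
    {B : ℕ → ℝ^(p + 1) → ℝ} (hBm : ∀ n, Measurable (B n))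
    (hB : ∀ᶠ n in atTop, ∀ x ∈ Icc lo hi, |B n x| ≤ 1 / 2)
    {ℓ : ℕ → ℕ → ℝ^(p + 1) → Subj S p → ℝ}
    (hℓm : ∀ n i, Measurable fun v : ℝ^(p + 1) × Subj S p => ℓ n i v.1 v.2)
    (hℓ : ∀ᵐ ω ∂P, ∃ C : ℝ, 0 ≤ C ∧ ∀ᶠ n : ℕ in atTop, ∀ m ≤ n, ∀ x ∈ Icc lo hi,
      |(n : ℝ)⁻¹ * ∑ i ∈ range m, ℓ n i x (D i ω)| ≤ C * δ n)
    (hdiag : ∃ C : ℝ, 0 ≤ C ∧ ∀ᶠ n in atTop, ∀ x ∈ Icc lo hi, ∀ i d,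
      |ℓ n i x d| ≤ C * ((∏ k, hμ n k)⁻¹ * smp (range (N n i)) (1 / (N n i : ℝ)) timeCov
        (fun j d => env mm j d.1) ((Icc (fun k => x k - hμ n k) fun k => x k + hμ n k).indicator 1) d + 1))
    (hmem : ∀ᵐ ω ∂P, ∀ n i, ∀ j ∈ range (N n i), timeCov j (D i ω) ∈ Icc lo hi) (Λ : ℕ)
    {f : Fin 2 → ℝ → ℝ} {M : ℝ^2} (hf : ∀ k, StepApprox (f k) (M k)) :
    ∀ᵐ ω ∂P, ∃ C : ℝ, 0 ≤ C ∧ ∀ᶠ n : ℕ in atTop, ∀ t : ℝ^2, (∀ k, |t k| ≤ Λ) →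
      ∀ (Δ : ℝ^(p + 1) → ℝ) (η : ℝ), 0 ≤ η → (∀ x ∈ Icc lo hi,
        |Δ x - B n x - (n : ℝ)⁻¹ * ∑ i ∈ range n, ℓ n i x (D i ω)| ≤ η) →
      |∑ i ∈ range n, Φ n i
          (fun α d => resid Pθ xc α.1 d * Δ (timeCov α.2 d)) (prodKer f (fun _ => hG n) t) (D i ω)| ≤
        C * (n * (rateX b n + hG n ^ 2 * (η + (n * ∏ k, hμ n k)⁻¹ * (hμ n 0 + invGam N 1 n)))) := by
  have hℓc : ∀ n l i (l' : Fin i), Measurable fun v : ℝ^(p + 1) × (Fin i → Subj S p) =>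
      ℓ n l v.1 (v.2 l') := fun n l i l' =>
    (hℓm n l).comp (measurable_fst.prodMk ((measurable_pi_apply l').comp measurable_snd))
  have hL1 : ∀ n i, Measurable fun v : ℝ^(p + 1) × (Fin i → Subj S p) =>
      B n v.1 + (n : ℝ)⁻¹ * ∑ l : Fin i, ℓ n l v.1 (v.2 l) := fun n i =>
    ((hBm n).comp measurable_fst).add ((measurable_sum _ fun (l : Fin i) _ => hℓc n l i l).const_mul _)
  have hL2 : ∀ n i : ℕ, Measurable fun v : ℝ^(p + 1) × (Fin i → Subj S p) =>
      (n : ℝ)⁻¹ * ∑ l : Fin i, ℓ n (revPerm n l) v.1 (v.2 l) := fun n i =>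
    (measurable_sum _ fun (l : Fin i) _ => hℓc n _ i l).const_mul _
  obtain ⟨Cd, hCd, hdiag⟩ := hdiag
  filter_upwards [ae_adapted_resid_le Cm H hq Hc Λ (fun _ i => i) (fun _ => Function.injective_id)
      (fun _ _ h => h) (fun n i x y => B n x + (n : ℝ)⁻¹ * ∑ l : Fin i, ℓ n l x (y l)) hL1 hf,
    ae_adapted_resid_le Cm H hq Hc Λ revPerm revPerm_injective revPerm_lt
      (fun n i x y => (n : ℝ)⁻¹ * ∑ l : Fin i, ℓ n (revPerm n l) x (y l)) hL2 hf,
    H.ae_smp_nearEnv_le hq Hc hN (fun n => hμ0 n 0) Λ, Hc.ae_smp_boxKer_le Λ, hℓ, hmem] with ω ⟨C₁, hC₁, h1⟩ ⟨C₂, hC₂, h2⟩ ⟨C₃, hC₃, h3⟩ ⟨C₄, hC₄, h4⟩ ⟨C₅, hC₅, h5⟩ hmem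
  have hM : 0 ≤ ∏ k, M k := prod_nonneg fun k _ => (hf k).nonneg
  refine ⟨C₁ + C₂ + Cd * (∏ k, M k) * (C₃ + 2 * C₄) + 2 * (∏ k, M k) * C₄, by positivity, ?_⟩
  have hδ := hδ.const_mul C₅
  rw [mul_zero] at hδ
  filter_upwards [h1, h2, h3, h4, h5, hB, hdiag,
    hδ.eventually_le_const (show (0 : ℝ) < 1 / 2 by norm_num), hnH, Hc.le_rateX,
    hrate.eventually_le_const one_pos, (Hc.h_tendsto 0).eventually_le_const one_pos,
    eventually_gt_atTop 0]
    with n h1 h2 h3 h4 h5 hbias hdiag hsm2 hnH hnc hrate hG1 hn t htΛ Δ η hη hΔ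
  have hn0 : (0 : ℝ) < n := by exact_mod_cast hn
  have hGpos : 0 < hG n := Hc.h_pos n 0
  have hH : 0 < ∏ k, hμ n k := prod_pos fun k _ => hμ0 n k
  set Hn := ∏ k, hμ n k with hHn
  have hX := rateX_nonneg b n
  set F := prodKer f (fun _ => hG n) t with hF
  set F₀ := 𝓑 (fun _ : Fin 2 => hG n) t with hF₀
  set A₁ : ℕ → ℕ × ℕ → Subj S p → ℝ := fun i α d => resid Pθ xc α.1 d *
    clip (B n (timeCov α.2 d) + (n : ℝ)⁻¹ * ∑ l ∈ range i, ℓ n l (timeCov α.2 d) (D l ω)) with hA₁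
  set A₂ : ℕ → ℕ × ℕ → Subj S p → ℝ := fun i α d => resid Pθ xc α.1 d *
    clip ((n : ℝ)⁻¹ * (∑ l ∈ range n, ℓ n l (timeCov α.2 d) (D l ω) -
      ∑ l ∈ range (i + 1), ℓ n l (timeCov α.2 d) (D l ω))) with hA₂
  set A₃ : ℕ → ℕ × ℕ → Subj S p → ℝ := fun i α d => resid Pθ xc α.1 d *
    ((n : ℝ)⁻¹ * ℓ n i (timeCov α.2 d) (D i ω)) with hA₃
  set A₄ : ℕ → ℕ × ℕ → Subj S p → ℝ := fun i α d => resid Pθ xc α.1 d * (Δ (timeCov α.2 d) -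
    B n (timeCov α.2 d) - (n : ℝ)⁻¹ * ∑ l ∈ range n, ℓ n l (timeCov α.2 d) (D l ω)) with hA₄
  have hsplit : ∀ i ∈ range n, Φ n i (fun α d => resid Pθ xc α.1 d * Δ (timeCov α.2 d)) F (D i ω) =
      Φ n i (A₁ i) F (D i ω) +
      Φ n i (A₂ i) F (D i ω) +
      Φ n i (A₃ i) F (D i ω) +
      Φ n i (A₄ i) F (D i ω) := fun i hi => by
    rw [Finset.mem_range] at hi
    rw [← smp_add_weight, ← smp_add_weight, ← smp_add_weight]
    unfold smp
    congr 1
    refine sum_congr rfl fun α hα => ?_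
    have hx := hmem n i α.2 (Finset.mem_offDiag.1 hα).2.1
    set x := timeCov α.2 (D i ω) with hxdef
    have c1 := hbias x hx
    have c2 := h5 i hi.le x hx
    have c3 := h5 n le_rfl x hx
    have c4 := h5 (i + 1) hi x hx
    have e1 : |B n x + (n : ℝ)⁻¹ * ∑ l ∈ range i, ℓ n l x (D l ω)| ≤ 1 :=
      (abs_add_le _ _).trans (by linarith)
    have e2 : |(n : ℝ)⁻¹ * (∑ l ∈ range n, ℓ n l x (D l ω) -
        ∑ l ∈ range (i + 1), ℓ n l x (D l ω))| ≤ 1 := by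
      rw [mul_sub]
      exact (abs_sub _ _).trans (by linarith)
    simp only [hA₁, hA₂, hA₃, hA₄, ← hxdef]
    rw [clip_eq e1, clip_eq e2, Finset.sum_range_succ]
    ring
  rw [sum_congr rfl hsplit, sum_add_distrib, sum_add_distrib, sum_add_distrib]
  have b1 : |∑ i ∈ range n, Φ n i (A₁ i) F (D i ω)| ≤ C₁ * (n * rateX b n) := by
    refine le_trans (le_of_eq ?_) (h1 t htΛ)
    congr 1
    refine sum_congr rfl fun i _ => ?_
    have e1 : ∀ x, ∑ l : Fin i, ℓ n l x (D l ω) = ∑ l ∈ range i, ℓ n l x (D l ω) := fun x =>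
      Fin.sum_univ_eq_sum_range (fun l => ℓ n l x (D l ω)) i
    simp only [hA₁, e1]
    rfl
  have b2 : |∑ i ∈ range n, Φ n i (A₂ i) F (D i ω)| ≤ C₂ * (n * rateX b n) := by
    refine le_trans (le_of_eq ?_) (h2 t htΛ)
    congr 1
    rw [← Finset.sum_range_reflect]
    refine sum_congr rfl fun j hj => ?_
    rw [Finset.mem_range] at hj
    have e1 : revPerm n j = n - 1 - j := by rw [revPerm, if_pos hj]
    have e2 : ∀ x, ∑ l : Fin j, ℓ n (revPerm n l) x (D (revPerm n l) ω) = _ := fun x =>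
      sum_revPerm (fun l => ℓ n l x (D l ω)) hj
    simp only [e2, e1, hA₂]
    rfl
  have hsE : ∀ i, 0 ≤ Φ n i (𝔠 n i) F₀ (D i ω) := fun i => smp_nonneg (Hc.c_nonneg n i)
    (fun α _ => Hc.E_nonneg n i α _) (prodKer_boxKer_nonneg _ _)
  have hsE4 := h4 t htΛ
  rw [Fin.prod_univ_two, ← pow_two] at hsE4
  have hXG : rateX b n ≤ hG n ^ 2 := by rwa [div_le_one (by positivity)] at hrate
  have b3 : |∑ i ∈ range n, Φ n i (A₃ i) F (D i ω)|
      ≤ Cd * (∏ k, M k) * ((n : ℝ)⁻¹ * (Hn⁻¹ * (C₃ * (n * (hG n ^ 2 * (hμ n 0 + invGam N 1 n) + rateX b n)))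
        + C₄ * (n * (hG n ^ 2 + rateX b n)))) := by
    have hi : ∀ i ∈ range n, |Φ n i (A₃ i) F (D i ω)| ≤ Cd * (∏ k, M k) * ((n : ℝ)⁻¹ * (Hn⁻¹ *
        Φ n i (nearEnv mm (N n i) (hμ n 0)) F₀ (D i ω) + Φ n i (𝔠 n i) F₀ (D i ω))) := fun i hi => by
      refine (abs_smp_le (E := fun α d => Cd * ((n : ℝ)⁻¹ * (Hn⁻¹ *
        nearEnv mm (N n i) (hμ n 0) α d + covEnv mm (N n i) α d.1))) (Hc.c_nonneg n i) (fun α hα => ?_)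
        (abs_prodKer_le_boxKer hf _ _)).trans (le_of_eq (by
          simp only [smp, mul_sum, mul_add, add_mul, ← sum_add_distrib]
          exact sum_congr rfl fun α _ => by ring))
      have hx := hmem n i α.2 (Finset.mem_offDiag.1 hα).2.1
      have e1 := hdiag _ hx i (D i ω)
      have e2 := Cm.abs_resid_le α.1 (D i ω)
      have e3 := H.env_nonneg α.1 (D i ω).1
      simp only [hA₃]
      rw [abs_mul, abs_mul, abs_of_pos (inv_pos.2 hn0)]
      set V := smp (range (N n i)) (1 / (N n i : ℝ)) timeCov (fun j d => env mm j d.1)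
        ((Icc (fun k => timeCov α.2 (D i ω) k - hμ n k)
          fun k => timeCov α.2 (D i ω) k + hμ n k).indicator 1) (D i ω) with hV
      have e4 : env mm α.1 (D i ω).1 * V ≤ nearEnv mm (N n i) (hμ n 0) α (D i ω) := by
        rw [nearEnv, hV, smp, one_div]
        refine mul_le_mul_of_nonneg_left (mul_le_mul_of_nonneg_left (sum_le_sum fun m _ =>
          mul_le_mul_of_nonneg_left ?_ (H.env_nonneg _ _)) (by positivity)) e3
        refine indicator_apply_le' (fun hm => ?_) fun _ => boxKer_nonneg _
        have a1 := hm.1 0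
        have a2 := hm.2 0
        simp only [timeCov, Fin.cons_zero] at a1 a2
        have hpos : 0 < hμ n 0 := hμ0 n 0
        have hmem' : ((D i ω).2 m - (D i ω).2 α.2) / hμ n 0 ∈ Icc (-1 : ℝ) 1 := by
          rw [mem_Icc, le_div_iff₀ hpos, div_le_iff₀ hpos]
          constructor <;> linarith
        rw [boxKer, indicator_of_mem hmem']; rfl
      calc |resid Pθ xc α.1 (D i ω)| * ((n : ℝ)⁻¹ * |ℓ n i (timeCov α.2 (D i ω)) (D i ω)|)
          ≤ env mm α.1 (D i ω).1 * ((n : ℝ)⁻¹ * (Cd * (Hn⁻¹ * V + 1))) := by gcongr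
        _ = Cd * ((n : ℝ)⁻¹ * (Hn⁻¹ * (env mm α.1 (D i ω).1 * V) + env mm α.1 (D i ω).1)) := by ring
        _ ≤ _ := by
          gcongr
          exact H.env_le_covEnv _ _ _
    refine (abs_sum_le_sum_abs _ _).trans ((sum_le_sum hi).trans ?_)
    rw [← mul_sum, ← mul_sum, sum_add_distrib, ← mul_sum]
    have := h3 t htΛ
    gcongr
  have b4 : |∑ i ∈ range n, Φ n i (A₄ i) F (D i ω)|
      ≤ (∏ k, M k) * η * (C₄ * (n * (hG n ^ 2 + rateX b n))) := by
    have hi : ∀ i ∈ range n, |Φ n i (A₄ i) F (D i ω)| ≤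
        (∏ k, M k) * η * Φ n i (𝔠 n i) F₀ (D i ω) := fun i hi => by
      refine (abs_smp_le (E := fun α d => covEnv mm (N n i) α d.1 * η) (Hc.c_nonneg n i) (fun α hα => ?_)
        (abs_prodKer_le_boxKer hf _ _)).trans (le_of_eq ?_)
      · have hx := hmem n i α.2 (Finset.mem_offDiag.1 hα).2.1
        simp only [hA₄]
        rw [abs_mul]
        exact mul_le_mul ((Cm.abs_resid_le α.1 _).trans (H.env_le_covEnv _ α _)) (hΔ _ hx)
          (abs_nonneg _) (Hc.E_nonneg n i α _)
      · simp only [smp, mul_sum]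
        exact sum_congr rfl fun α _ => by ring
    refine (abs_sum_le_sum_abs _ _).trans ((sum_le_sum hi).trans ?_)
    rw [← mul_sum]
    gcongr
  have hg := invGam_nonneg N 1 n
  set Y := (n * Hn)⁻¹ * (hμ n 0 + invGam N 1 n) with hY
  have hY0 : 0 ≤ Y := mul_nonneg (by positivity) (add_nonneg (hμ0 n 0).le hg)
  have b3' : (n : ℝ)⁻¹ * (Hn⁻¹ * (C₃ * (n * (hG n ^ 2 * (hμ n 0 + invGam N 1 n) + rateX b n)))
      + C₄ * (n * (hG n ^ 2 + rateX b n))) ≤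
      (C₃ + 2 * C₄) * (n * (rateX b n + hG n ^ 2 * (η + Y))) := by
    have e1 : (n : ℝ)⁻¹ * (Hn⁻¹ * (C₃ * (n * (hG n ^ 2 * (hμ n 0 + invGam N 1 n) + rateX b n)))
        + C₄ * (n * (hG n ^ 2 + rateX b n))) =
        C₃ * (n * (hG n ^ 2 * Y) + (n * Hn)⁻¹ * (n * rateX b n)) + C₄ * (hG n ^ 2 + rateX b n) := by
      rw [hY]; field_simp
    have e2 := mul_le_of_le_one_left (show 0 ≤ n * rateX b n by positivity) hnH
    have e4 : 1 ≤ n * rateX b n := by rw [div_le_iff₀ hn0] at hnc; linarith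
    have e5 : hG n ^ 2 ≤ 1 := pow_le_one₀ hGpos.le hG1
    have e6 : 0 ≤ n * (hG n ^ 2 * η) := by positivity
    have e7 : 0 ≤ n * (hG n ^ 2 * Y) := by positivity
    rw [e1, add_mul, mul_comm 2 C₄, mul_assoc C₄]
    gcongr <;> linarith
  have b12 : n * rateX b n ≤ n * (rateX b n + hG n ^ 2 * (η + Y)) := by
    gcongr
    exact le_add_of_nonneg_right (by positivity)
  have b4' : (∏ k, M k) * η * (C₄ * (n * (hG n ^ 2 + rateX b n))) ≤
      2 * (∏ k, M k) * C₄ * (n * (rateX b n + hG n ^ 2 * (η + Y))) := by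
    calc _ ≤ (∏ k, M k) * η * (C₄ * (n * (hG n ^ 2 + hG n ^ 2))) := by gcongr
      _ = 2 * (∏ k, M k) * C₄ * (n * (hG n ^ 2 * η)) := by ring
      _ ≤ _ := by
        gcongr
        have : 0 ≤ hG n ^ 2 * Y := by positivity
        linarith
  refine (abs_add_le _ _).trans ((add_le_add_left ((abs_add_le _ _).trans
    (add_le_add_left (abs_add_le _ _) _)) _).trans ?_)
  have f1 := b1.trans (mul_le_mul_of_nonneg_left b12 hC₁)
  have f2 := b2.trans (mul_le_mul_of_nonneg_left b12 hC₂)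
  have f3 := b3.trans (mul_le_mul_of_nonneg_left b3' (show 0 ≤ Cd * ∏ k, M k by positivity))
  have f4 := b4.trans b4'
  linarith

/-! ### The rate of the covariance estimate -/

variable {hμ : ℕ → ℝ^(p + 1)}

lemma sum_offDiag_swap (N : ℕ) (F : ℕ × ℕ → ℝ) :
    ∑ α ∈ (range N).offDiag, F α.swap = ∑ α ∈ (range N).offDiag, F α :=
  Finset.sum_bij' (fun α _ => α.swap) (fun α _ => α.swap)
    (fun α hα => by simp only [Finset.mem_offDiag, Prod.fst_swap, Prod.snd_swap] at hα ⊢; tauto)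
    (fun α hα => by simp only [Finset.mem_offDiag, Prod.fst_swap, Prod.snd_swap] at hα ⊢; tauto)
    (fun _ _ => rfl) (fun _ _ => rfl) (fun _ _ => rfl)

lemma prodKer_timePair_swap (f : Fin 2 → ℝ → ℝ) (h : ℝ) (t : ℝ^2) (α : ℕ × ℕ) (d : Subj S p) :
    prodKer f (fun _ => h) t (timePair α.swap d) =
      prodKer (fun k => f k.rev) (fun _ => h) (fun k => t k.rev) (timePair α d) := by
  simp only [prodKer, Fin.prod_univ_two]
  rw [mul_comm]; rfl

set_option maxHeartbeats 800000 in
/-- The covariance fit to the estimated residuals. -/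
theorem ae_covFit_le (Cm : 𝒞) (H : ℳ q)
    (hq : 2 ≤ q) (hN : ∀ n i, 2 ≤ N n i) (hφ : ∀ j (d : Subj S p), obsC xc j d - φ (timeCov j d) = resid Pθ xc j d)
    (I : IsSmoother P ℒ D (fun n i => range (N n i))
      (fun n i => 1 / (N n i : ℝ)) timeCov (fun _ _ j d => env mm j d.1)
      hμ bμ K lo hi ν (fun _ _ j => obsC xc j) φ G Cφ)
    {lo' hi' : ℝ^2} {ν' : Measure ℝ^2} [IsProbabilityMeasure ν'] {ψ : ℝ^2 → ℝ}
    {G' : ℝ^2 → ℝ^2} {Cψ : ℝ}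
    (J : IsSmoother P ℒ D 𝔬 𝔴 timePair 𝔠 (fun n _ => hG n) b K lo' hi' ν'
      (fun _ _ α d => resid Pθ xc α.1 d * resid Pθ xc α.2 d) ψ G' Cψ) :
    ∀ᵐ ω ∂P, ∃ C : ℝ, 0 ≤ C ∧ ∀ᶠ n : ℕ in atTop, ∀ m : ℝ^(p + 1) → ℝ,
      (∀ x ∈ Icc lo hi, ∃ bh : Option (Fin (p + 1)) → ℝ, bh none = m x ∧
        IsLocalFit K n (fun i => range (N n i)) (fun i => 1 / (N n i : ℝ)) timeCov
          (fun i => D i ω) (fun i j => obsC xc j (D i ω)) (hμ n) x bh) →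
      ∀ t ∈ Icc lo' hi', ∀ bh : Option (Fin 2) → ℝ, IsLocalFit K n (fun i => (range (N n i)).offDiag)
          (fun i => 1 / ((N n i : ℝ) * ((N n i : ℝ) - 1))) timePair (fun i => D i ω)
          (fun i α => (obsC xc α.1 (D i ω) - m (timeCov α.1 (D i ω))) *
            (obsC xc α.2 (D i ω) - m (timeCov α.2 (D i ω)))) (fun _ => hG n) t bh →
        |bh none - ψ t| ≤ C * (rateX b n / hG n ^ 2 + hG n ^ 2 +
          (rateX bμ n / (∏ k, hμ n k) + ∑ k, hμ n k ^ 2) ^ 2 +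
          (n * ∏ k, hμ n k)⁻¹ * (hμ n 0 + invGam N 1 n)) := by
  obtain ⟨Λ, hΛ⟩ := exists_nat_abs_le lo' hi'
  obtain ⟨M, hM0, hM⟩ := I.kernel.exists_stepApprox_momKer (ι := Fin 2)
  choose M' hM' hMle using hM
  have hrate : Tendsto (fun n => rateX b n / hG n ^ 2) atTop (𝓝 0) := by
    simpa [Fin.prod_univ_two, pow_two] using J.rate
  obtain ⟨Cb, hCb, hbias⟩ := I.abs_llBias_le
  have hhz : Tendsto (fun n => Cb * ∑ k, hμ n k ^ 2) atTop (𝓝 0) := by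
    have := (tendsto_finsetSum Finset.univ fun k _ => (I.env.h_tendsto k).pow 2).const_mul Cb
    simpa using this
  have hB : ∀ᶠ n in atTop, ∀ x ∈ Icc lo hi, |llBias K ν φ G (hμ n) x| ≤ 1 / 2 := by
    filter_upwards [hbias, hhz.eventually_le_const (show (0 : ℝ) < 1 / 2 by norm_num)]
      with n h1 h2 x hx using (h1 x hx).trans h2
  have hnH : ∀ᶠ n : ℕ in atTop, (n * ∏ k, hμ n k)⁻¹ ≤ 1 := by
    filter_upwards [I.env.le_rateX, I.rate.eventually_le_const one_pos] with n h1 h2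
    rw [mul_inv, ← one_div, ← div_eq_mul_inv]
    exact (div_le_div_of_nonneg_right h1 (I.prod_h_pos n).le).trans h2
  have hcross := fun {f : Fin 2 → ℝ → ℝ} {M : ℝ^2} (hf : ∀ k, StepApprox (f k) (M k)) =>
    ae_resid_mul_error_le Cm H hq hN J.env hrate I.env.h_pos I.rate hnH I.measurable_llBias hB
      (fun n i => I.measurable_infl n i) I.ae_infl_le I.abs_infl_le I.ae_mem Λ hf
  filter_upwards [ae_all_iff.2 fun e : Option (Fin 2) => hcross (hM' e none),
    ae_all_iff.2 fun e : Option (Fin 2) => hcross (f := fun k => momKer K e none k.rev)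
      (M := fun k => M' e none k.rev) fun k => hM' e none k.rev,
    I.ae_fit_le, J.ae_fit_le, J.env.ae_smp_boxKer_le Λ, I.ae_mem]
    with ω h1 h2 ⟨C₃, hC₃, h3⟩ ⟨C₄, hC₄, h4⟩ ⟨C₅, hC₅, h5⟩ hmem
  choose C₁ hC₁ h1 using h1
  choose C₂ hC₂ h2 using h2
  have hS1 : 0 ≤ ∑ e, C₁ e := sum_nonneg fun e _ => hC₁ e
  have hS2 : 0 ≤ ∑ e, C₂ e := sum_nonneg fun e _ => hC₂ e
  set Cη : ℝ := (∑ e, C₁ e + ∑ e, C₂ e) * (1 + C₃) + C₃ ^ 2 * M * (2 * C₅) with hCη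
  have hCη0 : 0 ≤ Cη := by positivity
  refine ⟨C₄ * (2 + Cη), by positivity, ?_⟩
  filter_upwards [eventually_all.2 h1, eventually_all.2 h2, h3, h4, h5,
    hrate.eventually_le_const one_pos, eventually_gt_atTop 0]
    with n h1 h2 h3 h4 h5 hXG hn m hm t ht bh hbh
  have hn0 : (0 : ℝ) < n := by exact_mod_cast hn
  have hGpos : 0 < hG n := J.env.h_pos n 0
  have hH := I.prod_h_pos n
  have hg := invGam_nonneg N 1 n
  have hX := rateX_nonneg b n
  set δ := rateX bμ n / ∏ k, hμ n k with hδ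
  have hδ0 : 0 ≤ δ := div_nonneg (rateX_nonneg bμ n) hH.le
  set hh := ∑ k, hμ n k ^ 2 with hhh
  have hh0 : 0 ≤ hh := by positivity
  set Y := (n * ∏ k, hμ n k)⁻¹ * (hμ n 0 + invGam N 1 n) with hY
  have hY0 : 0 ≤ Y := mul_nonneg (by positivity) (add_nonneg (I.env.h_pos n 0).le hg)
  set X := rateX b n / hG n ^ 2 with hXdef
  have hX0 : 0 ≤ X := by positivity
  have hXeq : rateX b n = hG n ^ 2 * X := by rw [hXdef]; field_simp
  set Δ : ℝ^(p + 1) → ℝ := fun x => m x - φ x with hΔ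
  have hfit : ∀ x ∈ Icc lo hi, |Δ x| ≤ C₃ * (δ + hh) ∧
      |Δ x - llBias K ν φ G (hμ n) x - (n : ℝ)⁻¹ * ∑ i ∈ range n,
        infl K ℒ ν (range (N n i)) (1 / (N n i : ℝ)) timeCov
          (fun j => obsC xc j) φ G (hμ n) x (D i ω)| ≤ C₃ * (δ * (δ + hh)) := fun x hx => by
    obtain ⟨b₀, hb₀, hb₁⟩ := hm x hx
    have := h3 x hx (fun i j => obsC xc j (D i ω)) b₀ 0 hb₁ fun e => by simp
    rwa [hb₀, add_zero, add_zero] at this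
  set R := X + (δ + hh) ^ 2 + Y with hR
  have hR0 : 0 ≤ R := by positivity
  have hη0 : 0 ≤ C₃ * (δ * (δ + hh)) := by positivity
  have hRb : rateX b n + hG n ^ 2 * (C₃ * (δ * (δ + hh)) + Y) ≤ (1 + C₃) * (hG n ^ 2 * R) := by
    have e1 : δ * (δ + hh) ≤ (δ + hh) ^ 2 := by nlinarith
    have e2 := mul_le_mul_of_nonneg_left e1 hC₃
    have e3 : X + (C₃ * (δ * (δ + hh)) + Y) ≤ (1 + C₃) * R := by
      rw [hR]
      nlinarith [mul_nonneg hC₃ hX0, mul_nonneg hC₃ hY0, sq_nonneg (δ + hh)]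
    rw [hXeq]
    calc _ = hG n ^ 2 * (X + (C₃ * (δ * (δ + hh)) + Y)) := by ring
      _ ≤ hG n ^ 2 * ((1 + C₃) * R) := by gcongr
      _ = _ := by ring
  have hpert : ∀ e : Option (Fin 2), |(n * ∏ _k : Fin 2, hG n)⁻¹ * ∑ i ∈ range n,
      1 / ((N n i : ℝ) * ((N n i : ℝ) - 1)) * ∑ α ∈ (range (N n i)).offDiag,
        ((obsC xc α.1 (D i ω) - m (timeCov α.1 (D i ω))) * (obsC xc α.2 (D i ω) - m (timeCov α.2 (D i ω))) -
          resid Pθ xc α.1 (D i ω) * resid Pθ xc α.2 (D i ω)) *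
          prodKer (momKer K e none) (fun _ => hG n) t (timePair α (D i ω))| ≤ Cη * R := fun e => by
    set F := prodKer (momKer K e none) (fun _ => hG n) t with hF
    set T₁ := ∑ i ∈ range n, Φ n i (fun α d => resid Pθ xc α.1 d * Δ (timeCov α.2 d)) F (D i ω) with hT₁
    set T₂ := ∑ i ∈ range n, Φ n i (fun α d => resid Pθ xc α.1 d * Δ (timeCov α.2 d))
        (prodKer (fun k => momKer K e none k.rev) (fun _ => hG n) fun k => t k.rev) (D i ω) with hT₂
    set T₃ := ∑ i ∈ range n, Φ n i (fun α d => Δ (timeCov α.1 d) * Δ (timeCov α.2 d)) F (D i ω) with hT₃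
    have e1 : ∑ i ∈ range n, 1 / ((N n i : ℝ) * ((N n i : ℝ) - 1)) * ∑ α ∈ (range (N n i)).offDiag,
        ((obsC xc α.1 (D i ω) - m (timeCov α.1 (D i ω))) * (obsC xc α.2 (D i ω) - m (timeCov α.2 (D i ω))) -
          resid Pθ xc α.1 (D i ω) * resid Pθ xc α.2 (D i ω)) * F (timePair α (D i ω)) =
        -T₁ - T₂ + T₃ := by
      rw [hT₁, hT₂, hT₃, ← sum_neg_distrib, ← sum_sub_distrib, ← sum_add_distrib]
      refine sum_congr rfl fun i _ => ?_
      have e2 : Φ n i (fun α d => resid Pθ xc α.1 d * Δ (timeCov α.2 d))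
          (prodKer (fun k => momKer K e none k.rev) (fun _ => hG n) fun k => t k.rev) (D i ω) =
          1 / ((N n i : ℝ) * ((N n i : ℝ) - 1)) * ∑ α ∈ (range (N n i)).offDiag,
            resid Pθ xc α.2 (D i ω) * Δ (timeCov α.1 (D i ω)) * F (timePair α (D i ω)) := by
        rw [smp, ← sum_offDiag_swap (N n i) fun α =>
          resid Pθ xc α.2 (D i ω) * Δ (timeCov α.1 (D i ω)) * F (timePair α (D i ω))]
        simp only [hF, prodKer_timePair_swap, Prod.fst_swap, Prod.snd_swap]
      rw [e2, smp, smp, ← mul_neg, ← mul_sub, ← mul_add, ← sum_neg_distrib,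
        ← sum_sub_distrib, ← sum_add_distrib]
      congr 1
      refine sum_congr rfl fun α _ => ?_
      have a1 := hφ α.1 (D i ω)
      have a2 := hφ α.2 (D i ω)
      simp only [hΔ]
      rw [← a1, ← a2]; ring
    have hCe : ∀ C' : Option (Fin 2) → ℝ, (∀ e, 0 ≤ C' e) → C' e ≤ ∑ e, C' e := fun C' h0 =>
      single_le_sum (f := C') (fun e _ => h0 e) (Finset.mem_univ e)
    have b1 : |T₁| ≤ (∑ e, C₁ e) * (n * ((1 + C₃) * (hG n ^ 2 * R))) := by
      refine (h1 e t (hΛ t ht) Δ _ hη0 fun x hx => (hfit x hx).2).trans ?_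
      exact mul_le_mul (hCe C₁ hC₁) (by gcongr) (by positivity) hS1
    have b2 : |T₂| ≤ (∑ e, C₂ e) * (n * ((1 + C₃) * (hG n ^ 2 * R))) := by
      refine (h2 e _ (fun k => hΛ t ht k.rev) Δ _ hη0 fun x hx => (hfit x hx).2).trans ?_
      exact mul_le_mul (hCe C₂ hC₂) (by gcongr) (by positivity) hS2
    have b3 : |T₃| ≤ C₃ ^ 2 * M * (2 * C₅) * (n * (hG n ^ 2 * R)) := by
      have hi : ∀ i ∈ range n, |Φ n i (fun α d => Δ (timeCov α.1 d) * Δ (timeCov α.2 d)) F (D i ω)| ≤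
          (C₃ * (δ + hh)) ^ 2 * M * Φ n i (𝔠 n i) (𝓑 (fun _ => hG n) t) (D i ω) := by
        intro i _
        refine (abs_smp_le (E := fun α d => covEnv mm (N n i) α d.1 * (C₃ * (δ + hh)) ^ 2)
          (g := fun u => M * 𝓑 (fun _ => hG n) t u)
          (J.env.c_nonneg n i) (fun α hα => ?_) fun u => ?_).trans (le_of_eq ?_)
        · rw [Finset.mem_offDiag] at hα
          rw [abs_mul]
          calc _ ≤ C₃ * (δ + hh) * (C₃ * (δ + hh)) := mul_le_mul (hfit _ (hmem n i α.1 hα.1)).1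
                (hfit _ (hmem n i α.2 hα.2.1)).1 (abs_nonneg _) (by positivity)
            _ = 1 * (C₃ * (δ + hh)) ^ 2 := by ring
            _ ≤ _ := by gcongr; exact J.one_le n i α _
        · exact (abs_prodKer_le_boxKer (hM' e none) _ _ u).trans
            (mul_le_mul_of_nonneg_right (hMle e none) (prodKer_boxKer_nonneg _ _ u))
        · simp only [smp, mul_sum]
          exact sum_congr rfl fun α _ => by ring
      refine (abs_sum_le_sum_abs _ _).trans ((sum_le_sum hi).trans ?_)
      rw [← mul_sum]
      have h6 := h5 t (hΛ t ht)
      rw [Fin.prod_univ_two, ← pow_two, hXeq] at h6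
      have h7 : hG n ^ 2 + hG n ^ 2 * X ≤ 2 * hG n ^ 2 := by
        have : hG n ^ 2 * X ≤ hG n ^ 2 * 1 := by gcongr
        linarith
      calc _ ≤ (C₃ * (δ + hh)) ^ 2 * M * (C₅ * (n * (2 * hG n ^ 2))) := by
            refine mul_le_mul_of_nonneg_left (h6.trans ?_) (by positivity)
            gcongr
        _ = C₃ ^ 2 * M * (2 * C₅) * (n * (hG n ^ 2 * (δ + hh) ^ 2)) := by ring
        _ ≤ _ := by
          gcongr
          rw [hR]
          linarith
    rw [e1, abs_mul, Fin.prod_univ_two, abs_of_pos (by positivity), inv_mul_le_iff₀ (by positivity)]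
    calc |-T₁ - T₂ + T₃| ≤ |T₁| + |T₂| + |T₃| := by
          refine (abs_add_le _ _).trans (add_le_add_left ((abs_sub _ _).trans ?_) _)
          rw [abs_neg]
      _ ≤ _ := (add_le_add (add_le_add b1 b2) b3).trans (le_of_eq (by rw [hCη]; ring))
  have hfin := (h4 t ht _ bh (Cη * R) hbh hpert).1
  rw [Fin.prod_univ_two, Fin.sum_univ_two, ← pow_two, ← hXdef] at hfin
  refine hfin.trans ?_
  rw [mul_assoc]
  gcongr
  rw [hR]
  nlinarith [mul_nonneg hCη0 (sq_nonneg (hG n)), sq_nonneg (δ + hh), sq_nonneg (hG n)]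

end Cross

/-! ### Taylor expansions -/

lemma exists_hasTaylor {ι : Type} [Fintype ι] {φ : (ι → ℝ) → ℝ} {lo hi : ι → ℝ} {C₀ C₁ : ℝ}
    (hφm : Measurable φ) (hφ : ∀ u, |φ u| ≤ C₀) {g : (ι → ℝ) → ι → ℝ}
    (hg : ∀ k, ContinuousOn (fun x => g x k) (Icc lo hi))
    (hT : ∀ x ∈ Icc lo hi, ∀ u ∈ Icc lo hi,
      |φ u - φ x - ∑ k, g x k * (u k - x k)| ≤ C₁ * ∑ k, (u k - x k) ^ 2) :
    ∃ C G, HasTaylor φ G lo hi C ∧ ∀ k, Measurable fun x => G x k := by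
  classical
  choose M hM using fun k => isCompact_Icc.exists_bound_of_continuousOn (hg k)
  have hM0 : ∀ k, M k ≤ ∑ k, |M k| := fun k => (le_abs_self _).trans
    (single_le_sum (f := fun k => |M k|) (fun _ _ => abs_nonneg _) (Finset.mem_univ k))
  have hs : 0 ≤ ∑ k, |M k| := by positivity
  have h0 : 0 ≤ C₀ := (abs_nonneg _).trans (hφ 0)
  refine ⟨C₀ + |C₁| + ∑ k, |M k|, fun x k => (Icc lo hi).piecewise (fun x => g x k) 0 x,
    ⟨hφm, fun u => by linarith [hφ u, abs_nonneg C₁], fun x k => ?_, fun x hx u hu => ?_⟩,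
    fun k => (hg k).measurable_piecewise continuousOn_const measurableSet_Icc⟩
  · by_cases hx : x ∈ Icc lo hi
    · rw [piecewise_eq_of_mem _ _ _ hx]
      have := hM k x hx
      rw [norm_eq_abs] at this
      linarith [hM0 k, abs_nonneg C₁]
    · rw [piecewise_eq_of_notMem _ _ _ hx, Pi.zero_apply, abs_zero]
      positivity
  · simp only [piecewise_eq_of_mem _ _ _ hx]
    refine (hT x hx u hu).trans ?_
    gcongr
    linarith [le_abs_self C₁]

lemma TwiceDiffBounded.taylor {E : Type*} [NormedAddCommGroup E] [NormedSpace ℝ E] {f : E → ℝ}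
    {B : Set E} (hf : TwiceDiffBounded f B) (hB : Convex ℝ B) :
    ∃ C : ℝ, 0 ≤ C ∧ ∀ x ∈ B, ∀ u ∈ B, |f u - f x - fderivWithin ℝ f B x (u - x)| ≤ C * ‖u - x‖ ^ 2 := by
  obtain ⟨h1, h2, C, hC⟩ := hf
  refine ⟨|C|, abs_nonneg C, fun x hx u hu => ?_⟩
  have hsub := hB.segment_subset hx hu
  have := Convex.norm_image_sub_le_of_norm_hasFDerivWithin_le' (s := segment ℝ x u) (x := x) (y := u)
    (f' := fderivWithin ℝ f B) (φ := fderivWithin ℝ f B x) (C := |C| * ‖u - x‖)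
    (fun y hy => (h1 y (hsub hy)).hasFDerivWithinAt.mono hsub) (fun y hy => ?_) (convex_segment x u)
    (left_mem_segment ℝ x u) (right_mem_segment ℝ x u)
  · rw [pow_two, ← mul_assoc]; exact this
  · refine (hB.norm_image_sub_le_of_norm_fderivWithin_le h2 (fun v hv => (hC v hv).trans
      (le_abs_self C)) hx (hsub hy)).trans ?_
    gcongr
    exact norm_sub_le_of_mem_segment hy

/-- The time and the covariate of a point of the design. -/
def splitPt {p : ℕ} : ℝ^(p + 1) →ₗ[ℝ] ℝ × ℝ^p where
  toFun x := (x 0, fun k => x k.succ)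
  map_add' _ _ := rfl
  map_smul' _ _ := rfl

lemma norm_sq_le_sum {ι : Type*} [Fintype ι] (v : ι → ℝ) : ‖v‖ ^ 2 ≤ ∑ k, v k ^ 2 := by
  have h : ‖v‖ ≤ sqrt (∑ k, v k ^ 2) := (pi_norm_le_iff_of_nonneg (sqrt_nonneg _)).2 fun k =>
    Real.abs_le_sqrt (single_le_sum (f := fun k => v k ^ 2) (fun _ _ => sq_nonneg _) (Finset.mem_univ k))
  calc ‖v‖ ^ 2 ≤ sqrt (∑ k, v k ^ 2) ^ 2 := by gcongr
    _ = _ := sq_sqrt (by positivity)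

lemma norm_splitPt_le {p : ℕ} (x : ℝ^(p + 1)) : ‖splitPt x‖ ≤ ‖x‖ := max_le (norm_le_pi_norm x 0)
    ((pi_norm_le_iff_of_nonneg (norm_nonneg _)).2 fun k => norm_le_pi_norm x k.succ)

lemma splitPt_mem {p : ℕ} {a b : ℝ} {zlo zhi : ℝ^p} {x : ℝ^(p + 1)} :
    splitPt x ∈ Icc a b ×ˢ Icc zlo zhi ↔ x ∈ Icc (Fin.cons a zlo : ℝ^(p + 1)) (Fin.cons b zhi) := by
  simp only [splitPt, LinearMap.coe_mk, AddHom.coe_mk, mem_prod, mem_Icc, Pi.le_def,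
    Fin.forall_fin_succ, Fin.cons_zero, Fin.cons_succ]
  tauto

lemma exists_hasTaylor_mean {p : ℕ} {a b : ℝ} {zlo zhi : ℝ^p} {f : ℝ × ℝ^p → ℝ}
    (hf : TwiceDiffBounded f (Icc a b ×ˢ Icc zlo zhi)) {φ : ℝ^(p + 1) → ℝ} {C₀ : ℝ}
    (hφm : Measurable φ) (hφ : ∀ u, |φ u| ≤ C₀)
    (heq : ∀ x ∈ Icc (Fin.cons a zlo : ℝ^(p + 1)) (Fin.cons b zhi), φ x = f (splitPt x)) :
    ∃ C G, HasTaylor φ G (Fin.cons a zlo) (Fin.cons b zhi) C ∧ ∀ k, Measurable fun x => G x k := by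
  set B := Icc a b ×ˢ Icc zlo zhi
  obtain ⟨C, hC, h1⟩ := hf.taylor ((convex_Icc a b).prod (convex_Icc zlo zhi))
  refine exists_hasTaylor hφm hφ (C₁ := C)
    (g := fun x k => fderivWithin ℝ f B (splitPt x) (splitPt fun j => if k = j then 1 else 0))
    (fun k => ?_) fun x hx u hu => ?_
  · exact (hf.2.1.continuousOn.comp splitPt.continuous_of_finiteDimensional.continuousOn
      fun x hx => splitPt_mem.2 hx).clm_apply continuousOn_const
  · have h2 := h1 _ (splitPt_mem.2 hx) _ (splitPt_mem.2 hu)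
    rw [← map_sub] at h2
    have h3 := (fderivWithin ℝ f B (splitPt x)).toLinearMap.comp splitPt |>.pi_apply_eq_sum_univ (u - x)
    simp only [LinearMap.comp_apply, ContinuousLinearMap.coe_coe, smul_eq_mul, Pi.sub_apply] at h3
    rw [heq x hx, heq u hu]
    simp only [mul_comm _ (u _ - x _), ← h3]
    refine h2.trans (mul_le_mul_of_nonneg_left ?_ hC)
    calc ‖splitPt (u - x)‖ ^ 2 ≤ ‖u - x‖ ^ 2 := by gcongr; exact norm_splitPt_le _
      _ ≤ _ := norm_sq_le_sum _

lemma abs_sub_taylor_le {f f' f'' : ℝ → ℝ} {a b C : ℝ}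
    (hf : ∀ x ∈ Icc a b, HasDerivWithinAt f (f' x) (Icc a b) x)
    (hf' : ∀ x ∈ Icc a b, HasDerivWithinAt f' (f'' x) (Icc a b) x) (hC : ∀ x ∈ Icc a b, |f'' x| ≤ C)
    {t u : ℝ} (ht : t ∈ Icc a b) (hu : u ∈ Icc a b) : |f u - f t - f' t * (u - t)| ≤ C * (u - t) ^ 2 := by
  have hsub : uIcc t u ⊆ Icc a b := (convex_Icc a b).ordConnected.uIcc_subset ht hu
  have hC0 : 0 ≤ C := (abs_nonneg _).trans (hC t ht)
  have := (convex_uIcc t u).norm_image_sub_le_of_norm_hasDerivWithin_le (f := fun w => f w - f' t * w)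
    (f' := fun w => f' w - f' t) (C := C * |u - t|) (fun w hw => ?_) (fun w hw => ?_) left_mem_uIcc
    right_mem_uIcc
  · rw [mul_assoc, norm_eq_abs, norm_eq_abs, abs_mul_abs_self] at this
    convert this using 2 <;> ring
  · have h1 := ((hf w (hsub hw)).mono hsub).sub ((hasDerivWithinAt_id w (uIcc t u)).const_mul (f' t))
    rw [mul_one] at h1
    exact h1
  · refine ((convex_Icc a b).norm_image_sub_le_of_norm_hasDerivWithin_le hf' hC ht (hsub hw)).trans ?_
    gcongr
    exact abs_sub_left_of_mem_uIcc hw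

lemma exists_hasTaylor_cov {a b : ℝ} {Γ : ℝ → ℝ → ℝ} (hΓ : BoundedSecondPartials Γ (Icc a b))
    {φ : ℝ^2 → ℝ} {C₀ : ℝ} (hφm : Measurable φ) (hφ : ∀ u, |φ u| ≤ C₀)
    (heq : ∀ x ∈ Icc (fun _ : Fin 2 => a) fun _ => b, φ x = Γ (x 0) (x 1)) :
    ∃ C G, HasTaylor φ G (fun _ => a) (fun _ => b) C ∧ ∀ k, Measurable fun x => G x k := by
  obtain ⟨G₁, G₂, G₁₁, G₁₂, G₂₁, G₂₂, C, h⟩ := hΓ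
  have hm : ∀ x ∈ Icc (fun _ : Fin 2 => a) fun _ => b, ∀ k, x k ∈ Icc a b := fun x hx k => ⟨hx.1 k, hx.2 k⟩
  have hlip : ∀ F F₁ F₂ : ℝ → ℝ → ℝ, (∀ s ∈ Icc a b, ∀ t ∈ Icc a b,
      HasDerivWithinAt (fun u => F u t) (F₁ s t) (Icc a b) s ∧ |F₁ s t| ≤ C ∧
      HasDerivWithinAt (fun v => F s v) (F₂ s t) (Icc a b) t ∧ |F₂ s t| ≤ C) →
      (∀ s ∈ Icc a b, ∀ t ∈ Icc a b, ∀ v ∈ Icc a b, |F s v - F s t| ≤ C * |v - t|) ∧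
      ContinuousOn (fun x : ℝ^2 => F (x 0) (x 1)) (Icc (fun _ => a) fun _ => b) := by
    intro F F₁ F₂ hF
    have h1 : ∀ s ∈ Icc a b, ∀ t ∈ Icc a b, ∀ v ∈ Icc a b, |F s v - F s t| ≤ C * |v - t| :=
      fun s hs t ht v hv => (convex_Icc a b).norm_image_sub_le_of_norm_hasDerivWithin_le
        (fun w hw => (hF s hs w hw).2.2.1) (fun w hw => (hF s hs w hw).2.2.2) ht hv
    refine ⟨h1, (LipschitzOnWith.of_dist_le_mul (K := (2 * C).toNNReal) fun x hx y hy => ?_).continuousOn⟩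
    have hC0 : 0 ≤ C := (abs_nonneg _).trans (hF _ (hm x hx 0) _ (hm x hx 1)).2.1
    have h2 := (convex_Icc a b).norm_image_sub_le_of_norm_hasDerivWithin_le
      (fun w hw => (hF w hw (x 1) (hm x hx 1)).1) (fun w hw => (hF w hw (x 1) (hm x hx 1)).2.1)
      (hm y hy 0) (hm x hx 0)
    have h3 := h1 _ (hm y hy 0) _ (hm y hy 1) _ (hm x hx 1)
    rw [Real.coe_toNNReal _ (by positivity)]
    have h4 : ∀ k, |x k - y k| ≤ dist x y := fun k => dist_le_pi_dist x y k
    have h5 := mul_le_mul_of_nonneg_left (h4 0) hC0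
    have h6 := mul_le_mul_of_nonneg_left (h4 1) hC0
    rw [Real.dist_eq]
    rw [norm_eq_abs, norm_eq_abs] at h2
    have h7 := abs_sub_le (F (x 0) (x 1)) (F (y 0) (x 1)) (F (y 0) (y 1))
    linarith
  obtain ⟨l1, c1⟩ := hlip G₁ G₁₁ G₁₂ fun s hs t ht => by have := h s hs t ht; tauto
  obtain ⟨-, c2⟩ := hlip G₂ G₂₁ G₂₂ fun s hs t ht => by have := h s hs t ht; tauto
  refine exists_hasTaylor hφm hφ (C₁ := 2 * C) (g := fun x => ![G₁ (x 0) (x 1), G₂ (x 0) (x 1)])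
    (fun k => by fin_cases k; exacts [c1, c2]) fun x hx u hu => ?_
  have hx0 := hm x hx 0
  have hx1 := hm x hx 1
  have hu0 := hm u hu 0
  have hu1 := hm u hu 1
  have hC0 : 0 ≤ C := (abs_nonneg _).trans (h _ hx0 _ hx1).2.2.2.2.2.2.1
  have t1 := abs_sub_taylor_le (fun s hs => (h s hs _ hu1).1) (fun s hs => (h s hs _ hu1).2.2.1)
    (fun s hs => (h s hs _ hu1).2.2.2.2.2.2.1) hx0 hu0
  have t2 := abs_sub_taylor_le (fun t ht => (h _ hx0 t ht).2.1) (fun t ht => (h _ hx0 t ht).2.2.2.2.2.1)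
    (fun t ht => (h _ hx0 t ht).2.2.2.2.2.2.2.2.2) hx1 hu1
  have t3 : |(G₁ (x 0) (u 1) - G₁ (x 0) (x 1)) * (u 0 - x 0)| ≤
      C * ((u 0 - x 0) ^ 2 + (u 1 - x 1) ^ 2) := by
    rw [abs_mul]
    refine (mul_le_mul_of_nonneg_right (l1 _ hx0 _ hx1 _ hu1) (abs_nonneg _)).trans ?_
    rw [mul_assoc]
    gcongr
    nlinarith [sq_nonneg (|u 1 - x 1| - |u 0 - x 0|), sq_abs (u 1 - x 1), sq_abs (u 0 - x 0)]
  rw [heq x hx, heq u hu, Fin.sum_univ_two, Fin.sum_univ_two]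
  simp only [Matrix.cons_val_zero, Matrix.cons_val_one]
  rw [abs_le] at t1 t2 t3 ⊢
  constructor <;> linarith [t1.1, t1.2, t2.1, t2.2, t3.1, t3.2]

/-! ### The laws of the sampling scheme -/

variable {a b : ℝ} {zlo zhi : ℝ^p} {x : S → ℝ → ℝ^p → ℝ} {θ : ℕ → Ω → S}
  {Z : ℕ → Ω → ℝ^p} {T ε : ℕ → ℕ → Ω → ℝ} {σ : ℝ} {g : ℝ × ℝ^p → ℝ}

/-- The data of the subject `i`. -/
def subjData (θ : ℕ → Ω → S) (Z : ℕ → Ω → ℝ^p) (T ε : ℕ → ℕ → Ω → ℝ) (i : ℕ) (ω : Ω) : Subj S p :=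
  ((θ i ω, Z i ω, fun j => ε i j ω), fun j => T i j ω)

lemma map_equiv_restrict {α β : Type*} [MeasureSpace α] [MeasureSpace β] (e : α ≃ᵐ β)
    (he : MeasurePreserving e) {s : Set α} (hs : MeasurableSet s) (c : NNReal) :
    (c • volume.restrict (e.symm ⁻¹' s)).map e.symm = c • volume.restrict s := by
  rw [Measure.map_smul, ((he.symm e).restrict_preimage hs).map_eq]

local notation "ℐ𝓈" => IsSampling P x θ Z T ε σ (Icc a b) (Icc zlo zhi) g

namespace IsSampling

lemma isProbabilityMeasure_map (h : ℐ𝓈) : IsProbabilityMeasure (P.map (Z 0)) ∧ IsProbabilityMeasure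
    (P.map (T 0 0)) ∧ IsProbabilityMeasure (P.map (θ 0)) ∧ IsProbabilityMeasure (P.map (ε 0 0)) :=
  ⟨Measure.isProbabilityMeasure_map (h.measurable_Z 0).aemeasurable,
    Measure.isProbabilityMeasure_map (h.measurable_T 0 0).aemeasurable,
    Measure.isProbabilityMeasure_map (h.measurable_θ 0).aemeasurable,
    Measure.isProbabilityMeasure_map (h.measurable_ε 0 0).aemeasurable⟩

lemma measurable_subjData (h : ℐ𝓈) (i : ℕ) : Measurable (subjData θ Z T ε i) :=
  ((h.measurable_θ i).prodMk ((h.measurable_Z i).prodMk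
    (measurable_pi_lambda _ (h.measurable_ε i)))).prodMk (measurable_pi_lambda _ (h.measurable_T i))

lemma map_TZ (h : ℐ𝓈) (i j : ℕ) :
    P.map (fun ω => (T i j ω, Z i ω)) = (P.map (T 0 0)).prod (P.map (Z 0)) := by
  rw [h.law_TZ i j, ← h.law_TZ 0 0]
  refine (indepFun_iff_map_prod_eq_prod_map_map (h.measurable_T 0 0).aemeasurable
    (h.measurable_Z 0).aemeasurable).1 ?_
  exact ((h.indep_T 0).comp measurable_snd (measurable_pi_apply 0)).symm

lemma map_T (h : ℐ𝓈) (i j : ℕ) : P.map (T i j) = P.map (T 0 0) := by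
  have := h.isProbabilityMeasure_map.1
  have h1 := congrArg (Measure.map Prod.fst) (h.map_TZ i j)
  rwa [Measure.map_map measurable_fst ((h.measurable_T i j).prodMk (h.measurable_Z i)),
    Measure.map_fst_prod, measure_univ, one_smul] at h1

lemma map_Z (h : ℐ𝓈) (i : ℕ) : P.map (Z i) = P.map (Z 0) := by
  have := h.isProbabilityMeasure_map.2.1
  have h1 := congrArg (Measure.map Prod.snd) (h.map_TZ i 0)
  rwa [Measure.map_map measurable_snd ((h.measurable_T i 0).prodMk (h.measurable_Z i)),
    Measure.map_snd_prod, measure_univ, one_smul] at h1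

lemma map_subjData (h : ℐ𝓈) (i : ℕ) : P.map (subjData θ Z T ε i) =
      subjLaw (P.map (θ 0)) (P.map (Z 0)) (P.map (T 0 0)) (P.map (ε 0 0)) := by
  obtain ⟨p1, p2, p3, p4⟩ := h.isProbabilityMeasure_map
  have mθ := h.measurable_θ i
  have mZ := h.measurable_Z i
  have mT := measurable_pi_lambda (fun ω j => T i j ω) (h.measurable_T i)
  have mε := measurable_pi_lambda (fun ω j => ε i j ω) (h.measurable_ε i)
  have e1 := (indepFun_iff_map_prod_eq_prod_map_map mθ.aemeasurable mZ.aemeasurable).1 (h.indep_θ_Z i)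
  have e2 := (indepFun_iff_map_prod_eq_prod_map_map (mθ.prodMk mZ).aemeasurable mT.aemeasurable).1
    (h.indep_T i)
  have e3 := (indepFun_iff_map_prod_eq_prod_map_map (mθ.prodMk (mZ.prodMk mT)).aemeasurable
    mε.aemeasurable).1 (h.indep_ε i)
  have e4 := (iIndepFun_iff_map_fun_eq_infinitePi_map (h.measurable_T i)).1 (h.iIndep_T i)
  have e5 := (iIndepFun_iff_map_fun_eq_infinitePi_map (h.measurable_ε i)).1 (h.iIndep_ε i)
  simp only [h.map_T] at e4
  simp only [(h.ident_ε _ _).map_eq] at e5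
  rw [(h.ident_θ i).map_eq, h.map_Z] at e1
  rw [e1, e4] at e2
  have e6 := congrArg (Measure.map MeasurableEquiv.prodAssoc) e2
  rw [Measure.map_map MeasurableEquiv.prodAssoc.measurable ((mθ.prodMk mZ).prodMk mT),
    Measure.prodAssoc_prod] at e6
  have e7 : P.map (fun ω => (θ i ω, Z i ω, fun j => T i j ω)) = _ := e6
  rw [e7, e5, ← measurePreserving_regroup.map_eq] at e3
  set r : (Base S p) × (ℕ → ℝ) → Subj S p := fun w => ((w.1.1, w.1.2.1, w.2), w.1.2.2)
  have hr : Measurable r := by fun_prop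
  have e8 := congrArg (Measure.map r) e3
  rw [Measure.map_map hr ((mθ.prodMk (mZ.prodMk mT)).prodMk mε),
    Measure.map_map hr (by unfold regroup; fun_prop)] at e8
  refine e8.trans ?_
  rw [show r ∘ regroup = id from rfl, Measure.map_id]

lemma isIID_subjData (h : ℐ𝓈) : IsIID P (subjData θ Z T ε)
    (subjLaw (P.map (θ 0)) (P.map (Z 0)) (P.map (T 0 0)) (P.map (ε 0 0))) :=
  ⟨h.measurable_subjData, h.indep_subjects.comp (fun _ v => ((v.1, v.2.1, v.2.2.2), v.2.2.1))
    fun _ => by fun_prop, h.map_subjData⟩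

lemma exists_density_bounds (h : ℐ𝓈) (hab : a < b)
    (hz : ∀ k, zlo k < zhi k) (hg : DensityCondition g (Icc a b ×ˢ Icc zlo zhi)) :
    ∃ κ C : NNReal, 0 < κ ∧
      (κ • volume.restrict (Icc a b ×ˢ Icc zlo zhi) ≤ (P.map (T 0 0)).prod (P.map (Z 0)) ∧
        (P.map (T 0 0)).prod (P.map (Z 0)) ≤ C • volume.restrict (Icc a b ×ˢ Icc zlo zhi)) ∧
      (κ • volume.restrict (Icc a b) ≤ P.map (T 0 0) ∧ P.map (T 0 0) ≤ C • volume.restrict (Icc a b)) ∧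
      P.map (Z 0) ≤ C • volume.restrict (Icc zlo zhi) := by
  obtain ⟨p1, p2, p3, p4⟩ := h.isProbabilityMeasure_map
  obtain ⟨⟨m, M, hm, hmM⟩, -⟩ := hg
  set B := Icc a b ×ˢ Icc zlo zhi with hB
  have hBm : MeasurableSet B := measurableSet_Icc.prod measurableSet_Icc
  have hd := (h.map_TZ 0 0).symm.trans (h.law_TZ 0 0)
  have l1 : m.toNNReal • volume.restrict B ≤ (P.map (T 0 0)).prod (P.map (Z 0)) := by
    rw [hd, show m.toNNReal • volume.restrict B = (volume.restrict B).withDensity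
      (fun _ => ofReal m) by rw [withDensity_const]; rfl]
    exact withDensity_mono ((ae_restrict_mem hBm).mono fun v hv => ofReal_le_ofReal (hmM v hv).1)
  have u1 : (P.map (T 0 0)).prod (P.map (Z 0)) ≤ M.toNNReal • volume.restrict B := by
    rw [hd, show M.toNNReal • volume.restrict B = (volume.restrict B).withDensity
      (fun _ => ofReal M) by rw [withDensity_const]; rfl]
    exact withDensity_mono ((ae_restrict_mem hBm).mono fun v hv => ofReal_le_ofReal (hmM v hv).2)
  set vT : NNReal := (volume (Icc a b)).toNNReal with hvT
  set vZ : NNReal := (volume (Icc zlo zhi)).toNNReal with hvZ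
  have fT : (volume (Icc a b) : ENNReal) = vT := (coe_toNNReal measure_Icc_lt_top.ne).symm
  have fZ : (volume (Icc zlo zhi) : ENNReal) = vZ := (coe_toNNReal measure_Icc_lt_top.ne).symm
  have hvZ0 : 0 < vZ := by
    rw [pos_iff_ne_zero, Ne, ← ENNReal.coe_eq_zero, ← fZ, Real.volume_Icc_pi, Finset.prod_eq_zero_iff]
    rintro ⟨k, -, hk⟩
    rw [ENNReal.ofReal_eq_zero] at hk
    linarith [hz k]
  have hfst : ∀ c : NNReal, (c • volume.restrict B).map Prod.fst = (c * vZ) • volume.restrict (Icc a b) := by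
    intro c
    rw [Measure.map_smul, hB, volume_eq_prod, ← prod_restrict, Measure.map_fst_prod,
      Measure.restrict_apply_univ, fZ, mul_smul]; rfl
  have hsnd : ∀ c : NNReal, (c • volume.restrict B).map Prod.snd =
      (c * vT) • volume.restrict (Icc zlo zhi) := by
    intro c
    rw [Measure.map_smul, hB, volume_eq_prod, ← prod_restrict, Measure.map_snd_prod,
      Measure.restrict_apply_univ, fT, mul_smul]; rfl
  have l2 := Measure.map_mono l1 measurable_fst
  have u2 := Measure.map_mono u1 measurable_fst
  have u3 := Measure.map_mono u1 measurable_snd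
  rw [hfst, Measure.map_fst_prod, measure_univ, one_smul] at l2 u2
  rw [hsnd, Measure.map_snd_prod, measure_univ, one_smul] at u3
  have mono : ∀ {α : Type _} [MeasurableSpace α] (μ : Measure α) {c d : NNReal}, c ≤ d → c • μ ≤ d • μ :=
    fun μ c d hcd s => by
      simp only [Measure.smul_apply, ENNReal.smul_def, smul_eq_mul]
      gcongr
  have hm0 : 0 < m.toNNReal := Real.toNNReal_pos.2 hm
  refine ⟨min m.toNNReal (m.toNNReal * vZ), max M.toNNReal (max (M.toNNReal * vZ) (M.toNNReal * vT)),
    lt_min hm0 (mul_pos hm0 hvZ0), ⟨(mono _ (min_le_left _ _)).trans l1, u1.trans (mono _ (le_max_left _ _))⟩,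
    ⟨(mono _ (min_le_right _ _)).trans l2, u2.trans (mono _ ?_)⟩, u3.trans (mono _ ?_)⟩
  · exact (le_max_left _ _).trans (le_max_right _ _)
  · exact (le_max_right _ _).trans (le_max_right _ _)

end IsSampling

/-! ### Truncation of the curves -/

lemma ae_mem_of_le_smul_restrict {α : Type*} [MeasurableSpace α] {μ ν : Measure α} {s : Set α}
    (hs : MeasurableSet s) {c : NNReal} (h : μ ≤ c • ν.restrict s) : ∀ᵐ u ∂μ, u ∈ s :=
  ((Measure.absolutelyContinuous_of_le h).trans (Measure.smul_absolutelyContinuous (c := c))).ae_le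
    (ae_restrict_mem hs)

lemma rpow_le_one_add_rpow {a r q : ℝ} (ha : 0 ≤ a) (hr : 0 ≤ r) (hrq : r ≤ q) : a ^ r ≤ 1 + a ^ q := by
  have h0 := rpow_nonneg ha q
  rcases le_total a 1 with h | h
  · linarith [Real.rpow_le_one ha h hr]
  · linarith [Real.rpow_le_rpow_of_exponent_le h hrq]

lemma SubjModel.mono (H : ℳ q) {r : ℝ} (hr : 0 ≤ r) (hrq : r ≤ q) : ℳ r := by
  obtain ⟨C, hC⟩ := H.moment_mm
  refine ⟨H.measurable_mm, H.one_le_mm, ⟨C, fun z => (lintegral_mono fun θ => ?_).trans (hC z)⟩, ?_,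
    H.PT_le, H.PZ_le⟩
  · exact ofReal_le_ofReal (Real.rpow_le_rpow_of_exponent_le (H.one_le_mm θ z) hrq)
  · refine ((integrable_const (1 : ℝ)).add H.moment_e).mono' (by fun_prop) (ae_of_all _ fun e => ?_)
    rw [norm_of_nonneg (by positivity)]
    exact rpow_le_one_add_rpow (abs_nonneg e) hr hrq

/-- The curve, set to zero where it exceeds `m`. -/
def truncCurve (x : S → ℝ → ℝ^p → ℝ) (m : S → ℝ^p → ℝ) (θ : S) (t : ℝ) (z : ℝ^p) : ℝ :=
  if |x θ t z| ≤ m θ z then x θ t z else 0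

lemma measurable_truncCurve {x : S → ℝ → ℝ^p → ℝ} {m : S → ℝ^p → ℝ}
    (hx : Measurable fun v : S × ℝ × ℝ^p => x v.1 v.2.1 v.2.2)
    (hm : Measurable fun v : S × ℝ^p => m v.1 v.2) :
    Measurable fun v : S × ℝ × ℝ^p => truncCurve x m v.1 v.2.1 v.2.2 :=
  Measurable.ite (measurableSet_le hx.abs (hm.comp
    (by fun_prop : Measurable fun v : S × ℝ × ℝ^p => (v.1, v.2.2)))) hx measurable_const

lemma exists_curveModel {x : S → ℝ → ℝ^p → ℝ} {m : S → ℝ^p → ℝ}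
    (hx : Measurable fun v : S × ℝ × ℝ^p => x v.1 v.2.1 v.2.2)
    (hm : Measurable fun v : S × ℝ^p => m v.1 v.2) (hm0 : ∀ θ z, 0 ≤ m θ z) (hq : 1 ≤ q)
    {C : NNReal} (hC : ∀ z, ∫⁻ θ, ofReal (m θ z ^ q) ∂Pθ ≤ C) (hε : ∫ e, e ∂Pε = 0) :
    ∃ mm : S → ℝ^p → ℝ, CurveModel Pθ Pε mm (truncCurve x m) ∧
      (Measurable fun v : S × ℝ^p => mm v.1 v.2) ∧ (∀ θ z, 1 ≤ mm θ z) ∧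
      (∃ C : NNReal, ∀ z, ∫⁻ θ, ofReal (mm θ z ^ q) ∂Pθ ≤ C) ∧
      ∀ t z, |curveMean Pθ (truncCurve x m) t z| ≤ 1 + C := by
  have hxm : ∀ θ t z, |truncCurve x m θ t z| ≤ m θ z := fun θ t z => by
    unfold truncCurve
    split_ifs with h
    · exact h
    · simpa using hm0 θ z
  have hmz : ∀ z, Measurable fun θ => m θ z := fun z => hm.comp measurable_prodMk_right
  have hmq : ∀ z, Integrable (fun θ => m θ z ^ q) Pθ ∧ ∫ θ, m θ z ^ q ∂Pθ ≤ C := fun z => by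
    have hnn : 0 ≤ᵐ[Pθ] fun θ => m θ z ^ q := ae_of_all _ fun θ => rpow_nonneg (hm0 θ z) q
    have hi : Integrable (fun θ => m θ z ^ q) Pθ := by
      refine ⟨((hmz z).pow_const q).aestronglyMeasurable, ?_⟩
      rw [hasFiniteIntegral_iff_ofReal hnn]
      exact (hC z).trans_lt coe_lt_top
    refine ⟨hi, ?_⟩
    rw [integral_eq_lintegral_of_nonneg_ae hnn hi.aestronglyMeasurable]
    exact ENNReal.toReal_le_coe_of_le_coe (hC z)
  have hmean : ∀ t z, |curveMean Pθ (truncCurve x m) t z| ≤ 1 + C := fun t z => by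
    refine (norm_integral_le_of_norm_le (f := fun θ => truncCurve x m θ t z) ((integrable_const (1 : ℝ)).add (hmq z).1)
      (ae_of_all _ fun θ => (hxm θ t z).trans ?_)).trans ?_
    · simpa using rpow_le_one_add_rpow (hm0 θ z) zero_le_one hq
    · simp only [Pi.add_apply]
      rw [integral_add (integrable_const _) (hmq z).1]
      simpa using (hmq z).2
  have hC0 : (0 : ℝ) ≤ C := C.2
  refine ⟨fun θ z => 2 + C + m θ z, ⟨measurable_truncCurve hx hm, fun θ t z => ?_, fun θ t z => ?_, hε⟩,
    hm.const_add _, fun θ z => by linarith [hm0 θ z],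
    ⟨((2 : ℝ) ^ q * (2 + C) ^ q).toNNReal + ((2 : ℝ) ^ q).toNNReal * C, fun z => ?_⟩, hmean⟩
  · linarith [hxm θ t z]
  · linarith [abs_sub (truncCurve x m θ t z) (curveMean Pθ (truncCurve x m) t z), hxm θ t z, hmean t z]
  · have hb : ∀ θ, ofReal ((2 + C + m θ z) ^ q) ≤
        ofReal (2 ^ q * (2 + C) ^ q) + ofReal (2 ^ q) * ofReal (m θ z ^ q) := by
      intro θ
      rw [← ofReal_mul (by positivity), ← ofReal_add (by positivity)
        (mul_nonneg (by positivity) (rpow_nonneg (hm0 θ z) q))]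
      refine ofReal_le_ofReal ((SubjModel.add_rpow_le (by positivity) (hm0 θ z) (by linarith)).trans_eq ?_)
      ring
    refine (lintegral_mono hb).trans ?_
    rw [lintegral_add_left measurable_const, lintegral_const, measure_univ, mul_one,
      lintegral_const_mul _ ((hmz z).pow_const q).ennreal_ofReal]
    push_cast
    gcongr
    · exact le_rfl
    · exact le_rfl
    · exact hC z

lemma ae_subjLaw_of_forall_ae {I : Set ℝ} {D : Set ℝ^p} (hI : ∀ᵐ t ∂PT, t ∈ I)
    (hD : ∀ᵐ z ∂PZ, z ∈ D) {A : Set (S × ℝ × ℝ^p)} (hA : MeasurableSet A)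
    (h : ∀ z ∈ D, ∀ t ∈ I, ∀ᵐ θ ∂Pθ, (θ, t, z) ∈ A) (j : ℕ) :
    ∀ᵐ d ∂ℒ, d.2 j ∈ I ∧ d.1.2.1 ∈ D ∧ (d.1.1, d.2 j, d.1.2.1) ∈ A := by
  set ρ := PZ.prod PT^ℕ
  have h1 : ∀ᵐ w ∂ρ, w.1 ∈ D := Measure.quasiMeasurePreserving_fst.ae hD
  have h2 : ∀ᵐ w ∂ρ, w.2 j ∈ I := by
    refine Measure.quasiMeasurePreserving_snd.ae (p := fun τ : ℕ → ℝ => τ j ∈ I) ?_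
    refine ae_of_ae_map (f := fun τ : ℕ → ℝ => τ j) (measurable_pi_apply j).aemeasurable
      (p := fun t : ℝ => t ∈ I) ?_
    rwa [infinitePi_map_eval (fun _ : ℕ => PT) j]
  have h3 : ∀ᵐ w ∂Pθ.prod ρ, (w.1, w.2.2 j, w.2.1) ∈ A := by
    have hm : MeasurableSet {w : Base S p | (w.1, w.2.2 j, w.2.1) ∉ A} :=
      (hA.preimage (by fun_prop : Measurable fun w : Base S p => (w.1, w.2.2 j, w.2.1))).compl
    rw [ae_iff, Measure.prod_apply_symm hm, lintegral_eq_zero_iff (measurable_measure_prodMk_right hm)]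
    filter_upwards [h1, h2] with w hw1 hw2 using h _ hw1 _ hw2
  have h4 := (Measure.quasiMeasurePreserving_snd (μ := Pθ) (ν := ρ)).ae h1
  have h5 := (Measure.quasiMeasurePreserving_snd (μ := Pθ) (ν := ρ)).ae h2
  filter_upwards [(measurePreserving_regroup_fst (Pε := Pε)).quasiMeasurePreserving.ae h3,
    (measurePreserving_regroup_fst (Pε := Pε)).quasiMeasurePreserving.ae h4,
    (measurePreserving_regroup_fst (Pε := Pε)).quasiMeasurePreserving.ae h5] with d e3 e4 e5
  exact ⟨e5, e4, e3⟩

lemma IsSampling.exists_curves (h : ℐ𝓈) {q : ℝ} (hq : 1 ≤ q)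
    {CT CZ : NNReal} (hCT : P.map (T 0 0) ≤ CT • volume.restrict (Icc a b))
    (hCZ : P.map (Z 0) ≤ CZ • volume.restrict (Icc zlo zhi))
    (hX : HasSupMoment P x θ (Icc a b) (Icc zlo zhi) q)
    (hU : Integrable (fun ω => |err P x θ Z T ε 0 0 ω| ^ q) P) :
    ∃ (mm : S → ℝ^p → ℝ) (xc : S → ℝ → ℝ^p → ℝ) (C : NNReal),
      CurveModel (P.map (θ 0)) (P.map (ε 0 0)) mm xc ∧
      SubjModel (P.map (θ 0)) (P.map (Z 0)) (P.map (T 0 0)) (P.map (ε 0 0)) mm q ∧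
      (∀ t z, |curveMean (P.map (θ 0)) xc t z| ≤ C) ∧
      (∀ t ∈ Icc a b, ∀ z ∈ Icc zlo zhi, curveMean (P.map (θ 0)) xc t z = meanFn P x θ t z) ∧
      (∀ s ∈ Icc a b, ∀ t ∈ Icc a b,
        curveCov (P.map (θ 0)) (P.map (Z 0)) xc (s, t) = pooledCov P x θ Z s t) ∧
      ∀ᵐ ω ∂P, ∀ i j, T i j ω ∈ Icc a b ∧ Z i ω ∈ Icc zlo zhi ∧
        xc (θ i ω) (T i j ω) (Z i ω) = x (θ i ω) (T i j ω) (Z i ω) := by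
  obtain ⟨p1, p2, p3, p4⟩ := h.isProbabilityMeasure_map
  have hmθ := h.measurable_θ 0
  obtain ⟨M, C, hM, hxM, hMC⟩ := hX
  set m : S → ℝ^p → ℝ := fun s z => (Icc zlo zhi).indicator (fun z => (M s z).toReal ^ (1 / q)) z with hm
  have hmm : Measurable fun v : S × ℝ^p => m v.1 v.2 :=
    Measurable.ite (measurableSet_Icc.preimage measurable_snd) (hM.ennreal_toReal.pow_const _)
      measurable_const
  have hMz : ∀ z, Measurable fun s => M s z := fun z => hM.comp measurable_prodMk_right
  have hmap : ∀ z ∈ Icc zlo zhi, ∫⁻ s, M s z ∂P.map (θ 0) ≤ C := fun z hz => by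
    rw [lintegral_map (hMz z) hmθ]; exact hMC z hz
  have hfin : ∀ z ∈ Icc zlo zhi, ∀ᵐ s ∂P.map (θ 0), M s z < ⊤ := fun z hz =>
    ae_lt_top (hMz z) ((hmap z hz).trans_lt coe_lt_top).ne
  have hq0 : 0 < q := by linarith
  have hε : ∫ e, e ∂P.map (ε 0 0) = 0 := by
    rw [integral_map (h.measurable_ε 0 0).aemeasurable (f := fun e => e) measurable_id.aestronglyMeasurable]
    exact h.mean_ε 0 0
  have hxz : ∀ t z, Measurable fun s => x s t z := fun t z =>
    h.measurable_x.comp (by fun_prop : Measurable fun s : S => (s, t, z))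
  obtain ⟨mm, Cm, hmmm, hmm1, ⟨C', hC'⟩, hmean⟩ := exists_curveModel (Pθ := P.map (θ 0)) (C := C)
    h.measurable_x hmm (fun s z => indicator_nonneg (fun z _ => by positivity) z) hq (fun z => by
      by_cases hz : z ∈ Icc zlo zhi
      · refine (lintegral_mono fun s => ?_).trans (hmap z hz)
        rw [hm]
        simp only [indicator_of_mem hz]
        rw [← rpow_mul toReal_nonneg, one_div_mul_cancel hq0.ne', rpow_one]
        exact ENNReal.ofReal_toReal_le
      · simp [hm, indicator_of_notMem hz, Real.zero_rpow hq0.ne']) hε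
  have hae : ∀ z ∈ Icc zlo zhi, ∀ t ∈ Icc a b, ∀ᵐ s ∂P.map (θ 0), truncCurve x m s t z = x s t z := by
    intro z hz t ht
    have h1 : ∀ᵐ s ∂P.map (θ 0), ofReal (|x s t z| ^ q) ≤ M s z := by
      rw [ae_map_iff hmθ.aemeasurable (measurableSet_le ((hxz t z).abs.pow_const q).ennreal_ofReal (hMz z))]
      filter_upwards [hxM] with ω hω using hω z hz t ht
    filter_upwards [h1, hfin z hz] with s h1 h2
    refine if_pos ?_
    rw [hm]
    simp only [indicator_of_mem hz]
    rw [← Real.rpow_le_rpow_iff (abs_nonneg _) (by positivity) hq0, ← rpow_mul toReal_nonneg,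
      one_div_mul_cancel hq0.ne', rpow_one]
    exact (ENNReal.ofReal_le_iff_le_toReal h2.ne).1 h1
  have hA : MeasurableSet {v : S × ℝ × ℝ^p | truncCurve x m v.1 v.2.1 v.2.2 = x v.1 v.2.1 v.2.2} :=
    measurableSet_eq_fun (measurable_truncCurve h.measurable_x hmm) h.measurable_x
  have hpt : ∀ᵐ ω ∂P, ∀ i j, T i j ω ∈ Icc a b ∧ Z i ω ∈ Icc zlo zhi ∧
      truncCurve x m (θ i ω) (T i j ω) (Z i ω) = x (θ i ω) (T i j ω) (Z i ω) := by
    refine ae_all_iff.2 fun i => ae_all_iff.2 fun j => ?_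
    have := ae_subjLaw_of_forall_ae (Pε := P.map (ε 0 0)) (ae_mem_of_le_smul_restrict measurableSet_Icc hCT)
      (ae_mem_of_le_smul_restrict measurableSet_Icc hCZ) hA hae j
    rw [← h.map_subjData i] at this
    exact ae_of_ae_map (h.measurable_subjData i).aemeasurable this
  have hme : ∀ t ∈ Icc a b, ∀ z ∈ Icc zlo zhi,
      curveMean (P.map (θ 0)) (truncCurve x m) t z = meanFn P x θ t z := fun t ht z hz => by
    unfold meanFn curveMean
    rw [integral_congr_ae (hae _ hz _ ht), integral_map hmθ.aemeasurable (hxz _ _).aestronglyMeasurable]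
  refine ⟨mm, truncCurve x m, 1 + C, Cm, ⟨hmmm, hmm1, ⟨C', hC'⟩, ?_, ⟨CT, hCT.trans ?_⟩,
    ⟨CZ, hCZ.trans ?_⟩⟩, hmean, hme, fun s hs t ht => ?_, hpt⟩
  · have hi : Integrable (fun ω => mm (θ 0 ω) (Z 0 ω) ^ q) P := by
      have hp := (indepFun_iff_map_prod_eq_prod_map_map (h.measurable_θ 0).aemeasurable
        (h.measurable_Z 0).aemeasurable).1 (h.indep_θ_Z 0)
      have hmq := (hmmm.pow_const q)
      refine ⟨(hmq.comp ((h.measurable_θ 0).prodMk (h.measurable_Z 0))).aestronglyMeasurable, ?_⟩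
      rw [hasFiniteIntegral_iff_ofReal (ae_of_all _ fun ω =>
        rpow_nonneg (zero_le_one.trans (hmm1 _ _)) q), ← lintegral_map
          (f := fun v : S × ℝ^p => ofReal (mm v.1 v.2 ^ q)) hmq.ennreal_ofReal
          ((h.measurable_θ 0).prodMk (h.measurable_Z 0)), hp, lintegral_prod_symm _
          hmq.ennreal_ofReal.aemeasurable]
      refine (lintegral_mono hC').trans_lt ?_
      simp
    refine (integrable_map_measure (g := fun e : ℝ => |e| ^ q)
      (measurable_id.abs.pow_const q).aestronglyMeasurable (h.measurable_ε 0 0).aemeasurable).2 ?_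
    refine ((hU.add hi).const_mul (2 ^ q)).mono' 
      ((h.measurable_ε 0 0).abs.pow_const q).aestronglyMeasurable ?_
    filter_upwards [hpt] with ω hω
    obtain ⟨hT, hZ, he⟩ := hω 0 0
    have hd := Cm.abs_dev_le (θ 0 ω) (T 0 0 ω) (Z 0 ω)
    rw [he, hme _ hT _ hZ] at hd
    have h1 : |ε 0 0 ω| ≤ |err P x θ Z T ε 0 0 ω| + mm (θ 0 ω) (Z 0 ω) := by
      rw [show ε 0 0 ω = err P x θ Z T ε 0 0 ω - (x (θ 0 ω) (T 0 0 ω) (Z 0 ω) -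
        meanFn P x θ (T 0 0 ω) (Z 0 ω)) by simp only [err, obs]; ring]
      exact (abs_sub _ _).trans (by gcongr)
    simp only [Function.comp_apply, Pi.add_apply]
    rw [norm_of_nonneg (by positivity)]
    exact (rpow_le_rpow (abs_nonneg _) h1 hq0.le).trans
      (SubjModel.add_rpow_le (abs_nonneg _) (zero_le_one.trans (hmm1 _ _)) hq0.le)
  · gcongr; exact restrict_le_self
  · gcongr; exact restrict_le_self
  · have hs1 := (Cm.stronglyMeasurable_integral_dev.comp_measurable
      (measurable_prodMk_left (x := (s, t)))).aestronglyMeasurable (μ := P.map (Z 0))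
    unfold curveCov pooledCov
    refine (integral_map (h.measurable_Z 0).aemeasurable hs1).trans (integral_congr_ae ?_)
    filter_upwards [hpt] with ω hω
    have hz := (hω 0 0).2.1
    refine Eq.trans (integral_congr_ae ?_) (integral_map hmθ.aemeasurable (f := fun u => (x u s (Z 0 ω) -
      meanFn P x θ s (Z 0 ω)) * (x u t (Z 0 ω) - meanFn P x θ t (Z 0 ω)))
      (((hxz _ _).sub_const _).mul ((hxz _ _).sub_const _)).aestronglyMeasurable)
    filter_upwards [hae _ hz _ hs, hae _ hz _ ht] with u h1 h2
    rw [h1, h2, hme _ hs _ hz, hme _ ht _ hz]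

/-! ### The two smoothers of the sampling scheme -/

section Smoothers

lemma map_equiv_bounds {ι : Type} [Fintype ι] {β : Type*} [MeasureSpace β] (e : (ι → ℝ) ≃ᵐ β)
    (he : MeasurePreserving e) {lo hi : ι → ℝ} {π : Measure β} {κ C : NNReal} (hκ : 0 < κ)
    (hl : κ • volume.restrict (e.symm ⁻¹' Icc lo hi) ≤ π)
    (hu : π ≤ C • volume.restrict (e.symm ⁻¹' Icc lo hi)) :
    (∃ C : NNReal, π.map e.symm ≤ C • volume) ∧
      (∃ κ : NNReal, 0 < κ ∧ κ • volume.restrict (Icc lo hi) ≤ π.map e.symm) ∧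
      ∀ᵐ u ∂π.map e.symm, u ∈ Icc lo hi := by
  have h1 := Measure.map_mono hl e.symm.measurable
  have h2 := Measure.map_mono hu e.symm.measurable
  rw [map_equiv_restrict e he measurableSet_Icc] at h1 h2
  refine ⟨⟨C, h2.trans ?_⟩, ⟨κ, hκ, h1⟩, ae_mem_of_le_smul_restrict measurableSet_Icc h2⟩
  gcongr
  exact restrict_le_self

variable {D : ℕ → Ω → Subj S p}

lemma map_timeCov (j : ℕ) : (ℒ).map (timeCov j) =
    (PT.prod PZ).map (MeasurableEquiv.piFinSuccAbove (fun _ : Fin (p + 1) => ℝ) 0).symm := by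
  have h1 : MeasurePreserving (fun w : ℝ^p × (ℕ → ℝ) => (w.1, w.2 j)) (PZ.prod PT^ℕ) (PZ.prod PT) :=
    (MeasurePreserving.id PZ).prod ⟨measurable_pi_apply j, infinitePi_map_eval (fun _ : ℕ => PT) j⟩
  have h2 := Measure.measurePreserving_swap.comp (h1.comp
    (measurePreserving_snd.comp (measurePreserving_regroup_fst (Pθ := Pθ) (Pε := Pε))))
  rw [← h2.map_eq, Measure.map_map (MeasurableEquiv.measurable _) h2.measurable]
  congr 1
  funext d
  exact (Fin.insertNth_zero' _ _).symm

lemma map_timePair {α : ℕ × ℕ} (hα : α.1 ≠ α.2) : (ℒ).map (timePair α) =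
    (PT.prod PT).map (MeasurableEquiv.finTwoArrow (α := ℝ)).symm := by
  have h1 : MeasurePreserving (fun τ : ℕ → ℝ => (τ α.1, τ α.2)) PT^ℕ
      (PT.prod PT) := ⟨by fun_prop, map_pair_infinitePi hα⟩
  have h2 : MeasurePreserving _ ℒ _ := h1.comp measurePreserving_snd
  rw [← h2.map_eq, Measure.map_map (MeasurableEquiv.measurable _) h2.measurable]
  rfl

theorem exists_isSmoother_mean (hD : IsIID P D ℒ) (Cm : 𝒞) (H : ℳ q) (hq : 2 < q) (hN : ∀ n i, 2 ≤ N n i)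
    (hB : MeanBandwidth N ht hz hzv q) (hK : IsKernel K) (hab : a < b) (hzz : ∀ k, zlo k < zhi k)
    {κ C C₀ : NNReal} (hκ : 0 < κ) (hl : κ • volume.restrict (Icc a b ×ˢ Icc zlo zhi) ≤ PT.prod PZ)
    (hu : PT.prod PZ ≤ C • volume.restrict (Icc a b ×ˢ Icc zlo zhi))
    (hm : ∀ t z, |curveMean Pθ xc t z| ≤ C₀) {f : ℝ × ℝ^p → ℝ}
    (hf : TwiceDiffBounded f (Icc a b ×ˢ Icc zlo zhi))
    (heq : ∀ t ∈ Icc a b, ∀ z ∈ Icc zlo zhi, curveMean Pθ xc t z = f (t, z)) :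
    ∃ (ν : Measure ℝ^(p + 1)) (G : ℝ^(p + 1) → ℝ^(p + 1)) (Cφ : ℝ),
      IsProbabilityMeasure ν ∧ IsSmoother P ℒ D (fun n i => range (N n i))
      (fun n i => 1 / (N n i : ℝ)) timeCov (fun _ _ j d => env mm j d.1)
      (fun n => Fin.cons (ht n) (hzv n)) (meanB N ht hzv) K (Fin.cons a zlo) (Fin.cons b zhi) ν
      (fun _ _ j => obsC xc j) (fun u => curveMean Pθ xc (u 0) fun k => u k.succ) G Cφ := by
  set e := MeasurableEquiv.piFinSuccAbove (fun _ : Fin (p + 1) => ℝ) 0 with he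
  have hE := isEnvelope_mean hD H hq hN hB
  have hφm : Measurable fun u : ℝ^(p + 1) => curveMean Pθ xc (u 0) fun k => u k.succ :=
    Cm.measurable_curveMean.comp (by fun_prop : Measurable fun u : ℝ^(p + 1) =>
      (u 0, fun k : Fin p => u k.succ))
  obtain ⟨Cφ, G, hG, hGm⟩ := exists_hasTaylor_mean hf hφm (fun u => hm _ _) fun u hu => by
    obtain ⟨h1, h2⟩ := splitPt_mem.2 hu
    exact heq _ h1 _ h2
  have hpre : e.symm ⁻¹' Icc (Fin.cons a zlo : ℝ^(p + 1)) (Fin.cons b zhi) = Icc a b ×ˢ Icc zlo zhi := by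
    ext w
    rw [mem_preimage, ← splitPt_mem]
    exact iff_of_eq (congrArg (· ∈ _) (e.apply_symm_apply w))
  rw [← hpre] at hl hu
  obtain ⟨b1, b2, b3⟩ := map_equiv_bounds e (volume_preserving_piFinSuccAbove (fun _ => ℝ) 0) hκ hl hu
  have hlaw : ∀ j, (ℒ).map (timeCov j) = (PT.prod PZ).map e.symm := map_timeCov
  have hν : IsProbabilityMeasure ((PT.prod PZ).map e.symm) :=
    isProbabilityMeasure_map e.symm.measurable.aemeasurable
  refine ⟨_, G, Cφ, hν, hE, fun _ _ j d => H.one_le_env j d.1, ⟨fun n i => ?_, fun _ _ j _ => hlaw j, b1,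
    b2, b3, fun k => ?_⟩, hK, fun _ _ j => Cm.measurable_obsC j, fun _ _ j d => Cm.abs_obsC_le j d,
    fun n i j _ F hF ⟨M, hM⟩ => ?_, hG, hGm, ?_⟩
  · have : (N n i : ℝ) ≠ 0 := by have := hN n i; positivity
    rw [card_range, one_div_mul_cancel this]
  · refine Fin.cases ?_ (fun k => ?_) k
    · exact hab
    · exact hzz k
  · have h1 := Cm.integral_resid_mul H hq.le j (G := fun w => F (Fin.cons (w.2 j) w.1)) (hF.comp (measurable_cons j)) (fun w => hM _)
    have hb : Measurable fun u : ℝ^(p + 1) => curveMean Pθ xc (u 0) (fun k => u k.succ) * F u := hφm.mul hF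
    have i1 : Integrable (fun d : Subj S p => resid Pθ xc j d * F (timeCov j d)) ℒ := by
      refine ((hE.integrable_E n i j).mul_const M).mono'
        ((Cm.measurable_resid j).mul (hF.comp (measurable_timeCov j))).aestronglyMeasurable (ae_of_all _ fun d => ?_)
      rw [norm_mul]
      exact mul_le_mul (Cm.abs_resid_le j d) (hM _) (abs_nonneg _) (H.env_nonneg _ _)
    have i2 : Integrable (fun d : Subj S p => (fun u : ℝ^(p + 1) =>
        curveMean Pθ xc (u 0) (fun k => u k.succ) * F u) (timeCov j d)) ℒ := by
      refine Integrable.of_bound (hb.comp (measurable_timeCov j)).aestronglyMeasurable (C₀ * M)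
        (ae_of_all _ fun d => ?_)
      rw [norm_mul]
      exact mul_le_mul (hm _ _) (hM _) (abs_nonneg _) C₀.2
    rw [← hlaw j, integral_map (measurable_timeCov j).aemeasurable hb.aestronglyMeasurable]
    refine Eq.trans (integral_congr_ae (ae_of_all _ fun d => ?_))
      ((integral_add i1 i2).trans ((congrArg (· + _) h1).trans (zero_add _)))
    simp only [obsC_eq (Pθ := Pθ) j d, add_mul, timeCov, Fin.cons_zero, Fin.cons_succ]
  · simp only [Fin.prod_univ_succ, Fin.cons_zero, Fin.cons_succ]
    exact tendsto_rateX_div hB.meanB_pos (fun n => mul_pos (hB.ht_pos n)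
      (prod_pos fun k _ => hB.hzv_pos n k)) hq hB.rate
      ((hB.eventually_meanB_le hN).mono fun n h => h.1)

lemma CurveModel.exists_curveCov_le (Cm : 𝒞) (H : ℳ q)
    (hq : 2 ≤ q) : ∃ C : ℝ, ∀ w, |curveCov Pθ PZ xc w| ≤ C := by
  obtain ⟨M, hM⟩ := H.moment_mm
  refine ⟨M, fun w => ?_⟩
  have h0 : ∀ θ z, 0 ≤ mm θ z := fun θ z => zero_le_one.trans (H.one_le_mm θ z)
  unfold curveCov
  rw [← norm_eq_abs]
  refine (norm_integral_le_of_norm_le_const (C := M) (ae_of_all _ fun z => ?_)).trans_eq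
    (by rw [probReal_univ, mul_one])
  have hnn : 0 ≤ᵐ[Pθ] fun θ => mm θ z ^ q := ae_of_all _ fun θ => rpow_nonneg (h0 θ z) q
  have hi := H.integrable_mm_rpow z
  refine (norm_integral_le_of_norm_le hi (ae_of_all _ fun θ => ?_)).trans ?_
  · rw [norm_mul]
    refine (mul_le_mul (Cm.abs_dev_le θ w.1 z) (Cm.abs_dev_le θ w.2 z) (abs_nonneg _) (h0 θ z)).trans ?_
    rw [← pow_two, ← rpow_natCast]
    exact Real.rpow_le_rpow_of_exponent_le (H.one_le_mm θ z) (by exact_mod_cast hq)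
  · rw [integral_eq_lintegral_of_nonneg_ae hnn hi.aestronglyMeasurable]
    exact ENNReal.toReal_le_coe_of_le_coe (hM z)

theorem exists_isSmoother_cov (hD : IsIID P D ℒ) (Cm : 𝒞)
    (H : ℳ (2 * L)) (hL : 2 < L) (hN : ∀ n i, 2 ≤ N n i)
    (hB : CovBandwidth N hG L) (hK : IsKernel K) (hab : a < b) {κ C : NNReal} (hκ : 0 < κ)
    (hl : κ • volume.restrict (Icc a b) ≤ PT) (hu : PT ≤ C • volume.restrict (Icc a b)) {Γ : ℝ → ℝ → ℝ}
    (hΓ : BoundedSecondPartials Γ (Icc a b))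
    (heq : ∀ s ∈ Icc a b, ∀ t ∈ Icc a b, curveCov Pθ PZ xc (s, t) = Γ s t) :
    ∃ (ν : Measure ℝ^2) (G : ℝ^2 → ℝ^2) (Cφ : ℝ), IsProbabilityMeasure ν ∧ IsSmoother P ℒ D 𝔬 𝔴 timePair
      𝔠 (fun n _ => hG n) (covB N hG) K (fun _ => a) (fun _ => b) ν
      (fun _ _ α d => resid Pθ xc α.1 d * resid Pθ xc α.2 d) (fun u => curveCov Pθ PZ xc (u 0, u 1)) G Cφ := by
  set e := MeasurableEquiv.finTwoArrow (α := ℝ) with he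
  have hE := isEnvelope_cov hD H hL hN hB
  have hφm : Measurable fun u : ℝ^2 => curveCov Pθ PZ xc (u 0, u 1) :=
    Cm.measurable_curveCov.comp (by fun_prop : Measurable fun u : ℝ^2 => (u 0, u 1))
  obtain ⟨C₀, hC₀⟩ := Cm.exists_curveCov_le H (by linarith)
  obtain ⟨Cφ, G, hGT, hGm⟩ := exists_hasTaylor_cov hΓ hφm (fun u => hC₀ _) fun u hu =>
    heq _ ⟨hu.1 0, hu.2 0⟩ _ ⟨hu.1 1, hu.2 1⟩
  have hpre : e.symm ⁻¹' Icc (fun _ : Fin 2 => a) (fun _ => b) = Icc a b ×ˢ Icc a b := by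
    ext w
    simp only [mem_preimage, mem_Icc, Pi.le_def, Fin.forall_fin_two, mem_prod]
    exact ⟨fun h => ⟨⟨h.1.1, h.2.1⟩, h.1.2, h.2.2⟩, fun h => ⟨⟨h.1.1, h.2.1⟩, h.1.2, h.2.2⟩⟩
  have hsq : ∀ c : NNReal, (c • volume.restrict (Icc a b)).prod (c • volume.restrict (Icc a b)) =
      (c * c) • volume.restrict (e.symm ⁻¹' Icc (fun _ : Fin 2 => a) fun _ => b) := fun c => by
    rw [hpre, volume_eq_prod, ← prod_restrict, mul_smul]
    exact (Measure.prod_smul_left _).trans (congrArg _ (Measure.prod_smul_right _))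
  have hl2 := Measure.prod_mono hl hl
  have hu2 := Measure.prod_mono hu hu
  rw [hsq] at hl2 hu2
  obtain ⟨b1, b2, b3⟩ := map_equiv_bounds e (volume_preserving_finTwoArrow ℝ) (mul_pos hκ hκ) hl2 hu2
  have hν : IsProbabilityMeasure ((PT.prod PT).map e.symm) :=
    isProbabilityMeasure_map e.symm.measurable.aemeasurable
  have hRb : ∀ N (α : ℕ × ℕ) (d : Subj S p),
      |resid Pθ xc α.1 d * resid Pθ xc α.2 d| ≤ covEnv mm N α d.1 := fun N α d => by
    rw [abs_mul]
    refine mul_le_mul (Cm.abs_resid_le _ d) ((Cm.abs_resid_le _ d).trans (le_add_of_nonneg_right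
      (mul_nonneg (by positivity) (sum_nonneg fun m _ => H.env_nonneg m _)))) (abs_nonneg _)
      (H.env_nonneg _ _)
  have hne : ∀ {n i : ℕ} {α : ℕ × ℕ}, α ∈ (range (N n i)).offDiag → α.1 ≠ α.2 := fun hα =>
    (Finset.mem_offDiag.1 hα).2.2
  refine ⟨_, G, Cφ, hν, hE, fun n i α d => (H.one_le_env α.1 d.1).trans (H.env_le_covEnv _ α d.1),
    ⟨fun n i => ?_, fun _ _ α hα => map_timePair (hne hα), b1, b2, b3, fun k => hab⟩, hK,
    fun _ _ α => (Cm.measurable_resid _).mul (Cm.measurable_resid _), fun n i α d => hRb _ α d,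
    fun n i α hα F hF ⟨M, hM⟩ => ?_, hGT, hGm, ?_⟩
  · have h2 : (2 : ℝ) ≤ N n i := by exact_mod_cast hN n i
    rw [card_offDiag_range, one_div_mul_cancel (mul_pos (by linarith) (by linarith)).ne']
  · rw [integral_map_equiv]
    exact Cm.integral_resid_mul_resid H (by linarith) (hne hα) (g := fun w => F (e.symm w))
      (hF.comp e.symm.measurable) (fun w => hM _)
  · simp only [Fin.prod_univ_two, ← pow_two]
    exact tendsto_rateX_div hB.covB_pos (fun n => pow_pos (hB.pos n) 2) hL hB.rate
      ((hB.eventually_covB_le hN).mono fun n h => h.1)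

end Smoothers

/-! ### The estimators as local linear fits -/

section Fits

variable {n : ℕ} {N : ℕ → ℕ} {D : ℕ → Subj S p}

lemma IsMeanFit.exists_isLocalFit {ht m : ℝ} {hz : ℝ^p} {Y : ℕ → ℕ → ℝ} {x : ℝ^(p + 1)}
    (h0 : 0 < ht) (hz0 : ∀ k, 0 < hz k) (h : IsMeanFit K ht hz n N (fun i j => (D i).2 j)
      (fun i => (D i).1.2.1) Y (x 0) (fun k => x k.succ) m) :
    ∃ bh : Option (Fin (p + 1)) → ℝ, bh none = m ∧ IsLocalFit K n (fun i => range (N i))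
      (fun i => 1 / (N i : ℝ)) timeCov D Y (Fin.cons ht hz) x bh := by
  have hp : 0 < ∏ k, hz k := prod_pos fun k _ => hz0 k
  have key : ∀ b : Option (Fin (p + 1)) → ℝ,
      meanLoss K ht hz n N (fun i j => (D i).2 j) (fun i => (D i).1.2.1) Y (x 0) (fun k => x k.succ)
        (b none) (b (some 0) / ht) (fun k => b (some k.succ) / hz k) =
      1 / n * (ht * ∏ k, hz k)⁻¹ * ∑ i ∈ range n, (1 / (N i : ℝ)) * ∑ j ∈ range (N i),
        (Y i j - ∑ e, b e * dsg (Fin.cons ht hz) x e (timeCov j (D i))) ^ 2 *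
          prodKer (fun _ => K) (Fin.cons ht hz) x (timeCov j (D i)) := by
    intro b
    simp only [meanLoss, mul_sum]
    refine sum_congr rfl fun i _ => sum_congr rfl fun j _ => ?_
    simp only [prodKer, dsg, timeCov, scaled, Fintype.sum_option, Option.elim, Fin.sum_univ_succ,
      Fin.prod_univ_succ, Fin.cons_zero, Fin.cons_succ, Finset.prod_div_distrib]
    have e1 : ∀ k, b (some k.succ) / hz k * ((D i).1.2.1 k - x k.succ) =
        b (some k.succ) * (((D i).1.2.1 k - x k.succ) / hz k) := fun k => by ring
    simp only [e1]
    field_simp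
    ring
  obtain ⟨b₁, b₂, hb⟩ := h
  refine ⟨fun e => e.elim m (Fin.cons (b₁ * ht) fun k => b₂ k * hz k), rfl, fun b' => ?_⟩
  rcases Nat.eq_zero_or_pos n with rfl | hn
  · simp
  have hc : 0 < 1 / (n : ℝ) * (ht * ∏ k, hz k)⁻¹ := by positivity
  refine le_of_mul_le_mul_left ?_ hc
  rw [← key, ← key]
  have e1 : b₁ * ht / ht = b₁ := mul_div_cancel_right₀ _ h0.ne'
  have e2 : ∀ k, b₂ k * hz k / hz k = b₂ k := fun k => mul_div_cancel_right₀ _ (hz0 k).ne'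
  simp only [Option.elim, Fin.cons_zero, Fin.cons_succ, e1, e2]
  exact hb _ _ _

lemma sum_erase_eq_sum_offDiag (s : Finset ℕ) (F : ℕ × ℕ → ℝ) :
    ∑ j ∈ s, ∑ k ∈ s.erase j, F (j, k) = ∑ α ∈ s.offDiag, F α := by
  rw [← Finset.sum_finset_product' s.offDiag s (fun j => s.erase j) (f := fun j k => F (j, k))]
  rintro ⟨j, k⟩
  simp only [Finset.mem_offDiag, Finset.mem_erase]
  tauto

lemma IsCovFit.exists_isLocalFit {h c s t : ℝ} {R : ℕ → ℕ → ℝ} (h0 : 0 < h)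
    (hf : IsCovFit K h n N (fun i j => (D i).2 j) R s t c) :
    ∃ bh : Option (Fin 2) → ℝ, bh none = c ∧ IsLocalFit K n (fun i => (range (N i)).offDiag)
      (fun i => 1 / ((N i : ℝ) * ((N i : ℝ) - 1))) timePair D (fun i α => R i α.1 * R i α.2)
      (fun _ => h) ![s, t] bh := by
  have key : ∀ b : Option (Fin 2) → ℝ,
      covLoss K h n N (fun i j => (D i).2 j) R s t (b none) (b (some 0) / h) (b (some 1) / h) =
      1 / n * (h ^ 2)⁻¹ * ∑ i ∈ range n, (1 / ((N i : ℝ) * ((N i : ℝ) - 1))) *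
        ∑ α ∈ (range (N i)).offDiag, (R i α.1 * R i α.2 -
          ∑ e, b e * dsg (fun _ => h) ![s, t] e (timePair α (D i))) ^ 2 *
          prodKer (fun _ => K) (fun _ => h) ![s, t] (timePair α (D i)) := by
    intro b
    simp only [covLoss, ← sum_erase_eq_sum_offDiag, mul_sum]
    refine sum_congr rfl fun i _ => sum_congr rfl fun j _ => sum_congr rfl fun k _ => ?_
    simp only [prodKer, dsg, timePair, scaled, Fintype.sum_option, Option.elim, Fin.sum_univ_two,
      Fin.prod_univ_two, Matrix.cons_val_zero, Matrix.cons_val_one]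
    field_simp
    ring
  obtain ⟨b₁, b₂, hb⟩ := hf
  refine ⟨fun e => e.elim c ![b₁ * h, b₂ * h], rfl, fun b' => ?_⟩
  rcases Nat.eq_zero_or_pos n with rfl | hn
  · simp
  have hc : 0 < 1 / (n : ℝ) * (h ^ 2)⁻¹ := by positivity
  refine le_of_mul_le_mul_left ?_ hc
  rw [← key, ← key]
  have e1 : ∀ b : ℝ, b * h / h = b := fun b => mul_div_cancel_right₀ _ h0.ne'
  simp only [Option.elim, Matrix.cons_val_zero, Matrix.cons_val_one, e1]
  exact hb _ _ _

end Fits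

/-! ### The rates -/

lemma one_div_gam_mul (k n : ℕ) (h : ℝ) : 1 / (gam N k n * h) = invGam N k n / h := by
  rw [gam_eq_inv, one_div, mul_inv, inv_inv, div_eq_mul_inv]

lemma rateX_covB_div {n : ℕ} (h : 0 < hG n) : rateX (covB N hG) n / hG n ^ 2 = delta2 N hG n := by
  rw [rateX, delta2, one_div_gam_mul, one_div_gam_mul, covB_eq]
  nth_rewrite 2 [← Real.sqrt_sq (by positivity : 0 ≤ hG n ^ 2)]
  rw [← Real.sqrt_div' _ (by positivity)]
  congr 1
  field_simp

lemma MeanBandwidth.eventually_rate_le (hB : MeanBandwidth N ht hz hzv q) : ∃ A : ℝ, 0 ≤ A ∧ ∀ᶠ n in atTop,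
    (rateX (meanB N ht hzv) n / (∏ k, (Fin.cons (ht n) (hzv n) : ℝ^(p + 1)) k) +
      ∑ k, (Fin.cons (ht n) (hzv n) : ℝ^(p + 1)) k ^ 2) ^ 2 +
    (n * ∏ k, (Fin.cons (ht n) (hzv n) : ℝ^(p + 1)) k)⁻¹ *
      ((Fin.cons (ht n) (hzv n) : ℝ^(p + 1)) 0 + invGam N 1 n) ≤
    A * (ht n ^ 4 + hz n ^ 4 + delta N p ht hz n ^ 2) := by
  have h1 : ∀ k, ∃ c : ℝ, 0 < c ∧ ∀ᶠ n in atTop, hz n ≤ c * hzv n k := fun k => by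
    obtain ⟨c, hc, h⟩ := (hB.same_order k).isBigO_symm.exists_pos
    refine ⟨c, hc, h.bound.mono fun n hn => ?_⟩
    simpa [abs_of_pos (hB.hz_pos n), abs_of_pos (hB.hzv_pos n k)] using hn
  have h2 : ∀ k, ∃ c : ℝ, 0 < c ∧ ∀ᶠ n in atTop, hzv n k ≤ c * hz n := fun k => by
    obtain ⟨c, hc, h⟩ := (hB.same_order k).isBigO.exists_pos
    refine ⟨c, hc, h.bound.mono fun n hn => ?_⟩
    simpa [abs_of_pos (hB.hz_pos n), abs_of_pos (hB.hzv_pos n k)] using hn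
  choose c hc h1 using h1
  choose c' hc' h2 using h2
  set A := ∏ k, c k
  set B := ∑ k, c' k ^ 2
  have hA : 0 < A := prod_pos fun k _ => hc k
  have hB0 : 0 ≤ B := by positivity
  refine ⟨3 * A + 4 * (1 + B ^ 2), by positivity, ?_⟩
  have hlog : ∀ᶠ n : ℕ in atTop, 1 ≤ log n :=
    (Real.tendsto_log_atTop.comp tendsto_natCast_atTop_atTop).eventually_ge_atTop 1
  filter_upwards [eventually_all.2 h1, eventually_all.2 h2, hlog, eventually_gt_atTop 0]
    with n h1 h2 hlog hn
  have hn0 : (0 : ℝ) < n := by exact_mod_cast hn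
  have t0 := hB.ht_pos n
  have z0 := hB.hz_pos n
  have hg := invGam_nonneg N 1 n
  simp only [Fin.prod_univ_succ, Fin.sum_univ_succ, Fin.cons_zero, Fin.cons_succ]
  set H := ∏ k, hzv n k with hH
  have hH0 : 0 < H := prod_pos fun k _ => hB.hzv_pos n k
  have hzp : hz n ^ p ≤ A * H := by
    rw [← prod_mul_distrib]
    calc hz n ^ p = ∏ _k : Fin p, hz n := by simp
      _ ≤ _ := Finset.prod_le_prod (fun _ _ => z0.le) fun k _ => h1 k
  have hHi : H⁻¹ ≤ A * (hz n ^ p)⁻¹ := by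
    rw [← div_eq_mul_inv, le_div_iff₀ (by positivity), ← div_eq_inv_mul, div_le_iff₀ hH0]
    exact hzp
  have hs : ∑ k, hzv n k ^ 2 ≤ B * hz n ^ 2 := by
    rw [sum_mul]
    refine sum_le_sum fun k _ => ?_
    rw [← mul_pow]
    exact pow_le_pow_left₀ (hB.hzv_pos n k).le (h2 k) 2
  have hδ : delta N p ht hz n ^ 2 = (1 + invGam N 1 n / ht n) * (log n / n) * (hz n ^ p)⁻¹ := by
    rw [delta, one_div_gam_mul, sq_sqrt (by positivity)]
    field_simp
  set u := 1 + invGam N 1 n / ht n with hu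
  have hu0 : 0 ≤ u := by positivity
  have e1 : (rateX (meanB N ht hzv) n / (ht n * H)) ^ 2 = u * (log n / n) * H⁻¹ := by
    rw [div_pow, rateX, sq_sqrt (mul_nonneg (hB.meanB_pos n).le (by positivity)), meanB_eq, ← hH, hu]
    field_simp
  have e2 : (n * (ht n * H))⁻¹ * (ht n + invGam N 1 n) = u * (1 / n) * H⁻¹ := by rw [hu]; field_simp
  have b1 : u * (log n / n) * H⁻¹ ≤ A * delta N p ht hz n ^ 2 := by
    rw [hδ]
    calc _ ≤ u * (log n / n) * (A * (hz n ^ p)⁻¹) := by gcongr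
      _ = _ := by ring
  have b2 : u * (1 / n) * H⁻¹ ≤ A * delta N p ht hz n ^ 2 := le_trans (by gcongr) b1
  rw [e2]
  set r := rateX (meanB N ht hzv) n / (ht n * H)
  set s := ∑ k, hzv n k ^ 2
  have hs0 : 0 ≤ s := by positivity
  have hs2 : s ^ 2 ≤ B ^ 2 * hz n ^ 4 := by
    calc s ^ 2 ≤ (B * hz n ^ 2) ^ 2 := pow_le_pow_left₀ hs0 hs 2
      _ = _ := by ring
  have h3 : (r + (ht n ^ 2 + s)) ^ 2 ≤ 2 * r ^ 2 + 4 * (ht n ^ 4 + s ^ 2) := by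
    nlinarith [sq_nonneg (r - (ht n ^ 2 + s)), sq_nonneg (ht n ^ 2 - s)]
  have hδ0 := sq_nonneg (delta N p ht hz n)
  have t4 : 0 ≤ ht n ^ 4 := by positivity
  have z4 : 0 ≤ hz n ^ 4 := by positivity
  nlinarith [mul_nonneg hA.le t4, mul_nonneg hA.le z4, mul_nonneg (sq_nonneg B) t4,
    mul_nonneg (sq_nonneg B) hδ0]

end PooledCov

end

theorem theorem2 {Ω S : Type*} [MeasurableSpace Ω] [MeasurableSpace S]
    (P : Measure Ω) [IsProbabilityMeasure P] {p : ℕ}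
    -- the time interval and the covariate box
    (a b : ℝ) (hab : a < b) (zlo zhi : Fin p → ℝ) (hzlohi : ∀ k, zlo k < zhi k)
    -- the model
    (x : S → ℝ → (Fin p → ℝ) → ℝ) (θ : ℕ → Ω → S) (Z : ℕ → Ω → Fin p → ℝ)
    (T ε : ℕ → ℕ → Ω → ℝ) (σ : ℝ) (g : ℝ × (Fin p → ℝ) → ℝ)
    (hmodel : PooledCov.IsSampling P x θ Z T ε σ (Icc a b) (Icc zlo zhi) g)
    -- numbers of observations, kernel and bandwidths
    (N : ℕ → ℕ → ℕ) (hN : ∀ n i, 2 ≤ N n i)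
    (K : ℝ → ℝ) (ht hz hG : ℕ → ℝ) (hzv : ℕ → Fin p → ℝ) (qμ qΓ : ℝ)
    (hA1 : PooledCov.DensityCondition g (Icc a b ×ˢ Icc zlo zhi))
    (hA2 : PooledCov.IsKernel K)
    (hB1 : PooledCov.TwiceDiffBounded
      (fun v : ℝ × (Fin p → ℝ) => PooledCov.meanFn P x θ v.1 v.2) (Icc a b ×ˢ Icc zlo zhi))
    (hqμ : 2 < qμ)
    (hB2U : ∀ i j, Integrable (fun ω => |PooledCov.err P x θ Z T ε i j ω| ^ qμ) P)
    (hB2X : PooledCov.HasSupMoment P x θ (Icc a b) (Icc zlo zhi) qμ)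
    (hB2h : PooledCov.MeanBandwidth N ht hz hzv qμ)
    (hB3 : PooledCov.BoundedSecondPartials (PooledCov.pooledCov P x θ Z) (Icc a b))
    (hqΓ : 2 < qΓ)
    (hB4U : ∀ i j, Integrable (fun ω => |PooledCov.err P x θ Z T ε i j ω| ^ (2 * qΓ)) P)
    (hB4X : PooledCov.HasSupMoment P x θ (Icc a b) (Icc zlo zhi) (2 * qΓ))
    (hB4h : PooledCov.CovBandwidth N hG qΓ)
    -- the estimators (any choice of minimizers)
    (muHat : ℕ → Ω → ℝ → (Fin p → ℝ) → ℝ)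
    (hmu : ∀ n ω t z, PooledCov.IsMeanFit K (ht n) (hzv n) n (N n)
      (fun i j => T i j ω) (fun i => Z i ω) (fun i j => PooledCov.obs x θ Z T ε i j ω)
      t z (muHat n ω t z))
    (GHat : ℕ → Ω → ℝ → ℝ → ℝ)
    (hGHat : ∀ n ω s t, PooledCov.IsCovFit K (hG n) n (N n) (fun i j => T i j ω)
      (fun i j => PooledCov.obs x θ Z T ε i j ω - muHat n ω (T i j ω) (Z i ω))
      s t (GHat n ω s t)) :
    (∀ᵐ ω ∂P, ∃ C : ℝ, ∀ᶠ n : ℕ in atTop, ∀ s ∈ Icc a b, ∀ t ∈ Icc a b,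
      |GHat n ω s t - PooledCov.pooledCov P x θ Z s t| ≤
        C * (PooledCov.delta2 N hG n + hG n ^ 2
          + PooledCov.delta1 N hG n * (ht n ^ 2 + hz n ^ 2 + PooledCov.delta N p ht hz n)
          + ht n ^ 4 + hz n ^ 4 + PooledCov.delta N p ht hz n ^ 2)) ∧
    (∀ᵐ ω ∂P, ∃ C : ℝ, ∀ᶠ n : ℕ in atTop, ∀ s ∈ Icc a b, ∀ t ∈ Icc a b,
      |GHat n ω s t - PooledCov.pooledCov P x θ Z s t| ≤
        C * (PooledCov.delta2 N hG n + hG n ^ 2 + ht n ^ 4 + hz n ^ 4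
          + PooledCov.delta N p ht hz n ^ 2)) := by
  obtain ⟨p1, p2, p3, p4⟩ := hmodel.isProbabilityMeasure_map
  obtain ⟨κ, C, hκ, ⟨hl, hu⟩, ⟨hlT, huT⟩, huZ⟩ := hmodel.exists_density_bounds hab hzlohi hA1
  obtain ⟨q, hq1, hq2, hqX, hqU⟩ : ∃ q, qμ ≤ q ∧ 2 * qΓ ≤ q ∧
      PooledCov.HasSupMoment P x θ (Icc a b) (Icc zlo zhi) q ∧
      Integrable (fun ω => |PooledCov.err P x θ Z T ε 0 0 ω| ^ q) P := by
    rcases le_total qμ (2 * qΓ) with h | h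
    · exact ⟨_, h, le_rfl, hB4X, hB4U 0 0⟩
    · exact ⟨_, le_rfl, h, hB2X, hB2U 0 0⟩
  obtain ⟨mm, xc, C₀, Cm, H, hm, hmean, hcov, hpt⟩ :=
    hmodel.exists_curves (by linarith) huT huZ hqX hqU
  have hD := hmodel.isIID_subjData
  obtain ⟨ν, G, Cφ, hν, I⟩ := PooledCov.exists_isSmoother_mean hD Cm
    (H.mono (by linarith) hq1) hqμ hN hB2h hA2 hab hzlohi hκ hl hu hm hB1 hmean
  obtain ⟨ν', G', Cψ, hν', J⟩ := PooledCov.exists_isSmoother_cov hD Cm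
    (H.mono (by linarith) hq2) hqΓ hN hB4h hA2 hab hκ hlT huT hB3 hcov
  obtain ⟨A, hA, hrate⟩ := hB2h.eventually_rate_le
  have main : ∀ᵐ ω ∂P, ∃ C : ℝ, 0 ≤ C ∧ ∀ᶠ n : ℕ in atTop, ∀ s ∈ Icc a b, ∀ t ∈ Icc a b,
      |GHat n ω s t - PooledCov.pooledCov P x θ Z s t| ≤
        C * (PooledCov.delta2 N hG n + hG n ^ 2 + ht n ^ 4 + hz n ^ 4
          + PooledCov.delta N p ht hz n ^ 2) := by
    filter_upwards [PooledCov.ae_covFit_le Cm (H.mono (by linarith) hq1) hqμ.le hN (fun j d => by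
      simp only [PooledCov.obsC_eq (Pθ := P.map (θ 0)) j d, PooledCov.timeCov, Fin.cons_zero,
        Fin.cons_succ, add_sub_cancel_right]) I J, hpt] with ω ⟨C, hC, h⟩ hω
    refine ⟨C * (1 + A), by positivity, ?_⟩
    filter_upwards [h, hrate] with n h hr s hs t ht'
    have hobs : ∀ i j, PooledCov.obs x θ Z T ε i j ω =
        PooledCov.obsC xc j (PooledCov.subjData θ Z T ε i ω) := fun i j => by
      simp only [PooledCov.obs, PooledCov.obsC, PooledCov.subjData, (hω i j).2.2]
    have hfit := hGHat n ω s t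
    have hmu' := hmu n ω
    simp only [hobs] at hfit hmu'
    obtain ⟨bh, hb0, hbh⟩ := PooledCov.IsCovFit.exists_isLocalFit
      (D := fun i => PooledCov.subjData θ Z T ε i ω) (hB4h.pos n) hfit
    have h1 := h (fun u => muHat n ω (u 0) fun k => u k.succ)
      (fun u _ => PooledCov.IsMeanFit.exists_isLocalFit (hB2h.ht_pos n) (hB2h.hzv_pos n) (hmu' _ _))
      ![s, t] (by simp [Pi.le_def, Fin.forall_fin_two, hs.1, hs.2, ht'.1, ht'.2]) bh hbh
    rw [hb0, PooledCov.rateX_covB_div (hB4h.pos n)] at h1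
    have h2 : PooledCov.curveCov (P.map (θ 0)) (P.map (Z 0)) xc (![s, t] 0, ![s, t] 1) =
      PooledCov.pooledCov P x θ Z s t := hcov s hs t ht'
    rw [h2] at h1
    have hd : 0 ≤ PooledCov.delta2 N hG n := Real.sqrt_nonneg _
    have hR : 0 ≤ ht n ^ 4 + hz n ^ 4 + PooledCov.delta N p ht hz n ^ 2 := by positivity
    rw [mul_assoc]
    refine h1.trans (mul_le_mul_of_nonneg_left ?_ hC)
    nlinarith [mul_nonneg hA hd, mul_nonneg hA (sq_nonneg (hG n))]
  refine ⟨main.mono fun ω ⟨C, hC, h⟩ => ⟨C, h.mono fun n h s hs t ht' => (h s hs t ht').trans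
    (mul_le_mul_of_nonneg_left ?_ hC)⟩, main.mono fun ω ⟨C, _, h⟩ => ⟨C, h⟩⟩
  have h1 : 0 ≤ PooledCov.delta1 N hG n * (ht n ^ 2 + hz n ^ 2 + PooledCov.delta N p ht hz n) :=
    mul_nonneg (Real.sqrt_nonneg _) (add_nonneg (by positivity) (Real.sqrt_nonneg _))
  linarith
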